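/- Let $n\ge 3$, $r=\lfloor (n+2)/2\rfloor$, and $\nu\in\{0,1\}$ with $\nu\equiv n \pmod 2$. Let $\eta=\mathrm{diag}(1,1,-1,\dots,-1)$, indexed by $a,b\in\{-1,0,\dots,n\}$, let $y^2=\eta_{ab}y^ay^b$ on $\mathbb R^{2,n}$, and let $\mathcal G_n=\mathfrak{so}(2,n)$ have the basis $M_{ab}=-M_{ba}$, $a<b$, with $[M_{ab},M_{cd}]=\eta_{ad}M_{bc}+\eta_{bc}M_{ad}-\eta_{ac}M_{bd}-\eta_{bd}M_{ac}$. For vectors $e_a$ put $e'_{\pm1}=\frac{i}{\sqrt2}(e_{-1}\pm ie_0)$, $e'_{\pm j}=\frac1{\sqrt2}(e_{2j-3}\pm ie_{2j-2})$ for $2\le j\le r$, and $e'_0=e_n$ if $n$ is odd; write $e'_j=\sum_aA_j^ae_a$ and $X_{jk}=\sum_{a,b}A_j^aA_k^bM_{ab}\in\mathcal G_n^{\mathbb C}$. A maximal vector of weight $\lambda=(\lambda_1,\dots,\lambda_r)$ is a nonzero vector annihilated by the $X_{jk}$ with $1-\nu\le j,k\le r$ and by the $X_{j,-k}$ with $1\le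 j<k\le r$, and on which $H_j=X_{-j,j}$ acts as $\lambda_j$, $1\le j\le r$. $D(E_0,\lambda_2,\dots,\lambda_r)$ denotes the irreducible representation with highest weight $(-E_0,\lambda_2,\dots,\lambda_r)$. A representation on a topological vector space carries it if its $\mathfrak{so}(2)\oplus\mathfrak{so}(n)$-finite vectors are dense and form an irreducible $\mathcal G_n$-module with a maximal vector of that weight. Let $\mathcal S=\mathbb C^{2^r}$, let $\gamma_{-1},\dots,\gamma_n$ be matrices on $\mathcal S$ with $\gamma_a\gamma_b+\gamma_b\gamma_a=2\eta_{ab}$, let $S_{ab}=\frac12(\gamma_a\gamma_b-\eta_{ab})$ and $\omega_j=\sum_aA^a_j\gamma_a$, and let $v_\sigma\in\mathcal S$ be a maximal vector of weight $(\frac12,\dots,\frac12)$ for $M_{ab}\mapsto S_{ab}$. Let $H_+=\{y: y^2>0\}$ and $Q=\{y\neq0: y^2=0\}$. All fields and points below live on the universal covering of $\{y:(y^{-1},y^0)\ne0\}\supset H_+\cup Q$, on which the powers of $x_1=\frac{i}{\sqrt2}(y^{-1}+iy^0)$ are single valued. $\mathcal G_n$ acts on smooth spinor fields $\Psi:H_+\to\mathcal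 S$ by $U(M_{ab})=y_a\partial_b-y_b\partial_a+S_{ab}$, and we put $\not y=y^a\gamma_a$ and $\not\partial=\eta^{ab}\gamma_a\partial_b$. The space of fields has the topology of uniform convergence of all partial derivatives on the sets $K\cap H_+$, $K$ a compact subset of $H_+\cup Q$. Let $$\Psi_1=x_1^{-n/2}\,\omega_{-1}\omega_{(\nu-1)r}v_\sigma,\qquad \Psi_2=x_1^{-n/2}\,v_\sigma,\qquad \Psi_3=\not y\,x_1^{-(n+2)/2}\,\omega_{(\nu-1)r}v_\sigma,$$ and let $\mathcal H_i^{(1/2)}$ be the closure of $\mathcal U(\mathcal G_n^{\mathbb C})\Psi_i$. Then: 1. $\mathcal H_1^{(1/2)}\supset\mathcal H_2^{(1/2)}\supset\mathcal H_3^{(1/2)}$, and these are closed invariant subspaces. 2. $\mathcal H_1^{(1/2)}/\mathcal H_2^{(1/2)}$ and $\mathcal H_3^{(1/2)}$ carry $D(\frac{n+1}2,\frac12,\dots,\frac12,\nu-\frac12)$, and $\mathcal H_2^{(1/2)}/\mathcal H_3^{(1/2)}$ carries $D(\frac{n-1}2,\frac12,\dots,\frac12)$. 3. $\not\partial\Psi_2=\not\partial\Psi_3=0$,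 $\not y\not\partial\Psi_1=n\Psi_3\ne0$ and $(\not y\not\partial)^2\Psi_1=0$. 4. For every $\Psi\in\mathcal H_3^{(1/2)}$ and every $q\in Q$ one has $\lim_{y\to q}(\not y\Psi)(y)=0$ ($y\in H_+$), while $\lim_{y\to q}(\not y\Psi_2)(y)$ exists and is nonzero for every $q\in Q$. The representation $D(\frac{n-1}2,\frac12,\dots,\frac12)$ is realized on the cone: for $\Psi\in\mathcal H_2^{(1/2)}$ the boundary value $q\mapsto\lim_{y\to q}(\not y\Psi)(y)$ exists on $Q$ and induces an injective linear map from $\mathcal H_2^{(1/2)}/\mathcal H_3^{(1/2)}$ to the spinor fields on $Q$ that intertwines the action of $\mathcal G_n$ with $M_{ab}\mapsto y_a\partial_b-y_b\partial_a+S_{ab}$ on fields on $Q$ (the vector fields $y_a\partial_b-y_b\partial_a$ being tangent to $Q$). -/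

import Mathlib

open Topology
open scoped ContDiff

noncomputable section

namespace GuptaBleuler

/-! ### The Lie algebra `so(2,n)` and its highest weight representations

The index `a : Fin (n + 2)` stands for the index `a - 1 ∈ {-1, 0, 1, …, n}` of `ℝ^{2,n}`. -/

/-- The diagonal entries of `η = diag(1, 1, -1, …, -1)`. -/
def eta {n : ℕ} (a : Fin (n + 2)) : ℝ := if a.val < 2 then 1 else -1

/-- The entries `η_{ab}`, as complex numbers. -/
def etaMat {n : ℕ} (a b : Fin (n + 2)) : ℂ := if a = b then (eta a : ℂ) else 0

/-- The rank `r = ⌊(n + 2) / 2⌋`. -/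
abbrev rk (n : ℕ) : ℕ := (n + 2) / 2

/-- The parity `ν` of `n`: `0` if `n` is even, `1` if `n` is odd. -/
abbrev parity (n : ℕ) : ℕ := n % 2

section Representations

variable {n : ℕ} {V : Type*} [AddCommGroup V] [Module ℂ V]

/-- The operators `T a b` on `V` are the images of the basis `M_{ab}` under a representation of
`so(2,n)`. -/
structure IsRep (T : Fin (n + 2) → Fin (n + 2) → Module.End ℂ V) : Prop where
  antisymm : ∀ a b, T a b = -T b a
  bracket : ∀ a b c d, T a b * T c d - T c d * T a b =
    etaMat a d • T b c + etaMat b c • T a d - etaMat a c • T b d - etaMat b d • T a c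

/-- Coefficients of the isotropic basis of `ℂ^{n+2}` indexed by `-r ≤ j ≤ r`
(`j = 0` only for odd `n`):
for `j = ±1` it is `(i/√2)(e_{-1} ± i e_0)`, for `j = ±k`, `2 ≤ k ≤ r`, it is
`(1/√2)(e_{2k-3} ± i e_{2k-2})`, and for `j = 0` it is `e_n`. -/
def isoCoeff (j : ℤ) (a : Fin (n + 2)) : ℂ :=
  if j = 0 then (if a.val = n + 1 then 1 else 0)
  else (if j.natAbs = 1 then Complex.I else 1) / (Real.sqrt 2 : ℂ) *
    (if a.val = 2 * (j.natAbs - 1) then 1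
      else if a.val = 2 * (j.natAbs - 1) + 1 then (j.sign : ℂ) * Complex.I
      else 0)

/-- The operator of `X_{jk}`, an element of the complexification of `so(2,n)`. -/
def rootOp (T : Fin (n + 2) → Fin (n + 2) → Module.End ℂ V) (j k : ℤ) : Module.End ℂ V :=
  ∑ a, ∑ b, (isoCoeff j a * isoCoeff k b) • T a b

/-- The pairs `(j, k)` for which the `X_{jk}` span `𝔫⁺`: either `1 - ν ≤ j, k ≤ r`, or
`k = -l` with `1 ≤ j < l ≤ r`. -/
def IsPosPair (n : ℕ) (j k : ℤ) : Prop :=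
  (1 - (parity n : ℤ) ≤ j ∧ j ≤ rk n ∧ 1 - (parity n : ℤ) ≤ k ∧ k ≤ rk n) ∨
    (1 ≤ j ∧ j < -k ∧ -k ≤ rk n)

/-- `v` is a maximal vector of weight `lam = (lam_1, …, lam_r)`: nonzero, annihilated by `𝔫⁺`, and
`H_j v = lam_j v` for `H_j = X_{-j,j}`. The entry `lam i` is `lam_{i+1}`. -/
structure IsMaximalVector (T : Fin (n + 2) → Fin (n + 2) → Module.End ℂ V)
    (lam : Fin (rk n) → ℝ) (v : V) : Prop where
  ne_zero : v ≠ 0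
  nilp : ∀ j k : ℤ, IsPosPair n j k → rootOp T j k v = 0
  weight : ∀ i : Fin (rk n),
    rootOp T (-((i.val : ℤ) + 1)) ((i.val : ℤ) + 1) v = (lam i : ℂ) • v

/-- `W` is stable under all the operators `T a b`. -/
def Invariant (T : Fin (n + 2) → Fin (n + 2) → Module.End ℂ V) (W : Submodule ℂ V) : Prop :=
  ∀ a b, ∀ v ∈ W, T a b v ∈ W

/-- The subspace of vectors contained in a finite dimensional subspace stable under
`𝔨 = so(2) ⊕ so(n)`. -/
def kFinite (T : Fin (n + 2) → Fin (n + 2) → Module.End ℂ V) : Submodule ℂ V :=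
  sSup {W | FiniteDimensional ℂ W ∧
    ∀ a b : Fin (n + 2), (a.val < 2 ↔ b.val < 2) → ∀ v ∈ W, T a b v ∈ W}

/-- The cyclic submodule `𝒰(𝔤^ℂ) v`. -/
def cyclic (T : Fin (n + 2) → Fin (n + 2) → Module.End ℂ V) (v : V) : Submodule ℂ V :=
  (Subalgebra.toSubmodule (Algebra.adjoin ℂ
    (Set.range fun p : Fin (n + 2) × Fin (n + 2) => T p.1 p.2))).map (LinearMap.applyₗ v)

/-- The representation `T` of `so(2,n)` on the topological vector space `V` carries the irreducible
representation with highest weight `lam`: the `𝔨`-finite vectors are dense and form an irreducible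
`so(2,n)`-module with a maximal vector of weight `lam`. -/
structure CarriesIrrep [TopologicalSpace V] (T : Fin (n + 2) → Fin (n + 2) → Module.End ℂ V)
    (lam : Fin (rk n) → ℝ) : Prop where
  isRep : IsRep T
  dense : Dense (kFinite T : Set V)
  invariant : Invariant T (kFinite T)
  irreducible : ∀ W ≤ kFinite T, Invariant T W → W = ⊥ ∨ W = kFinite T
  highest : ∃ v ∈ kFinite T, IsMaximalVector T lam v

/-- The action `T` on `V` induces on the subquotient `M / N` a representation that carries the
irreducible representation with highest weight `lam`. -/
def SubquotientCarries [TopologicalSpace V] (T : Fin (n + 2) → Fin (n + 2) → Module.End ℂ V)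
    (M N : Submodule ℂ V) (lam : Fin (rk n) → ℝ) : Prop :=
  ∃ R : Fin (n + 2) → Fin (n + 2) → Module.End ℂ (M ⧸ N.submoduleOf M),
    (∀ a b (v : M), ∃ h : T a b v ∈ M,
      R a b (Submodule.Quotient.mk v) = Submodule.Quotient.mk ⟨T a b v, h⟩) ∧
    CarriesIrrep R lam

end Representations

/-- The highest weight `(-(n-1)/2, 1/2, …, 1/2)` of `D((n-1)/2, 1/2, …, 1/2)`. -/
def weightPhys (n : ℕ) (i : Fin (rk n)) : ℝ := if i.val = 0 then -(((n : ℝ) - 1) / 2) else 1 / 2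

/-- The highest weight `(-(n+1)/2, 1/2, …, 1/2, ν - 1/2)` of `D((n+1)/2, 1/2, …, 1/2, ν - 1/2)`. -/
def weightGauge (n : ℕ) (i : Fin (rk n)) : ℝ :=
  if i.val = 0 then -(((n : ℝ) + 1) / 2)
  else if i.val + 1 = rk n then (parity n : ℝ) - 1 / 2 else 1 / 2

/-! ### Spinors -/

/-- The spinor space `𝒮`, of dimension `2 ^ r`. -/
abbrev Spinor (n : ℕ) : Type := Fin (2 ^ rk n) → ℂ

/-- Families of `n + 2` matrices on `𝒮`. -/
abbrev Gammas (n : ℕ) : Type :=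
  Fin (n + 2) → Matrix (Fin (2 ^ rk n)) (Fin (2 ^ rk n)) ℂ

variable {n : ℕ}

/-- The Clifford relations `γ_a γ_b + γ_b γ_a = 2 η_{ab}`. -/
def IsClifford (γ : Gammas n) : Prop :=
  ∀ a b, γ a * γ b + γ b * γ a = (2 * etaMat a b) • 1

/-- `S_{ab} = (γ_a γ_b - η_{ab}) / 2`. -/
def spinMat (γ : Gammas n) (a b : Fin (n + 2)) : Matrix (Fin (2 ^ rk n)) (Fin (2 ^ rk n)) ℂ :=
  (1 / 2 : ℂ) • (γ a * γ b - etaMat a b • 1)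

/-- The spinor action of `so(2,n)` on `𝒮`. -/
def spinRep (γ : Gammas n) (a b : Fin (n + 2)) : Module.End ℂ (Spinor n) :=
  Matrix.toLin' (spinMat γ a b)

/-- The generators `ω_j`, `-r ≤ j ≤ r`. -/
def omega (γ : Gammas n) (j : ℤ) : Matrix (Fin (2 ^ rk n)) (Fin (2 ^ rk n)) ℂ :=
  ∑ a, isoCoeff j a • γ a

/-- The highest weight `σ = (1/2, …, 1/2)` of the spinor representation. -/
def sigma (n : ℕ) (_ : Fin (rk n)) : ℝ := 1 / 2

/-! ### Spinor fields

The point `(τ, 𝐲)` of `Cover n = ℂ × ℝⁿ` lies above the point `y` of `ℝ^{2,n}` with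
`y^{-1} + i y^0 = exp τ` and space part `𝐲`: this is the universal covering of
`{y | (y^{-1}, y^0) ≠ 0}`, and it restricts to the universal coverings of `{y | y² > 0}` and, for
`3 ≤ n`, of the cone `{y | y² = 0}` without its apex. -/

/-- The covering space. -/
abbrev Cover (n : ℕ) : Type := ℂ × (Fin n → ℝ)

/-- The coordinates `y^a` as functions on the covering. -/
def coord (a : Fin (n + 2)) (z : Cover n) : ℝ :=
  (Fin.cons (Complex.exp z.1).re (Fin.cons (Complex.exp z.1).im z.2 : Fin (n + 1) → ℝ) :
    Fin (n + 2) → ℝ) a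

/-- The lifts to the covering of the coordinate vector fields `∂/∂y^a`. -/
def frame (a : Fin (n + 2)) (z : Cover n) : Cover n :=
  (Fin.cons (Complex.exp (-z.1), 0) (Fin.cons (Complex.I * Complex.exp (-z.1), 0)
    (fun k => (0, Pi.single k 1)) : Fin (n + 1) → Cover n) : Fin (n + 2) → Cover n) a

/-- `y² = η_{ab} y^a y^b`. -/
def ySq (z : Cover n) : ℝ := ∑ a, eta a * coord a z ^ 2

/-- The covering of `H_+^{2,n} = {y | y² > 0}`. -/
def HPlus (n : ℕ) : Set (Cover n) := {z | 0 < ySq z}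

/-- The covering of the cone `Q^{2,n} = {y | y² = 0}` without its apex. -/
def Cone (n : ℕ) : Set (Cover n) := {z | ySq z = 0}

theorem contDiff_coord (a : Fin (n + 2)) : ContDiff ℝ ∞ (coord a : Cover n → ℝ) := by
  have h : ContDiff ℝ ∞ (fun z : Cover n => Complex.exp z.1) := contDiff_fst.cexp
  refine Fin.cases ?_ (fun b => ?_) a
  · exact Complex.reCLM.contDiff.comp h
  · refine Fin.cases ?_ (fun k => ?_) b
    · exact Complex.imCLM.contDiff.comp h
    · exact (contDiff_apply ℝ ℝ k).comp contDiff_snd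

theorem contDiff_frame (a : Fin (n + 2)) : ContDiff ℝ ∞ (frame a : Cover n → Cover n) := by
  have h : ContDiff ℝ ∞ (fun z : Cover n => Complex.exp (-z.1)) := contDiff_fst.neg.cexp
  refine Fin.cases ?_ (fun b => ?_) a
  · exact h.prodMk contDiff_const
  · refine Fin.cases ?_ (fun k => ?_) b
    · exact (contDiff_const.mul h).prodMk contDiff_const
    · exact contDiff_const

theorem isOpen_HPlus (n : ℕ) : IsOpen (HPlus n) := by
  refine isOpen_lt continuous_const ?_
  exact continuous_finsetSum _ fun a _ =>
    continuous_const.mul ((contDiff_coord a).continuous.pow 2)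

/-- Smooth spinor fields on `H_+`, as functions extended by zero. -/
def spinorFieldSubmodule (n : ℕ) : Submodule ℂ (Cover n → Spinor n) where
  carrier := {f | ContDiffOn ℝ ∞ f (HPlus n) ∧ ∀ z ∉ HPlus n, f z = 0}
  zero_mem' := ⟨contDiffOn_const, fun _ _ => rfl⟩
  add_mem' := fun {f g} hf hg => ⟨hf.1.add hg.1, fun z hz => by simp [hf.2 z hz, hg.2 z hz]⟩
  smul_mem' := fun c f hf => ⟨hf.1.const_smul c, fun z hz => by simp [hf.2 z hz]⟩

/-- The space of smooth spinor fields `H_+ → 𝒮`. -/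
def SpinorField (n : ℕ) : Type := spinorFieldSubmodule n

instance : AddCommGroup (SpinorField n) := inferInstanceAs (AddCommGroup (spinorFieldSubmodule n))

instance : Module ℂ (SpinorField n) := inferInstanceAs (Module ℂ (spinorFieldSubmodule n))

instance : CoeFun (SpinorField n) (fun _ => Cover n → Spinor n) := ⟨fun f => f.1⟩

/-- The field that agrees on `H_+` with a given smooth function. -/
def mkField (f : Cover n → Spinor n) (hf : ContDiffOn ℝ ∞ f (HPlus n)) : SpinorField n :=
  ⟨(HPlus n).indicator f,
    hf.congr fun _ hz => Set.indicator_of_mem hz f, fun _ hz => Set.indicator_of_notMem hz f⟩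

theorem SpinorField.contDiffOn (f : SpinorField n) : ContDiffOn ℝ ∞ f (HPlus n) := f.2.1

theorem SpinorField.differentiableAt (f : SpinorField n) {z : Cover n} (hz : z ∈ HPlus n) :
    DifferentiableAt ℝ f z :=
  (f.contDiffOn.contDiffAt ((isOpen_HPlus n).mem_nhds hz)).differentiableAt (by simp)

/-- The operator `∂_a = ∂/∂y^a`. -/
def pd (a : Fin (n + 2)) : Module.End ℂ (SpinorField n) where
  toFun f := mkField (fun z => fderiv ℝ f z (frame a z))
    ((f.contDiffOn.fderiv_of_isOpen (isOpen_HPlus n) (by simp)).clm_apply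
      (contDiff_frame a).contDiffOn)
  map_add' f g := by
    apply Subtype.ext
    funext z
    by_cases hz : z ∈ HPlus n
    · have h : fderiv ℝ (f.1 + g.1) z = fderiv ℝ f.1 z + fderiv ℝ g.1 z :=
        fderiv_add (f.differentiableAt hz) (g.differentiableAt hz)
      change (HPlus n).indicator (fun z => fderiv ℝ (f.1 + g.1) z (frame a z)) z =
        (HPlus n).indicator (fun z => fderiv ℝ f.1 z (frame a z)) z +
        (HPlus n).indicator (fun z => fderiv ℝ g.1 z (frame a z)) z
      simp [hz, h]
    · change (HPlus n).indicator (fun z => fderiv ℝ (f.1 + g.1) z (frame a z)) z =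
        (HPlus n).indicator (fun z => fderiv ℝ f.1 z (frame a z)) z +
        (HPlus n).indicator (fun z => fderiv ℝ g.1 z (frame a z)) z
      simp [hz]
  map_smul' c f := by
    apply Subtype.ext
    funext z
    by_cases hz : z ∈ HPlus n
    · have h : fderiv ℝ (c • f.1) z = c • fderiv ℝ f.1 z :=
        fderiv_const_smul (f.differentiableAt hz) c
      change (HPlus n).indicator (fun z => fderiv ℝ (c • f.1) z (frame a z)) z =
        c • (HPlus n).indicator (fun z => fderiv ℝ f.1 z (frame a z)) z
      simp [hz, h]
    · change (HPlus n).indicator (fun z => fderiv ℝ (c • f.1) z (frame a z)) z =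
        c • (HPlus n).indicator (fun z => fderiv ℝ f.1 z (frame a z)) z
      simp [hz]

/-- Multiplication by the coordinate `y^a`. -/
def mulY (a : Fin (n + 2)) : Module.End ℂ (SpinorField n) where
  toFun f := ⟨fun z => coord a z • f z, (contDiff_coord a).contDiffOn.smul f.contDiffOn,
    fun z hz => by simp [f.2.2 z hz]⟩
  map_add' f g := Subtype.ext (funext fun z => smul_add (coord a z) (f.1 z) (g.1 z))
  map_smul' c f := Subtype.ext (funext fun z => smul_comm (coord a z) c (f.1 z))

/-- Pointwise application of a matrix. -/
def mulMat (A : Matrix (Fin (2 ^ rk n)) (Fin (2 ^ rk n)) ℂ) : Module.End ℂ (SpinorField n) where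
  toFun f := ⟨fun z => A.mulVec (f z),
    (((Matrix.toLin' A).restrictScalars ℝ).toContinuousLinearMap.contDiff.comp_contDiffOn
      f.contDiffOn),
    fun z hz => by simp [f.2.2 z hz]⟩
  map_add' f g := Subtype.ext (funext fun z => Matrix.mulVec_add A (f.1 z) (g.1 z))
  map_smul' c f := Subtype.ext (funext fun z => Matrix.mulVec_smul A c (f.1 z))

/-- `L_{ab} = y_a ∂_b - y_b ∂_a`. -/
def orbital (a b : Fin (n + 2)) : Module.End ℂ (SpinorField n) :=
  (eta a : ℂ) • (mulY a * pd b) - (eta b : ℂ) • (mulY b * pd a)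

/-- The action `U(M_{ab}) = L_{ab} + S_{ab}` on spinor fields. -/
def fieldRep (γ : Gammas n) (a b : Fin (n + 2)) : Module.End ℂ (SpinorField n) :=
  orbital a b + mulMat (spinMat γ a b)

/-- `y̸ = y^a γ_a`. -/
def ySlash (γ : Gammas n) : Module.End ℂ (SpinorField n) := ∑ a, mulY a * mulMat (γ a)

/-- `∂̸ = ∂^a γ_a`. -/
def dSlash (γ : Gammas n) : Module.End ℂ (SpinorField n) :=
  ∑ a, (eta a : ℂ) • (pd a * mulMat (γ a))

/-- The field `x_1^s u`, where `x_1 = (i/√2)(y^{-1} + i y^0) = (i/√2) exp τ`. -/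
def powField (s : ℂ) (u : Spinor n) : SpinorField n :=
  mkField (fun z => Complex.exp (s * (z.1 + Complex.log (Complex.I / (Real.sqrt 2 : ℂ)))) • u)
    (ContDiff.contDiffOn
      ((contDiff_const.mul (contDiff_fst.add contDiff_const)).cexp.smul contDiff_const))

/-- `ω_{(ν-1)r}`, that is `ω_{-r}` for even `n` and `ω_0` for odd `n`. -/
def omegaStar (γ : Gammas n) : Matrix (Fin (2 ^ rk n)) (Fin (2 ^ rk n)) ℂ :=
  omega γ (((parity n : ℤ) - 1) * rk n)

/-- `Ψ_1 = x_1^{-n/2} ω_{-1} ω_{(ν-1)r} v`. -/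
def Psi1 (γ : Gammas n) (v : Spinor n) : SpinorField n :=
  powField (-(n : ℂ) / 2) ((omega γ (-1) * omegaStar γ).mulVec v)

/-- `Ψ_2 = x_1^{-n/2} v`. -/
def Psi2 (v : Spinor n) : SpinorField n := powField (-(n : ℂ) / 2) v

/-- `Ψ_3 = y̸ x_1^{-(n+2)/2} ω_{(ν-1)r} v`. -/
def Psi3 (γ : Gammas n) (v : Spinor n) : SpinorField n :=
  ySlash γ (powField (-((n : ℂ) + 2) / 2) ((omegaStar γ).mulVec v))

/-! ### The topology and the closures -/

/-- The traces on `H_+` of the compact subsets of `H_+ ∪ Q`. -/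
def compactTraces (n : ℕ) : Set (Set (Cover n)) :=
  {B | ∃ K, IsCompact K ∧ K ⊆ HPlus n ∪ Cone n ∧ B = K ∩ HPlus n}

/-- A field together with all its partial derivatives `∂_{a_1} ⋯ ∂_{a_k}`. -/
def jet (n : ℕ) : SpinorField n →ₗ[ℂ]
    (List (Fin (n + 2)) → UniformOnFun (Cover n) (Spinor n) (compactTraces n)) where
  toFun f w := UniformOnFun.ofFun (compactTraces n) (((w.map pd).prod f : SpinorField n) :
    Cover n → Spinor n)
  map_add' f g := by
    funext w
    rw [map_add]
    rfl
  map_smul' c f := by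
    funext w
    rw [map_smul]
    rfl

/-- The topology of uniform convergence of all partial derivatives on the compact subsets of
`H_+ ∪ Q`. -/
instance : TopologicalSpace (SpinorField n) := TopologicalSpace.induced (jet n) inferInstance

instance : IsTopologicalAddGroup (SpinorField n) := topologicalAddGroup_induced (jet n)

instance : ContinuousConstSMul ℂ (SpinorField n) where
  continuous_const_smul c := by
    refine continuous_induced_rng.2 ?_
    have h : (jet n) ∘ (fun f : SpinorField n => c • f) = fun f => c • jet n f := by
      funext f
      exact map_smul (jet n) c f
    rw [h]
    exact continuous_induced_dom.const_smul c

/-- The closure of `𝒰(𝔤^ℂ) Ψ`. -/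
def closedModule (γ : Gammas n) (Ψ : SpinorField n) : Submodule ℂ (SpinorField n) :=
  (cyclic (fieldRep γ) Ψ).topologicalClosure

/-- The vector field `y_a ∂_b - y_b ∂_a`; it is tangent to the cone. -/
def rotField (a b : Fin (n + 2)) (z : Cover n) : Cover n :=
  (eta a * coord a z) • frame b z - (eta b * coord b z) • frame a z

/-- On the field `F` on the cone the operator `L_{ab} + S_{ab}` is defined at `q`, with value `w`;
the derivative is taken along the cone. -/
def HasConeAction (γ : Gammas n) (a b : Fin (n + 2)) (F : Cover n → Spinor n) (q : Cover n)
    (w : Spinor n) : Prop :=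
  ∃ F' : Cover n →L[ℝ] Spinor n, HasFDerivWithinAt F F' (Cone n) q ∧
    w = F' (rotField a b q) + (spinMat γ a b).mulVec (F q)

end GuptaBleuler

end

noncomputable section

namespace GuptaBleuler

variable {n : ℕ}

/-! ### The Weyl–Clifford operator algebra on spinor fields -/

/-! All operators live in the algebra generated by the coordinates, the derivatives and the gamma
matrices. In it `ySlash` and `dSlash` commute with the Lie algebra (`genOp_ySlash`, `genOp_dSlash`),
and their anticommutator is `2 degOp + n + 2`, so the degree is invariant too. Hence every field
generated by `Psi1` has degree `-n/2`, `dSlash` vanishes on everything generated by `Psi2`, and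
`ySlash * dSlash` maps the module of `Psi1` into that of `Psi3`.

Algebraic part: the three cyclic modules before closure. The generator `H` of `so(2)` grades them by
the eigenvalues `-(n-1)/2 - d`, with finite dimensional pieces consisting of polynomials in the
spatial coordinates. The engine is the Casimir identity `WeylClifford.casimir`. On the fields in
question it reads (`T_apply`) `T = 2 ∑ P⁻P⁺ - ySlash dSlash - d(d-1)`, where `T` is essentially the
Casimir operator of `so(n)`, and `T + c` with `c > 0` is injective on polynomials (`eq_zero_of_T`).
For `d ≥ 2` the constant `d(d-1)` is positive, and induction on `d` shows (`le_of_low_degrees`) that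
an invariant `W ⊇ N` with `ySlash dSlash W ⊆ N` equals `N` as soon as the two agree in degrees `0`
and `1`. In these two degrees everything reduces to the irreducibility of the spinor modules of
`so(n)` (`spatialStable_irreducible`). That in turn follows from the Fock space description, because
the vacuum is a line (`finrank_vacuum`). The result is the irreducibility of the successive
quotients: `irreducible_one`, `irreducible_two`, `irreducible_three`.

Analytic part: passing to closures. Averaging over rotations of the time plane against a character
extracts the component of weight `d`. It is continuous, so a field in the closure of a cyclic module
has components in the module itself (`exists_component`), and the series of its components converges
to it (`tendsto_sum_components`). A `𝔨`-finite vector of a quotient of closures is annihilated by a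
polynomial in the time rotation, so modulo the smaller closure it has only finitely many components.
Therefore the `𝔨`-finite vectors are exactly the image of the algebraic module, and
`subquotientCarries` transfers irreducibility and the maximal vector.

Boundary values: the topology controls all derivatives up to the cone, so limits exist there and may
be differentiated along the cone (`hasFDerivAt_boundary`). Because `ySlash` squares to `y²`, the
field `ySlash Ψ` tends to zero on the cone for `Ψ` generated by `Psi3`, while for `Psi2` it does
not. The fields in the module of `Psi2` with this vanishing property form an invariant subspace, so
irreducibility identifies it with the module of `Psi3`. Averaging extends this to the closures
(`mem_closure_of_mem_nullFields`), which is the injectivity of the boundary map. -/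

theorem field_ext {f g : SpinorField n} (h : ∀ z ∈ HPlus n, f z = g z) : f = g := by
  apply Subtype.ext
  funext z
  by_cases hz : z ∈ HPlus n
  · exact h z hz
  · exact (f.2.2 z hz).trans (g.2.2 z hz).symm

theorem field_add_apply (f g : SpinorField n) (z : Cover n) : (f + g) z = f z + g z := rfl

theorem field_sub_apply (f g : SpinorField n) (z : Cover n) : (f - g) z = f z - g z := rfl

theorem field_smul_apply (c : ℂ) (f : SpinorField n) (z : Cover n) : (c • f) z = c • f z := rfl

/-- Evaluation at a point. -/
def evalAt (z : Cover n) : SpinorField n →ₗ[ℂ] Spinor n where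
  toFun f := f z
  map_add' _ _ := rfl
  map_smul' _ _ := rfl

theorem field_sum_apply {ι : Type*} (s : Finset ι) (f : ι → SpinorField n) (z : Cover n) :
    (∑ i ∈ s, f i) z = ∑ i ∈ s, f i z :=
  map_sum (evalAt z) f s

theorem mkField_apply {f : Cover n → Spinor n} (hf : ContDiffOn ℝ ∞ f (HPlus n)) {z : Cover n}
    (hz : z ∈ HPlus n) : mkField f hf z = f z :=
  Set.indicator_of_mem hz f

theorem pd_apply (a : Fin (n + 2)) (f : SpinorField n) {z : Cover n} (hz : z ∈ HPlus n) :
    pd a f z = fderiv ℝ f z (frame a z) :=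
  Set.indicator_of_mem hz fun z => fderiv ℝ f z (frame a z)

theorem mulY_apply (a : Fin (n + 2)) (f : SpinorField n) (z : Cover n) :
    mulY a f z = coord a z • f z := rfl

theorem mulMat_apply (A : Matrix (Fin (2 ^ rk n)) (Fin (2 ^ rk n)) ℂ) (f : SpinorField n)
    (z : Cover n) : mulMat A f z = A.mulVec (f z) := rfl

theorem hasFDerivAt_exp_neg_fst (z : Cover n) :
    HasFDerivAt (fun z : Cover n => Complex.exp (-z.1))
      ((-Complex.exp (-z.1)) • ContinuousLinearMap.fst ℝ ℂ (Fin n → ℝ)) z := by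
  have h1 : HasFDerivAt (fun z : Cover n => -z.1) (-ContinuousLinearMap.fst ℝ ℂ (Fin n → ℝ)) z :=
    hasFDerivAt_fst.neg
  have h2 := h1.cexp
  rw [smul_neg, ← neg_smul] at h2
  exact h2

theorem hasFDerivAt_exp_fst (z : Cover n) :
    HasFDerivAt (fun z : Cover n => Complex.exp z.1)
      (Complex.exp z.1 • ContinuousLinearMap.fst ℝ ℂ (Fin n → ℝ)) z :=
  (hasFDerivAt_fst (p := z)).cexp

/-- The derivative of `frame b` in the direction `δ`. -/
def frameDeriv (b : Fin (n + 2)) (z δ : Cover n) : Cover n :=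
  (Fin.cons (-Complex.exp (-z.1) * δ.1, 0)
    (Fin.cons (Complex.I * (-Complex.exp (-z.1) * δ.1), 0)
    (fun _ => 0) : Fin (n + 1) → Cover n) : Fin (n + 2) → Cover n) b

theorem fderiv_frame (b : Fin (n + 2)) (z δ : Cover n) :
    fderiv ℝ (frame b) z δ = frameDeriv b z δ := by
  refine Fin.cases ?_ (fun b => ?_) b
  · have h := (hasFDerivAt_exp_neg_fst z).prodMk (hasFDerivAt_const (0 : Fin n → ℝ) z)
    have h' : HasFDerivAt (frame 0) _ z := h
    rw [h'.fderiv]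
    simp [frameDeriv]
  · refine Fin.cases ?_ (fun k => ?_) b
    · have h := ((hasFDerivAt_exp_neg_fst z).const_mul Complex.I).prodMk
        (hasFDerivAt_const (0 : Fin n → ℝ) z)
      have h' : HasFDerivAt (frame (Fin.succ 0)) _ z := h
      rw [h'.fderiv]
      simp [frameDeriv]
    · have h' : HasFDerivAt (frame (k.succ.succ)) (0 : Cover n →L[ℝ] Cover n) z :=
        hasFDerivAt_const ((0, Pi.single k 1) : Cover n) z
      rw [h'.fderiv]
      simp [frameDeriv]

/-- The frame consists of lifts of coordinate vector fields, so its Lie brackets vanish. Only the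
pair of time directions needs a computation, since the other fields are constant and the time fields
do not depend on the space part. -/
theorem frameDeriv_comm (a b : Fin (n + 2)) (z : Cover n) :
    frameDeriv b z (frame a z) = frameDeriv a z (frame b z) := by
  refine Fin.cases ?_ (fun a => ?_) a <;> refine Fin.cases ?_ (fun b => ?_) b
  · rfl
  · refine Fin.cases ?_ (fun k => ?_) b
    · simp only [frameDeriv, frame, Fin.cons_zero, Fin.cons_succ]
      refine Prod.ext ?_ rfl
      simp only
      ring
    · simp [frameDeriv, frame, Prod.zero_eq_mk]
  · refine Fin.cases ?_ (fun k => ?_) a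
    · simp only [frameDeriv, frame, Fin.cons_zero, Fin.cons_succ]
      refine Prod.ext ?_ rfl
      simp only
      ring
    · simp [frameDeriv, frame, Prod.zero_eq_mk]
  · refine Fin.cases ?_ (fun k => ?_) a <;> refine Fin.cases ?_ (fun l => ?_) b <;>
      simp [frameDeriv, frame, Prod.zero_eq_mk]

/-- The frame is dual to the differentials of the coordinates. The derivative is left abstract
because only its values on the frame enter the commutation relations. -/
theorem fderiv_coord (b : Fin (n + 2)) (z : Cover n) :
    ∃ L : Cover n →L[ℝ] ℝ, HasFDerivAt (coord b) L z ∧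
      ∀ a, L (frame a z) = if a = b then 1 else 0 := by
  have e1 : Complex.exp z.1 * Complex.exp (-z.1) = 1 := by
    rw [← Complex.exp_add]; simp
  have e2 : Complex.exp z.1 * (Complex.I * Complex.exp (-z.1)) = Complex.I := by
    rw [mul_left_comm, e1, mul_one]
  refine Fin.cases ?_ (fun b => ?_) b
  · refine ⟨_, Complex.reCLM.hasFDerivAt.comp z (hasFDerivAt_exp_fst z), fun a => ?_⟩
    refine Fin.cases ?_ (fun a => ?_) a
    · simp [frame, e1]
    · refine Fin.cases ?_ (fun k => ?_) a <;> simp [frame, e2, -Complex.mul_re]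
  · refine Fin.cases ?_ (fun k => ?_) b
    · refine ⟨_, Complex.imCLM.hasFDerivAt.comp z (hasFDerivAt_exp_fst z), fun a => ?_⟩
      refine Fin.cases ?_ (fun a => ?_) a
      · simp [frame, e1, -Complex.mul_im]
      · refine Fin.cases ?_ (fun k => ?_) a <;> simp [frame, e2, -Complex.mul_im, Fin.ext_iff]
    · refine ⟨(ContinuousLinearMap.proj k).comp (ContinuousLinearMap.snd ℝ ℂ (Fin n → ℝ)),
        ((ContinuousLinearMap.proj k).comp
          (ContinuousLinearMap.snd ℝ ℂ (Fin n → ℝ))).hasFDerivAt, fun a => ?_⟩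
      refine Fin.cases ?_ (fun a => ?_) a
      · simp [frame, Fin.ext_iff]
      · refine Fin.cases ?_ (fun l => ?_) a
        · simp [frame, Fin.ext_iff]
        · simp [frame, Pi.single_apply, eq_comm]

/-- Applying two frame derivatives gives the second derivative of the field, symmetric because the
field is smooth, and a first order term from differentiating the frame, symmetric by
`frameDeriv_comm`. -/
theorem pd_comm (a b : Fin (n + 2)) : (pd a * pd b : Module.End ℂ (SpinorField n)) = pd b * pd a := by
  have key : ∀ (a b : Fin (n + 2)) (f : SpinorField n) (z : Cover n), z ∈ HPlus n →
      pd a (pd b f) z = fderiv ℝ (fderiv ℝ f) z (frame a z) (frame b z) +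
        fderiv ℝ f z (frameDeriv b z (frame a z)) := by
    intro a b f z hz
    have hnh := (isOpen_HPlus n).mem_nhds hz
    rw [pd_apply a _ hz]
    have h1 : (pd b f : Cover n → Spinor n) =ᶠ[𝓝 z] fun z => fderiv ℝ f z (frame b z) := by
      filter_upwards [hnh] with z' hz'
      exact pd_apply b f hz'
    rw [h1.fderiv_eq]
    have h2 : DifferentiableAt ℝ (fderiv ℝ f) z :=
      ((f.contDiffOn.contDiffAt hnh).fderiv_right (m := 1) (WithTop.coe_le_coe.2 le_top)).differentiableAt (by simp)
    have h3 : DifferentiableAt ℝ (frame b) z :=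
      (contDiff_frame b).contDiffAt.differentiableAt (by simp)
    rw [fderiv_clm_apply h2 h3]
    simp only [add_apply, ContinuousLinearMap.comp_apply,
      ContinuousLinearMap.flip_apply, fderiv_frame]
    rw [add_comm]
  refine LinearMap.ext fun f => field_ext fun z hz => ?_
  change pd a (pd b f) z = pd b (pd a f) z
  rw [key a b f z hz, key b a f z hz, frameDeriv_comm a b]
  have hs : IsSymmSndFDerivAt ℝ f z :=
    (f.contDiffOn.contDiffAt ((isOpen_HPlus n).mem_nhds hz)).isSymmSndFDerivAt
      (by simpa using (ENat.LEInfty.out : (2 : WithTop ℕ∞) ≤ ∞))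
  rw [hs]

theorem pd_mulY (a b : Fin (n + 2)) :
    (pd a * mulY b : Module.End ℂ (SpinorField n)) =
      mulY b * pd a + (if a = b then (1 : ℂ) else 0) • 1 := by
  refine LinearMap.ext fun f => field_ext fun z hz => ?_
  change pd a (mulY b f) z = mulY b (pd a f) z + (if a = b then (1 : ℂ) else 0) • f z
  rw [pd_apply a _ hz, mulY_apply, pd_apply a _ hz]
  obtain ⟨L, hL, hL'⟩ := fderiv_coord b z
  have h : HasFDerivAt (mulY b f : Cover n → Spinor n) _ z :=
    hL.smul (f.differentiableAt hz).hasFDerivAt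
  rw [h.fderiv]
  simp only [add_apply, smul_apply,
    ContinuousLinearMap.smulRight_apply, hL']
  congr 1
  split_ifs <;> simp

theorem mulY_comm (a b : Fin (n + 2)) :
    (mulY a * mulY b : Module.End ℂ (SpinorField n)) = mulY b * mulY a := by
  refine LinearMap.ext fun f => field_ext fun z _ => ?_
  change coord a z • coord b z • f z = coord b z • coord a z • f z
  rw [smul_comm]

theorem mulMat_mulY (A : Matrix (Fin (2 ^ rk n)) (Fin (2 ^ rk n)) ℂ) (a : Fin (n + 2)) :
    mulMat A * mulY a = mulY a * mulMat A := by
  refine LinearMap.ext fun f => field_ext fun z _ => ?_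
  change A.mulVec (coord a z • f z) = coord a z • A.mulVec (f z)
  rw [Matrix.mulVec_smul]

theorem mulMat_pd (A : Matrix (Fin (2 ^ rk n)) (Fin (2 ^ rk n)) ℂ) (a : Fin (n + 2)) :
    mulMat A * pd a = pd a * mulMat A := by
  refine LinearMap.ext fun f => field_ext fun z hz => ?_
  change A.mulVec (pd a f z) = pd a (mulMat A f) z
  rw [pd_apply a _ hz, pd_apply a _ hz]
  have h : HasFDerivAt (mulMat A f : Cover n → Spinor n) _ z :=
    ((Matrix.toLin' A).restrictScalars ℝ).toContinuousLinearMap.hasFDerivAt.comp z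
      (f.differentiableAt hz).hasFDerivAt
  rw [h.fderiv]
  rfl

/-- `mulMat` as a homomorphism of algebras. -/
def mulMatHom (n : ℕ) :
    Matrix (Fin (2 ^ rk n)) (Fin (2 ^ rk n)) ℂ →ₐ[ℂ] Module.End ℂ (SpinorField n) where
  toFun := mulMat
  map_one' := LinearMap.ext fun f => field_ext fun z _ => Matrix.one_mulVec (f z)
  map_mul' A B := LinearMap.ext fun f => field_ext fun z _ =>
    (Matrix.mulVec_mulVec (f z) A B).symm
  map_zero' := LinearMap.ext fun f => field_ext fun z _ => Matrix.zero_mulVec (f z)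
  map_add' A B := LinearMap.ext fun f => field_ext fun z _ => Matrix.add_mulVec A B (f z)
  commutes' c := LinearMap.ext fun f => field_ext fun z _ => by
    change (algebraMap ℂ (Matrix (Fin (2 ^ rk n)) (Fin (2 ^ rk n)) ℂ) c).mulVec (f z) = c • f z
    rw [Algebra.algebraMap_eq_smul_one, Matrix.smul_mulVec, Matrix.one_mulVec]

theorem mulMatHom_apply (A : Matrix (Fin (2 ^ rk n)) (Fin (2 ^ rk n)) ℂ) :
    mulMatHom n A = mulMat A := rfl

theorem mulMat_mul (A B : Matrix (Fin (2 ^ rk n)) (Fin (2 ^ rk n)) ℂ) :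
    mulMat (A * B) = mulMat A * mulMat B := map_mul (mulMatHom n) A B

theorem mulMat_sub (A B : Matrix (Fin (2 ^ rk n)) (Fin (2 ^ rk n)) ℂ) :
    mulMat (A - B) = mulMat A - mulMat B := map_sub (mulMatHom n) A B

theorem mulMat_smul (c : ℂ) (A : Matrix (Fin (2 ^ rk n)) (Fin (2 ^ rk n)) ℂ) :
    mulMat (c • A) = c • mulMat A := map_smul (mulMatHom n) c A

theorem mulMat_one : (mulMat 1 : Module.End ℂ (SpinorField n)) = 1 := map_one (mulMatHom n)

theorem mulMat_sum {ι : Type*} (s : Finset ι)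
    (A : ι → Matrix (Fin (2 ^ rk n)) (Fin (2 ^ rk n)) ℂ) :
    mulMat (∑ i ∈ s, A i) = ∑ i ∈ s, mulMat (A i) := map_sum (mulMatHom n) A s

end GuptaBleuler

end

noncomputable section

namespace GuptaBleuler

variable {n : ℕ}

/-! ### Contractions with complex vectors -/

/-- The bilinear form `η` on `ℂ^{n+2}`. -/
def ip (ξ ζ : Fin (n + 2) → ℂ) : ℂ := ∑ a, (eta a : ℂ) * ξ a * ζ a

/-- Multiplication by `ξ^a y_a`. -/
def lowY (ξ : Fin (n + 2) → ℂ) : Module.End ℂ (SpinorField n) := ∑ a, (ξ a * (eta a : ℂ)) • mulY a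

/-- The derivative `ξ^a ∂_a`. -/
def dirD (ξ : Fin (n + 2) → ℂ) : Module.End ℂ (SpinorField n) := ∑ a, ξ a • pd a

/-- The matrix `ξ^a γ_a`. -/
def gam (γ : Gammas n) (ξ : Fin (n + 2) → ℂ) : Matrix (Fin (2 ^ rk n)) (Fin (2 ^ rk n)) ℂ :=
  ∑ a, ξ a • γ a

/-- The operator of the element `ξ^a ζ^b M_{ab}` of the complexified Lie algebra. -/
def genOp (γ : Gammas n) (ξ ζ : Fin (n + 2) → ℂ) : Module.End ℂ (SpinorField n) :=
  lowY ξ * dirD ζ - lowY ζ * dirD ξ +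
    (1 / 2 : ℂ) • (mulMat (gam γ ξ) * mulMat (gam γ ζ) - ip ξ ζ • 1)

theorem eta_mul_self (a : Fin (n + 2)) : (eta a : ℂ) * eta a = 1 := by
  unfold eta; split_ifs <;> simp

theorem ip_comm (ξ ζ : Fin (n + 2) → ℂ) : ip ξ ζ = ip ζ ξ :=
  Finset.sum_congr rfl fun _ _ => by ring

theorem ip_single (a b : Fin (n + 2)) : ip (Pi.single a 1) (Pi.single b 1) = etaMat a b := by
  unfold ip etaMat
  rw [Finset.sum_eq_single a] <;> simp +contextual [Pi.single_apply]

theorem ip_single_left (a : Fin (n + 2)) (ζ : Fin (n + 2) → ℂ) :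
    ip (Pi.single a 1) ζ = eta a * ζ a := by
  unfold ip
  rw [Finset.sum_eq_single a] <;> simp +contextual

theorem lowY_single (a : Fin (n + 2)) : lowY (Pi.single a 1) = (eta a : ℂ) • mulY a := by
  unfold lowY
  rw [Finset.sum_eq_single a] <;> simp +contextual

theorem dirD_single (a : Fin (n + 2)) : dirD (Pi.single a 1) = pd a := by
  unfold dirD
  rw [Finset.sum_eq_single a] <;> simp +contextual

theorem gam_single (γ : Gammas n) (a : Fin (n + 2)) : gam γ (Pi.single a 1) = γ a := by
  unfold gam
  rw [Finset.sum_eq_single a] <;> simp +contextual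

theorem mulMat_gam (γ : Gammas n) (ξ : Fin (n + 2) → ℂ) :
    mulMat (gam γ ξ) = ∑ a, ξ a • mulMat (γ a) := by
  simp only [gam, mulMat_sum, mulMat_smul]

theorem dirD_lowY (ξ ζ : Fin (n + 2) → ℂ) :
    dirD ξ * lowY ζ = lowY ζ * dirD ξ + ip ξ ζ • 1 := by
  have h : ∀ a b : Fin (n + 2), (ξ a • pd a : Module.End ℂ (SpinorField n)) *
      ((ζ b * (eta b : ℂ)) • mulY b) = ((ζ b * (eta b : ℂ)) • mulY b) * (ξ a • pd a) +
        (if a = b then (eta b : ℂ) * ξ a * ζ b else 0) • 1 := by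
    intro a b
    rw [smul_mul_smul_comm, smul_mul_smul_comm, pd_mulY, smul_add, smul_smul]
    congr 1
    · rw [mul_comm]
    · congr 1
      split_ifs <;> ring
  unfold dirD lowY
  rw [Finset.sum_mul_sum, Finset.sum_mul_sum]
  simp only [h, Finset.sum_add_distrib]
  congr 1
  · rw [Finset.sum_comm]
  · simp [← Finset.sum_smul, ip]

theorem dirD_comm (ξ ζ : Fin (n + 2) → ℂ) :
    (dirD ξ * dirD ζ : Module.End ℂ (SpinorField n)) = dirD ζ * dirD ξ := by
  unfold dirD
  rw [Finset.sum_mul_sum, Finset.sum_mul_sum, Finset.sum_comm]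
  refine Finset.sum_congr rfl fun a _ => Finset.sum_congr rfl fun b _ => ?_
  rw [smul_mul_smul_comm, smul_mul_smul_comm, pd_comm, mul_comm]

theorem lowY_comm (ξ ζ : Fin (n + 2) → ℂ) :
    (lowY ξ * lowY ζ : Module.End ℂ (SpinorField n)) = lowY ζ * lowY ξ := by
  unfold lowY
  rw [Finset.sum_mul_sum, Finset.sum_mul_sum, Finset.sum_comm]
  refine Finset.sum_congr rfl fun a _ => Finset.sum_congr rfl fun b _ => ?_
  rw [smul_mul_smul_comm, smul_mul_smul_comm, mulY_comm, mul_comm]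

theorem mulMat_lowY (A : Matrix (Fin (2 ^ rk n)) (Fin (2 ^ rk n)) ℂ) (ξ : Fin (n + 2) → ℂ) :
    mulMat A * lowY ξ = lowY ξ * mulMat A := by
  unfold lowY
  simp only [Finset.mul_sum, Finset.sum_mul, mul_smul_comm, smul_mul_assoc, mulMat_mulY]

theorem mulMat_dirD (A : Matrix (Fin (2 ^ rk n)) (Fin (2 ^ rk n)) ℂ) (ξ : Fin (n + 2) → ℂ) :
    mulMat A * dirD ξ = dirD ξ * mulMat A := by
  unfold dirD
  simp only [Finset.mul_sum, Finset.sum_mul, mul_smul_comm, smul_mul_assoc, mulMat_pd]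

theorem gam_anticomm {γ : Gammas n} (hγ : IsClifford γ) (ξ ζ : Fin (n + 2) → ℂ) :
    gam γ ξ * gam γ ζ = -(gam γ ζ * gam γ ξ) + (2 * ip ξ ζ) • 1 := by
  have h : ∀ a b : Fin (n + 2), (ξ a • γ a) * (ζ b • γ b) =
      -((ζ b • γ b) * (ξ a • γ a)) + (ξ a * ζ b * (2 * etaMat a b)) • 1 := by
    intro a b
    have := hγ a b
    rw [smul_mul_smul_comm, smul_mul_smul_comm, mul_smul (ξ a * ζ b), ← this]
    module
  unfold gam
  rw [Finset.sum_mul_sum, Finset.sum_mul_sum]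
  simp only [h, Finset.sum_add_distrib, Finset.sum_neg_distrib]
  congr 1
  · rw [Finset.sum_comm]
  · simp only [← Finset.sum_smul]
    congr 1
    unfold ip etaMat
    rw [Finset.mul_sum]
    refine Finset.sum_congr rfl fun a _ => ?_
    rw [Finset.sum_eq_single a] <;> simp +contextual [eq_comm]
    ring

theorem mulGam_anticomm {γ : Gammas n} (hγ : IsClifford γ) (ξ ζ : Fin (n + 2) → ℂ) :
    mulMat (gam γ ξ) * mulMat (gam γ ζ) =
      -(mulMat (gam γ ζ) * mulMat (gam γ ξ)) + (2 * ip ξ ζ) • 1 := by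
  have h := congrArg (mulMatHom n) (gam_anticomm hγ ξ ζ)
  simpa only [map_mul, map_add, map_neg, map_smul, map_one, mulMatHom_apply] using h

theorem genOp_antisymm {γ : Gammas n} (hγ : IsClifford γ) (ξ ζ : Fin (n + 2) → ℂ) :
    genOp γ ξ ζ = -genOp γ ζ ξ := by
  unfold genOp
  rw [mulGam_anticomm hγ ξ ζ, ip_comm ζ ξ]
  module

/-- Normal ordering: the quartic term `y₁ y₃ d₂ d₄` is the same for both products and cancels,
leaving one single contraction from each. -/
theorem weyl_bracket {R : Type*} [Ring R] [Algebra ℂ R] {y₁ d₂ y₃ d₄ : R} {c₂₃ c₄₁ : ℂ}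
    (hy : y₁ * y₃ = y₃ * y₁) (hd : d₂ * d₄ = d₄ * d₂) (h₂₃ : d₂ * y₃ = y₃ * d₂ + c₂₃ • 1)
    (h₄₁ : d₄ * y₁ = y₁ * d₄ + c₄₁ • 1) :
    y₁ * d₂ * (y₃ * d₄) - y₃ * d₄ * (y₁ * d₂) = c₂₃ • (y₁ * d₄) - c₄₁ • (y₃ * d₂) := by
  have e1 : y₁ * d₂ * (y₃ * d₄) = y₁ * y₃ * (d₂ * d₄) + c₂₃ • (y₁ * d₄) := by
    rw [mul_assoc, ← mul_assoc d₂, h₂₃]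
    simp only [add_mul, mul_add, smul_mul_assoc, mul_smul_comm, one_mul, mul_assoc]
  have e2 : y₃ * d₄ * (y₁ * d₂) = y₃ * y₁ * (d₄ * d₂) + c₄₁ • (y₃ * d₂) := by
    rw [mul_assoc, ← mul_assoc d₄, h₄₁]
    simp only [add_mul, mul_add, smul_mul_assoc, mul_smul_comm, one_mul, mul_assoc]
  rw [e1, e2, hy, hd]
  abel

/-- The letters `g₃` and `g₄` are moved to the left past `g₂` and `g₁`. The four transpositions cost
no sign in total, and each leaves behind one contraction. -/
theorem clifford_bracket {R : Type*} [Ring R] [Algebra ℂ R] {g₁ g₂ g₃ g₄ : R}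
    {c₂₃ c₁₃ c₂₄ c₁₄ : ℂ} (h₂₃ : g₂ * g₃ = -(g₃ * g₂) + (2 * c₂₃) • 1)
    (h₁₃ : g₁ * g₃ = -(g₃ * g₁) + (2 * c₁₃) • 1) (h₂₄ : g₂ * g₄ = -(g₄ * g₂) + (2 * c₂₄) • 1)
    (h₁₄ : g₁ * g₄ = -(g₄ * g₁) + (2 * c₁₄) • 1) :
    g₁ * g₂ * (g₃ * g₄) - g₃ * g₄ * (g₁ * g₂) =
      (2 * c₂₃) • (g₁ * g₄) - (2 * c₁₃) • (g₂ * g₄) + (2 * c₂₄) • (g₃ * g₁)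
        - (2 * c₁₄) • (g₃ * g₂) := by
  have e1 : g₁ * g₂ * (g₃ * g₄) = -(g₁ * g₃ * (g₂ * g₄)) + (2 * c₂₃) • (g₁ * g₄) := by
    rw [mul_assoc, ← mul_assoc g₂, h₂₃]
    simp only [add_mul, mul_add, smul_mul_assoc, mul_smul_comm, one_mul, mul_assoc, neg_mul,
      mul_neg]
  have e2 : g₁ * g₃ * (g₂ * g₄) = -(g₃ * g₁ * (g₂ * g₄)) + (2 * c₁₃) • (g₂ * g₄) := by
    rw [h₁₃]
    simp only [add_mul, smul_mul_assoc, one_mul, neg_mul]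
  have e3 : g₃ * g₁ * (g₂ * g₄) = -(g₃ * (g₁ * g₄) * g₂) + (2 * c₂₄) • (g₃ * g₁) := by
    rw [h₂₄]
    simp only [mul_add, mul_smul_comm, mul_one, mul_neg, mul_assoc]
  have e4 : g₃ * (g₁ * g₄) * g₂ = -(g₃ * g₄ * (g₁ * g₂)) + (2 * c₁₄) • (g₃ * g₂) := by
    rw [h₁₄]
    simp only [mul_add, add_mul, mul_smul_comm, smul_mul_assoc, mul_one, mul_neg, neg_mul,
      mul_assoc]
  rw [e1, e2, e3, e4]
  abel

/-- Orbital and spin parts commute, so the bracket splits into four Weyl brackets and a quarter of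
one Clifford bracket; the scalar corrections `ip` drop out. The vectors are arbitrary and complex,
which lets later computations use the null basis directly. -/
theorem genOp_bracket {γ : Gammas n} (hγ : IsClifford γ) (ξ ζ ξ' ζ' : Fin (n + 2) → ℂ) :
    genOp γ ξ ζ * genOp γ ξ' ζ' - genOp γ ξ' ζ' * genOp γ ξ ζ =
      ip ξ ζ' • genOp γ ζ ξ' + ip ζ ξ' • genOp γ ξ ζ' - ip ξ ξ' • genOp γ ζ ζ' -
        ip ζ ζ' • genOp γ ξ ξ' := by
  set y₁ : Module.End ℂ (SpinorField n) := lowY ξ with hy₁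
  set y₂ : Module.End ℂ (SpinorField n) := lowY ζ with hy₂
  set y₃ : Module.End ℂ (SpinorField n) := lowY ξ' with hy₃
  set y₄ : Module.End ℂ (SpinorField n) := lowY ζ' with hy₄
  set d₁ : Module.End ℂ (SpinorField n) := dirD ξ with hd₁
  set d₂ : Module.End ℂ (SpinorField n) := dirD ζ with hd₂
  set d₃ : Module.End ℂ (SpinorField n) := dirD ξ' with hd₃
  set d₄ : Module.End ℂ (SpinorField n) := dirD ζ' with hd₄
  set g₁ := mulMat (gam γ ξ) with hg₁
  set g₂ := mulMat (gam γ ζ) with hg₂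
  set g₃ := mulMat (gam γ ξ') with hg₃
  set g₄ := mulMat (gam γ ζ') with hg₄
  have w1 := weyl_bracket (lowY_comm ξ ξ') (dirD_comm ζ ζ') (dirD_lowY ζ ξ') (dirD_lowY ζ' ξ)
  have w2 := weyl_bracket (lowY_comm ξ ζ') (dirD_comm ζ ξ') (dirD_lowY ζ ζ') (dirD_lowY ξ' ξ)
  have w3 := weyl_bracket (lowY_comm ζ ξ') (dirD_comm ξ ζ') (dirD_lowY ξ ξ') (dirD_lowY ζ' ζ)
  have w4 := weyl_bracket (lowY_comm ζ ζ') (dirD_comm ξ ξ') (dirD_lowY ξ ζ') (dirD_lowY ξ' ζ)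
  have c1 := clifford_bracket (mulGam_anticomm hγ ζ ξ') (mulGam_anticomm hγ ξ ξ')
    (mulGam_anticomm hγ ζ ζ') (mulGam_anticomm hγ ξ ζ')
  have k1 := mulGam_anticomm hγ ζ ξ'
  have k2 := mulGam_anticomm hγ ξ ξ'
  simp only [← hy₁, ← hy₂, ← hy₃, ← hy₄, ← hd₁, ← hd₂, ← hd₃, ← hd₄, ← hg₁, ← hg₂, ← hg₃, ← hg₄]
    at w1 w2 w3 w4 c1 k1 k2
  rw [ip_comm ζ' ξ] at w1
  rw [ip_comm ξ' ξ] at w2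
  rw [ip_comm ζ' ζ] at w3
  rw [ip_comm ξ' ζ] at w4
  have o1 : ∀ g d y : Module.End ℂ (SpinorField n), g * y = y * g → g * d = d * g →
      g * (y * d) = y * d * g := fun g d y h1 h2 => by
    rw [← mul_assoc, h1, mul_assoc, h2, mul_assoc]
  have m1 : ∀ (A B : Matrix (Fin (2 ^ rk n)) (Fin (2 ^ rk n)) ℂ) (ξ ζ : Fin (n + 2) → ℂ),
      mulMat A * mulMat B * (lowY ξ * dirD ζ) = lowY ξ * dirD ζ * (mulMat A * mulMat B) := by
    intro A B ξ ζ
    rw [← mulMat_mul]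
    exact o1 _ _ _ (mulMat_lowY _ _) (mulMat_dirD _ _)
  have m12 : g₁ * g₂ * (y₃ * d₄) = y₃ * d₄ * (g₁ * g₂) := m1 _ _ _ _
  have m12' : g₁ * g₂ * (y₄ * d₃) = y₄ * d₃ * (g₁ * g₂) := m1 _ _ _ _
  have m34 : g₃ * g₄ * (y₁ * d₂) = y₁ * d₂ * (g₃ * g₄) := m1 _ _ _ _
  have m34' : g₃ * g₄ * (y₂ * d₁) = y₂ * d₁ * (g₃ * g₄) := m1 _ _ _ _
  unfold genOp
  simp only [← hy₁, ← hy₂, ← hy₃, ← hy₄, ← hd₁, ← hd₂, ← hd₃, ← hd₄, ← hg₁, ← hg₂, ← hg₃, ← hg₄]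
  -- The Clifford bracket is expressed with `g₃ g₂` and `g₃ g₁`, whereas the generators on the right
  -- contain these products in the opposite order.
  rw [k1, k2]
  have key : (y₁ * d₂ - y₂ * d₁ + (1 / 2 : ℂ) • (g₁ * g₂ - ip ξ ζ • 1)) *
      (y₃ * d₄ - y₄ * d₃ + (1 / 2 : ℂ) • (g₃ * g₄ - ip ξ' ζ' • 1)) -
      (y₃ * d₄ - y₄ * d₃ + (1 / 2 : ℂ) • (g₃ * g₄ - ip ξ' ζ' • 1)) *
      (y₁ * d₂ - y₂ * d₁ + (1 / 2 : ℂ) • (g₁ * g₂ - ip ξ ζ • 1)) =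
      (y₁ * d₂ * (y₃ * d₄) - y₃ * d₄ * (y₁ * d₂)) - (y₁ * d₂ * (y₄ * d₃) - y₄ * d₃ * (y₁ * d₂))
      - (y₂ * d₁ * (y₃ * d₄) - y₃ * d₄ * (y₂ * d₁)) + (y₂ * d₁ * (y₄ * d₃) - y₄ * d₃ * (y₂ * d₁))
      + (1 / 4 : ℂ) • (g₁ * g₂ * (g₃ * g₄) - g₃ * g₄ * (g₁ * g₂)) := by
    simp only [mul_add, add_mul, mul_sub, sub_mul, smul_mul_assoc, mul_smul_comm, mul_one, one_mul,
      m12, m12', m34, m34', smul_sub, smul_smul]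
    module
  rw [key, w1, w2, w3, w4, c1]
  module

theorem fieldRep_eq_genOp (γ : Gammas n) (a b : Fin (n + 2)) :
    fieldRep γ a b = genOp γ (Pi.single a 1) (Pi.single b 1) := by
  unfold fieldRep genOp orbital spinMat
  rw [lowY_single, lowY_single, dirD_single, dirD_single, gam_single, gam_single, ip_single,
    mulMat_smul, mulMat_sub, mulMat_smul, mulMat_one, mulMat_mul, smul_mul_assoc, smul_mul_assoc]

theorem isRep_fieldRep {γ : Gammas n} (hγ : IsClifford γ) : IsRep (fieldRep γ) where
  antisymm a b := by
    rw [fieldRep_eq_genOp, fieldRep_eq_genOp, genOp_antisymm hγ]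
  bracket a b c d := by
    simp only [fieldRep_eq_genOp, genOp_bracket hγ, ip_single]

theorem sum_sum_fieldRep (γ : Gammas n) (ξ ζ : Fin (n + 2) → ℂ) :
    ∑ a, ∑ b, (ξ a * ζ b) • fieldRep γ a b = genOp γ ξ ζ := by
  have h : ∀ a b : Fin (n + 2), (ξ a * ζ b) • fieldRep γ a b =
      ((ξ a * (eta a : ℂ)) • mulY a) * (ζ b • pd b) - ((ζ b * (eta b : ℂ)) • mulY b) * (ξ a • pd a) +
      (1 / 2 : ℂ) • ((ξ a • mulMat (γ a)) * (ζ b • mulMat (γ b)) - (ξ a * ζ b * etaMat a b) • 1) := by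
    intro a b
    rw [fieldRep_eq_genOp]
    unfold genOp
    rw [lowY_single, lowY_single, dirD_single, dirD_single, gam_single, gam_single, ip_single]
    simp only [smul_mul_assoc, mul_smul_comm]
    module
  simp only [h, Finset.sum_add_distrib, Finset.sum_sub_distrib, ← Finset.smul_sum]
  unfold genOp
  rw [mulMat_gam, mulMat_gam]
  unfold lowY dirD
  simp only [Finset.sum_mul_sum]
  congr 2
  · rw [Finset.sum_comm]
  · congr 1
    simp only [← Finset.sum_smul]
    congr 1
    unfold ip etaMat
    refine Finset.sum_congr rfl fun a _ => ?_
    rw [Finset.sum_eq_single a] <;> simp +contextual [eq_comm]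
    ring

theorem rootOp_fieldRep (γ : Gammas n) (j k : ℤ) :
    rootOp (fieldRep γ) j k = genOp γ (isoCoeff j) (isoCoeff k) :=
  sum_sum_fieldRep γ _ _

/-! ### Invariance of the Dirac operators -/

/-- The degree operator `y^a ∂_a`. -/
def degOp (n : ℕ) : Module.End ℂ (SpinorField n) := ∑ a, mulY a * pd a

theorem dirD_ySlash (γ : Gammas n) (ξ : Fin (n + 2) → ℂ) :
    dirD ξ * ySlash γ = ySlash γ * dirD ξ + mulMat (gam γ ξ) := by
  have h : ∀ a b : Fin (n + 2), (ξ a • pd a) * (mulY b * mulMat (γ b)) =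
      (mulY b * mulMat (γ b)) * (ξ a • pd a) + if a = b then ξ a • mulMat (γ a) else 0 := by
    intro a b
    rw [smul_mul_assoc, ← mul_assoc, pd_mulY, add_mul, mul_assoc, ← mulMat_pd, mul_smul_comm,
      smul_add, mul_assoc]
    congr 1
    split_ifs with hab
    · subst hab; simp
    · simp
  unfold dirD ySlash
  rw [mulMat_gam, Finset.sum_mul_sum, Finset.sum_mul_sum]
  simp only [h, Finset.sum_add_distrib]
  rw [Finset.sum_comm]
  simp

theorem lowY_ySlash (γ : Gammas n) (ξ : Fin (n + 2) → ℂ) :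
    lowY ξ * ySlash γ = ySlash γ * lowY ξ := by
  unfold ySlash
  rw [Finset.mul_sum, Finset.sum_mul]
  refine Finset.sum_congr rfl fun a _ => ?_
  rw [mul_assoc, mulMat_lowY, ← mul_assoc, ← mul_assoc]
  have := lowY_comm ξ (Pi.single a 1)
  rw [lowY_single, mul_smul_comm, smul_mul_assoc] at this
  have h2 := congrArg (fun x => (eta a : ℂ) • x) this
  simp only [smul_smul, eta_mul_self, one_smul] at h2
  rw [h2]

theorem gam_ySlash {γ : Gammas n} (hγ : IsClifford γ) (ξ : Fin (n + 2) → ℂ) :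
    mulMat (gam γ ξ) * ySlash γ = -(ySlash γ * mulMat (gam γ ξ)) + (2 : ℂ) • lowY ξ := by
  have h : ∀ a, mulMat (gam γ ξ) * (mulY a * mulMat (γ a)) =
      -((mulY a * mulMat (γ a)) * mulMat (gam γ ξ)) + (2 : ℂ) • ((ξ a * (eta a : ℂ)) • mulY a) := by
    intro a
    have := mulGam_anticomm hγ ξ (Pi.single a 1)
    rw [gam_single, ip_comm, ip_single_left] at this
    rw [← mul_assoc, mulMat_mulY, mul_assoc, this, mul_add, mul_neg, mul_assoc, mul_smul_comm,
      mul_one, smul_smul]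
    congr 2
    ring
  unfold ySlash lowY
  rw [Finset.mul_sum, Finset.sum_mul, Finset.smul_sum, ← Finset.sum_neg_distrib,
    ← Finset.sum_add_distrib]
  exact Finset.sum_congr rfl fun a _ => h a

theorem dirD_dSlash (γ : Gammas n) (ξ : Fin (n + 2) → ℂ) :
    dirD ξ * dSlash γ = dSlash γ * dirD ξ := by
  unfold dSlash
  rw [Finset.mul_sum, Finset.sum_mul]
  refine Finset.sum_congr rfl fun a _ => ?_
  have := dirD_comm ξ (Pi.single a 1)
  rw [dirD_single] at this
  rw [mul_smul_comm, smul_mul_assoc, ← mul_assoc, this, mul_assoc, mul_assoc, mulMat_dirD]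

theorem dSlash_lowY (γ : Gammas n) (ξ : Fin (n + 2) → ℂ) :
    dSlash γ * lowY ξ = lowY ξ * dSlash γ + mulMat (gam γ ξ) := by
  unfold dSlash
  rw [mulMat_gam, Finset.mul_sum, Finset.sum_mul, ← Finset.sum_add_distrib]
  refine Finset.sum_congr rfl fun a _ => ?_
  have := dirD_lowY (Pi.single a 1) ξ
  rw [dirD_single, ip_single_left] at this
  rw [smul_mul_assoc, mul_assoc, mulMat_lowY, ← mul_assoc, this, add_mul, smul_add, smul_mul_assoc,
    one_mul, smul_smul, ← mul_assoc, eta_mul_self, one_mul, mul_assoc, mul_smul_comm]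

theorem gam_dSlash {γ : Gammas n} (hγ : IsClifford γ) (ξ : Fin (n + 2) → ℂ) :
    mulMat (gam γ ξ) * dSlash γ = -(dSlash γ * mulMat (gam γ ξ)) + (2 : ℂ) • dirD ξ := by
  unfold dSlash dirD
  rw [Finset.mul_sum, Finset.sum_mul, Finset.smul_sum, ← Finset.sum_neg_distrib,
    ← Finset.sum_add_distrib]
  refine Finset.sum_congr rfl fun a _ => ?_
  have := mulGam_anticomm hγ ξ (Pi.single a 1)
  rw [gam_single, ip_comm, ip_single_left] at this
  rw [mul_smul_comm, ← mul_assoc, mulMat_pd, mul_assoc, this, mul_add, mul_neg, smul_add, smul_neg,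
    smul_mul_assoc, mul_assoc, mul_smul_comm, mul_one, smul_smul, smul_smul]
  congr 2
  linear_combination 2 * ξ a * eta_mul_self a

/-- Commuting `ySlash` with the orbital part gives `lowY ξ γ(ζ) - lowY ζ γ(ξ)`, and the spin part
gives exactly the negative of this. The same cancellation, with derivatives in place of coordinates,
makes `dSlash` invariant. -/
theorem genOp_ySlash {γ : Gammas n} (hγ : IsClifford γ) (ξ ζ : Fin (n + 2) → ℂ) :
    genOp γ ξ ζ * ySlash γ = ySlash γ * genOp γ ξ ζ := by
  have e1 : ∀ ξ ζ : Fin (n + 2) → ℂ, lowY ξ * dirD ζ * ySlash γ =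
      ySlash γ * (lowY ξ * dirD ζ) + lowY ξ * mulMat (gam γ ζ) := by
    intro ξ ζ
    rw [mul_assoc, dirD_ySlash, mul_add, ← mul_assoc, lowY_ySlash, mul_assoc]
  have e2 : mulMat (gam γ ξ) * mulMat (gam γ ζ) * ySlash γ =
      ySlash γ * (mulMat (gam γ ξ) * mulMat (gam γ ζ)) - (2 : ℂ) • (lowY ξ * mulMat (gam γ ζ)) +
      (2 : ℂ) • (lowY ζ * mulMat (gam γ ξ)) := by
    rw [mul_assoc, gam_ySlash hγ ζ, mul_add, mul_smul_comm, mulMat_lowY, mul_neg, ← mul_assoc,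
      gam_ySlash hγ ξ, add_mul, neg_mul, smul_mul_assoc, mul_assoc]
    module
  unfold genOp
  rw [add_mul, sub_mul, e1, e1, smul_mul_assoc, sub_mul, e2]
  simp only [mul_add, mul_sub, mul_smul_comm, smul_mul_assoc, mul_one, one_mul]
  module

theorem genOp_dSlash {γ : Gammas n} (hγ : IsClifford γ) (ξ ζ : Fin (n + 2) → ℂ) :
    genOp γ ξ ζ * dSlash γ = dSlash γ * genOp γ ξ ζ := by
  have e1 : ∀ ξ ζ : Fin (n + 2) → ℂ, lowY ξ * dirD ζ * dSlash γ =
      dSlash γ * (lowY ξ * dirD ζ) - dirD ζ * mulMat (gam γ ξ) := by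
    intro ξ ζ
    rw [mul_assoc, dirD_dSlash, ← mul_assoc, ← mul_assoc, dSlash_lowY, add_mul, mulMat_dirD,
      add_sub_cancel_right]
  have e2 : mulMat (gam γ ξ) * mulMat (gam γ ζ) * dSlash γ =
      dSlash γ * (mulMat (gam γ ξ) * mulMat (gam γ ζ)) - (2 : ℂ) • (dirD ξ * mulMat (gam γ ζ)) +
      (2 : ℂ) • (dirD ζ * mulMat (gam γ ξ)) := by
    rw [mul_assoc, gam_dSlash hγ ζ, mul_add, mul_smul_comm, mulMat_dirD, mul_neg, ← mul_assoc,
      gam_dSlash hγ ξ, add_mul, neg_mul, smul_mul_assoc, mul_assoc]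
    module
  unfold genOp
  rw [add_mul, sub_mul, e1, e1, smul_mul_assoc, sub_mul, e2]
  simp only [mul_add, mul_sub, mul_smul_comm, smul_mul_assoc, mul_one, one_mul]
  module

/-- Each of the `n + 2` indices contributes `2 y^a ∂_a + 1`. Read backwards, the identity writes the
degree operator through two invariant operators, which is how its invariance is obtained. -/
theorem dSlash_ySlash {γ : Gammas n} (hγ : IsClifford γ) :
    dSlash γ * ySlash γ = -(ySlash γ * dSlash γ) + (2 : ℂ) • degOp n + ((n : ℂ) + 2) • 1 := by
  have h : ∀ a : Fin (n + 2), ((eta a : ℂ) • (pd a * mulMat (γ a))) * ySlash γ =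
      -(ySlash γ * ((eta a : ℂ) • (pd a * mulMat (γ a)))) + (2 : ℂ) • (mulY a * pd a) + 1 := by
    intro a
    have h1 := dirD_ySlash γ (Pi.single a 1)
    have h2 := gam_ySlash hγ (Pi.single a 1)
    have h3 := mulGam_anticomm hγ (Pi.single a 1) (Pi.single a 1)
    rw [dirD_single, gam_single] at h1
    rw [gam_single, lowY_single] at h2
    rw [gam_single, ip_single] at h3
    have h4 : mulMat (γ a) * mulMat (γ a) = (eta a : ℂ) • 1 := by
      have : (2 : ℂ) • (mulMat (γ a) * mulMat (γ a)) = (2 : ℂ) • ((eta a : ℂ) • 1) := by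
        rw [two_smul, smul_smul]
        nth_rewrite 1 [h3]
        simp [etaMat]
      exact smul_right_injective _ (two_ne_zero) this
    rw [← mulMat_pd, smul_mul_assoc, mul_assoc, h1, mul_add, ← mul_assoc, h2, h4]
    simp only [add_mul, neg_mul, smul_mul_assoc, mul_smul_comm, smul_add, smul_neg, smul_smul,
      eta_mul_self, one_smul, mul_assoc]
    congr 2
    rw [mul_left_comm, eta_mul_self, mul_one]
  unfold dSlash degOp
  rw [Finset.sum_mul, Finset.mul_sum, Finset.sum_congr rfl fun a _ => h a]
  simp only [Finset.sum_add_distrib, Finset.sum_neg_distrib, Finset.smul_sum]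
  congr 1
  rw [Finset.sum_const, Finset.card_univ, Fintype.card_fin]
  rw [← Nat.cast_smul_eq_nsmul ℂ]
  push_cast
  rfl

theorem genOp_degOp {γ : Gammas n} (hγ : IsClifford γ) (ξ ζ : Fin (n + 2) → ℂ) :
    genOp γ ξ ζ * degOp n = degOp n * genOp γ ξ ζ := by
  have h := dSlash_ySlash hγ
  have h1 := genOp_ySlash hγ ξ ζ
  have h2 := genOp_dSlash hγ ξ ζ
  have e : degOp n = (1 / 2 : ℂ) • (dSlash γ * ySlash γ + ySlash γ * dSlash γ -
      ((n : ℂ) + 2) • 1) := by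
    rw [h]; module
  rw [e]
  simp only [mul_smul_comm, smul_mul_assoc, mul_sub, sub_mul, mul_add, add_mul, mul_one, one_mul,
    ← mul_assoc, h1, h2]
  simp only [mul_assoc, h1, h2]

end GuptaBleuler

end

noncomputable section

namespace GuptaBleuler

variable {n : ℕ}

/-! ### The isotropic basis -/

/-- The admissible indices of the isotropic basis: `-r ≤ j ≤ r`, and `j = 0` only for odd `n`. -/
def Valid (n : ℕ) (j : ℤ) : Prop := j.natAbs ≤ rk n ∧ (j = 0 → n % 2 = 1)

theorem Valid.neg {j : ℤ} (h : Valid n j) : Valid n (-j) :=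
  ⟨by simpa using h.1, fun h0 => h.2 (by omega)⟩

theorem two_mul_rk_le (n : ℕ) : 2 * rk n ≤ n + 2 := by unfold rk; omega

theorem sum_isoCoeff {M : Type*} [AddCommGroup M] [Module ℂ M] (f : Fin (n + 2) → M) {j : ℤ}
    (h0 : j ≠ 0) (h : j.natAbs ≤ rk n) :
    ∑ a, isoCoeff j a • f a = ((if j.natAbs = 1 then Complex.I else 1) / (Real.sqrt 2 : ℂ)) •
      (f ⟨2 * (j.natAbs - 1), by have := two_mul_rk_le n; omega⟩ +
        ((j.sign : ℂ) * Complex.I) •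
          f ⟨2 * (j.natAbs - 1) + 1, by have := two_mul_rk_le n; omega⟩) := by
  have hm := two_mul_rk_le n
  rw [Finset.sum_eq_add (⟨2 * (j.natAbs - 1), by omega⟩ : Fin (n + 2))
    ⟨2 * (j.natAbs - 1) + 1, by omega⟩ (by simp)]
  · simp only [isoCoeff, h0, if_false, if_true]
    rw [if_neg (show ¬ (2 * (j.natAbs - 1) + 1 = 2 * (j.natAbs - 1)) by omega)]
    module
  · intro a _ ha
    have h1 : a.val ≠ 2 * (j.natAbs - 1) := fun h => ha.1 (Fin.ext h)
    have h2 : a.val ≠ 2 * (j.natAbs - 1) + 1 := fun h => ha.2 (Fin.ext h)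
    simp [isoCoeff, h0, h1, h2]
  · simp
  · simp

theorem sum_isoCoeff_zero {M : Type*} [AddCommGroup M] [Module ℂ M] (f : Fin (n + 2) → M) :
    ∑ a, isoCoeff 0 a • f a = f (Fin.last (n + 1)) := by
  rw [Finset.sum_eq_single (Fin.last (n + 1))]
  · simp [isoCoeff]
  · intro a _ ha
    have : a.val ≠ n + 1 := fun h => ha (Fin.ext h)
    simp [isoCoeff, this]
  · simp

theorem sqrt_two_sq : (Real.sqrt 2 : ℂ) * (Real.sqrt 2 : ℂ) = 2 := by
  rw [← Complex.ofReal_mul, Real.mul_self_sqrt (by norm_num)]; simp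

theorem sqrt_two_ne : (Real.sqrt 2 : ℂ) ≠ 0 := by
  rw [Ne, Complex.ofReal_eq_zero, Real.sqrt_eq_zero (by norm_num)]; norm_num

/-- Vectors with different `|j|` have disjoint supports, and within one plane `(1, i)` and `(1, -i)`
are isotropic and pair nontrivially. The extra factor `i` for `|j| = 1` compensates the positive
signature of the time plane, so that every pairing is `-1`. Thus the `ω_j` are fermionic
oscillators. -/
theorem ip_isoCoeff {j k : ℤ} (hj : Valid n j) (hk : Valid n k) :
    ip (isoCoeff j : Fin (n + 2) → ℂ) (isoCoeff k) = if j = -k then -1 else 0 := by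
  have e : ip (isoCoeff j : Fin (n + 2) → ℂ) (isoCoeff k) =
      ∑ a : Fin (n + 2), isoCoeff j a • ((eta a : ℂ) * isoCoeff k a) := by
    unfold ip
    exact Finset.sum_congr rfl fun a _ => by rw [smul_eq_mul]; ring
  have hm := two_mul_rk_le n
  have hI2 : Complex.I ^ 2 = -1 := Complex.I_sq
  have hs : (Real.sqrt 2 : ℂ) ^ 2 = 2 := by rw [sq, sqrt_two_sq]
  by_cases hj0 : j = 0
  · subst hj0
    rw [e, sum_isoCoeff_zero]
    have hn := hj.2 rfl
    by_cases hk0 : k = 0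
    · subst hk0
      simp [isoCoeff, eta, show n ≠ 0 by omega]
    · have h1 : n + 1 ≠ 2 * (k.natAbs - 1) := by have := hk.1; unfold rk at this; omega
      have h2 := hk.1
      unfold rk at h2
      have h3 : ¬ (0 = -k) := by omega
      simp [isoCoeff, hk0, h1, show n ≠ 2 * (k.natAbs - 1) by omega, h3]
  · rw [e, sum_isoCoeff _ hj0 hj.1]
    by_cases hk0 : k = 0
    · subst hk0
      have hn := hk.2 rfl
      have h1 : 2 * (j.natAbs - 1) ≠ n + 1 := by have := hj.1; unfold rk at this; omega
      have h2 : 2 * (j.natAbs - 1) + 1 ≠ n + 1 := by have := hj.1; unfold rk at this; omega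
      simp only [isoCoeff, h1, h2, hj0, if_true, if_false, neg_zero]
      simp
    · by_cases hjk : j.natAbs = k.natAbs
      · have hc : 2 * (k.natAbs - 1) + 1 ≠ 2 * (k.natAbs - 1) := by omega
        have hsg : (j = -k ∧ j.sign = -k.sign) ∨ (j ≠ -k ∧ j.sign = k.sign) := by
          rcases Int.natAbs_eq_natAbs_iff.1 hjk with h | h
          · right; subst h; exact ⟨by omega, rfl⟩
          · left; subst h; simp
        have hk1 : (k.sign : ℂ) * (k.sign : ℂ) = 1 := by
          rcases lt_or_gt_of_ne hk0 with h | h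
          · rw [Int.sign_eq_neg_one_of_neg h]; norm_num
          · rw [Int.sign_eq_one_of_pos h]; norm_num
        simp only [isoCoeff, hk0, if_false, hjk, if_true, hc, eta, smul_eq_mul]
        have hq : (Real.sqrt 2 : ℂ)⁻¹ ^ 2 = 1 / 2 := by rw [inv_pow, hs]; norm_num
        set q := (Real.sqrt 2 : ℂ)⁻¹ with hqdef
        simp only [div_eq_mul_inv, ← hqdef]
        by_cases h1 : k.natAbs = 1
        · simp only [h1, if_true, Nat.sub_self, Nat.mul_zero, Nat.zero_add, Nat.one_lt_two,
            Nat.zero_lt_two]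
          rcases hsg with ⟨h, h'⟩ | ⟨h, h'⟩
          · rw [if_pos h, h']
            push_cast
            linear_combination (-Complex.I ^ 4 * q ^ 2) * hk1 +
              q ^ 2 * (2 - Complex.I ^ 2) * hI2 - 2 * hq
          · rw [if_neg h, h']
            push_cast
            linear_combination (Complex.I ^ 4 * q ^ 2) * hk1 + q ^ 2 * Complex.I ^ 2 * hI2
        · have h2 : ¬ (2 * (k.natAbs - 1) < 2) := by omega
          have h3 : ¬ (2 * (k.natAbs - 1) + 1 < 2) := by omega
          simp only [h1, h2, h3, if_false]
          rcases hsg with ⟨h, h'⟩ | ⟨h, h'⟩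
          · rw [if_pos h, h']
            push_cast
            linear_combination (q ^ 2 * Complex.I ^ 2) * hk1 + q ^ 2 * hI2 - 2 * hq
          · rw [if_neg h, h']
            push_cast
            linear_combination (-q ^ 2 * Complex.I ^ 2) * hk1 - q ^ 2 * hI2
      · have h1 : 2 * (j.natAbs - 1) ≠ 2 * (k.natAbs - 1) := by omega
        have h2 : 2 * (j.natAbs - 1) + 1 ≠ 2 * (k.natAbs - 1) + 1 := by omega
        have h3 : 2 * (j.natAbs - 1) ≠ 2 * (k.natAbs - 1) + 1 := by omega
        have h4 : 2 * (j.natAbs - 1) + 1 ≠ 2 * (k.natAbs - 1) := by omega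
        have h5 : j ≠ -k := fun h => hjk (by rw [h]; simp)
        simp [isoCoeff, hk0, h1, h3, h4, h5]

theorem omega_eq_gam (γ : Gammas n) (j : ℤ) : omega γ j = gam γ (isoCoeff j) := rfl

theorem omega_anticomm {γ : Gammas n} (hγ : IsClifford γ) {j k : ℤ} (hj : Valid n j)
    (hk : Valid n k) (hjk : j ≠ -k) : omega γ j * omega γ k = -(omega γ k * omega γ j) := by
  rw [omega_eq_gam, omega_eq_gam, gam_anticomm hγ, ip_isoCoeff hj hk, if_neg hjk]
  simp

theorem omega_neg_mul {γ : Gammas n} (hγ : IsClifford γ) {j : ℤ} (hj : Valid n j) :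
    omega γ j * omega γ (-j) = -(omega γ (-j) * omega γ j) - (2 : ℂ) • 1 := by
  rw [omega_eq_gam, omega_eq_gam, gam_anticomm hγ, ip_isoCoeff hj hj.neg, if_pos (by simp)]
  module

theorem eq_zero_of_eq_neg {M : Type*} [AddCommGroup M] [Module ℂ M] {x : M} (h : x = -x) :
    x = 0 := by
  have : (2 : ℂ) • x = 0 := by rw [two_smul]; nth_rewrite 1 [h]; simp
  exact (smul_eq_zero.1 this).resolve_left two_ne_zero

theorem omega_sq {γ : Gammas n} (hγ : IsClifford γ) {j : ℤ} (hj : Valid n j) (h0 : j ≠ 0) :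
    omega γ j * omega γ j = 0 :=
  eq_zero_of_eq_neg (omega_anticomm hγ hj hj (by omega))

theorem omega_zero_sq {γ : Gammas n} (hγ : IsClifford γ) (hn : n % 2 = 1) :
    omega γ 0 * omega γ 0 = -1 := by
  have h := omega_neg_mul hγ (j := 0) ⟨by simp, fun _ => hn⟩
  rw [neg_zero] at h
  have h2 : (2 : ℂ) • (omega γ 0 * omega γ 0) = (2 : ℂ) • (-1) := by
    rw [two_smul]
    nth_rewrite 1 [h]
    module
  exact smul_right_injective _ two_ne_zero h2

theorem valid_of_pos {j : ℕ} (h1 : 1 ≤ j) (h2 : j ≤ rk n) : Valid n j :=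
  ⟨by simpa using h2, fun h => by omega⟩

/-! ### The vacuum -/

/-- `s` is annihilated by `ω_1, …, ω_r`. -/
def IsVacuum (γ : Gammas n) (s : Spinor n) : Prop :=
  ∀ j : ℕ, 1 ≤ j → j ≤ rk n → (omega γ j).mulVec s = 0

/-- The product of the first `k` of the projections `-ω_j ω_{-j} / 2`. -/
def vacProj (γ : Gammas n) : ℕ → Matrix (Fin (2 ^ rk n)) (Fin (2 ^ rk n)) ℂ
  | 0 => 1
  | k + 1 => vacProj γ k *
      ((-1 / 2 : ℂ) • (omega γ ((k + 1 : ℕ) : ℤ) * omega γ (-((k + 1 : ℕ) : ℤ))))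

/-- Every factor is a product of two generators that anticommute with `ω_j`, so the signs cancel in
pairs. -/
theorem vacProj_commute {γ : Gammas n} (hγ : IsClifford γ) (k : ℕ) {j : ℤ} (hj : Valid n j)
    (hk : k ≤ rk n) (h : k < j.natAbs) : vacProj γ k * omega γ j = omega γ j * vacProj γ k := by
  induction k with
  | zero => simp [vacProj]
  | succ k ih =>
    have hv : Valid n ((k + 1 : ℕ) : ℤ) := valid_of_pos (by omega) hk
    have e1 := omega_anticomm hγ hv hj (by omega)
    have e2 := omega_anticomm hγ hv.neg hj (by omega)
    have e3 := ih (by omega) (by omega)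
    rw [vacProj, mul_smul_comm, smul_mul_assoc, mul_smul_comm, mul_assoc, mul_assoc, e2, mul_neg,
      ← mul_assoc (omega γ ((k + 1 : ℕ) : ℤ)), e1, neg_mul, neg_neg, ← mul_assoc, ← mul_assoc, e3,
      mul_assoc, mul_assoc]

theorem omega_mul_vacProj {γ : Gammas n} (hγ : IsClifford γ) (k : ℕ) (hk : k ≤ rk n) {j : ℕ}
    (h1 : 1 ≤ j) (hj : j ≤ k) : omega γ j * vacProj γ k = 0 := by
  induction k with
  | zero => omega
  | succ k ih =>
    rcases Nat.lt_or_ge j (k + 1) with h | h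
    · rw [vacProj, ← mul_assoc, ih (by omega) (by omega), zero_mul]
    · obtain rfl : j = k + 1 := by omega
      have hv : Valid n ((k + 1 : ℕ) : ℤ) := valid_of_pos (by omega) hk
      rw [vacProj, ← mul_assoc, ← vacProj_commute hγ k hv (by omega) (by omega), mul_assoc,
        mul_smul_comm, ← mul_assoc (omega γ _), omega_sq hγ hv (by omega)]
      simp

theorem vacProj_mulVec {γ : Gammas n} (hγ : IsClifford γ) (k : ℕ) (hk : k ≤ rk n) {s : Spinor n}
    (hs : ∀ j : ℕ, 1 ≤ j → j ≤ k → (omega γ j).mulVec s = 0) : (vacProj γ k).mulVec s = s := by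
  induction k with
  | zero => simp [vacProj]
  | succ k ih =>
    have hv : Valid n ((k + 1 : ℕ) : ℤ) := valid_of_pos (by omega) hk
    rw [vacProj, ← Matrix.mulVec_mulVec, omega_neg_mul hγ hv, Matrix.smul_mulVec,
      Matrix.sub_mulVec, Matrix.neg_mulVec, ← Matrix.mulVec_mulVec, hs (k + 1) (by omega) le_rfl,
      Matrix.smul_mulVec]
    simp only [Matrix.mulVec_zero, Matrix.one_mulVec, neg_zero, zero_sub, smul_smul,
      ← neg_smul]
    norm_num
    exact ih (by omega) fun j h1 h2 => hs j h1 (by omega)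

/-- With `P` the previous product and `ω, ω'` the next pair, cyclicity of the trace gives `tr(P ω
ω') = tr(P ω' ω)`, while the two add up to `-2 tr P`. So each new factor halves the trace, starting
from the dimension `2 ^ r`. -/
theorem trace_vacProj {γ : Gammas n} (hγ : IsClifford γ) (k : ℕ) (hk : k ≤ rk n) :
    2 ^ k * (vacProj γ k).trace = 2 ^ rk n := by
  induction k with
  | zero => simp [vacProj]
  | succ k ih =>
    have hv : Valid n ((k + 1 : ℕ) : ℤ) := valid_of_pos (by omega) hk
    set w := omega γ ((k + 1 : ℕ) : ℤ)
    set w' := omega γ (-((k + 1 : ℕ) : ℤ))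
    have hc : vacProj γ k * w = w * vacProj γ k := vacProj_commute hγ k hv (by omega) (by omega)
    have h1 : (vacProj γ k * (w * w')).trace = (vacProj γ k * (w' * w)).trace := by
      rw [← mul_assoc, Matrix.trace_mul_comm, hc, ← mul_assoc, Matrix.trace_mul_comm]
    have h2 : (vacProj γ k * (w * w')).trace =
        -(vacProj γ k * (w' * w)).trace - 2 * (vacProj γ k).trace := by
      rw [show w * w' = -(w' * w) - (2 : ℂ) • 1 from omega_neg_mul hγ hv, mul_sub,
        Matrix.trace_sub, mul_neg, Matrix.trace_neg, mul_smul_comm, Matrix.trace_smul, mul_one,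
        smul_eq_mul]
    have h3 := ih (by omega)
    rw [vacProj, mul_smul_comm, Matrix.trace_smul, smul_eq_mul, pow_succ]
    change 2 ^ k * 2 * (-1 / 2 * (vacProj γ k * (w * w')).trace) = _
    rw [← h1] at h2
    linear_combination h3 - (2 ^ k : ℂ) / 2 * h2

/-- The subspace of vacuum vectors. -/
def vacuum (γ : Gammas n) : Submodule ℂ (Spinor n) where
  carrier := {s | IsVacuum γ s}
  zero_mem' := fun j _ _ => Matrix.mulVec_zero _
  add_mem' := fun {s t} hs ht j h1 h2 => by
    rw [Matrix.mulVec_add, hs j h1 h2, ht j h1 h2, add_zero]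
  smul_mem' := fun c s hs j h1 h2 => by rw [Matrix.mulVec_smul, hs j h1 h2, smul_zero]

/-- The full product `vacProj` projects onto the vacuum vectors, so their dimension is its trace,
which is `1`. This is the only place where the dimension `2 ^ r` of the spinor space matters; no
classification of Clifford modules is needed. -/
theorem finrank_vacuum {γ : Gammas n} (hγ : IsClifford γ) :
    Module.finrank ℂ (vacuum γ) = 1 := by
  have hp : LinearMap.IsProj (vacuum γ) (Matrix.toLin' (vacProj γ (rk n))) := by
    refine ⟨fun s j h1 h2 => ?_, fun s hs => ?_⟩
    · rw [Matrix.toLin'_apply, Matrix.mulVec_mulVec, omega_mul_vacProj hγ _ le_rfl h1 h2,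
        Matrix.zero_mulVec]
    · exact vacProj_mulVec hγ _ le_rfl hs
  have h1 := hp.trace
  have h2 := trace_vacProj hγ (rk n) le_rfl
  rw [Matrix.trace_toLin'_eq] at h1
  have h3 : (vacProj γ (rk n)).trace = 1 := by
    have : (2 : ℂ) ^ rk n ≠ 0 := pow_ne_zero _ two_ne_zero
    exact mul_left_cancel₀ this (by rw [h2, mul_one])
  rw [h3] at h1
  exact_mod_cast h1.symm

theorem exists_smul_of_isVacuum {γ : Gammas n} (hγ : IsClifford γ) {v s : Spinor n} (hv : v ≠ 0)
    (hvv : IsVacuum γ v) (hs : IsVacuum γ s) : ∃ c : ℂ, s = c • v := by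
  obtain ⟨c, hc⟩ := (finrank_eq_one_iff_of_nonzero' (⟨v, hvv⟩ : vacuum γ)
    (fun h => hv (congrArg Subtype.val h))).1 (finrank_vacuum hγ) ⟨s, hs⟩
  exact ⟨c, (congrArg Subtype.val hc).symm⟩

end GuptaBleuler

end

noncomputable section

namespace GuptaBleuler

variable {n : ℕ}

/-! ### Chirality and irreducibility of the spinor modules of `so(n)` -/

/-- The product of all the matrices `γ_a`. -/
def chi (γ : Gammas n) : Matrix (Fin (2 ^ rk n)) (Fin (2 ^ rk n)) ℂ :=
  ((List.finRange (n + 2)).map γ).prod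

theorem gamma_sq {γ : Gammas n} (hγ : IsClifford γ) (a : Fin (n + 2)) :
    γ a * γ a = (eta a : ℂ) • 1 := by
  have h := hγ a a
  rw [← two_smul ℂ, mul_smul] at h
  simpa [etaMat] using smul_right_injective _ (two_ne_zero (α := ℂ)) h

theorem gamma_anticomm {γ : Gammas n} (hγ : IsClifford γ) {a b : Fin (n + 2)} (hab : a ≠ b) :
    γ a * γ b = -(γ b * γ a) := by
  have h := hγ a b
  simp only [etaMat, hab, if_false, mul_zero, zero_smul] at h
  exact eq_neg_of_add_eq_zero_left h

/-- In passing through the product, `γ_a` picks up one sign for every factor other than itself. For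
the full list with `n` even this number is odd, which makes `chi` anticommute with every `γ_a`. -/
theorem gamma_mul_prod {γ : Gammas n} (hγ : IsClifford γ) (a : Fin (n + 2))
    (l : List (Fin (n + 2))) (hl : l.Nodup) :
    γ a * (l.map γ).prod =
      (-1 : ℂ) ^ (l.length + if a ∈ l then 1 else 0) • ((l.map γ).prod * γ a) := by
  induction l with
  | nil => simp
  | cons b l ih =>
    rw [List.nodup_cons] at hl
    have h := ih hl.2
    rw [List.map_cons, List.prod_cons, List.length_cons]
    by_cases hab : a = b
    · subst hab
      simp only [hl.1, if_false, add_zero] at h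
      simp only [List.mem_cons, true_or, if_true]
      rw [h, mul_smul_comm, smul_mul_assoc, smul_smul, ← pow_add, ← mul_assoc, h, smul_mul_assoc]
      have : (-1 : ℂ) ^ (l.length + 1 + 1 + l.length) = 1 := by
        rw [show l.length + 1 + 1 + l.length = 2 * (l.length + 1) by ring, pow_mul]; simp
      rw [this, one_smul, smul_smul, ← pow_add, ← two_mul, pow_mul]
      simp
    · rw [← mul_assoc, gamma_anticomm hγ hab, neg_mul, mul_assoc, h]
      simp only [List.mem_cons, hab, false_or]
      rw [mul_smul_comm, ← mul_assoc, ← neg_smul]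
      congr 1
      ring

theorem chi_gamma {γ : Gammas n} (hγ : IsClifford γ) (hn : n % 2 = 0) (a : Fin (n + 2)) :
    chi γ * γ a = -(γ a * chi γ) := by
  have h := gamma_mul_prod hγ a (List.finRange (n + 2)) (List.nodup_finRange _)
  have e : (-1 : ℂ) ^ (n + 2 + 1) = -1 := Odd.neg_one_pow ⟨(n + 2) / 2, by omega⟩
  simp only [List.length_finRange, List.mem_finRange, if_true, e] at h
  change γ a * chi γ = (-1 : ℂ) • (chi γ * γ a) at h
  rw [h]
  simp

theorem chi_gam {γ : Gammas n} (hγ : IsClifford γ) (hn : n % 2 = 0) (ξ : Fin (n + 2) → ℂ) :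
    chi γ * gam γ ξ = -(gam γ ξ * chi γ) := by
  unfold gam
  rw [Finset.mul_sum, Finset.sum_mul, ← Finset.sum_neg_distrib]
  refine Finset.sum_congr rfl fun a _ => ?_
  rw [mul_smul_comm, chi_gamma hγ hn, smul_mul_assoc, smul_neg]

theorem isUnit_gamma {γ : Gammas n} (hγ : IsClifford γ) (a : Fin (n + 2)) : IsUnit (γ a) := by
  refine IsUnit.of_mul_eq_one ((eta a : ℂ) • γ a) ?_
  rw [mul_smul_comm, gamma_sq hγ, smul_smul, eta_mul_self, one_smul]

theorem isUnit_chi {γ : Gammas n} (hγ : IsClifford γ) : IsUnit (chi γ) := by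
  refine List.prod_isUnit fun m hm => ?_
  obtain ⟨a, _, rfl⟩ := List.mem_map.1 hm
  exact isUnit_gamma hγ a

theorem mulVec_eq_zero_of_isUnit {A : Matrix (Fin (2 ^ rk n)) (Fin (2 ^ rk n)) ℂ} (hA : IsUnit A)
    {s : Spinor n} (h : A.mulVec s = 0) : s = 0 := by
  obtain ⟨B, hB⟩ := hA.exists_left_inv
  rw [← Matrix.one_mulVec s, ← hB, ← Matrix.mulVec_mulVec, h, Matrix.mulVec_zero]

/-- For even `n`, the spinor `s` has chirality `c`. -/
def Chir (γ : Gammas n) (c : ℂ) (s : Spinor n) : Prop := n % 2 = 0 → (chi γ).mulVec s = c • s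

theorem Chir.gam_mulVec {γ : Gammas n} (hγ : IsClifford γ) {c : ℂ} {s : Spinor n} (h : Chir γ c s)
    (ξ : Fin (n + 2) → ℂ) : Chir γ (-c) ((gam γ ξ).mulVec s) := by
  intro hn
  rw [Matrix.mulVec_mulVec, chi_gam hγ hn, Matrix.neg_mulVec, ← Matrix.mulVec_mulVec, h hn,
    Matrix.mulVec_smul, neg_smul]

theorem Chir.omega_mulVec {γ : Gammas n} (hγ : IsClifford γ) {c : ℂ} {s : Spinor n}
    (h : Chir γ c s) (j : ℤ) : Chir γ (-c) ((omega γ j).mulVec s) :=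
  h.gam_mulVec hγ _

theorem Chir.gamma_mulVec {γ : Gammas n} (hγ : IsClifford γ) {c : ℂ} {s : Spinor n}
    (h : Chir γ c s) (a : Fin (n + 2)) : Chir γ (-c) ((γ a).mulVec s) := by
  rw [← gam_single γ a]; exact h.gam_mulVec hγ _

/-- For even `n`, `chi` anticommutes with the `ω_j` and hence preserves the vacuum line, acting
there by a scalar that is nonzero since `chi` is invertible. For odd `n` the condition `Chir` is
void and any nonzero constant serves, so both parities can be treated together. -/
theorem exists_chirality {γ : Gammas n} (hγ : IsClifford γ) {v : Spinor n} (hv : v ≠ 0)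
    (hvv : IsVacuum γ v) : ∃ c : ℂ, c ≠ 0 ∧ Chir γ c v := by
  by_cases hn : n % 2 = 0
  · have h : IsVacuum γ ((chi γ).mulVec v) := by
      intro j h1 h2
      have e : omega γ j * chi γ = -(chi γ * omega γ j) := by
        rw [omega_eq_gam, chi_gam hγ hn, neg_neg]
      rw [Matrix.mulVec_mulVec, e, Matrix.neg_mulVec, ← Matrix.mulVec_mulVec, hvv j h1 h2,
        Matrix.mulVec_zero, neg_zero]
    obtain ⟨c, hc⟩ := exists_smul_of_isVacuum hγ hv hvv h
    refine ⟨c, fun h0 => hv ?_, fun _ => hc⟩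
    rw [h0, zero_smul] at hc
    exact mulVec_eq_zero_of_isUnit (isUnit_chi hγ) hc
  · exact ⟨1, one_ne_zero, fun h => absurd h hn⟩

/-- On spinors `H_j = (ω_{-j} ω_j + 1) / 2`, so weight `1/2` means `ω_{-j} ω_j v = 0`. Multiplying
by `ω_j` turns this into `-2 ω_j v = 0`. The weights alone suffice. -/
theorem isVacuum_of_isMaximalVector {γ : Gammas n} (hγ : IsClifford γ) {v : Spinor n}
    (hv : IsMaximalVector (spinRep γ) (sigma n) v) : IsVacuum γ v := by
  intro j h1 h2
  have hval : Valid n (j : ℤ) := valid_of_pos h1 h2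
  have e : ∀ j k : ℤ, rootOp (spinRep γ) j k =
      Matrix.toLin' ((1 / 2 : ℂ) • (omega γ j * omega γ k -
        ip (isoCoeff j : Fin (n + 2) → ℂ) (isoCoeff k) • 1)) := by
    intro j k
    have h : ∑ a, ∑ b, (isoCoeff j a * isoCoeff k b) • spinMat γ a b =
        (1 / 2 : ℂ) • (omega γ j * omega γ k -
        ip (isoCoeff j : Fin (n + 2) → ℂ) (isoCoeff k) • 1) := by
      have h' : ∀ a b : Fin (n + 2), (isoCoeff j a * isoCoeff k b) • spinMat γ a b =
          (1 / 2 : ℂ) • ((isoCoeff j a • γ a) * (isoCoeff k b • γ b) -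
            (isoCoeff j a * isoCoeff k b * etaMat a b) • 1) := by
        intro a b
        unfold spinMat
        rw [smul_mul_smul_comm]
        module
      simp only [h', ← Finset.smul_sum, Finset.sum_sub_distrib]
      unfold omega
      rw [Finset.sum_mul_sum]
      congr 2
      simp only [← Finset.sum_smul]
      congr 1
      unfold ip etaMat
      refine Finset.sum_congr rfl fun a _ => ?_
      rw [Finset.sum_eq_single a] <;> simp +contextual [eq_comm]
      ring
    rw [← h]
    simp only [map_sum, map_smul]
    rfl
  have hw := hv.weight ⟨j - 1, by omega⟩
  have hcast : ((j - 1 : ℕ) : ℤ) + 1 = j := by omega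
  simp only [hcast] at hw
  rw [e, Matrix.toLin'_apply, ip_isoCoeff hval.neg hval, if_pos rfl, Matrix.smul_mulVec,
    Matrix.sub_mulVec, neg_smul, one_smul, Matrix.neg_mulVec, Matrix.one_mulVec] at hw
  have h0 : (omega γ (-(j : ℤ)) * omega γ (j : ℤ)).mulVec v = 0 := by
    have := congrArg (fun x => (2 : ℂ) • x) hw
    simp only [sigma, smul_smul] at this
    norm_num at this
    exact this
  have h3 := congrArg (omega γ (j : ℤ)).mulVec h0
  rw [Matrix.mulVec_mulVec, ← mul_assoc, omega_neg_mul hγ hval, sub_mul, neg_mul, mul_assoc,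
    omega_sq hγ hval (by omega), smul_mul_assoc, one_mul, mul_zero, neg_zero, zero_sub,
    Matrix.neg_mulVec, Matrix.smul_mulVec, Matrix.mulVec_zero, neg_eq_zero, smul_eq_zero] at h3
  exact h3.resolve_left two_ne_zero

/-- Stability under the products `γ_i γ_j` of spatial gamma matrices. -/
def SpatialStable (γ : Gammas n) (A : Submodule ℂ (Spinor n)) : Prop :=
  ∀ i j : Fin n, ∀ s ∈ A, (γ i.succ.succ * γ j.succ.succ).mulVec s ∈ A

/-- The spinors mapped into `A` by all the spatial gamma matrices. -/
def oddPart (γ : Gammas n) (A : Submodule ℂ (Spinor n)) : Submodule ℂ (Spinor n) where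
  carrier := {t | ∀ i : Fin n, (γ i.succ.succ).mulVec t ∈ A}
  zero_mem' := fun i => by rw [Matrix.mulVec_zero]; exact A.zero_mem
  add_mem' := fun hs ht i => by rw [Matrix.mulVec_add]; exact A.add_mem (hs i) (ht i)
  smul_mem' := fun c s hs i => by rw [Matrix.mulVec_smul]; exact A.smul_mem c (hs i)

theorem gam_spatial (γ : Gammas n) {ξ : Fin (n + 2) → ℂ} (h0 : ξ 0 = 0) (h1 : ξ 1 = 0) :
    gam γ ξ = ∑ i : Fin n, ξ i.succ.succ • γ i.succ.succ := by
  unfold gam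
  rw [Fin.sum_univ_succ, Fin.sum_univ_succ, h0]
  have h1' : ξ (Fin.succ 0) = 0 := h1
  rw [h1']
  simp

theorem sum_mulVec {ι : Type*} (s : Finset ι)
    (A : ι → Matrix (Fin (2 ^ rk n)) (Fin (2 ^ rk n)) ℂ) (t : Spinor n) :
    (∑ i ∈ s, A i).mulVec t = ∑ i ∈ s, (A i).mulVec t := by
  exact map_sum (AddMonoidHom.mk' (fun M : Matrix (Fin (2 ^ rk n)) (Fin (2 ^ rk n)) ℂ => M.mulVec t)
    fun M N => Matrix.add_mulVec M N t) A s

theorem isoCoeff_spatial (hn : 1 ≤ n) {j : ℤ} (hj : j = 0 ∨ 2 ≤ j.natAbs) :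
    isoCoeff j (0 : Fin (n + 2)) = 0 ∧ isoCoeff j (1 : Fin (n + 2)) = 0 := by
  rcases hj with rfl | h
  · simp [isoCoeff]; omega
  · have h0 : j ≠ 0 := by rintro rfl; simp at h
    have h1 : ¬ (0 = 2 * (j.natAbs - 1)) := by omega
    have h2 : ¬ (1 = 2 * (j.natAbs - 1)) := by omega
    have h3 : ¬ (1 = 2 * (j.natAbs - 1) + 1) := by omega
    have h4 : ¬ (0 = 2 * (j.natAbs - 1) + 1) := by omega
    constructor
    · simp only [isoCoeff, h0, if_false, Fin.val_zero, h1, h4, mul_zero]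
    · simp only [isoCoeff, h0, if_false, Fin.val_one, h2, h3, mul_zero]

/-- A stable subspace is preserved only by even products. Passing back and forth between `A` and
`oddPart γ A` makes it possible to apply single spatial oscillators nevertheless. -/
theorem SpatialStable.omega_mem_oddPart (hn : 1 ≤ n) {γ : Gammas n} {A : Submodule ℂ (Spinor n)}
    (hA : SpatialStable γ A) {j : ℤ} (hj : j = 0 ∨ 2 ≤ j.natAbs) {s : Spinor n} (hs : s ∈ A) :
    (omega γ j).mulVec s ∈ oddPart γ A := by
  intro i
  rw [Matrix.mulVec_mulVec, omega_eq_gam,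
    gam_spatial γ (isoCoeff_spatial hn hj).1 (isoCoeff_spatial hn hj).2, Finset.mul_sum, sum_mulVec]
  refine A.sum_mem fun k _ => ?_
  rw [mul_smul_comm, Matrix.smul_mulVec]
  exact A.smul_mem _ (hA i k s hs)

theorem omega_mem_of_oddPart (hn : 1 ≤ n) {γ : Gammas n} {A : Submodule ℂ (Spinor n)}
    {j : ℤ} (hj : j = 0 ∨ 2 ≤ j.natAbs) {s : Spinor n} (hs : s ∈ oddPart γ A) :
    (omega γ j).mulVec s ∈ A := by
  rw [omega_eq_gam,
    gam_spatial γ (isoCoeff_spatial hn hj).1 (isoCoeff_spatial hn hj).2, sum_mulVec]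
  refine A.sum_mem fun k _ => ?_
  rw [Matrix.smul_mulVec]
  exact A.smul_mem _ (hs k)

/-- For odd `n`, `ω_0` anticommutes with the annihilators and so preserves the vacuum line; `ω_0² =
-1` excludes the eigenvalue zero. This extra operator takes over the role that chirality plays for
even `n`. -/
theorem exists_omega_zero_eigen {γ : Gammas n} (hγ : IsClifford γ) (hn : n % 2 = 1) {v : Spinor n}
    (hv : v ≠ 0) (hvv : IsVacuum γ v) : ∃ μ : ℂ, μ ≠ 0 ∧ (omega γ 0).mulVec v = μ • v := by
  have h : IsVacuum γ ((omega γ 0).mulVec v) := by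
    intro j h1 h2
    rw [Matrix.mulVec_mulVec, omega_anticomm hγ (valid_of_pos h1 h2) ⟨by simp, fun _ => hn⟩
      (by omega), Matrix.neg_mulVec, ← Matrix.mulVec_mulVec, hvv j h1 h2, Matrix.mulVec_zero,
      neg_zero]
  obtain ⟨μ, hμ⟩ := exists_smul_of_isVacuum hγ hv hvv h
  refine ⟨μ, fun h0 => hv ?_, hμ⟩
  rw [h0, zero_smul] at hμ
  have h2 := congrArg (omega γ 0).mulVec hμ
  rw [Matrix.mulVec_mulVec, omega_zero_sq hγ hn, Matrix.mulVec_zero, Matrix.neg_mulVec,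
    Matrix.one_mulVec, neg_eq_zero] at h2
  exact h2

/-- Applying annihilation operators produces a vacuum vector. -/
theorem vacuum_mem_of_spatialStable (hn1 : 1 ≤ n) {γ : Gammas n} (hγ : IsClifford γ) {v : Spinor n}
    (hv : v ≠ 0) (hvv : IsVacuum γ v) {c : ℂ} (hc : c ≠ 0) (hcv : Chir γ c v)
    {A : Submodule ℂ (Spinor n)} (hA : SpatialStable γ A) {s : Spinor n} (hs : s ∈ A) (hs0 : s ≠ 0)
    (hs1 : (omega γ 1).mulVec s = 0) (hsc : Chir γ c s) : v ∈ A := by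
  -- Apply the next annihilator, if the result is nonzero, and otherwise keep the vector. The
  -- disjunction records the parity of the number of operators applied, together with the matching
  -- chirality.
  have key : ∀ k : ℕ, k + 1 ≤ rk n → ∃ t : Spinor n, t ≠ 0 ∧
      (∀ j : ℕ, 1 ≤ j → j ≤ k + 1 → (omega γ j).mulVec t = 0) ∧
      ((t ∈ A ∧ Chir γ c t) ∨ (t ∈ oddPart γ A ∧ Chir γ (-c) t)) := by
    intro k
    induction k with
    | zero =>
      intro _
      refine ⟨s, hs0, fun j h1 h2 => ?_, Or.inl ⟨hs, hsc⟩⟩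
      obtain rfl : j = 1 := by omega
      exact_mod_cast hs1
    | succ k ih =>
      intro hk
      obtain ⟨t, ht0, ht1, ht2⟩ := ih (by omega)
      have hval : Valid n ((k + 2 : ℕ) : ℤ) := valid_of_pos (by omega) hk
      by_cases h : (omega γ ((k + 2 : ℕ) : ℤ)).mulVec t = 0
      · refine ⟨t, ht0, fun j h1 h2 => ?_, ht2⟩
        rcases Nat.lt_or_ge j (k + 2) with h3 | h3
        · exact ht1 j h1 (by omega)
        · obtain rfl : j = k + 2 := by omega
          exact h
      · refine ⟨_, h, fun j h1 h2 => ?_, ?_⟩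
        · rcases Nat.lt_or_ge j (k + 2) with h3 | h3
          · rw [Matrix.mulVec_mulVec, omega_anticomm hγ (valid_of_pos h1 (by omega)) hval
              (by omega), Matrix.neg_mulVec, ← Matrix.mulVec_mulVec, ht1 j h1 (by omega),
              Matrix.mulVec_zero, neg_zero]
          · obtain rfl : j = k + 2 := by omega
            rw [Matrix.mulVec_mulVec, omega_sq hγ hval (by omega), Matrix.zero_mulVec]
        · rcases ht2 with ⟨h3, h4⟩ | ⟨h3, h4⟩
          · exact Or.inr ⟨hA.omega_mem_oddPart hn1 (Or.inr (by omega)) h3, h4.omega_mulVec hγ _⟩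
          · refine Or.inl ⟨omega_mem_of_oddPart hn1 (Or.inr (by omega)) h3, ?_⟩
            have := h4.omega_mulVec hγ ((k + 2 : ℕ) : ℤ)
            rwa [neg_neg] at this
  have hr : 1 ≤ rk n := by unfold rk; omega
  obtain ⟨t, ht0, ht1, ht2⟩ := key (rk n - 1) (by omega)
  obtain ⟨b, hb⟩ := exists_smul_of_isVacuum hγ hv hvv
    (fun j h1 h2 => ht1 j h1 (by omega) : IsVacuum γ t)
  have hb0 : b ≠ 0 := by rintro rfl; exact ht0 (by rw [hb, zero_smul])
  rcases ht2 with ⟨h3, _⟩ | ⟨h3, h4⟩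
  · rw [hb] at h3
    exact (A.smul_mem_iff hb0).1 h3
  -- A multiple of the vacuum has been reached in the odd part. For even `n` this contradicts its
  -- chirality; for odd `n` one application of `ω_0` brings it back into `A`.
  · by_cases hn : n % 2 = 0
    · exfalso
      have e1 := h4 hn
      rw [hb, Matrix.mulVec_smul, hcv hn, smul_smul, smul_smul, ← sub_eq_zero, ← sub_smul,
        smul_eq_zero] at e1
      refine (e1.resolve_right hv) |> fun h => ?_
      have : b * c * 2 = 0 := by linear_combination h
      simp [hb0, hc] at this
    · obtain ⟨μ, hμ, hμv⟩ := exists_omega_zero_eigen hγ (by omega) hv hvv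
      rw [hb] at h3
      have h5 := omega_mem_of_oddPart hn1 (j := 0) (Or.inl rfl)
        (((oddPart γ A).smul_mem_iff hb0).1 h3)
      rw [hμv] at h5
      exact (A.smul_mem_iff hμ).1 h5

/-- Spinors annihilated by `ω_1` are generated from the vacuum by `ω_{-2}, …, ω_{-r}`. -/
theorem mem_sup_of_omega_one {γ : Gammas n} (hγ : IsClifford γ) (hn1 : 1 ≤ n) {v : Spinor n}
    (hv : v ≠ 0) (hvv : IsVacuum γ v) {B₀ B₁ : Submodule ℂ (Spinor n)} (hv0 : v ∈ B₀)
    (h01 : ∀ k : ℕ, 2 ≤ k → ∀ s ∈ B₀, (omega γ (-(k : ℤ))).mulVec s ∈ B₁)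
    (h10 : ∀ k : ℕ, 2 ≤ k → ∀ s ∈ B₁, (omega γ (-(k : ℤ))).mulVec s ∈ B₀)
    {s : Spinor n} (hs : (omega γ 1).mulVec s = 0) : s ∈ B₀ ⊔ B₁ := by
  have key : ∀ k : ℕ, k + 1 ≤ rk n → ∀ s : Spinor n,
      (∀ j : ℕ, 1 ≤ j → j ≤ rk n - k → (omega γ j).mulVec s = 0) → s ∈ B₀ ⊔ B₁ := by
    intro k
    induction k with
    | zero =>
      intro _ s hs
      obtain ⟨c, rfl⟩ := exists_smul_of_isVacuum hγ hv hvv (s := s) hs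
      exact Submodule.mem_sup_left (B₀.smul_mem c hv0)
    | succ k ih =>
      intro hk s hs
      set m := rk n - k with hm
      have hval : Valid n (m : ℤ) := valid_of_pos (by omega) (by omega)
      have hω : ∀ t : Spinor n, (∀ j : ℕ, 1 ≤ j → j ≤ rk n - (k + 1) → (omega γ j).mulVec t = 0) →
          (omega γ (m : ℤ)).mulVec t ∈ B₀ ⊔ B₁ := by
        intro t ht
        refine ih (by omega) _ fun j h1 h2 => ?_
        rcases Nat.lt_or_ge j m with h3 | h3
        · rw [Matrix.mulVec_mulVec, omega_anticomm hγ (valid_of_pos h1 (by omega)) hval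
            (by omega), Matrix.neg_mulVec, ← Matrix.mulVec_mulVec, ht j h1 (by omega),
            Matrix.mulVec_zero, neg_zero]
        · obtain rfl : j = m := by omega
          rw [Matrix.mulVec_mulVec, omega_sq hγ hval (by omega), Matrix.zero_mulVec]
      have hstep : ∀ t ∈ B₀ ⊔ B₁, (omega γ (-(m : ℤ))).mulVec t ∈ B₀ ⊔ B₁ := by
        intro t ht
        obtain ⟨a, ha, b, hb, rfl⟩ := Submodule.mem_sup.1 ht
        rw [Matrix.mulVec_add]
        exact add_mem (Submodule.mem_sup_right (h01 m (by omega) a ha))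
          (Submodule.mem_sup_left (h10 m (by omega) b hb))
      -- The resolution of the identity for one oscillator. In both terms `ω_m` acts on a vector
      -- killed by the lower annihilators, so the induction hypothesis applies to its image, which
      -- `ω_m` kills as well; in the second term a creation operator follows.
      have e : s = (-1 / 2 : ℂ) • ((omega γ (m : ℤ)).mulVec ((omega γ (-(m : ℤ))).mulVec s) +
          (omega γ (-(m : ℤ))).mulVec ((omega γ (m : ℤ)).mulVec s)) := by
        rw [Matrix.mulVec_mulVec, omega_neg_mul hγ hval, Matrix.sub_mulVec, Matrix.neg_mulVec,
          Matrix.smul_mulVec, Matrix.one_mulVec, Matrix.mulVec_mulVec]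
        module
      rw [e]
      refine Submodule.smul_mem _ _ (add_mem (hω _ fun j h1 h2 => ?_) (hstep _ (hω s hs)))
      rw [Matrix.mulVec_mulVec, omega_anticomm hγ (valid_of_pos h1 (by omega)) hval.neg
        (by omega), Matrix.neg_mulVec, ← Matrix.mulVec_mulVec, hs j h1 h2, Matrix.mulVec_zero,
        neg_zero]
  have hr : 1 ≤ rk n := by unfold rk; omega
  refine key (rk n - 1) (by omega) s fun j h1 h2 => ?_
  obtain rfl : j = 1 := by omega
  exact_mod_cast hs

/-- The Fock construction, with creation operators alternating between `A` and its odd part. For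
even `n` the two are intersected with the chirality eigenspaces, and the chirality of `s` removes
its odd component. For odd `n`, `ω_0` puts the vacuum into `A ⊓ oddPart γ A`, which is stable under
all creation operators used. -/
theorem mem_of_vacuum_mem (hn1 : 1 ≤ n) {γ : Gammas n} (hγ : IsClifford γ) {v : Spinor n}
    (hv : v ≠ 0) (hvv : IsVacuum γ v) {c : ℂ} (hc : c ≠ 0) (hcv : Chir γ c v)
    {A : Submodule ℂ (Spinor n)} (hA : SpatialStable γ A) (hvA : v ∈ A) {s : Spinor n}
    (hs : (omega γ 1).mulVec s = 0) (hsc : Chir γ c s) : s ∈ A := by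
  by_cases hn : n % 2 = 0
  · set E : ℂ → Submodule ℂ (Spinor n) :=
      fun c => LinearMap.ker (Matrix.toLin' (chi γ) - c • LinearMap.id) with hE
    have memE : ∀ c s, s ∈ E c ↔ Chir γ c s := by
      intro c s
      simp only [hE, LinearMap.mem_ker, LinearMap.sub_apply, Matrix.toLin'_apply,
        LinearMap.smul_apply, LinearMap.id_apply, sub_eq_zero]
      exact ⟨fun h _ => h, fun h => h hn⟩
    have := mem_sup_of_omega_one hγ hn1 hv hvv (B₀ := A ⊓ E c) (B₁ := oddPart γ A ⊓ E (-c))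
      ⟨hvA, (memE _ _).2 hcv⟩
      (fun k hk s hs => ⟨hA.omega_mem_oddPart hn1 (Or.inr (by omega)) hs.1,
        (memE _ _).2 (((memE _ _).1 hs.2).omega_mulVec hγ _)⟩)
      (fun k hk s hs => ⟨omega_mem_of_oddPart hn1 (Or.inr (by omega)) hs.1,
        (memE _ _).2 (by simpa using ((memE _ _).1 hs.2).omega_mulVec hγ (-(k : ℤ)))⟩) hs
    obtain ⟨a, ha, b, hb, rfl⟩ := Submodule.mem_sup.1 this
    have h1 := hsc hn
    rw [Matrix.mulVec_add, ((memE _ _).1 ha.2) hn, ((memE _ _).1 hb.2) hn] at h1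
    have h2 : (2 * c) • b = 0 := by
      have : (2 * c) • b = c • (a + b) - (c • a + -c • b) := by module
      rw [this, h1, sub_self]
    have h3 : b = 0 := (smul_eq_zero.1 h2).resolve_left (by simp [hc])
    rw [h3, add_zero]
    exact ha.1
  · obtain ⟨μ, hμ, hμv⟩ := exists_omega_zero_eigen hγ (by omega) hv hvv
    have hvo : v ∈ oddPart γ A := by
      have := hA.omega_mem_oddPart hn1 (j := 0) (Or.inl rfl) hvA
      rw [hμv] at this
      exact ((oddPart γ A).smul_mem_iff hμ).1 this
    have := mem_sup_of_omega_one hγ hn1 hv hvv (B₀ := A ⊓ oddPart γ A) (B₁ := A ⊓ oddPart γ A)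
      ⟨hvA, hvo⟩
      (fun k hk s hs => ⟨omega_mem_of_oddPart hn1 (Or.inr (by omega)) hs.2,
        hA.omega_mem_oddPart hn1 (Or.inr (by omega)) hs.1⟩)
      (fun k hk s hs => ⟨omega_mem_of_oddPart hn1 (Or.inr (by omega)) hs.2,
        hA.omega_mem_oddPart hn1 (Or.inr (by omega)) hs.1⟩) hs
    rw [sup_idem] at this
    exact this.1

/-- The spinors annihilated by `ω_1` of the chirality of the vacuum form an irreducible
`so(n)`-module. -/
theorem spatialStable_irreducible (hn1 : 1 ≤ n) {γ : Gammas n} (hγ : IsClifford γ) {v : Spinor n}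
    (hv : v ≠ 0) (hvv : IsVacuum γ v) {c : ℂ} (hc : c ≠ 0) (hcv : Chir γ c v)
    {A : Submodule ℂ (Spinor n)} (hA : SpatialStable γ A) {s t : Spinor n} (hs : s ∈ A)
    (hs0 : s ≠ 0) (hs1 : (omega γ 1).mulVec s = 0) (hsc : Chir γ c s)
    (ht1 : (omega γ 1).mulVec t = 0) (htc : Chir γ c t) : t ∈ A :=
  mem_of_vacuum_mem hn1 hγ hv hvv hc hcv hA
    (vacuum_mem_of_spatialStable hn1 hγ hv hvv hc hcv hA hs hs0 hs1 hsc) ht1 htc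

theorem omega_one_spatial {γ : Gammas n} (hγ : IsClifford γ) (i : Fin n) :
    omega γ 1 * γ i.succ.succ = -(γ i.succ.succ * omega γ 1) := by
  have h := gam_anticomm hγ (isoCoeff 1) (Pi.single i.succ.succ 1)
  rw [gam_single, ip_comm, ip_single_left] at h
  have : isoCoeff 1 (i.succ.succ : Fin (n + 2)) = 0 := by simp [isoCoeff]
  rw [this, mul_zero, mul_zero, zero_smul, add_zero] at h
  exact h

theorem omega_neg_one_spatial {γ : Gammas n} (hγ : IsClifford γ) (i : Fin n) :
    omega γ (-1) * γ i.succ.succ = -(γ i.succ.succ * omega γ (-1)) := by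
  have h := gam_anticomm hγ (isoCoeff (-1)) (Pi.single i.succ.succ 1)
  rw [gam_single, ip_comm, ip_single_left] at h
  have : isoCoeff (-1) (i.succ.succ : Fin (n + 2)) = 0 := by simp [isoCoeff]
  rw [this, mul_zero, mul_zero, zero_smul, add_zero] at h
  exact h

/-- The same for the opposite chirality. -/
theorem spatialStable_irreducible_neg (hn1 : 1 ≤ n) {γ : Gammas n} (hγ : IsClifford γ)
    {v : Spinor n} (hv : v ≠ 0) (hvv : IsVacuum γ v) {c : ℂ} (hc : c ≠ 0) (hcv : Chir γ c v)
    {A : Submodule ℂ (Spinor n)} (hA : SpatialStable γ A) {s t : Spinor n} (hs : s ∈ A)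
    (hs0 : s ≠ 0) (hs1 : (omega γ 1).mulVec s = 0) (hsc : Chir γ (-c) s)
    (ht1 : (omega γ 1).mulVec t = 0) (htc : Chir γ (-c) t) : t ∈ A := by
  set i : Fin n := ⟨0, hn1⟩
  have hsq : γ i.succ.succ * γ i.succ.succ = -1 := by
    rw [gamma_sq hγ]; simp [eta]
  -- A single spatial gamma matrix exchanges the chiralities, preserves the kernel of `ω_1` and has
  -- square `-1`, so pulling back along it reduces the claim to the chirality of the vacuum.
  set A' : Submodule ℂ (Spinor n) := A.comap (Matrix.toLin' (γ i.succ.succ)) with hA'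
  have hflip : ∀ u : Spinor n, (omega γ 1).mulVec u = 0 →
      (omega γ 1).mulVec ((γ i.succ.succ).mulVec u) = 0 := by
    intro u hu
    rw [Matrix.mulVec_mulVec, omega_one_spatial hγ, Matrix.neg_mulVec, ← Matrix.mulVec_mulVec, hu,
      Matrix.mulVec_zero, neg_zero]
  have hstab : SpatialStable γ A' := by
    intro j k u hu
    have h1 := hA i j _ (hA k i _ (show (γ i.succ.succ).mulVec u ∈ A from hu))
    rw [Matrix.mulVec_mulVec, Matrix.mulVec_mulVec, mul_assoc, mul_assoc, mul_assoc, hsq] at h1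
    have h2 := A.neg_mem h1
    rw [← Matrix.neg_mulVec] at h2
    change (γ i.succ.succ).mulVec _ ∈ A
    rw [Matrix.mulVec_mulVec]
    rwa [mul_neg, mul_neg, mul_neg, neg_neg, mul_one] at h2
  have hmem : ∀ u, (γ i.succ.succ).mulVec u ∈ A' ↔ u ∈ A := by
    intro u
    change (γ i.succ.succ).mulVec ((γ i.succ.succ).mulVec u) ∈ A ↔ _
    rw [Matrix.mulVec_mulVec, hsq, Matrix.neg_mulVec, Matrix.one_mulVec, neg_mem_iff]
  rw [← hmem]
  refine spatialStable_irreducible hn1 hγ hv hvv hc hcv hstab ((hmem s).2 hs) (fun h => hs0 ?_)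
    (hflip s hs1) (by simpa using hsc.gamma_mulVec hγ i.succ.succ) (hflip t ht1)
    (by simpa using htc.gamma_mulVec hγ i.succ.succ)
  exact mulVec_eq_zero_of_isUnit (isUnit_gamma hγ _) h

end GuptaBleuler

end

noncomputable section

namespace GuptaBleuler

variable {n : ℕ}

/-! ### The Weyl–Clifford algebra in null coordinates -/

/-- Generators of the tensor product of a Weyl and a Clifford algebra: null coordinates `u, w` and
spatial coordinates `y i`, the derivatives with respect to them, and Clifford generators. -/
structure WeylClifford (R : Type*) [Ring R] [Algebra ℂ R] (n : ℕ) where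
  (u w du dw p m : R)
  (y d g : Fin n → R)
  wu : w * u = u * w
  dudw : du * dw = dw * du
  duu : du * u = u * du + 1
  dww : dw * w = w * dw + 1
  duw : du * w = w * du
  dwu : dw * u = u * dw
  yu : ∀ i, y i * u = u * y i
  yw : ∀ i, y i * w = w * y i
  du_y : ∀ i, du * y i = y i * du
  dw_y : ∀ i, dw * y i = y i * dw
  d_u : ∀ i, d i * u = u * d i
  d_w : ∀ i, d i * w = w * d i
  d_du : ∀ i, d i * du = du * d i
  d_dw : ∀ i, d i * dw = dw * d i
  yy : ∀ i j, y i * y j = y j * y i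
  dd : ∀ i j, d i * d j = d j * d i
  dy : ∀ i j, d i * y j = y j * d i + if i = j then 1 else 0
  pu : p * u = u * p
  pw : p * w = w * p
  pdu : p * du = du * p
  pdw : p * dw = dw * p
  p_y : ∀ i, p * y i = y i * p
  p_d : ∀ i, p * d i = d i * p
  mu : m * u = u * m
  mw : m * w = w * m
  mdu : m * du = du * m
  mdw : m * dw = dw * m
  m_y : ∀ i, m * y i = y i * m
  m_d : ∀ i, m * d i = d i * m
  gu : ∀ i, g i * u = u * g i
  gw : ∀ i, g i * w = w * g i
  gdu : ∀ i, g i * du = du * g i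
  gdw : ∀ i, g i * dw = dw * g i
  g_y : ∀ i j, g i * y j = y j * g i
  g_d : ∀ i j, g i * d j = d j * g i
  pp : p * p = 0
  mm : m * m = 0
  pm : p * m = -(m * p) - (2 : ℂ) • 1
  gg : ∀ i j, g i * g j = -(g j * g i) - if i = j then (2 : ℂ) • 1 else 0
  pg : ∀ i, p * g i = -(g i * p)
  mg : ∀ i, m * g i = -(g i * m)

namespace WeylClifford

variable {R : Type*} [Ring R] [Algebra ℂ R] (X : WeylClifford R n)

/-- The spatial degree operator. -/
def e : R := ∑ i, X.y i * X.d i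

/-- The square of the spatial radius. -/
def rsq : R := ∑ i, X.y i * X.y i

/-- The spatial Laplacian. -/
def lap : R := ∑ i, X.d i * X.d i

/-- The spatial Dirac operator. -/
def D : R := ∑ i, X.g i * X.d i

/-- The spatial vector variable. -/
def Y : R := ∑ i, X.y i * X.g i

/-- The operators raising the eigenvalue of `H`. -/
def Pp (i : Fin n) : R := X.u * X.d i - X.y i * X.dw + (1 / 2 : ℂ) • (X.p * X.g i)

/-- The operators lowering the eigenvalue of `H`. -/
def Pm (i : Fin n) : R := X.w * X.d i - X.y i * X.du + (1 / 2 : ℂ) • (X.m * X.g i)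

/-- The generator of `so(2)`. -/
def H : R := X.u * X.du - X.w * X.dw + (1 / 2 : ℂ) • (X.m * X.p + 1)

/-- The full degree operator. -/
def deg : R := X.u * X.du + X.w * X.dw + X.e

/-- The full vector variable. -/
def ys : R := X.Y - X.u * X.m - X.w * X.p

/-- The full Dirac operator. -/
def ds : R := X.p * X.du + X.m * X.dw - X.D

/-- The Casimir operator of `so(n)`, up to a constant. -/
def T : R := X.e * (X.e + ((n : ℂ) - 1) • 1) + (X.Y + X.rsq * X.D) * X.D

theorem gg_self (i : Fin n) : X.g i * X.g i = -1 := by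
  have h := X.gg i i
  rw [if_pos rfl] at h
  have h2 : (2 : ℂ) • (X.g i * X.g i) = (2 : ℂ) • (-1) := by
    rw [two_smul]
    nth_rewrite 1 [h]
    module
  have h3 := congrArg (fun x => (1 / 2 : ℂ) • x) h2
  simpa [smul_smul] using h3

theorem d_e (i : Fin n) : X.d i * X.e = X.e * X.d i + X.d i := by
  unfold e
  rw [Finset.mul_sum, Finset.sum_mul]
  have h : ∀ j, X.d i * (X.y j * X.d j) = X.y j * X.d j * X.d i + if i = j then X.d i else 0 := by
    intro j
    rw [← mul_assoc, X.dy, add_mul, mul_assoc, X.dd i j, ← mul_assoc]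
    congr 1
    split_ifs with h
    · subst h; simp
    · simp
  simp only [h, Finset.sum_add_distrib]
  simp

theorem D_e : X.D * X.e = X.e * X.D + X.D := by
  have hg : ∀ i, X.g i * X.e = X.e * X.g i := by
    intro i
    unfold e
    rw [Finset.mul_sum, Finset.sum_mul]
    refine Finset.sum_congr rfl fun j _ => ?_
    rw [← mul_assoc, X.g_y, mul_assoc, X.g_d, mul_assoc]
  unfold D
  rw [Finset.sum_mul, Finset.mul_sum, ← Finset.sum_add_distrib]
  refine Finset.sum_congr rfl fun i _ => ?_
  rw [mul_assoc, X.d_e, mul_add, ← mul_assoc, hg, mul_assoc]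

theorem D_Y : X.D * X.Y = -(X.Y * X.D) - (2 : ℂ) • X.e - (n : ℂ) • 1 := by
  have h : ∀ i j, X.g i * X.d i * (X.y j * X.g j) = -(X.y j * X.g j * (X.g i * X.d i)) -
      (2 : ℂ) • (if i = j then X.y i * X.d i else 0) - if i = j then 1 else 0 := by
    intro i j
    have e1 : X.g i * X.d i * (X.y j * X.g j) = X.y j * (X.g i * X.g j) * X.d i +
        if i = j then X.g i * X.g j else 0 := by
      rw [mul_assoc, ← mul_assoc (X.d i), X.dy, add_mul, mul_add, mul_assoc, ← X.g_d,
        ← mul_assoc (X.g i), X.g_y]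
      split_ifs <;> simp only [mul_assoc, one_mul, zero_mul, mul_zero]
    rw [e1]
    by_cases hij : i = j
    · subst hij
      have h2 : X.y i * X.g i * (X.g i * X.d i) = -(X.y i * X.d i) := by
        rw [mul_assoc, ← mul_assoc (X.g i), X.gg_self, neg_mul, one_mul, mul_neg]
      simp only [if_true, X.gg_self, h2, mul_neg, neg_mul, mul_one]
      module
    · rw [X.gg i j]
      simp [hij, mul_assoc]
  unfold D Y e
  rw [Finset.sum_mul_sum, Finset.sum_mul_sum, Finset.smul_sum]
  simp only [h, Finset.sum_sub_distrib, Finset.sum_neg_distrib, ← Finset.smul_sum]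
  rw [Finset.sum_comm]
  simp only [Finset.sum_ite_eq, Finset.mem_univ, if_true, Finset.sum_const, Finset.card_univ,
    Fintype.card_fin]
  rw [← Nat.cast_smul_eq_nsmul ℂ]

theorem D_rsq : X.D * X.rsq = X.rsq * X.D + (2 : ℂ) • X.Y := by
  have h : ∀ i j, X.g i * X.d i * (X.y j * X.y j) = X.y j * X.y j * (X.g i * X.d i) +
      (2 : ℂ) • (if i = j then X.y i * X.g i else 0) := by
    intro i j
    have e1 : X.d i * (X.y j * X.y j) = X.y j * X.y j * X.d i +
        (2 : ℂ) • (if i = j then X.y i else 0) := by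
      rw [← mul_assoc, X.dy, add_mul, mul_assoc, X.dy, mul_add]
      by_cases hij : i = j
      · subst hij
        simp only [if_true, mul_one, one_mul, mul_assoc]
        module
      · simp [hij, mul_assoc]
    rw [mul_assoc, e1, mul_add, ← mul_assoc, ← mul_assoc, X.g_y, mul_assoc (X.y j), X.g_y]
    by_cases hij : i = j
    · subst hij
      simp only [if_true, mul_smul_comm, X.g_y, mul_assoc]
    · simp [hij, mul_assoc]
  unfold D rsq Y
  rw [Finset.sum_mul_sum, Finset.sum_mul_sum, Finset.smul_sum]
  simp only [h, Finset.sum_add_distrib, ← Finset.smul_sum]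
  rw [Finset.sum_comm]
  simp

/-- The commutators of `D` with `e`, `Y` and `rsq` produce terms that cancel exactly for the
coefficients chosen in `T`. It lets an equation `T f = -c f` be passed on to `D f`, which has lower
degree. -/
theorem D_T : X.D * X.T = X.T * X.D := by
  have h1 : X.D * (X.e * X.e) = X.e * X.e * X.D + (2 : ℂ) • (X.e * X.D) + X.D := by
    rw [← mul_assoc, X.D_e, add_mul, mul_assoc, X.D_e, mul_add, ← mul_assoc]
    module
  have h2 : X.D * (X.Y * X.D) = -(X.Y * X.D * X.D) - (2 : ℂ) • (X.e * X.D) - (n : ℂ) • X.D := by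
    rw [← mul_assoc, X.D_Y, sub_mul, sub_mul, neg_mul, smul_mul_assoc, smul_mul_assoc, one_mul]
  have h3 : X.D * (X.rsq * X.D * X.D) = X.rsq * X.D * X.D * X.D + (2 : ℂ) • (X.Y * X.D * X.D) := by
    rw [← mul_assoc, ← mul_assoc, X.D_rsq, add_mul, add_mul, smul_mul_assoc, smul_mul_assoc]
  unfold T
  simp only [mul_add, add_mul, mul_smul_comm, smul_mul_assoc, mul_one, h1, h2, h3, X.D_e]
  module

theorem D_sq : X.D * X.D = -X.lap := by
  have h : ∀ i j, X.g i * X.d i * (X.g j * X.d j) = (X.g i * X.g j) * (X.d i * X.d j) := by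
    intro i j
    rw [mul_assoc, ← mul_assoc (X.d i), ← X.g_d, mul_assoc, mul_assoc]
  have h2 : X.D * X.D + X.D * X.D = -(X.lap + X.lap) := by
    unfold D lap
    rw [Finset.sum_mul_sum]
    nth_rewrite 2 [Finset.sum_comm]
    rw [← Finset.sum_add_distrib, ← Finset.sum_add_distrib, ← Finset.sum_neg_distrib]
    refine Finset.sum_congr rfl fun i _ => ?_
    rw [← Finset.sum_add_distrib, Finset.sum_eq_single i]
    · rw [h, X.gg_self]; simp
    · intro j _ hij
      rw [h, h, X.gg i j, if_neg (Ne.symm hij), sub_zero, X.dd i j, neg_mul, neg_add_cancel]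
    · simp
  have h3 := congrArg (fun x => (1 / 2 : ℂ) • x) h2
  simp only [← two_smul ℂ, ← smul_neg, smul_smul] at h3
  norm_num at h3
  exact h3

theorem ds_sq : X.ds * X.ds = -((2 : ℂ) • (X.du * X.dw) + X.lap) := by
  have pD : X.p * X.D = -(X.D * X.p) := by
    unfold D
    rw [Finset.mul_sum, Finset.sum_mul, ← Finset.sum_neg_distrib]
    exact Finset.sum_congr rfl fun i _ => by
      rw [← mul_assoc, X.pg, neg_mul, mul_assoc, X.p_d, mul_assoc]
  have mD : X.m * X.D = -(X.D * X.m) := by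
    unfold D
    rw [Finset.mul_sum, Finset.sum_mul, ← Finset.sum_neg_distrib]
    exact Finset.sum_congr rfl fun i _ => by
      rw [← mul_assoc, X.mg, neg_mul, mul_assoc, X.m_d, mul_assoc]
  have duD : X.du * X.D = X.D * X.du := by
    unfold D
    rw [Finset.mul_sum, Finset.sum_mul]
    exact Finset.sum_congr rfl fun i _ => by
      rw [← mul_assoc, ← X.gdu, mul_assoc, ← X.d_du, mul_assoc]
  have dwD : X.dw * X.D = X.D * X.dw := by
    unfold D
    rw [Finset.mul_sum, Finset.sum_mul]
    exact Finset.sum_congr rfl fun i _ => by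
      rw [← mul_assoc, ← X.gdw, mul_assoc, ← X.d_dw, mul_assoc]
  have t1 : X.p * X.du * (X.p * X.du) = 0 := by
    rw [mul_assoc, ← mul_assoc X.du, ← X.pdu, mul_assoc, ← mul_assoc, X.pp, zero_mul]
  have t2 : X.m * X.dw * (X.m * X.dw) = 0 := by
    rw [mul_assoc, ← mul_assoc X.dw, ← X.mdw, mul_assoc, ← mul_assoc, X.mm, zero_mul]
  have t3 : X.p * X.du * (X.m * X.dw) = X.p * X.m * (X.du * X.dw) := by
    rw [mul_assoc, ← mul_assoc X.du, ← X.mdu, mul_assoc, mul_assoc]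
  have t4 : X.m * X.dw * (X.p * X.du) = X.m * X.p * (X.du * X.dw) := by
    rw [mul_assoc, ← mul_assoc X.dw, ← X.pdw, mul_assoc, mul_assoc, X.dudw]
  have t5 : X.p * X.du * X.D = -(X.D * (X.p * X.du)) := by
    rw [mul_assoc, duD, ← mul_assoc, pD, neg_mul, mul_assoc]
  have t6 : X.m * X.dw * X.D = -(X.D * (X.m * X.dw)) := by
    rw [mul_assoc, dwD, ← mul_assoc, mD, neg_mul, mul_assoc]
  unfold ds
  simp only [mul_add, add_mul, mul_sub, sub_mul, t1, t2, t3, t4, t5, t6, X.D_sq, X.pm, neg_mul,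
    smul_mul_assoc, one_mul]
  module

/-- Normal ordering of the nine products. The spatial letters are collected so that the sum over `i`
turns them into `lap`, `e`, `D`, `rsq` and `Y`. -/
theorem Pm_Pp (i : Fin n) : X.Pm i * X.Pp i =
    X.u * X.w * (X.d i * X.d i) - X.w * X.dw * (X.y i * X.d i) - X.w * X.dw
    + (1 / 2 : ℂ) • (X.w * X.p * (X.g i * X.d i)) - (X.u * X.du + 1) * (X.y i * X.d i)
    + (X.y i * X.y i) * (X.du * X.dw) + (1 / 2 : ℂ) • ((X.y i * X.g i) * (X.p * X.du))
    + (1 / 2 : ℂ) • (X.u * X.m * (X.g i * X.d i)) + (1 / 2 : ℂ) • ((X.y i * X.g i) * (X.m * X.dw))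
    + (1 / 4 : ℂ) • (X.m * X.p) := by
  have t1 : X.w * X.d i * (X.u * X.d i) = X.u * X.w * (X.d i * X.d i) := by
    rw [mul_assoc, ← mul_assoc (X.d i), X.d_u, ← X.wu]; simp only [mul_assoc]
  have t2 : X.w * X.d i * (X.y i * X.dw) = X.w * X.dw * (X.y i * X.d i) + X.w * X.dw := by
    rw [mul_assoc, ← mul_assoc (X.d i), X.dy, if_pos rfl, add_mul, mul_add, one_mul, mul_assoc,
      mul_assoc, X.d_dw, ← mul_assoc (X.y i), ← X.dw_y, mul_assoc]
  have t3 : X.w * X.d i * (X.p * X.g i) = X.w * X.p * (X.g i * X.d i) := by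
    rw [mul_assoc, ← mul_assoc (X.d i), ← X.p_d, X.g_d]; simp only [mul_assoc]
  have t4 : X.y i * X.du * (X.u * X.d i) = (X.u * X.du + 1) * (X.y i * X.d i) := by
    rw [mul_assoc, ← mul_assoc X.du, X.duu]
    simp only [add_mul, mul_add, one_mul, mul_assoc]
    congr 1
    rw [← mul_assoc (X.y i), X.yu, mul_assoc, ← mul_assoc (X.y i), ← X.du_y, mul_assoc]
  have t5 : X.y i * X.du * (X.y i * X.dw) = (X.y i * X.y i) * (X.du * X.dw) := by
    rw [mul_assoc, ← mul_assoc X.du, X.du_y]; simp only [mul_assoc]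
  have t6 : X.y i * X.du * (X.p * X.g i) = -((X.y i * X.g i) * (X.p * X.du)) := by
    rw [mul_assoc, ← mul_assoc X.du, ← X.pdu, mul_assoc, ← X.gdu, ← mul_assoc X.p, X.pg]
    simp only [mul_assoc, neg_mul, mul_neg]
  have t7 : X.m * X.g i * (X.u * X.d i) = X.u * X.m * (X.g i * X.d i) := by
    rw [mul_assoc, ← mul_assoc (X.g i), X.gu, mul_assoc, ← mul_assoc, X.mu, mul_assoc]
  have t8 : X.m * X.g i * (X.y i * X.dw) = -((X.y i * X.g i) * (X.m * X.dw)) := by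
    rw [X.mg, neg_mul, mul_assoc, ← mul_assoc X.m, X.m_y, ← mul_assoc, ← mul_assoc, X.g_y]
    simp only [mul_assoc]
  have t9 : X.m * X.g i * (X.p * X.g i) = X.m * X.p := by
    rw [mul_assoc, X.pg, mul_neg, ← mul_assoc (X.g i), X.gg_self]; simp
  unfold Pm Pp
  simp only [mul_add, add_mul, mul_sub, sub_mul, mul_smul_comm, smul_mul_assoc, t1, t2, t3, t4, t5,
    t6, t7, t8, t9]
  simp only [one_mul]
  module

theorem sum_Pm_Pp : ∑ i, X.Pm i * X.Pp i =
    X.u * X.w * X.lap - X.w * X.dw * X.e - (n : ℂ) • (X.w * X.dw)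
    + (1 / 2 : ℂ) • (X.w * X.p * X.D) - (X.u * X.du + 1) * X.e
    + X.rsq * (X.du * X.dw) + (1 / 2 : ℂ) • (X.Y * (X.p * X.du))
    + (1 / 2 : ℂ) • (X.u * X.m * X.D) + (1 / 2 : ℂ) • (X.Y * (X.m * X.dw))
    + (n / 4 : ℂ) • (X.m * X.p) := by
  simp only [X.Pm_Pp, Finset.sum_add_distrib, Finset.sum_sub_distrib, ← Finset.smul_sum,
    ← Finset.mul_sum, ← Finset.sum_mul, Finset.sum_const, Finset.card_univ, Fintype.card_fin,
    ← Nat.cast_smul_eq_nsmul ℂ, mul_smul_comm]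
  simp only [lap, e, D, Y, rsq]
  module

theorem ys_ds : X.ys * X.ds = X.Y * (X.p * X.du) + X.Y * (X.m * X.dw) - X.Y * X.D
    - X.m * X.p * (X.u * X.du) + X.u * X.m * X.D - X.p * X.m * (X.w * X.dw) + X.w * X.p * X.D := by
  have t1 : X.u * X.m * (X.p * X.du) = X.m * X.p * (X.u * X.du) := by
    rw [mul_assoc X.m, ← mul_assoc X.p, X.pu, ← X.mu]; simp only [mul_assoc]
  have t2 : X.u * X.m * (X.m * X.dw) = 0 := by
    rw [mul_assoc, ← mul_assoc X.m, X.mm]; simp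
  have t3 : X.w * X.p * (X.p * X.du) = 0 := by
    rw [mul_assoc, ← mul_assoc X.p, X.pp]; simp
  have t4 : X.w * X.p * (X.m * X.dw) = X.p * X.m * (X.w * X.dw) := by
    rw [mul_assoc X.p, ← mul_assoc X.m, X.mw, ← X.pw]; simp only [mul_assoc]
  unfold ys ds
  simp only [mul_add, mul_sub, sub_mul, t1, t2, t3, t4]
  abel

/-- The Casimir identity. -/
theorem casimir : (2 : ℂ) • ∑ i, X.Pm i * X.Pp i - X.ys * X.ds - X.T =
    -(((2 : ℂ) • (X.u * X.w) + X.rsq) * (X.ds * X.ds)) +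
    (X.H + (((n : ℂ) - 1) / 2) • 1) * (X.H + (((n : ℂ) + 1) / 2) • 1) -
    (X.deg + ((n : ℂ) / 2 + 1) • 1) * (X.deg + ((n : ℂ) / 2) • 1) := by
  have ce : ∀ z : R, (∀ i, z * X.y i = X.y i * z) → (∀ i, z * X.d i = X.d i * z) →
      z * X.e = X.e * z := by
    intro z h1 h2
    unfold e
    rw [Finset.mul_sum, Finset.sum_mul]
    exact Finset.sum_congr rfl fun i _ => by rw [← mul_assoc, h1, mul_assoc, h2, mul_assoc]
  -- The products arising from the quadratic terms in `H` and `deg` involve only `A`, `B`, `q` and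
  -- `e`. The relations below bring them to a common normal form; `q² = -2q` reflects that `-q/2` is
  -- a projection.
  set A := X.u * X.du with hA
  set B := X.w * X.dw with hB
  set q := X.m * X.p with hq
  have hAe : A * X.e = X.e * A := ce _
    (fun i => by rw [hA, mul_assoc, X.du_y, ← mul_assoc, ← X.yu, mul_assoc])
    (fun i => by rw [hA, mul_assoc, ← X.d_du, ← mul_assoc, ← X.d_u, mul_assoc])
  have hBe : B * X.e = X.e * B := ce _
    (fun i => by rw [hB, mul_assoc, X.dw_y, ← mul_assoc, ← X.yw, mul_assoc])
    (fun i => by rw [hB, mul_assoc, ← X.d_dw, ← mul_assoc, ← X.d_w, mul_assoc])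
  have hBA : B * A = A * B := by
    rw [hA, hB, mul_assoc, ← mul_assoc X.dw, X.dwu, mul_assoc, ← mul_assoc, X.wu, ← X.dudw,
      mul_assoc X.u X.w, ← mul_assoc X.w X.du, ← X.duw]
    simp only [mul_assoc]
  have hqA : q * A = A * q := by
    rw [hA, hq, mul_assoc, ← mul_assoc X.p, X.pu, mul_assoc X.u, X.pdu, ← mul_assoc, X.mu,
      mul_assoc, ← mul_assoc X.m, X.mdu]
    simp only [mul_assoc]
  have hqB : q * B = B * q := by
    rw [hB, hq, mul_assoc, ← mul_assoc X.p, X.pw, mul_assoc X.w, X.pdw, ← mul_assoc, X.mw,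
      mul_assoc, ← mul_assoc X.m, X.mdw]
    simp only [mul_assoc]
  have hqq : q * q = -((2 : ℂ) • q) := by
    rw [hq, mul_assoc, ← mul_assoc X.p, X.pm, sub_mul, neg_mul, mul_assoc, X.pp, mul_zero, neg_zero,
      zero_sub, smul_mul_assoc, one_mul, mul_neg, mul_smul_comm]
  have hAB : X.u * X.w * (X.du * X.dw) = A * B := by
    rw [hA, hB, mul_assoc, mul_assoc, ← mul_assoc X.w, ← X.duw]; simp only [mul_assoc]
  have hT : X.T = X.e * X.e + ((n : ℂ) - 1) • X.e + X.Y * X.D - X.rsq * X.lap := by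
    unfold T
    rw [add_mul, mul_assoc X.rsq, X.D_sq, mul_add, mul_smul_comm, mul_one]
    simp only [mul_neg]
    abel
  rw [X.sum_Pm_Pp, X.ys_ds, X.ds_sq, hT, X.pm]
  unfold H deg
  simp only [← hA, ← hB, ← hq]
  simp only [mul_add, add_mul, mul_sub, sub_mul, mul_neg, neg_mul, smul_mul_assoc, mul_smul_comm,
    mul_one, one_mul, smul_add, smul_sub, smul_neg, hAe, hBe, hBA, hqA, hqB, hqq, hAB,
    smul_smul]
  module

end WeylClifford

end GuptaBleuler

end

noncomputable section

namespace GuptaBleuler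

variable {n : ℕ}

/-! ### Polynomial dependence on the spatial coordinates -/

namespace WeylClifford

variable {V : Type*} [AddCommGroup V] [Module ℂ V] (X : WeylClifford (Module.End ℂ V) n)

/-- The vectors annihilated by all products of `k` spatial derivatives. -/
def polyLt : ℕ → Submodule ℂ V
  | 0 => ⊥
  | k + 1 => ⨅ i, (polyLt k).comap (X.d i)

theorem mem_polyLt_succ {k : ℕ} {f : V} : f ∈ X.polyLt (k + 1) ↔ ∀ i, X.d i f ∈ X.polyLt k := by
  simp [polyLt]

theorem mem_polyLt_of_commute {z : Module.End ℂ V} (hz : ∀ i, X.d i * z = z * X.d i) {k : ℕ}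
    {f : V} (hf : f ∈ X.polyLt k) : z f ∈ X.polyLt k := by
  induction k generalizing f with
  | zero =>
    rw [show f = 0 from hf, map_zero]; exact Submodule.zero_mem _
  | succ k ih =>
    rw [mem_polyLt_succ] at hf ⊢
    intro i
    have : X.d i (z f) = z (X.d i f) := LinearMap.congr_fun (hz i) f
    rw [this]
    exact ih (hf i)

theorem polyLt_le_succ (k : ℕ) : X.polyLt k ≤ X.polyLt (k + 1) := by
  induction k with
  | zero => exact bot_le
  | succ k ih =>
    intro f hf
    rw [mem_polyLt_succ] at hf ⊢
    exact fun i => ih (hf i)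

theorem d_mem_polyLt (i : Fin n) {k : ℕ} {f : V} (hf : f ∈ X.polyLt k) : X.d i f ∈ X.polyLt k :=
  X.mem_polyLt_of_commute (fun j => X.dd j i) hf

theorem y_mem_polyLt (i : Fin n) {k : ℕ} {f : V} (hf : f ∈ X.polyLt k) :
    X.y i f ∈ X.polyLt (k + 1) := by
  induction k generalizing f with
  | zero => rw [show f = 0 from hf, map_zero]; exact Submodule.zero_mem _
  | succ k ih =>
    rw [mem_polyLt_succ]
    intro j
    have : X.d j (X.y i f) = X.y i (X.d j f) + (if j = i then (1 : Module.End ℂ V) else 0) f :=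
      LinearMap.congr_fun (X.dy j i) f
    rw [this]
    refine add_mem (ih ((X.mem_polyLt_succ).1 hf j)) ?_
    split_ifs
    · exact hf
    · exact Submodule.zero_mem _

theorem D_mem_polyLt {k : ℕ} {f : V} (hf : f ∈ X.polyLt (k + 1)) : X.D f ∈ X.polyLt k := by
  unfold D
  rw [LinearMap.sum_apply]
  exact Submodule.sum_mem _ fun i _ => X.mem_polyLt_of_commute (fun j => (X.g_d i j).symm)
    ((X.mem_polyLt_succ).1 hf i)

/-- Euler's relation: on polynomials of degree at most `k`, the operator `e - k` kills the part of
top degree. -/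
theorem e_sub_mem_polyLt {k : ℕ} {f : V} (hf : f ∈ X.polyLt (k + 1)) :
    X.e f - (k : ℂ) • f ∈ X.polyLt k := by
  induction k generalizing f with
  | zero =>
    have : X.e f = 0 := by
      unfold e
      rw [LinearMap.sum_apply]
      refine Finset.sum_eq_zero fun i _ => ?_
      have := (X.mem_polyLt_succ).1 hf i
      rw [Module.End.mul_apply, show X.d i f = 0 from this, map_zero]
    rw [this]
    simp
  | succ k ih =>
    rw [mem_polyLt_succ]
    intro i
    have h1 : X.d i (X.e f) = X.e (X.d i f) + X.d i f := LinearMap.congr_fun (X.d_e i) f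
    have h2 := ih ((X.mem_polyLt_succ).1 hf i)
    rw [map_sub, map_smul, h1]
    convert h2 using 1
    push_cast
    module

/-- The operator `T + c`, with `c > 0`, is injective on polynomials. -/
theorem eq_zero_of_T {c : ℝ} (hc : 0 < c) (hn : 1 ≤ n) {k : ℕ} {f : V} (hf : f ∈ X.polyLt k)
    (hT : X.T f = -(c : ℂ) • f) : f = 0 := by
  induction k generalizing f with
  | zero => exact hf
  | succ k ih =>
    -- `D` lowers the degree and commutes with `T`, so `D f` solves the same equation and vanishes
    -- by induction. On the kernel of `D`, `T` becomes a polynomial in `e`.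
    have hD : X.D f = 0 := by
      refine ih (X.D_mem_polyLt hf) ?_
      have : X.D (X.T f) = X.T (X.D f) := LinearMap.congr_fun X.D_T f
      rw [← this, hT, map_smul]
    have hTD : ∀ f, X.D f = 0 → X.T f = X.e (X.e f) + ((n : ℂ) - 1) • X.e f := by
      intro f hf
      simp only [T, LinearMap.add_apply, Module.End.mul_apply, hf, map_zero, add_zero, map_add,
        LinearMap.smul_apply, map_smul, Module.End.one_apply]
    -- This difference again solves the equation and has lower degree, so it vanishes. Then `T` acts
    -- on `f` by `k² + (n-1) k`, which is nonnegative and cannot equal `-c`.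
    have he : X.e f - (k : ℂ) • f = 0 := by
      refine ih (X.e_sub_mem_polyLt hf) ?_
      have hDe : X.D (X.e f) = 0 := by
        have : X.D (X.e f) = X.e (X.D f) + X.D f := LinearMap.congr_fun X.D_e f
        rw [this, hD, map_zero, add_zero]
      rw [map_sub, map_smul, hT, hTD _ hDe]
      have h1 := hTD f hD
      rw [hT] at h1
      have h2 := congrArg X.e h1
      rw [map_add, map_smul, map_smul] at h2
      rw [← h2]
      module
    have he' : X.e f = (k : ℂ) • f := sub_eq_zero.1 he
    have h1 := hTD f hD
    rw [hT, he', map_smul, he'] at h1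
    have h2 : (((k : ℝ) * k + ((n : ℝ) - 1) * k + c : ℝ) : ℂ) • f = 0 := by
      have : (((k : ℝ) * k + ((n : ℝ) - 1) * k + c : ℝ) : ℂ) • f =
          ((k : ℂ) • (k : ℂ) • f + ((n : ℂ) - 1) • (k : ℂ) • f) - (-(c : ℂ) • f) := by
        push_cast; module
      rw [this, h1, sub_self]
    refine (smul_eq_zero.1 h2).resolve_left ?_
    rw [Complex.ofReal_eq_zero]
    have : (1 : ℝ) ≤ n := by exact_mod_cast hn
    have h3 : 0 ≤ ((n : ℝ) - 1) * k := mul_nonneg (by linarith) (Nat.cast_nonneg k)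
    have h4 : 0 ≤ (k : ℝ) * k := mul_self_nonneg _
    linarith

end WeylClifford

/-! ### The Weyl–Clifford algebra of operators on fields -/

theorem valid_one (n : ℕ) : Valid n 1 := ⟨by unfold rk; simp, fun h => by omega⟩

theorem ip_one_one : ip (isoCoeff 1 : Fin (n + 2) → ℂ) (isoCoeff 1) = 0 := by
  rw [ip_isoCoeff (valid_one n) (valid_one n)]; norm_num

theorem ip_neg_neg : ip (isoCoeff (-1) : Fin (n + 2) → ℂ) (isoCoeff (-1)) = 0 := by
  rw [ip_isoCoeff (valid_one n).neg (valid_one n).neg]; norm_num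

theorem ip_one_neg : ip (isoCoeff 1 : Fin (n + 2) → ℂ) (isoCoeff (-1)) = -1 := by
  rw [ip_isoCoeff (valid_one n) (valid_one n).neg]; norm_num

theorem ip_neg_one : ip (isoCoeff (-1) : Fin (n + 2) → ℂ) (isoCoeff 1) = -1 := by
  rw [ip_comm, ip_one_neg]

/-- The spatial unit vectors. -/
def spat (i : Fin n) : Fin (n + 2) → ℂ := Pi.single i.succ.succ 1

theorem ip_spat_one (i : Fin n) : ip (spat i) (isoCoeff 1) = 0 := by
  rw [spat, ip_single_left]; simp [isoCoeff]

theorem ip_spat_neg (i : Fin n) : ip (spat i) (isoCoeff (-1)) = 0 := by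
  rw [spat, ip_single_left]; simp [isoCoeff]

theorem ip_one_spat (i : Fin n) : ip (isoCoeff 1) (spat i) = 0 := by rw [ip_comm, ip_spat_one]

theorem ip_neg_spat (i : Fin n) : ip (isoCoeff (-1)) (spat i) = 0 := by rw [ip_comm, ip_spat_neg]

theorem ip_spat_spat (i j : Fin n) : ip (spat i) (spat j) = if i = j then -1 else 0 := by
  rw [spat, spat, ip_single]; simp [etaMat, eta]

/-- The operators on spinor fields in null coordinates. -/
def fieldWC {γ : Gammas n} (hγ : IsClifford γ) :
    WeylClifford (Module.End ℂ (SpinorField n)) n where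
  u := lowY (isoCoeff 1)
  w := lowY (isoCoeff (-1))
  -- The null vectors pair to `-1`, so the derivative dual to `u` is minus the derivative along the
  -- opposite null vector. The sign of `y i` undoes the lowering of a spatial index.
  du := -dirD (isoCoeff (-1))
  dw := -dirD (isoCoeff 1)
  p := mulMat (gam γ (isoCoeff 1))
  m := mulMat (gam γ (isoCoeff (-1)))
  y i := -lowY (spat i)
  d i := dirD (spat i)
  g i := mulMat (gam γ (spat i))
  wu := lowY_comm _ _
  dudw := by simp only [neg_mul_neg, dirD_comm (isoCoeff (-1))]
  duu := by rw [neg_mul, dirD_lowY, ip_neg_one, mul_neg, neg_add, neg_smul, one_smul, neg_neg]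
  dww := by rw [neg_mul, dirD_lowY, ip_one_neg, mul_neg, neg_add, neg_smul, one_smul, neg_neg]
  duw := by rw [neg_mul, dirD_lowY, ip_neg_neg, mul_neg, zero_smul, add_zero]
  dwu := by rw [neg_mul, dirD_lowY, ip_one_one, mul_neg, zero_smul, add_zero]
  yu i := by rw [neg_mul, lowY_comm, mul_neg]
  yw i := by rw [neg_mul, lowY_comm, mul_neg]
  du_y i := by rw [neg_mul_neg, neg_mul_neg, dirD_lowY, ip_neg_spat, zero_smul, add_zero]
  dw_y i := by rw [neg_mul_neg, neg_mul_neg, dirD_lowY, ip_one_spat, zero_smul, add_zero]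
  d_u i := by rw [dirD_lowY, ip_spat_one, zero_smul, add_zero]
  d_w i := by rw [dirD_lowY, ip_spat_neg, zero_smul, add_zero]
  d_du i := by rw [mul_neg, dirD_comm, neg_mul]
  d_dw i := by rw [mul_neg, dirD_comm, neg_mul]
  yy i j := by rw [neg_mul_neg, neg_mul_neg, lowY_comm]
  dd i j := dirD_comm _ _
  dy i j := by
    rw [mul_neg, dirD_lowY, ip_spat_spat, neg_add, neg_mul]
    split_ifs <;> simp
  pu := mulMat_lowY _ _
  pw := mulMat_lowY _ _
  pdu := by rw [mul_neg, mulMat_dirD, neg_mul]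
  pdw := by rw [mul_neg, mulMat_dirD, neg_mul]
  p_y i := by rw [mul_neg, mulMat_lowY, neg_mul]
  p_d i := mulMat_dirD _ _
  mu := mulMat_lowY _ _
  mw := mulMat_lowY _ _
  mdu := by rw [mul_neg, mulMat_dirD, neg_mul]
  mdw := by rw [mul_neg, mulMat_dirD, neg_mul]
  m_y i := by rw [mul_neg, mulMat_lowY, neg_mul]
  m_d i := mulMat_dirD _ _
  gu i := mulMat_lowY _ _
  gw i := mulMat_lowY _ _
  gdu i := by rw [mul_neg, mulMat_dirD, neg_mul]
  gdw i := by rw [mul_neg, mulMat_dirD, neg_mul]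
  g_y i j := by rw [mul_neg, mulMat_lowY, neg_mul]
  g_d i j := mulMat_dirD _ _
  pp := by
    apply eq_zero_of_eq_neg
    nth_rewrite 1 [mulGam_anticomm hγ, ip_one_one]
    simp
  mm := by
    apply eq_zero_of_eq_neg
    nth_rewrite 1 [mulGam_anticomm hγ, ip_neg_neg]
    simp
  pm := by rw [mulGam_anticomm hγ, ip_one_neg]; module
  gg i j := by
    rw [mulGam_anticomm hγ, ip_spat_spat]
    split_ifs
    · module
    · simp
  pg i := by rw [mulGam_anticomm hγ, ip_one_spat]; simp
  mg i := by rw [mulGam_anticomm hγ, ip_neg_spat]; simp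

theorem sum_isoCoeff_one {M : Type*} [AddCommGroup M] [Module ℂ M] (f : Fin (n + 2) → M) :
    ∑ a, isoCoeff 1 a • f a =
      (Complex.I * (Real.sqrt 2 : ℂ)⁻¹) • (f 0 + Complex.I • f 1) := by
  rw [sum_isoCoeff f (by norm_num) (valid_one n).1]
  simp only [Int.natAbs_one, if_true, Int.sign_one, Int.cast_one, one_mul, div_eq_mul_inv]
  rfl

theorem sum_isoCoeff_neg_one {M : Type*} [AddCommGroup M] [Module ℂ M] (f : Fin (n + 2) → M) :
    ∑ a, isoCoeff (-1) a • f a =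
      (Complex.I * (Real.sqrt 2 : ℂ)⁻¹) • (f 0 - Complex.I • f 1) := by
  rw [sum_isoCoeff f (by norm_num) (valid_one n).neg.1]
  simp only [Int.natAbs_neg, Int.natAbs_one, if_true, Int.sign_neg, Int.sign_one, Int.cast_neg,
    Int.cast_one, neg_mul, one_mul, div_eq_mul_inv, neg_smul, ← sub_eq_add_neg]
  rfl

theorem lowY_one : (lowY (isoCoeff 1) : Module.End ℂ (SpinorField n)) =
    (Complex.I * (Real.sqrt 2 : ℂ)⁻¹) • (mulY 0 + Complex.I • mulY 1) := by
  unfold lowY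
  rw [Finset.sum_congr rfl fun a _ => mul_smul (isoCoeff _ a) (eta a : ℂ) (mulY a)]
  rw [sum_isoCoeff_one]
  simp [eta]

theorem lowY_neg_one : (lowY (isoCoeff (-1)) : Module.End ℂ (SpinorField n)) =
    (Complex.I * (Real.sqrt 2 : ℂ)⁻¹) • (mulY 0 - Complex.I • mulY 1) := by
  unfold lowY
  rw [Finset.sum_congr rfl fun a _ => mul_smul (isoCoeff _ a) (eta a : ℂ) (mulY a)]
  rw [sum_isoCoeff_neg_one]
  simp [eta]

theorem dirD_one : (dirD (isoCoeff 1) : Module.End ℂ (SpinorField n)) =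
    (Complex.I * (Real.sqrt 2 : ℂ)⁻¹) • (pd 0 + Complex.I • pd 1) := sum_isoCoeff_one _

theorem dirD_neg_one : (dirD (isoCoeff (-1)) : Module.End ℂ (SpinorField n)) =
    (Complex.I * (Real.sqrt 2 : ℂ)⁻¹) • (pd 0 - Complex.I • pd 1) := sum_isoCoeff_neg_one _

theorem mulGam_one (γ : Gammas n) : mulMat (gam γ (isoCoeff 1)) =
    (Complex.I * (Real.sqrt 2 : ℂ)⁻¹) • (mulMat (γ 0) + Complex.I • mulMat (γ 1)) := by
  rw [mulMat_gam, sum_isoCoeff_one]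

theorem mulGam_neg_one (γ : Gammas n) : mulMat (gam γ (isoCoeff (-1))) =
    (Complex.I * (Real.sqrt 2 : ℂ)⁻¹) • (mulMat (γ 0) - Complex.I • mulMat (γ 1)) := by
  rw [mulMat_gam, sum_isoCoeff_neg_one]

/-- The inverse metric of the time plane in its null basis. It is applied to the degree operator, to
`ySlash` and to `dSlash`, to recognise the abstract operators of `WeylClifford`. -/
theorem null_sum {R : Type*} [Ring R] [Algebra ℂ R] (a b c d : R) :
    ((Complex.I * (Real.sqrt 2 : ℂ)⁻¹) • (a + Complex.I • b)) *
      ((Complex.I * (Real.sqrt 2 : ℂ)⁻¹) • (c - Complex.I • d)) +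
    ((Complex.I * (Real.sqrt 2 : ℂ)⁻¹) • (a - Complex.I • b)) *
      ((Complex.I * (Real.sqrt 2 : ℂ)⁻¹) • (c + Complex.I • d)) = -(a * c + b * d) := by
  have hq : (Real.sqrt 2 : ℂ)⁻¹ * (Real.sqrt 2 : ℂ)⁻¹ = 1 / 2 := by
    rw [← mul_inv, sqrt_two_sq]; norm_num
  have hI := Complex.I_mul_I
  have : Complex.I * (Real.sqrt 2 : ℂ)⁻¹ * (Complex.I * (Real.sqrt 2 : ℂ)⁻¹) = -1 / 2 := by
    linear_combination (Complex.I * Complex.I) * hq + 1 / 2 * hI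
  rw [smul_mul_smul_comm, smul_mul_smul_comm, this]
  simp only [add_mul, mul_add, sub_mul, mul_sub, smul_mul_assoc, mul_smul_comm, smul_add, smul_sub,
    smul_smul, hI]
  module

section
variable {γ : Gammas n} (hγ : IsClifford γ)

theorem fieldWC_y (i : Fin n) : (fieldWC hγ).y i = mulY i.succ.succ := by
  change -lowY (Pi.single i.succ.succ 1) = _
  rw [lowY_single]; simp [eta]

theorem fieldWC_d (i : Fin n) : (fieldWC hγ).d i = pd i.succ.succ := dirD_single _

theorem fieldWC_g (i : Fin n) : (fieldWC hγ).g i = mulMat (γ i.succ.succ) := by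
  change mulMat (gam γ (Pi.single i.succ.succ 1)) = _
  rw [gam_single]

theorem fieldWC_Pp (i : Fin n) : (fieldWC hγ).Pp i = genOp γ (isoCoeff 1) (spat i) := by
  unfold WeylClifford.Pp genOp
  rw [ip_one_spat]
  simp [fieldWC]

theorem fieldWC_Pm (i : Fin n) : (fieldWC hγ).Pm i = genOp γ (isoCoeff (-1)) (spat i) := by
  unfold WeylClifford.Pm genOp
  rw [ip_neg_spat]
  simp [fieldWC]

theorem fieldWC_H : (fieldWC hγ).H = genOp γ (isoCoeff (-1)) (isoCoeff 1) := by
  unfold WeylClifford.H genOp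
  rw [ip_neg_one]
  simp [fieldWC]
  abel

theorem fieldWC_deg : (fieldWC hγ).deg = degOp n := by
  unfold WeylClifford.deg WeylClifford.e degOp
  rw [Fin.sum_univ_succ, Fin.sum_univ_succ]
  simp only [fieldWC_y, fieldWC_d]
  rw [← add_assoc]
  congr 1
  have h := null_sum (mulY 0) (mulY 1) (pd 0) (pd 1 : Module.End ℂ (SpinorField n))
  rw [← lowY_one, ← lowY_neg_one, ← dirD_one, ← dirD_neg_one] at h
  change lowY _ * -dirD _ + lowY _ * -dirD _ = mulY 0 * pd 0 + mulY 1 * pd 1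
  rw [mul_neg, mul_neg, ← neg_add, h, neg_neg]

theorem fieldWC_ys : (fieldWC hγ).ys = ySlash γ := by
  unfold WeylClifford.ys WeylClifford.Y ySlash
  rw [Fin.sum_univ_succ, Fin.sum_univ_succ]
  simp only [fieldWC_y, fieldWC_g]
  have h := null_sum (mulY 0) (mulY 1) (mulMat (γ 0)) (mulMat (γ 1))
  rw [← lowY_one, ← lowY_neg_one, ← mulGam_one, ← mulGam_neg_one] at h
  change _ - lowY _ * mulMat _ - lowY _ * mulMat _ =
    mulY 0 * mulMat (γ 0) + (mulY 1 * mulMat (γ 1) + _)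
  rw [sub_sub, h]
  abel

theorem fieldWC_ds : (fieldWC hγ).ds = dSlash γ := by
  unfold WeylClifford.ds WeylClifford.D dSlash
  rw [Fin.sum_univ_succ, Fin.sum_univ_succ]
  simp only [fieldWC_d, fieldWC_g]
  have h := null_sum (mulMat (γ 0)) (mulMat (γ 1)) (pd 0) (pd 1)
  rw [← dirD_one, ← dirD_neg_one, ← mulGam_one, ← mulGam_neg_one] at h
  change mulMat _ * -dirD _ + mulMat _ * -dirD _ - _ = (eta 0 : ℂ) • (pd 0 * mulMat (γ 0)) +
    ((eta 1 : ℂ) • (pd 1 * mulMat (γ 1)) + _)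
  rw [mul_neg, mul_neg, ← neg_add, h]
  simp only [mulMat_pd]
  simp [eta]
  abel

end

end GuptaBleuler

end

noncomputable section

namespace GuptaBleuler

variable {n : ℕ}

/-! ### Power fields -/

theorem exp_log_null : Complex.exp (Complex.log (Complex.I / (Real.sqrt 2 : ℂ))) =
    Complex.I * (Real.sqrt 2 : ℂ)⁻¹ := by
  rw [Complex.exp_log (div_ne_zero Complex.I_ne_zero sqrt_two_ne), div_eq_mul_inv]

theorem null_sq : (Complex.I * (Real.sqrt 2 : ℂ)⁻¹) * (Complex.I * (Real.sqrt 2 : ℂ)⁻¹) = -1 / 2 := by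
  have hq : (Real.sqrt 2 : ℂ)⁻¹ * (Real.sqrt 2 : ℂ)⁻¹ = 1 / 2 := by
    rw [← mul_inv, sqrt_two_sq]; norm_num
  linear_combination (Complex.I * Complex.I) * hq + 1 / 2 * Complex.I_mul_I

/-- The function `x_1 ^ s` on the covering. -/
def xpow (s : ℂ) (z : Cover n) : ℂ :=
  Complex.exp (s * (z.1 + Complex.log (Complex.I / (Real.sqrt 2 : ℂ))))

theorem xpow_ne_zero (s : ℂ) (z : Cover n) : xpow s z ≠ 0 := Complex.exp_ne_zero _

theorem xpow_add_one (s : ℂ) (z : Cover n) :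
    xpow (s + 1) z = (Complex.I * (Real.sqrt 2 : ℂ)⁻¹) * Complex.exp z.1 * xpow s z := by
  unfold xpow
  rw [← exp_log_null, ← Complex.exp_add, ← Complex.exp_add]
  congr 1
  ring

theorem powField_apply (s : ℂ) (u : Spinor n) {z : Cover n} (hz : z ∈ HPlus n) :
    powField s u z = xpow s z • u := mkField_apply _ hz

/-- `powField s` as a linear map. -/
def powLin (s : ℂ) : Spinor n →ₗ[ℂ] SpinorField n where
  toFun := powField s
  map_add' u v := field_ext fun z hz => by
    rw [field_add_apply, powField_apply _ _ hz, powField_apply _ _ hz, powField_apply _ _ hz,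
      smul_add]
  map_smul' c u := field_ext fun z hz => by
    rw [field_smul_apply, powField_apply _ _ hz, powField_apply _ _ hz, smul_comm, RingHom.id_apply]

theorem powLin_apply (s : ℂ) (u : Spinor n) : powLin s u = powField s u := rfl

theorem powField_smul (s c : ℂ) (u : Spinor n) : powField s (c • u) = c • powField s u :=
  map_smul (powLin s) c u

theorem powField_zero (s : ℂ) : powField s (0 : Spinor n) = 0 := map_zero (powLin s)

theorem origin_mem_HPlus (n : ℕ) : ((0, 0) : Cover n) ∈ HPlus n := by
  change 0 < ySq _
  unfold ySq
  rw [Fin.sum_univ_succ, Fin.sum_univ_succ]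
  simp [coord, eta]

theorem powField_eq_zero {s : ℂ} {u : Spinor n} (h : powField s u = 0) : u = 0 := by
  have h1 : powField s u (0, 0) = 0 := congrArg (fun f : SpinorField n => f (0, 0)) h
  rw [powField_apply _ _ (origin_mem_HPlus n)] at h1
  exact (smul_eq_zero.1 h1).resolve_left (xpow_ne_zero _ _)

theorem mulMat_powField (A : Matrix (Fin (2 ^ rk n)) (Fin (2 ^ rk n)) ℂ) (s : ℂ) (u : Spinor n) :
    mulMat A (powField s u) = powField s (A.mulVec u) := by
  refine field_ext fun z hz => ?_
  rw [mulMat_apply, powField_apply _ _ hz, powField_apply _ _ hz, Matrix.mulVec_smul]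

theorem lowY_one_powField (s : ℂ) (u : Spinor n) :
    lowY (isoCoeff 1) (powField s u) = powField (s + 1) u := by
  refine field_ext fun z hz => ?_
  rw [lowY_one, powField_apply _ _ hz, xpow_add_one]
  simp only [LinearMap.smul_apply, LinearMap.add_apply, field_smul_apply, field_add_apply,
    mulY_apply, powField_apply _ _ hz, mul_smul]
  have h0 : coord 0 z = (Complex.exp z.1).re := rfl
  have h1 : coord 1 z = (Complex.exp z.1).im := rfl
  rw [h0, h1]
  congr 2
  rw [← Complex.coe_smul, ← Complex.coe_smul, smul_smul Complex.I, ← add_smul]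
  congr 1
  rw [mul_comm Complex.I]
  exact Complex.re_add_im _

theorem hasFDerivAt_xpow (s : ℂ) (u : Spinor n) (z : Cover n) :
    HasFDerivAt (fun z : Cover n => xpow s z • u)
      (((s * xpow s z) • ContinuousLinearMap.fst ℝ ℂ (Fin n → ℝ)).smulRight u) z := by
  have h1 : HasFDerivAt (fun z : Cover n => z.1 + Complex.log (Complex.I / (Real.sqrt 2 : ℂ)))
      (ContinuousLinearMap.fst ℝ ℂ (Fin n → ℝ)) z := hasFDerivAt_fst.add_const _
  have h2 := (h1.const_mul s).cexp
  have h3 := h2.smul_const u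
  rw [smul_smul, mul_comm] at h3
  exact h3

theorem pd_powField (a : Fin (n + 2)) (s : ℂ) (u : Spinor n) {z : Cover n} (hz : z ∈ HPlus n) :
    pd a (powField s u) z = (s * xpow s z * (frame a z).1) • u := by
  rw [pd_apply a _ hz]
  have h1 : (powField s u : Cover n → Spinor n) =ᶠ[𝓝 z] fun z => xpow s z • u := by
    filter_upwards [(isOpen_HPlus n).mem_nhds hz] with z' hz'
    exact powField_apply _ _ hz'
  rw [h1.fderiv_eq, (hasFDerivAt_xpow s u z).fderiv]
  rfl

/-- The field depends only on the null coordinate `u = x_1`, so the derivative along `isoCoeff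
(-1)`, which is `-∂/∂u`, is the only one of the null basis that does not annihilate it. -/
theorem dirD_neg_one_powField (s : ℂ) (u : Spinor n) :
    dirD (isoCoeff (-1)) (powField s u) = -(s • powField (s - 1) u) := by
  refine field_ext fun z hz => ?_
  rw [dirD_neg_one]
  change _ = -(s • powField (s - 1) u z)
  simp only [LinearMap.smul_apply, LinearMap.sub_apply, field_smul_apply, field_sub_apply,
    pd_powField _ _ _ hz, powField_apply _ _ hz]
  have h0 : (frame 0 z).1 = Complex.exp (-z.1) := rfl
  have h1 : (frame 1 z).1 = Complex.I * Complex.exp (-z.1) := rfl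
  have h2 := xpow_add_one (s - 1) z
  rw [sub_add_cancel] at h2
  have e1 : Complex.exp z.1 * Complex.exp (-z.1) = 1 := by rw [← Complex.exp_add]; simp
  rw [h0, h1, h2, smul_smul, ← sub_smul, smul_smul, smul_smul, ← neg_smul]
  congr 1
  generalize Complex.exp z.1 = E at *
  generalize Complex.exp (-z.1) = F at *
  generalize xpow (s - 1) z = x at *
  have h3 := null_sq
  generalize Complex.I * (Real.sqrt 2 : ℂ)⁻¹ = q at *
  linear_combination (s * x * E * F * (1 - Complex.I * Complex.I)) * h3 +
    (1 / 2 * s * x * E * F) * Complex.I_mul_I - s * x * e1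

theorem dirD_one_powField (s : ℂ) (u : Spinor n) :
    dirD (isoCoeff 1) (powField s u) = 0 := by
  refine field_ext fun z hz => ?_
  rw [dirD_one]
  change _ = (0 : Spinor n)
  simp only [LinearMap.smul_apply, LinearMap.add_apply, field_smul_apply, field_add_apply,
    pd_powField _ _ _ hz]
  have h0 : (frame 0 z).1 = Complex.exp (-z.1) := rfl
  have h1 : (frame 1 z).1 = Complex.I * Complex.exp (-z.1) := rfl
  rw [h0, h1, smul_smul, ← add_smul, smul_smul]
  convert zero_smul ℂ u
  linear_combination Complex.I * (Real.sqrt 2 : ℂ)⁻¹ * s * xpow s z * Complex.exp (-z.1) *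
    Complex.I_mul_I

theorem dirD_spat_powField (i : Fin n) (s : ℂ) (u : Spinor n) :
    dirD (spat i) (powField s u) = 0 := by
  refine field_ext fun z hz => ?_
  rw [spat, dirD_single, pd_powField _ _ _ hz]
  have : (frame i.succ.succ z).1 = 0 := rfl
  rw [this, mul_zero, zero_smul]
  rfl

/-! ### Cyclic submodules and the generators of the Lie algebra -/

section Cyclic

variable {V : Type*} [AddCommGroup V] [Module ℂ V]
  {T : Fin (n + 2) → Fin (n + 2) → Module.End ℂ V}

theorem mem_cyclic_self (T : Fin (n + 2) → Fin (n + 2) → Module.End ℂ V) (v : V) :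
    v ∈ cyclic T v :=
  ⟨1, Subalgebra.one_mem _, rfl⟩

theorem invariant_cyclic (T : Fin (n + 2) → Fin (n + 2) → Module.End ℂ V) (v : V) :
    Invariant T (cyclic T v) := by
  rintro a b _ ⟨x, hx, rfl⟩
  exact ⟨T a b * x, Subalgebra.mul_mem _ (Algebra.subset_adjoin ⟨(a, b), rfl⟩) hx, rfl⟩

theorem cyclic_le {W : Submodule ℂ V} (hW : Invariant T W) {v : V} (hv : v ∈ W) :
    cyclic T v ≤ W := by
  rintro _ ⟨x, hx, rfl⟩
  change x v ∈ W
  have key : ∀ y ∈ Algebra.adjoin ℂ (Set.range fun p : Fin (n + 2) × Fin (n + 2) => T p.1 p.2),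
      ∀ w ∈ W, y w ∈ W := by
    intro y hy
    induction hy using Algebra.adjoin_induction with
    | mem x hx =>
      obtain ⟨p, rfl⟩ := hx
      exact fun w hw => hW p.1 p.2 w hw
    | algebraMap r =>
      exact fun w hw => W.smul_mem r hw
    | add x y _ _ ihx ihy =>
      exact fun w hw => W.add_mem (ihx w hw) (ihy w hw)
    | mul x y _ _ ihx ihy =>
      exact fun w hw => ihx _ (ihy w hw)
  exact key x hx v hv

end Cyclic

theorem genOp_mem {γ : Gammas n} {W : Submodule ℂ (SpinorField n)}
    (hW : Invariant (fieldRep γ) W) (ξ ζ : Fin (n + 2) → ℂ) {f : SpinorField n} (hf : f ∈ W) :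
    genOp γ ξ ζ f ∈ W := by
  rw [← sum_sum_fieldRep]
  simp only [LinearMap.sum_apply, LinearMap.smul_apply]
  exact Submodule.sum_mem _ fun a _ => Submodule.sum_mem _ fun b _ =>
    Submodule.smul_mem _ _ (hW a b f hf)

/-- The complexified Lie algebra is spanned by its elements in null coordinates. -/
theorem invariant_of_null {γ : Gammas n} (hγ : IsClifford γ) {W : Submodule ℂ (SpinorField n)}
    (hH : ∀ f ∈ W, genOp γ (isoCoeff (-1)) (isoCoeff 1) f ∈ W)
    (hp : ∀ i, ∀ f ∈ W, genOp γ (isoCoeff 1) (spat i) f ∈ W)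
    (hm : ∀ i, ∀ f ∈ W, genOp γ (isoCoeff (-1)) (spat i) f ∈ W)
    (hs : ∀ i j, ∀ f ∈ W, genOp γ (spat i) (spat j) f ∈ W) :
    Invariant (fieldRep γ) W := by
  have hspat : ∀ (ξ : Fin (n + 2) → ℂ) (i : Fin n),
      genOp γ ξ (spat i) = ∑ a, ξ a • fieldRep γ a i.succ.succ := by
    intro ξ i
    rw [← sum_sum_fieldRep]
    refine Finset.sum_congr rfl fun a _ => ?_
    rw [Finset.sum_eq_single i.succ.succ] <;> simp +contextual [spat]
  have hq := null_sq
  have h01 : genOp γ (isoCoeff (-1)) (isoCoeff 1) = -Complex.I • fieldRep γ 0 1 := by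
    rw [← sum_sum_fieldRep]
    have e1 : ∀ a, ∑ b, (isoCoeff (-1) a * isoCoeff 1 b) • fieldRep γ a b =
        isoCoeff (-1) a • ((Complex.I * (Real.sqrt 2 : ℂ)⁻¹) • (fieldRep γ a 0 +
          Complex.I • fieldRep γ a 1)) := by
      intro a
      rw [← sum_isoCoeff_one (fun b => fieldRep γ a b), Finset.smul_sum]
      exact Finset.sum_congr rfl fun b _ => mul_smul _ _ _
    simp only [e1]
    rw [sum_isoCoeff_neg_one]
    have r := (isRep_fieldRep hγ).antisymm
    have r0 : fieldRep γ 0 0 = 0 := eq_zero_of_eq_neg (r 0 0)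
    have r1 : fieldRep γ 1 1 = 0 := eq_zero_of_eq_neg (r 1 1)
    rw [r0, r1, r 1 0]
    generalize Complex.I * (Real.sqrt 2 : ℂ)⁻¹ = q at *
    rw [zero_add, smul_zero, add_zero, smul_neg, smul_neg, smul_comm Complex.I q, sub_neg_eq_add,
      ← smul_add, smul_smul, hq]
    module
  have h01' : ∀ f ∈ W, fieldRep γ 0 1 f ∈ W := by
    intro f hf
    have := W.smul_mem Complex.I (hH f hf)
    rw [h01, LinearMap.smul_apply, smul_smul, mul_neg, Complex.I_mul_I, neg_neg, one_smul] at this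
    exact this
  have h0i : ∀ i, ∀ f ∈ W, fieldRep γ 0 (Fin.succ (Fin.succ i)) f ∈ W ∧
      fieldRep γ 1 (Fin.succ (Fin.succ i)) f ∈ W := by
    intro i f hf
    have h1 := hp i f hf
    have h2 := hm i f hf
    rw [hspat, sum_isoCoeff_one] at h1
    rw [hspat, sum_isoCoeff_neg_one] at h2
    have h3 := W.smul_mem (-(Complex.I * (Real.sqrt 2 : ℂ)⁻¹)) (W.add_mem h1 h2)
    have h4 := W.smul_mem ((Complex.I * (Real.sqrt 2 : ℂ)⁻¹) * Complex.I) (W.sub_mem h1 h2)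
    simp only [LinearMap.smul_apply, LinearMap.add_apply, LinearMap.sub_apply] at h3 h4
    generalize Complex.I * (Real.sqrt 2 : ℂ)⁻¹ = q at *
    constructor
    · convert h3 using 1
      rw [← smul_add, smul_smul, neg_mul, hq]
      module
    · convert h4 using 1
      rw [← smul_sub, smul_smul, mul_right_comm, hq, add_sub_sub_cancel, ← add_smul, smul_smul]
      rw [show -1 / 2 * Complex.I * (Complex.I + Complex.I) = -(Complex.I * Complex.I) by ring,
        Complex.I_mul_I, neg_neg, one_smul]
  have hij : ∀ i j : Fin n, ∀ f ∈ W, fieldRep γ i.succ.succ j.succ.succ f ∈ W := by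
    intro i j f hf
    rw [fieldRep_eq_genOp]
    exact hs i j f hf
  have hneg : ∀ a b f, fieldRep γ b a f ∈ W → fieldRep γ a b f ∈ W := by
    intro a b f hf
    rw [(isRep_fieldRep hγ).antisymm a b]
    exact W.neg_mem hf
  have hself : ∀ a f, fieldRep γ a a f ∈ W := by
    intro a f
    rw [eq_zero_of_eq_neg ((isRep_fieldRep hγ).antisymm a a)]
    exact W.zero_mem
  intro a b f hf
  refine Fin.cases ?_ (fun a => ?_) a <;> refine Fin.cases ?_ (fun b => ?_) b
  · exact hself 0 f
  · refine Fin.cases (h01' f hf) (fun k => (h0i k f hf).1) b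
  · refine Fin.cases (hneg _ _ f (h01' f hf)) (fun k => hneg _ _ f (h0i k f hf).1) a
  · refine Fin.cases ?_ (fun k => ?_) a <;> refine Fin.cases ?_ (fun l => ?_) b
    · exact hself _ f
    · exact (h0i l f hf).2
    · exact hneg _ _ f (h0i k f hf).2
    · exact hij k l f hf

end GuptaBleuler

end

noncomputable section

namespace GuptaBleuler

variable {n : ℕ}

/-! ### Graded modules -/

/-- Applying `H - μ_a` removes one summand and multiplies the others by nonzero numbers, so
induction on the number of summands applies. -/
theorem sum_eigen_mem {V ι : Type*} [AddCommGroup V] [Module ℂ V] [DecidableEq ι]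
    {H : Module.End ℂ V} {W : Submodule ℂ V} (hW : ∀ f ∈ W, H f ∈ W) (μ : ι → ℂ) (S : Finset ι)
    (hμ : Set.InjOn μ S) (g : ι → V) (hg : ∀ d ∈ S, H (g d) = μ d • g d)
    (hs : ∑ d ∈ S, g d ∈ W) : ∀ d ∈ S, g d ∈ W := by
  induction S using Finset.induction_on generalizing g with
  | empty => simp
  | insert a S ha ih =>
    have h1 : ∑ d ∈ S, (μ d - μ a) • g d ∈ W := by
      have h2 := W.sub_mem (hW _ hs) (W.smul_mem (μ a) hs)
      have e : ∑ d ∈ S, (μ d - μ a) • g d =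
          H (∑ d ∈ insert a S, g d) - μ a • ∑ d ∈ insert a S, g d := by
        rw [Finset.sum_insert ha, map_add, map_sum, hg a (Finset.mem_insert_self _ _), smul_add,
          Finset.smul_sum, Finset.sum_congr rfl fun d hd => hg d (Finset.mem_insert_of_mem hd)]
        simp only [sub_smul, Finset.sum_sub_distrib]
        abel
      rw [e]; exact h2
    have h3 := ih (hμ.mono (by simp)) (fun d => (μ d - μ a) • g d)
      (fun d hd => by
        rw [map_smul, hg d (Finset.mem_insert_of_mem hd), smul_comm]) h1
    have h4 : ∀ d ∈ S, g d ∈ W := by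
      intro d hd
      have hne : μ d - μ a ≠ 0 := by
        rw [sub_ne_zero]
        intro h
        have := hμ (by simp [hd]) (by simp) h
        exact ha (this ▸ hd)
      exact (W.smul_mem_iff hne).1 (h3 d hd)
    intro d hd
    rcases Finset.mem_insert.1 hd with rfl | hd
    · rw [Finset.sum_insert ha] at hs
      exact (W.add_mem_iff_left (W.sum_mem h4)).1 hs
    · exact h4 d hd

/-- The eigenvalues of `H`. -/
def hval (n d : ℕ) : ℂ := -((n : ℂ) - 1) / 2 - d

theorem hval_injective (n : ℕ) : Function.Injective (hval n) := by
  intro a b h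
  unfold hval at h
  exact_mod_cast sub_right_injective h

theorem hval_succ (n d : ℕ) : hval n (d + 1) = hval n d - 1 := by
  unfold hval; push_cast; ring

section Grade

variable {γ : Gammas n}

/-- The graded module generated from `A₀` in degree `0` and `A₁` in degree `1` by the lowering
operators. -/
def grade (γ : Gammas n) (A₀ A₁ : Submodule ℂ (SpinorField n)) : ℕ → Submodule ℂ (SpinorField n)
  | 0 => A₀
  | d + 1 => (if d = 0 then A₁ else ⊥) ⊔
      ⨆ i : Fin n, (grade γ A₀ A₁ d).map (genOp γ (isoCoeff (-1)) (spat i))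

/-- The conditions for `grade γ A₀ A₁` to be a graded `so(2,n)`-module. -/
structure IsGradeData (γ : Gammas n) (A₀ A₁ : Submodule ℂ (SpinorField n)) : Prop where
  H0 : ∀ f ∈ A₀, genOp γ (isoCoeff (-1)) (isoCoeff 1) f = hval n 0 • f
  H1 : ∀ f ∈ A₁, genOp γ (isoCoeff (-1)) (isoCoeff 1) f = hval n 1 • f
  s0 : ∀ i j, ∀ f ∈ A₀, genOp γ (spat i) (spat j) f ∈ A₀
  s1 : ∀ i j, ∀ f ∈ A₁, genOp γ (spat i) (spat j) f ∈ A₁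
  p0 : ∀ i, ∀ f ∈ A₀, genOp γ (isoCoeff 1) (spat i) f = 0
  p1 : ∀ i, ∀ f ∈ A₁, genOp γ (isoCoeff 1) (spat i) f ∈ A₀

variable {A₀ A₁ : Submodule ℂ (SpinorField n)}

theorem lower_mem_grade (i : Fin n) {d : ℕ} {f : SpinorField n} (hf : f ∈ grade γ A₀ A₁ d) :
    genOp γ (isoCoeff (-1)) (spat i) f ∈ grade γ A₀ A₁ (d + 1) :=
  Submodule.mem_sup_right (Submodule.mem_iSup_of_mem i ⟨f, hf, rfl⟩)

theorem grade_succ_le {d : ℕ} {W : Submodule ℂ (SpinorField n)} (h1 : d = 0 → A₁ ≤ W)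
    (h2 : ∀ i, ∀ f ∈ grade γ A₀ A₁ d, genOp γ (isoCoeff (-1)) (spat i) f ∈ W) :
    grade γ A₀ A₁ (d + 1) ≤ W := by
  rw [grade]
  refine sup_le ?_ (iSup_le fun i => ?_)
  · split_ifs with h
    · exact h1 h
    · exact bot_le
  · rintro _ ⟨f, hf, rfl⟩
    exact h2 i f hf

theorem grade_zero : grade γ A₀ A₁ 0 = A₀ := rfl

theorem le_grade_one : A₁ ≤ grade γ A₀ A₁ 1 := by
  rw [grade, if_pos rfl]
  exact le_sup_left

theorem finiteDimensional_grade [FiniteDimensional ℂ A₀] [FiniteDimensional ℂ A₁] (d : ℕ) :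
    FiniteDimensional ℂ (grade γ A₀ A₁ d) := by
  induction d with
  | zero => assumption
  | succ d ih =>
    rw [grade]
    by_cases h : d = 0
    · rw [if_pos h]; infer_instance
    · rw [if_neg h]; infer_instance

attribute [irreducible] grade

theorem genOp_bracket_apply (hγ : IsClifford γ) (ξ ζ ξ' ζ' : Fin (n + 2) → ℂ)
    (f : SpinorField n) :
    genOp γ ξ ζ (genOp γ ξ' ζ' f) = genOp γ ξ' ζ' (genOp γ ξ ζ f) +
      (ip ξ ζ' • genOp γ ζ ξ' f + ip ζ ξ' • genOp γ ξ ζ' f - ip ξ ξ' • genOp γ ζ ζ' f -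
        ip ζ ζ' • genOp γ ξ ξ' f) := by
  have h := LinearMap.congr_fun (genOp_bracket hγ ξ ζ ξ' ζ') f
  simp only [LinearMap.sub_apply, LinearMap.add_apply, LinearMap.smul_apply,
    Module.End.mul_apply] at h
  rw [← h]
  abel

theorem H_lower (hγ : IsClifford γ) (i : Fin n) (f : SpinorField n) :
    genOp γ (isoCoeff (-1)) (isoCoeff 1) (genOp γ (isoCoeff (-1)) (spat i) f) =
      genOp γ (isoCoeff (-1)) (spat i) (genOp γ (isoCoeff (-1)) (isoCoeff 1) f) -
        genOp γ (isoCoeff (-1)) (spat i) f := by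
  rw [genOp_bracket_apply hγ, ip_neg_spat, ip_one_neg, ip_neg_neg, ip_one_spat]
  module

theorem spat_lower (hγ : IsClifford γ) (i j k : Fin n) (f : SpinorField n) :
    genOp γ (spat i) (spat j) (genOp γ (isoCoeff (-1)) (spat k) f) =
      genOp γ (isoCoeff (-1)) (spat k) (genOp γ (spat i) (spat j) f) -
        ip (spat i) (spat k) • genOp γ (isoCoeff (-1)) (spat j) f +
        ip (spat j) (spat k) • genOp γ (isoCoeff (-1)) (spat i) f := by
  rw [genOp_bracket_apply hγ, ip_spat_neg, ip_spat_neg, genOp_antisymm hγ (spat j) (isoCoeff (-1)),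
    genOp_antisymm hγ (spat i) (isoCoeff (-1)), LinearMap.neg_apply, LinearMap.neg_apply]
  module

theorem raise_lower (hγ : IsClifford γ) (i k : Fin n) (f : SpinorField n) :
    genOp γ (isoCoeff 1) (spat i) (genOp γ (isoCoeff (-1)) (spat k) f) =
      genOp γ (isoCoeff (-1)) (spat k) (genOp γ (isoCoeff 1) (spat i) f) +
        genOp γ (spat i) (spat k) f +
        ip (spat i) (spat k) • genOp γ (isoCoeff (-1)) (isoCoeff 1) f := by
  rw [genOp_bracket_apply hγ, ip_spat_neg, ip_one_spat, ip_one_neg,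
    genOp_antisymm hγ (isoCoeff 1) (isoCoeff (-1)), LinearMap.neg_apply]
  module

theorem spat_mem_grade (hγ : IsClifford γ) (h : IsGradeData γ A₀ A₁) (i j : Fin n) {d : ℕ}
    {f : SpinorField n} (hf : f ∈ grade γ A₀ A₁ d) :
    genOp γ (spat i) (spat j) f ∈ grade γ A₀ A₁ d := by
  induction d generalizing f with
  | zero => rw [grade_zero] at hf ⊢; exact h.s0 i j f hf
  | succ d ih =>
    refine grade_succ_le (W := (grade γ A₀ A₁ (d + 1)).comap (genOp γ (spat i) (spat j))) ?_ ?_ hf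
    · rintro rfl f hf
      exact le_grade_one (h.s1 i j f hf)
    · intro k f hf
      rw [Submodule.mem_comap, spat_lower hγ]
      exact add_mem (sub_mem (lower_mem_grade k (ih hf))
        (Submodule.smul_mem _ _ (lower_mem_grade j hf)))
        (Submodule.smul_mem _ _ (lower_mem_grade i hf))

theorem H_grade (hγ : IsClifford γ) (h : IsGradeData γ A₀ A₁) {d : ℕ}
    {f : SpinorField n} (hf : f ∈ grade γ A₀ A₁ d) :
    genOp γ (isoCoeff (-1)) (isoCoeff 1) f = hval n d • f := by
  induction d generalizing f with
  | zero => exact h.H0 f (by rwa [grade_zero] at hf)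
  | succ d ih =>
    rw [← sub_eq_zero]
    refine grade_succ_le (W := LinearMap.ker (genOp γ (isoCoeff (-1)) (isoCoeff 1) -
      hval n (d + 1) • LinearMap.id)) ?_ ?_ hf
    · rintro rfl f hf
      exact sub_eq_zero.2 (h.H1 f hf)
    · intro k f hf
      refine sub_eq_zero.2 ?_
      rw [H_lower hγ, ih hf, map_smul, hval_succ, LinearMap.smul_apply, LinearMap.id_apply]
      module

/-- Commuting a raising operator past the outermost lowering operator leaves a rotation and a
multiple of `H`, both of which preserve the degree. -/
theorem raise_mem_grade (hγ : IsClifford γ) (h : IsGradeData γ A₀ A₁) (i : Fin n) {d : ℕ}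
    {f : SpinorField n} (hf : f ∈ grade γ A₀ A₁ (d + 1)) :
    genOp γ (isoCoeff 1) (spat i) f ∈ grade γ A₀ A₁ d := by
  induction d generalizing f with
  | zero =>
    refine grade_succ_le (W := (grade γ A₀ A₁ 0).comap (genOp γ (isoCoeff 1) (spat i))) ?_ ?_ hf
    · intro _ f hf
      rw [Submodule.mem_comap, grade_zero]
      exact h.p1 i f hf
    · intro k f hf
      rw [Submodule.mem_comap, raise_lower hγ, h.p0 i f (by rwa [grade_zero] at hf), map_zero, zero_add, H_grade hγ h hf]
      exact add_mem (spat_mem_grade hγ h _ _ hf)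
        (Submodule.smul_mem _ _ (Submodule.smul_mem _ _ hf))
  | succ d ih =>
    refine grade_succ_le (W := (grade γ A₀ A₁ (d + 1)).comap (genOp γ (isoCoeff 1) (spat i))) ?_ ?_
      hf
    · intro h0; omega
    · intro k f hf
      rw [Submodule.mem_comap, raise_lower hγ, H_grade hγ h hf]
      exact add_mem (add_mem (lower_mem_grade k (ih hf)) (spat_mem_grade hγ h _ _ hf))
        (Submodule.smul_mem _ _ (Submodule.smul_mem _ _ hf))

theorem invariant_iSup_grade (hγ : IsClifford γ) (h : IsGradeData γ A₀ A₁) :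
    Invariant (fieldRep γ) (⨆ d, grade γ A₀ A₁ d) := by
  have key : ∀ O : Module.End ℂ (SpinorField n),
      (∀ d, ∀ f ∈ grade γ A₀ A₁ d, O f ∈ ⨆ d, grade γ A₀ A₁ d) →
      ∀ f ∈ ⨆ d, grade γ A₀ A₁ d, O f ∈ ⨆ d, grade γ A₀ A₁ d := by
    intro O hO f hf
    have : (⨆ d, grade γ A₀ A₁ d) ≤ (⨆ d, grade γ A₀ A₁ d).comap O := iSup_le fun d f hf => hO d f hf
    exact this hf
  refine invariant_of_null hγ (key _ fun d f hf => ?_) (fun i => key _ fun d f hf => ?_)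
    (fun i => key _ fun d f hf => ?_) (fun i j => key _ fun d f hf => ?_)
  · rw [H_grade hγ h hf]
    exact Submodule.mem_iSup_of_mem d (Submodule.smul_mem _ _ hf)
  · cases d with
    | zero => rw [h.p0 i f (by rwa [grade_zero] at hf)]; exact Submodule.zero_mem _
    | succ d => exact Submodule.mem_iSup_of_mem d (raise_mem_grade hγ h i hf)
  · exact Submodule.mem_iSup_of_mem (d + 1) (lower_mem_grade i hf)
  · exact Submodule.mem_iSup_of_mem d (spat_mem_grade hγ h i j hf)

theorem exists_grade_decomposition {f : SpinorField n} (hf : f ∈ ⨆ d, grade γ A₀ A₁ d) :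
    ∃ g : ℕ →₀ SpinorField n, (∀ d, g d ∈ grade γ A₀ A₁ d) ∧ ∑ d ∈ g.support, g d = f := by
  obtain ⟨g, hg, h⟩ := (Submodule.mem_iSup_iff_exists_finsupp _ _).1 hf
  exact ⟨g, hg, h⟩

theorem mem_grade_of_eigen (hγ : IsClifford γ) (h : IsGradeData γ A₀ A₁) {d : ℕ}
    {f : SpinorField n} (hf : f ∈ ⨆ d, grade γ A₀ A₁ d)
    (hH : genOp γ (isoCoeff (-1)) (isoCoeff 1) f = hval n d • f) : f ∈ grade γ A₀ A₁ d := by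
  obtain ⟨g, hg, hsum⟩ := exists_grade_decomposition hf
  have hz : ∀ d' ∈ g.support, (hval n d' - hval n d) • g d' ∈ (⊥ : Submodule ℂ (SpinorField n)) := by
    refine sum_eigen_mem (H := genOp γ (isoCoeff (-1)) (isoCoeff 1)) (W := ⊥)
      (fun f hf => by rw [(Submodule.mem_bot ℂ).1 hf, map_zero]; exact Submodule.zero_mem _)
      (hval n) g.support (hval_injective n).injOn _ (fun d' _ => ?_) ?_
    · rw [map_smul, H_grade hγ h (hg d'), smul_comm]
    · rw [Submodule.mem_bot]
      have e : ∑ d' ∈ g.support, (hval n d' - hval n d) • g d' =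
          genOp γ (isoCoeff (-1)) (isoCoeff 1) (∑ d' ∈ g.support, g d') -
            hval n d • ∑ d' ∈ g.support, g d' := by
        rw [map_sum, Finset.smul_sum, ← Finset.sum_sub_distrib]
        exact Finset.sum_congr rfl fun d' _ => by rw [H_grade hγ h (hg d'), sub_smul]
      rw [e, hsum, hH, sub_self]
  have hz' : ∀ d' ∈ g.support, d' ≠ d → g d' = 0 := by
    intro d' hd' hne
    have := (Submodule.mem_bot ℂ).1 (hz d' hd')
    exact (smul_eq_zero.1 this).resolve_left (sub_ne_zero.2 fun h => hne (hval_injective n h))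
  rw [← hsum]
  refine Submodule.sum_mem _ fun d' hd' => ?_
  by_cases hdd : d' = d
  · rw [← hdd]; exact hg d'
  · rw [hz' d' hd' hdd]; exact Submodule.zero_mem _

/-- The homogeneous components of an element of an `H`-stable subspace belong to it. -/
theorem component_mem (hγ : IsClifford γ) (h : IsGradeData γ A₀ A₁)
    {W : Submodule ℂ (SpinorField n)} (hW : Invariant (fieldRep γ) W) {g : ℕ →₀ SpinorField n}
    (hg : ∀ d, g d ∈ grade γ A₀ A₁ d) (hs : ∑ d ∈ g.support, g d ∈ W) (d : ℕ) : g d ∈ W := by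
  by_cases hd : d ∈ g.support
  · exact sum_eigen_mem (H := genOp γ (isoCoeff (-1)) (isoCoeff 1)) (fun f hf => genOp_mem hW _ _ hf)
      (hval n) g.support (hval_injective n).injOn g (fun d' _ => H_grade hγ h (hg d')) hs d hd
  · rw [Finsupp.notMem_support_iff.1 hd]; exact W.zero_mem

/-- A lowering operator multiplies by at most one spatial coordinate, so each degree consists of
polynomials of bounded spatial degree. This is what makes `eq_zero_of_T` applicable. -/
theorem exists_grade_le_polyLt (hγ : IsClifford γ) {k₀ k₁ : ℕ}
    (h0 : A₀ ≤ (fieldWC hγ).polyLt k₀) (h1 : A₁ ≤ (fieldWC hγ).polyLt k₁) (d : ℕ) :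
    ∃ k, grade γ A₀ A₁ d ≤ (fieldWC hγ).polyLt k := by
  have hmono : Monotone (fieldWC hγ).polyLt := monotone_nat_of_le_succ (fieldWC hγ).polyLt_le_succ
  induction d with
  | zero => exact ⟨k₀, by rwa [grade_zero]⟩
  | succ d ih =>
    obtain ⟨k, hk⟩ := ih
    refine ⟨max k₁ (k + 1), grade_succ_le (fun _ => h1.trans (hmono (le_max_left _ _))) ?_⟩
    intro i f hf
    refine hmono (le_max_right _ _) ?_
    rw [← fieldWC_Pm hγ]
    have hf' := hk hf
    have hs := (fieldWC hγ).polyLt_le_succ k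
    simp only [WeylClifford.Pm, LinearMap.add_apply, LinearMap.sub_apply, LinearMap.smul_apply,
      Module.End.mul_apply]
    refine add_mem (sub_mem (hs ?_) ?_) (Submodule.smul_mem _ _ (hs ?_))
    · exact (fieldWC hγ).mem_polyLt_of_commute (fun j => (fieldWC hγ).d_w j)
        ((fieldWC hγ).d_mem_polyLt i hf')
    · exact (fieldWC hγ).y_mem_polyLt i
        ((fieldWC hγ).mem_polyLt_of_commute (fun j => (fieldWC hγ).d_du j) hf')
    · exact (fieldWC hγ).mem_polyLt_of_commute (fun j => ((fieldWC hγ).m_d j).symm)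
        ((fieldWC hγ).mem_polyLt_of_commute (fun j => ((fieldWC hγ).g_d i j).symm) hf')

end Grade

end GuptaBleuler

end

noncomputable section

namespace GuptaBleuler

variable {n : ℕ}

/-! ### The action on the fields `x_1^s u` -/

section PowerFields

variable {γ : Gammas n}

theorem powField_add (s : ℂ) (u t : Spinor n) :
    powField s (u + t) = powField s u + powField s t := map_add (powLin s) u t

theorem powField_neg (s : ℂ) (u : Spinor n) : powField s (-u) = -powField s u :=
  map_neg (powLin s) u

theorem powField_sub (s : ℂ) (u t : Spinor n) :
    powField s (u - t) = powField s u - powField s t := map_sub (powLin s) u t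

theorem dirD_powField_of_spatial {ξ : Fin (n + 2) → ℂ} (h0 : ξ 0 = 0) (h1 : ξ 1 = 0) (s : ℂ)
    (u : Spinor n) : dirD ξ (powField s u) = 0 := by
  have h1' : ξ (Fin.succ 0) = 0 := h1
  unfold dirD
  rw [Fin.sum_univ_succ, Fin.sum_univ_succ, h0, h1', zero_smul, zero_smul, zero_add, zero_add]
  simp only [LinearMap.sum_apply, LinearMap.smul_apply]
  refine Finset.sum_eq_zero fun i _ => ?_
  have := dirD_spat_powField i s u
  rw [spat, dirD_single] at this
  rw [this, smul_zero]

theorem dirD_isoCoeff_powField (hn : 1 ≤ n) {j : ℤ} (hj : j ≠ -1) (s : ℂ) (u : Spinor n) :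
    dirD (isoCoeff j) (powField s u) = 0 := by
  by_cases h1 : j = 1
  · rw [h1, dirD_one_powField]
  · have := isoCoeff_spatial hn (j := j) (by omega)
    exact dirD_powField_of_spatial this.1 this.2 s u

theorem genOp_powField {ξ ζ : Fin (n + 2) → ℂ} {s : ℂ} {u : Spinor n}
    (hξ : dirD ξ (powField s u) = 0) (hζ : dirD ζ (powField s u) = 0) :
    genOp γ ξ ζ (powField s u) =
      powField s ((1 / 2 : ℂ) • ((gam γ ξ * gam γ ζ).mulVec u - ip ξ ζ • u)) := by
  unfold genOp
  simp only [LinearMap.add_apply, LinearMap.sub_apply, LinearMap.smul_apply, Module.End.mul_apply,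
    hξ, hζ, map_zero, sub_zero, zero_add, mulMat_powField, Module.End.one_apply, powField_smul,
    powField_sub, Matrix.mulVec_mulVec]

theorem gam_spat (i : Fin n) : gam γ (spat i) = γ i.succ.succ := gam_single γ _

theorem H_powField (s : ℂ) (u : Spinor n) :
    genOp γ (isoCoeff (-1)) (isoCoeff 1) (powField s u) = s • powField s u +
      (1 / 2 : ℂ) • powField s ((omega γ (-1)).mulVec ((omega γ 1).mulVec u) + u) := by
  unfold genOp
  simp only [LinearMap.add_apply, LinearMap.sub_apply, LinearMap.smul_apply, Module.End.mul_apply,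
    dirD_one_powField, dirD_neg_one_powField, map_zero, mulMat_powField, Module.End.one_apply,
    map_neg, map_smul, lowY_one_powField, sub_add_cancel, ip_neg_one, powField_add,
    ← omega_eq_gam]
  module

theorem raise_powField (i : Fin n) (s : ℂ) (u : Spinor n) :
    genOp γ (isoCoeff 1) (spat i) (powField s u) =
      (1 / 2 : ℂ) • powField s ((omega γ 1).mulVec ((γ i.succ.succ).mulVec u)) := by
  rw [genOp_powField (dirD_one_powField s u) (dirD_spat_powField i s u), ip_one_spat, zero_smul,
    sub_zero, powField_smul, gam_spat, Matrix.mulVec_mulVec, omega_eq_gam]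

theorem lower_powField (i : Fin n) (s : ℂ) (u : Spinor n) :
    genOp γ (isoCoeff (-1)) (spat i) (powField s u) =
      s • lowY (spat i) (powField (s - 1) u) +
      (1 / 2 : ℂ) • powField s ((omega γ (-1)).mulVec ((γ i.succ.succ).mulVec u)) := by
  unfold genOp
  simp only [LinearMap.add_apply, LinearMap.sub_apply, LinearMap.smul_apply, Module.End.mul_apply,
    dirD_neg_one_powField, dirD_spat_powField, map_zero, mulMat_powField, Module.End.one_apply,
    map_neg, map_smul, ip_neg_spat, ← omega_eq_gam, gam_spat]
  module

theorem spat_powField (i j : Fin n) (s : ℂ) (u : Spinor n) :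
    genOp γ (spat i) (spat j) (powField s u) =
      powField s ((1 / 2 : ℂ) • ((γ i.succ.succ * γ j.succ.succ).mulVec u -
        ip (spat i) (spat j) • u)) := by
  rw [genOp_powField (dirD_spat_powField i s u) (dirD_spat_powField j s u), gam_spat, gam_spat]

theorem degOp_powField (hγ : IsClifford γ) (s : ℂ) (u : Spinor n) : degOp n (powField s u) = s • powField s u := by
  rw [← fieldWC_deg hγ]
  unfold WeylClifford.deg WeylClifford.e
  change (lowY (isoCoeff 1) * -dirD (isoCoeff (-1)) + lowY (isoCoeff (-1)) * -dirD (isoCoeff 1) +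
    ∑ i, -lowY (spat i) * dirD (spat i) : Module.End ℂ (SpinorField n)) (powField s u) = _
  simp only [LinearMap.add_apply, LinearMap.sum_apply, LinearMap.neg_apply, Module.End.mul_apply,
    dirD_neg_one_powField, dirD_one_powField, dirD_spat_powField, map_zero, map_smul,
    lowY_one_powField, sub_add_cancel, neg_zero, neg_neg, Finset.sum_const_zero, add_zero]

theorem dSlash_powField (hγ : IsClifford γ) (s : ℂ) (u : Spinor n) :
    dSlash γ (powField s u) = s • powField (s - 1) ((omega γ 1).mulVec u) := by
  rw [← fieldWC_ds hγ]
  unfold WeylClifford.ds WeylClifford.D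
  change (mulMat (gam γ (isoCoeff 1)) * -dirD (isoCoeff (-1)) +
    mulMat (gam γ (isoCoeff (-1))) * -dirD (isoCoeff 1) -
    ∑ i, mulMat (gam γ (spat i)) * dirD (spat i) : Module.End ℂ (SpinorField n)) (powField s u) = _
  simp only [LinearMap.add_apply, LinearMap.sub_apply, LinearMap.sum_apply, LinearMap.neg_apply,
    Module.End.mul_apply, dirD_neg_one_powField, dirD_one_powField, dirD_spat_powField, map_zero,
    map_smul, neg_zero, neg_neg, Finset.sum_const_zero, add_zero, sub_zero,
    mulMat_powField, omega_eq_gam]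

theorem ySlash_powField (hγ : IsClifford γ) (s : ℂ) (u : Spinor n) :
    ySlash γ (powField s u) = (fieldWC hγ).Y (powField s u) -
      powField (s + 1) ((omega γ (-1)).mulVec u) -
      lowY (isoCoeff (-1)) (powField s ((omega γ 1).mulVec u)) := by
  rw [← fieldWC_ys hγ]
  unfold WeylClifford.ys
  change ((fieldWC hγ).Y - lowY (isoCoeff 1) * mulMat (gam γ (isoCoeff (-1))) -
    lowY (isoCoeff (-1)) * mulMat (gam γ (isoCoeff 1)) : Module.End ℂ (SpinorField n)) (powField s u) = _
  simp only [LinearMap.sub_apply, Module.End.mul_apply, mulMat_powField, lowY_one_powField,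
    omega_eq_gam]

theorem d_powField (hγ : IsClifford γ) (i : Fin n) (s : ℂ) (u : Spinor n) :
    (fieldWC hγ).d i (powField s u) = 0 := dirD_spat_powField i s u

theorem g_powField (hγ : IsClifford γ) (i : Fin n) (s : ℂ) (u : Spinor n) :
    (fieldWC hγ).g i (powField s u) = powField s ((γ i.succ.succ).mulVec u) := by
  rw [fieldWC_g, mulMat_powField]

theorem powField_mem_polyLt (hγ : IsClifford γ) (s : ℂ) (u : Spinor n) : powField s u ∈ (fieldWC hγ).polyLt 1 := by
  rw [WeylClifford.mem_polyLt_succ]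
  intro i
  rw [d_powField]
  exact Submodule.zero_mem _

theorem T_powField (hγ : IsClifford γ) (s : ℂ) (u : Spinor n) : (fieldWC hγ).T (powField s u) = 0 := by
  unfold WeylClifford.T WeylClifford.e WeylClifford.D
  simp only [LinearMap.add_apply, LinearMap.sum_apply, Module.End.mul_apply, d_powField, map_zero,
    LinearMap.smul_apply, Module.End.one_apply, map_smul, Finset.sum_const_zero, add_zero, zero_add,
    smul_zero]

/-- `T` on a field that is linear in the spatial coordinates. -/
theorem T_lowY_powField (hγ : IsClifford γ) (i : Fin n) (s : ℂ) (u : Spinor n) :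
    (fieldWC hγ).T (lowY (spat i) (powField s u)) = (n : ℂ) • lowY (spat i) (powField s u) -
      (fieldWC hγ).Y (powField s ((γ i.succ.succ).mulVec u)) := by
  have hy : lowY (spat i) (powField s u) = -((fieldWC hγ).y i (powField s u)) := by
    change _ = -(-(lowY (spat i)) (powField s u))
    rw [neg_neg]
  have hd : ∀ j, (fieldWC hγ).d j ((fieldWC hγ).y i (powField s u)) =
      if j = i then powField s u else 0 := by
    intro j
    have h := LinearMap.congr_fun ((fieldWC hγ).dy j i) (powField s u)
    rw [Module.End.mul_apply] at h
    rw [h, LinearMap.add_apply, Module.End.mul_apply, d_powField, map_zero, zero_add]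
    split_ifs <;> rfl
  have he : (fieldWC hγ).e ((fieldWC hγ).y i (powField s u)) = (fieldWC hγ).y i (powField s u) := by
    unfold WeylClifford.e
    simp only [LinearMap.sum_apply, Module.End.mul_apply, hd]
    rw [Finset.sum_eq_single i (fun j _ hj => by rw [if_neg hj, map_zero]) (by simp), if_pos rfl]
  have hD : (fieldWC hγ).D ((fieldWC hγ).y i (powField s u)) =
      powField s ((γ i.succ.succ).mulVec u) := by
    unfold WeylClifford.D
    simp only [LinearMap.sum_apply, Module.End.mul_apply, hd]
    rw [Finset.sum_eq_single i (fun j _ hj => by rw [if_neg hj, map_zero]) (by simp), if_pos rfl,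
      g_powField]
  have hD2 : (fieldWC hγ).D (powField s ((γ i.succ.succ).mulVec u)) = 0 := by
    unfold WeylClifford.D
    simp only [LinearMap.sum_apply, Module.End.mul_apply, d_powField, map_zero,
      Finset.sum_const_zero]
  rw [hy, map_neg]
  unfold WeylClifford.T
  simp only [LinearMap.add_apply, Module.End.mul_apply, LinearMap.smul_apply, Module.End.one_apply,
    map_add, map_smul, he, hD, hD2, map_zero, add_zero]
  module

/-- `T` sees only the part that is linear in the spatial coordinates, and the term missing from `n`
times the lowered field combines with `Y` into a `ySlash` field. This is how fields of the type of
`Psi3` appear inside the module of `Psi2`. -/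
theorem T_lower_powField (hγ : IsClifford γ) (i : Fin n) {u : Spinor n} (hu : (omega γ 1).mulVec u = 0) :
    (fieldWC hγ).T (genOp γ (isoCoeff (-1)) (spat i) (powField (-(n : ℂ) / 2) u)) =
      (n : ℂ) • genOp γ (isoCoeff (-1)) (spat i) (powField (-(n : ℂ) / 2) u) +
      ((n : ℂ) / 2) • ySlash γ (powField (-((n : ℂ) + 2) / 2) ((γ i.succ.succ).mulVec u)) := by
  have hu' : (omega γ 1).mulVec ((γ i.succ.succ).mulVec u) = 0 := by
    rw [Matrix.mulVec_mulVec, omega_one_spatial hγ, Matrix.neg_mulVec, ← Matrix.mulVec_mulVec, hu,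
      Matrix.mulVec_zero, neg_zero]
  have e1 : -(n : ℂ) / 2 - 1 = -((n : ℂ) + 2) / 2 := by ring
  have e2 : -((n : ℂ) + 2) / 2 + 1 = -(n : ℂ) / 2 := by ring
  rw [lower_powField, map_add, map_smul, map_smul, T_powField, T_lowY_powField hγ, e1,
    ySlash_powField hγ, hu', powField_zero, map_zero, e2]
  module

end PowerFields

/-! ### Subspaces of spinors -/

/-- The spinors of chirality `c` annihilated by `ω_j`. -/
def spinorKer (γ : Gammas n) (j : ℤ) (c : ℂ) : Submodule ℂ (Spinor n) where
  carrier := {t | (omega γ j).mulVec t = 0 ∧ Chir γ c t}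
  zero_mem' := ⟨Matrix.mulVec_zero _, fun _ => by rw [Matrix.mulVec_zero, smul_zero]⟩
  add_mem' := fun hs ht => ⟨by rw [Matrix.mulVec_add, hs.1, ht.1, add_zero],
    fun h => by rw [Matrix.mulVec_add, hs.2 h, ht.2 h, smul_add]⟩
  smul_mem' := fun a s hs => ⟨by rw [Matrix.mulVec_smul, hs.1, smul_zero],
    fun h => by rw [Matrix.mulVec_smul, hs.2 h, smul_comm]⟩

section
variable {γ : Gammas n}

theorem gamma_mem_spinorKer (hγ : IsClifford γ) {j : ℤ} (hj : j = 1 ∨ j = -1) {c : ℂ} (i : Fin n) {s : Spinor n}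
    (hs : s ∈ spinorKer γ j c) : (γ i.succ.succ).mulVec s ∈ spinorKer γ j (-c) := by
  refine ⟨?_, hs.2.gamma_mulVec hγ _⟩
  have e : omega γ j * γ i.succ.succ = -(γ i.succ.succ * omega γ j) := by
    rcases hj with rfl | rfl
    · exact omega_one_spatial hγ i
    · exact omega_neg_one_spatial hγ i
  rw [Matrix.mulVec_mulVec, e, Matrix.neg_mulVec, ← Matrix.mulVec_mulVec, hs.1,
    Matrix.mulVec_zero, neg_zero]

theorem spatialStable_spinorKer (hγ : IsClifford γ) {j : ℤ} (hj : j = 1 ∨ j = -1) (c : ℂ) :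
    SpatialStable γ (spinorKer γ j c) := by
  intro i k s hs
  rw [← Matrix.mulVec_mulVec]
  have := gamma_mem_spinorKer hγ hj i (gamma_mem_spinorKer hγ hj k hs)
  rwa [_root_.neg_neg] at this

theorem omega_mem_spinorKer (hγ : IsClifford γ) {j : ℤ} (hj : j = 1 ∨ j = -1) {c : ℂ} {s : Spinor n}
    (hs : Chir γ c s) : (omega γ j).mulVec s ∈ spinorKer γ j (-c) := by
  refine ⟨?_, hs.omega_mulVec hγ _⟩
  have hv : Valid n j := by rcases hj with rfl | rfl; exacts [valid_one n, (valid_one n).neg]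
  rw [Matrix.mulVec_mulVec, omega_sq hγ hv (by omega), Matrix.zero_mulVec]

end

end GuptaBleuler

end

noncomputable section

namespace GuptaBleuler

variable {n : ℕ}

/-! ### The cyclic modules -/

/-- `v` is the vacuum of the Clifford module, and `c` its chirality. -/
structure IsVac (γ : Gammas n) (v : Spinor n) (c : ℂ) : Prop where
  clifford : IsClifford γ
  three_le : 3 ≤ n
  ne_zero : v ≠ 0
  vacuum : IsVacuum γ v
  chir_ne : c ≠ 0
  chir : Chir γ c v

/-- The field `y̸ x_1^{-(n+2)/2} u`. -/
def slashLin (γ : Gammas n) : Spinor n →ₗ[ℂ] SpinorField n :=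
  ySlash γ ∘ₗ powLin (-((n : ℂ) + 2) / 2)

theorem slashLin_apply (γ : Gammas n) (u : Spinor n) :
    slashLin γ u = ySlash γ (powField (-((n : ℂ) + 2) / 2) u) := rfl

/-- The index `(ν - 1) r`. -/
def starIdx (n : ℕ) : ℤ := ((parity n : ℤ) - 1) * rk n

theorem starIdx_even (h : n % 2 = 0) : starIdx n = -(rk n : ℤ) := by
  unfold starIdx parity; rw [h]; simp

theorem starIdx_odd (h : n % 2 = 1) : starIdx n = 0 := by
  unfold starIdx parity; rw [h]; simp

theorem valid_starIdx (n : ℕ) : Valid n (starIdx n) := by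
  rcases Nat.mod_two_eq_zero_or_one n with h | h
  · rw [starIdx_even h]
    exact (valid_of_pos (by unfold rk; omega) le_rfl).neg
  · rw [starIdx_odd h]
    exact ⟨by simp, fun _ => h⟩

section
variable {γ : Gammas n} {v : Spinor n} {c : ℂ}

theorem IsVac.rk_ge (hV : IsVac γ v c) : 2 ≤ rk n := by
  have := hV.three_le; unfold rk; omega

theorem IsVac.omega_zero (hV : IsVac γ v c) {j : ℤ} (h1 : 1 ≤ j) (h2 : j ≤ rk n) :
    (omega γ j).mulVec v = 0 := by
  lift j to ℕ using by omega
  exact hV.vacuum j (by omega) (by omega)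

theorem genOp_spat_slash (hγ : IsClifford γ) (ξ ζ : Fin (n + 2) → ℂ) (f : SpinorField n) :
    genOp γ ξ ζ (ySlash γ f) = ySlash γ (genOp γ ξ ζ f) :=
  LinearMap.congr_fun (genOp_ySlash hγ ξ ζ) f

theorem omega_mulVec_comm (hγ : IsClifford γ) {j k : ℤ} (hj : Valid n j) (hk : Valid n k)
    (hjk : j ≠ -k) (s : Spinor n) :
    (omega γ j).mulVec ((omega γ k).mulVec s) = -(omega γ k).mulVec ((omega γ j).mulVec s) := by
  rw [Matrix.mulVec_mulVec, omega_anticomm hγ hj hk hjk, Matrix.neg_mulVec, Matrix.mulVec_mulVec]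

theorem omega_mulVec_neg (hγ : IsClifford γ) {j : ℤ} (hj : Valid n j) (s : Spinor n) :
    (omega γ j).mulVec ((omega γ (-j)).mulVec s) =
      -(omega γ (-j)).mulVec ((omega γ j).mulVec s) - (2 : ℂ) • s := by
  rw [Matrix.mulVec_mulVec, omega_neg_mul hγ hj, Matrix.sub_mulVec, Matrix.neg_mulVec,
    Matrix.mulVec_mulVec, Matrix.smul_mulVec, Matrix.one_mulVec]

theorem IsVac.vac_mem (hV : IsVac γ v c) : v ∈ spinorKer γ 1 c :=
  ⟨hV.omega_zero le_rfl (by have := hV.rk_ge; omega), hV.chir⟩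

/-- For even `n`, `omegaStar` is the creation operator `ω_{-r}` and flips the chirality; for odd `n`
it is `ω_0`, a scalar on the vacuum. In both cases its index is not opposite to `1`, so it
anticommutes with `ω_1`. -/
theorem IsVac.star_mem (hV : IsVac γ v c) : (omegaStar γ).mulVec v ∈ spinorKer γ 1 (-c) := by
  refine ⟨?_, hV.chir.omega_mulVec hV.clifford _⟩
  have hr := hV.rk_ge
  have h1 : (1 : ℤ) ≠ -starIdx n := by
    rcases Nat.mod_two_eq_zero_or_one n with h | h
    · rw [starIdx_even h]; omega
    · rw [starIdx_odd h]; omega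
  change (omega γ 1).mulVec ((omega γ (starIdx n)).mulVec v) = 0
  rw [omega_mulVec_comm hV.clifford (valid_one n) (valid_starIdx n) h1, hV.vac_mem.1,
    Matrix.mulVec_zero, neg_zero]

theorem IsVac.star_ne (hV : IsVac γ v c) : (omegaStar γ).mulVec v ≠ 0 := by
  have hr := hV.rk_ge
  intro h0
  change (omega γ (starIdx n)).mulVec v = 0 at h0
  rcases Nat.mod_two_eq_zero_or_one n with h | h
  · rw [starIdx_even h] at h0
    have h2 := omega_mulVec_neg hV.clifford (valid_of_pos (j := rk n) (by omega) le_rfl) v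
    rw [h0, hV.omega_zero (by omega) le_rfl, Matrix.mulVec_zero, Matrix.mulVec_zero, neg_zero,
      zero_sub, eq_comm, neg_eq_zero] at h2
    exact hV.ne_zero ((smul_eq_zero.1 h2).resolve_left two_ne_zero)
  · rw [starIdx_odd h] at h0
    obtain ⟨μ, hμ, hm⟩ := exists_omega_zero_eigen hV.clifford h hV.ne_zero hV.vacuum
    rw [hm] at h0
    exact hV.ne_zero ((smul_eq_zero.1 h0).resolve_left hμ)

/-- The linear maps from spinors to fields that intertwine the rotations. -/
def RotEquivariant (γ : Gammas n) (L : Spinor n →ₗ[ℂ] SpinorField n) : Prop :=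
  ∀ (i j : Fin n) (u : Spinor n), genOp γ (spat i) (spat j) (L u) =
    L ((1 / 2 : ℂ) • ((γ i.succ.succ * γ j.succ.succ).mulVec u - ip (spat i) (spat j) • u))

theorem rotEquivariant_powLin (s : ℂ) : RotEquivariant γ (powLin s) :=
  fun i j u => spat_powField i j s u

theorem rotEquivariant_slashLin (hγ : IsClifford γ) : RotEquivariant γ (slashLin γ) := by
  intro i j u
  rw [slashLin_apply, genOp_spat_slash hγ, spat_powField]
  rfl

theorem RotEquivariant.map_mem {L : Spinor n →ₗ[ℂ] SpinorField n} (hL : RotEquivariant γ L)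
    {A : Submodule ℂ (Spinor n)} (hA : SpatialStable γ A) (i j : Fin n) {f : SpinorField n}
    (hf : f ∈ A.map L) : genOp γ (spat i) (spat j) f ∈ A.map L := by
  obtain ⟨u, hu, rfl⟩ := hf
  rw [hL]
  exact ⟨_, A.smul_mem _ (A.sub_mem (hA i j u hu) (A.smul_mem _ hu)), rfl⟩

theorem RotEquivariant.spatialStable_comap {L : Spinor n →ₗ[ℂ] SpinorField n}
    (hL : RotEquivariant γ L) {W : Submodule ℂ (SpinorField n)} (hW : Invariant (fieldRep γ) W) :
    SpatialStable γ (W.comap L) := by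
  intro i j s hs
  have h1 := genOp_mem hW (spat i) (spat j) hs
  rw [hL, map_smul, map_sub, map_smul] at h1
  have h2 := (W.smul_mem_iff (by norm_num : (1 / 2 : ℂ) ≠ 0)).1 h1
  exact (W.sub_mem_iff_left (W.smul_mem _ hs)).1 h2

/-- The preimage of an invariant space under a rotation-equivariant map is stable under spatial
gamma products. By irreducibility of the spinor module a single nonzero vector in it gives all of
them. -/
theorem IsVac.mem_of_mem (hV : IsVac γ v c) {L : Spinor n →ₗ[ℂ] SpinorField n}
    (hL : RotEquivariant γ L) {W : Submodule ℂ (SpinorField n)} (hW : Invariant (fieldRep γ) W)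
    {c' : ℂ} (hc' : c' = c ∨ c' = -c) {s t : Spinor n} (hs : s ∈ spinorKer γ 1 c') (hs0 : s ≠ 0)
    (hsW : L s ∈ W) (ht : t ∈ spinorKer γ 1 c') : L t ∈ W := by
  have h1 : 1 ≤ n := by have := hV.three_le; omega
  rcases hc' with rfl | rfl
  · exact spatialStable_irreducible h1 hV.clifford hV.ne_zero hV.vacuum hV.chir_ne hV.chir
      (hL.spatialStable_comap hW) (s := s) hsW hs0 hs.1 hs.2 ht.1 ht.2
  · exact spatialStable_irreducible_neg h1 hV.clifford hV.ne_zero hV.vacuum hV.chir_ne hV.chir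
      (hL.spatialStable_comap hW) (s := s) hsW hs0 hs.1 hs.2 ht.1 ht.2

/-- On `x_1^{-n/2} u` the eigenvalue of `H` is `-n/2 + 1/2` when `ω_1 u = 0` and `-n/2 - 1/2` when
`ω_{-1} u = 0`; these are the degrees `0` and `1`. Raising operators carry the second kind to the
first through `ω_1`. -/
theorem isGradeData_powLin (hγ : IsClifford γ) (c : ℂ) :
    IsGradeData γ ((spinorKer γ 1 c).map (powLin (-(n : ℂ) / 2)))
      ((spinorKer γ (-1) c).map (powLin (-(n : ℂ) / 2))) where
  H0 := by
    rintro _ ⟨u, hu, rfl⟩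
    rw [powLin_apply, H_powField, hu.1, Matrix.mulVec_zero, zero_add]
    unfold hval
    push_cast
    module
  H1 := by
    rintro _ ⟨u, hu, rfl⟩
    have h : (omega γ (-1)).mulVec ((omega γ 1).mulVec u) = -(2 : ℂ) • u := by
      have := omega_mulVec_neg hγ (valid_one n).neg u
      rw [_root_.neg_neg, hu.1, Matrix.mulVec_zero, neg_zero, zero_sub] at this
      rw [this, neg_smul]
    rw [powLin_apply, H_powField, h, powField_add, powField_smul]
    unfold hval
    push_cast
    module
  s0 i j f hf := (rotEquivariant_powLin _).map_mem (spatialStable_spinorKer hγ (Or.inl rfl) c) i j hf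
  s1 i j f hf := (rotEquivariant_powLin _).map_mem (spatialStable_spinorKer hγ (Or.inr rfl) c) i j hf
  p0 i := by
    rintro _ ⟨u, hu, rfl⟩
    rw [powLin_apply, raise_powField, (gamma_mem_spinorKer hγ (Or.inl rfl) i hu).1, powField_zero,
      smul_zero]
  p1 i := by
    rintro _ ⟨u, hu, rfl⟩
    rw [powLin_apply, raise_powField]
    refine Submodule.smul_mem _ _ ⟨_, ?_, rfl⟩
    have := omega_mem_spinorKer hγ (j := 1) (Or.inl rfl) (hu.2.gamma_mulVec hγ i.succ.succ)
    rwa [_root_.neg_neg] at this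

/-- The exponent `-(n+2)/2` places these fields at the eigenvalue of degree `1`. Keeping an empty
degree `0` lets them share the numbering, and hence `T_apply`, with the larger modules. -/
theorem isGradeData_slashLin (hγ : IsClifford γ) (c : ℂ) :
    IsGradeData γ ⊥ ((spinorKer γ 1 c).map (slashLin γ)) where
  H0 f hf := by rw [(Submodule.mem_bot ℂ).1 hf, map_zero, smul_zero]
  H1 := by
    rintro _ ⟨u, hu, rfl⟩
    rw [slashLin_apply, genOp_spat_slash hγ, H_powField, hu.1, Matrix.mulVec_zero, zero_add, map_add,
      map_smul, map_smul]
    unfold hval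
    push_cast
    module
  s0 i j f hf := by rw [(Submodule.mem_bot ℂ).1 hf, map_zero]; exact Submodule.zero_mem _
  s1 i j f hf :=
    (rotEquivariant_slashLin hγ).map_mem (spatialStable_spinorKer hγ (Or.inl rfl) c) i j hf
  p0 i f hf := by rw [(Submodule.mem_bot ℂ).1 hf, map_zero]
  p1 i := by
    rintro _ ⟨u, hu, rfl⟩
    rw [slashLin_apply, genOp_spat_slash hγ, raise_powField,
      (gamma_mem_spinorKer hγ (Or.inl rfl) i hu).1, powField_zero, smul_zero, map_zero]
    exact Submodule.zero_mem _

/-- The Casimir identity on homogeneous fields. -/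
theorem T_apply (hγ : IsClifford γ) {f : SpinorField n} {d : ℕ}
    (hdeg : degOp n f = (-(n : ℂ) / 2) • f) (hds : dSlash γ (dSlash γ f) = 0)
    (hH : genOp γ (isoCoeff (-1)) (isoCoeff 1) f = hval n d • f) :
    (fieldWC hγ).T f = (2 : ℂ) • ∑ i, genOp γ (isoCoeff (-1)) (spat i)
      (genOp γ (isoCoeff 1) (spat i) f) - ySlash γ (dSlash γ f) - ((d : ℂ) * ((d : ℂ) - 1)) • f := by
  have h := LinearMap.congr_fun (fieldWC hγ).casimir f
  simp only [fieldWC_Pp, fieldWC_Pm, fieldWC_H, fieldWC_deg, fieldWC_ys, fieldWC_ds,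
    LinearMap.sub_apply, LinearMap.add_apply, LinearMap.smul_apply, LinearMap.sum_apply,
    Module.End.mul_apply, LinearMap.neg_apply, Module.End.one_apply, hdeg, hds, hH, map_zero,
    neg_zero, map_add, map_smul] at h
  have h2 : ∀ A B C : SpinorField n, A - B - C = ((d : ℂ) * ((d : ℂ) - 1)) • f →
      C = A - B - ((d : ℂ) * ((d : ℂ) - 1)) • f := by
    intro A B C h
    rw [← h]; abel
  apply h2
  rw [h]
  -- With `H = -(n-1)/2 - d` the product of the two `H`-factors is `d(d-1)`, and the degree factor
  -- vanishes at `-n/2`.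
  unfold hval
  match_scalars
  ring

/-- Comparison of graded modules that agree in degrees `0` and `1`. -/
theorem le_of_low_degrees (hγ : IsClifford γ) (hn : 1 ≤ n) {A₀ A₁ : Submodule ℂ (SpinorField n)}
    [FiniteDimensional ℂ A₀] [FiniteDimensional ℂ A₁] (hG : IsGradeData γ A₀ A₁)
    {k₀ k₁ : ℕ} (h0 : A₀ ≤ (fieldWC hγ).polyLt k₀) (h1 : A₁ ≤ (fieldWC hγ).polyLt k₁)
    {N W : Submodule ℂ (SpinorField n)} (hN : Invariant (fieldRep γ) N)
    (hW : Invariant (fieldRep γ) W) (hNW : N ≤ W) (hWG : W ≤ ⨆ d, grade γ A₀ A₁ d)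
    (hdeg : ∀ f ∈ W, degOp n f = (-(n : ℂ) / 2) • f) (hds : ∀ f ∈ W, dSlash γ (dSlash γ f) = 0)
    (hyd : ∀ f ∈ W, ySlash γ (dSlash γ f) ∈ N)
    (hlow : ∀ d ≤ 1, ∀ f ∈ W, f ∈ grade γ A₀ A₁ d → f ∈ N) : W ≤ N := by
  have key : ∀ d, ∀ f ∈ W, f ∈ grade γ A₀ A₁ d → f ∈ N := by
    intro d
    induction d using Nat.strong_induction_on with
    | _ d ih =>
    rcases Nat.lt_or_ge d 2 with hd | hd
    · exact hlow d (by omega)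
    obtain ⟨d, rfl⟩ : ∃ e, d = e + 1 := ⟨d - 1, by omega⟩
    intro f hf hfd
    obtain ⟨k, hk⟩ := exists_grade_le_polyLt (A₀ := A₀) (A₁ := A₁) hγ h0 h1 (d + 1)
    have := finiteDimensional_grade (γ := γ) (A₀ := A₀) (A₁ := A₁) (d + 1)
    -- The number `d(d-1)` for the present degree `d + 1`; it is positive precisely because that
    -- degree is at least `2`.
    set C : ℝ := ((d + 1 : ℕ) : ℝ) * (((d + 1 : ℕ) : ℝ) - 1) with hC
    have hCpos : 0 < C := by
      have : (1 : ℝ) ≤ (d : ℝ) := by exact_mod_cast (by omega : 1 ≤ d)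
      rw [hC]; push_cast; nlinarith
    have hCc : (C : ℂ) = ((d + 1 : ℕ) : ℂ) * (((d + 1 : ℕ) : ℂ) - 1) := by rw [hC]; push_cast; ring
    -- By the Casimir identity `S` maps homogeneous elements of `W` into `N`: raising operators land
    -- in the previous degree, where the claim holds by induction, and the Dirac term is in `N` by
    -- hypothesis.
    set S : Module.End ℂ (SpinorField n) := (fieldWC hγ).T + (C : ℂ) • 1 with hS
    have hSf : ∀ g ∈ W, g ∈ grade γ A₀ A₁ (d + 1) → S g = (2 : ℂ) •
        ∑ i, genOp γ (isoCoeff (-1)) (spat i) (genOp γ (isoCoeff 1) (spat i) g) -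
        ySlash γ (dSlash γ g) := by
      intro g hg hgd
      rw [hS, LinearMap.add_apply, LinearMap.smul_apply, Module.End.one_apply,
        T_apply hγ (hdeg g hg) (hds g hg) (H_grade hγ hG hgd), hCc]
      abel
    have hSmem : ∀ g ∈ W, g ∈ grade γ A₀ A₁ (d + 1) → S g ∈ N ⊓ grade γ A₀ A₁ (d + 1) := by
      intro g hg hgd
      rw [hSf g hg hgd]
      have hr : ∀ i, genOp γ (isoCoeff 1) (spat i) g ∈ grade γ A₀ A₁ d := fun i =>
        raise_mem_grade hγ hG i hgd
      have hyd' := hyd g hg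
      refine Submodule.sub_mem _ (Submodule.smul_mem _ _ (Submodule.sum_mem _ fun i _ => ?_)) ?_
      · exact ⟨genOp_mem hN _ _ (ih d (by omega) _ (genOp_mem hW _ _ hg) (hr i)),
          lower_mem_grade i (hr i)⟩
      · refine ⟨hyd', mem_grade_of_eigen hγ hG (hWG (hNW hyd')) ?_⟩
        rw [genOp_spat_slash hγ, ← Module.End.mul_apply (genOp _ _ _) (dSlash γ),
          genOp_dSlash hγ, Module.End.mul_apply, H_grade hγ hG hgd, map_smul, map_smul]
    have hinj : ∀ g ∈ grade γ A₀ A₁ (d + 1), S g = 0 → g = 0 := by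
      intro g hg h
      refine (fieldWC hγ).eq_zero_of_T hCpos hn (hk hg) ?_
      rw [hS, LinearMap.add_apply, LinearMap.smul_apply, Module.End.one_apply] at h
      rw [neg_smul]
      exact eq_neg_of_add_eq_zero_left h
    set ND := N ⊓ grade γ A₀ A₁ (d + 1) with hND
    have : FiniteDimensional ℂ ND := Submodule.finiteDimensional_of_le inf_le_right
    have hmaps : ∀ g ∈ ND, S g ∈ ND := fun g hg => hSmem g (hNW hg.1) hg.2
    -- An injective operator on the finite dimensional part of `N` is onto. So `S f = S g` with `g`
    -- in `N`, and injectivity on the whole degree gives `f = g`.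
    have hsurj : Function.Surjective (S.restrict hmaps) := by
      refine LinearMap.surjective_of_injective ?_
      rw [← LinearMap.ker_eq_bot, LinearMap.ker_eq_bot']
      intro g hg
      exact Subtype.ext (hinj g g.2.2 (congrArg Subtype.val hg))
    obtain ⟨g, hg⟩ := hsurj ⟨S f, hSmem f hf hfd⟩
    have hg' : S g = S f := congrArg Subtype.val hg
    have := hinj (f - g) (Submodule.sub_mem _ hfd g.2.2) (by rw [map_sub, hg', sub_self])
    rw [sub_eq_zero.1 this]
    exact g.2.1
  intro f hf
  obtain ⟨g, hg, hs⟩ := exists_grade_decomposition (hWG hf)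
  rw [← hs]
  refine Submodule.sum_mem _ fun d _ => key d _ ?_ (hg d)
  exact component_mem hγ hG hW hg (hs.symm ▸ hf) d

end

end GuptaBleuler

end

noncomputable section

namespace GuptaBleuler

variable {n : ℕ} {γ : Gammas n} {v : Spinor n} {c : ℂ}

/-! ### Invariant subspaces defined by commuting operators -/

theorem invariant_comap_of_commute {O : Module.End ℂ (SpinorField n)}
    (hO : ∀ ξ ζ, genOp γ ξ ζ * O = O * genOp γ ξ ζ) {W : Submodule ℂ (SpinorField n)}
    (hW : Invariant (fieldRep γ) W) : Invariant (fieldRep γ) (W.comap O) := by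
  intro a b f hf
  have h := genOp_mem hW (Pi.single a 1) (Pi.single b 1) (f := O f) hf
  rw [← Module.End.mul_apply, hO, Module.End.mul_apply, ← fieldRep_eq_genOp] at h
  exact h

theorem invariant_bot : Invariant (fieldRep γ) (⊥ : Submodule ℂ (SpinorField n)) := by
  intro a b f hf
  rw [(Submodule.mem_bot ℂ).1 hf, map_zero]
  exact Submodule.zero_mem _

theorem genOp_ySlash_dSlash (hγ : IsClifford γ) (ξ ζ : Fin (n + 2) → ℂ) :
    genOp γ ξ ζ * (ySlash γ * dSlash γ) = ySlash γ * dSlash γ * genOp γ ξ ζ := by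
  rw [← mul_assoc, genOp_ySlash hγ, mul_assoc, genOp_dSlash hγ, mul_assoc]

/-! ### The Dirac operator on the generators -/

theorem dSlash_powField_of_ker (hγ : IsClifford γ) (s : ℂ) {u : Spinor n}
    (hu : (omega γ 1).mulVec u = 0) : dSlash γ (powField s u) = 0 := by
  rw [dSlash_powField hγ, hu, powField_zero, smul_zero]

/-- Only the anticommutator survives, and `2 · (-(n+2)/2) + (n+2) = 0`: this is what singles out the
exponent in `Psi3`. -/
theorem dSlash_slashLin (hγ : IsClifford γ) {u : Spinor n} (hu : (omega γ 1).mulVec u = 0) :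
    dSlash γ (slashLin γ u) = 0 := by
  rw [slashLin_apply, ← Module.End.mul_apply, dSlash_ySlash hγ]
  simp only [LinearMap.add_apply, LinearMap.neg_apply, LinearMap.smul_apply, Module.End.mul_apply,
    Module.End.one_apply, dSlash_powField_of_ker hγ _ hu, map_zero, neg_zero, degOp_powField hγ]
  module

theorem dirD_spat_slashLin (i : Fin n) (u : Spinor n) : dirD (spat i) (slashLin γ u) =
    powField (-((n : ℂ) + 2) / 2) ((γ i.succ.succ).mulVec u) := by
  rw [slashLin_apply, ← Module.End.mul_apply, dirD_ySlash, LinearMap.add_apply,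
    Module.End.mul_apply, dirD_spat_powField, map_zero, zero_add, mulMat_powField, gam_spat]

theorem slashLin_eq_zero (hγ : IsClifford γ) (hn : 1 ≤ n) {u : Spinor n} (h : slashLin γ u = 0) :
    u = 0 := by
  have h1 := dirD_spat_slashLin (γ := γ) ⟨0, hn⟩ u
  rw [h, map_zero] at h1
  exact mulVec_eq_zero_of_isUnit (isUnit_gamma hγ _) (powField_eq_zero h1.symm)

theorem slashLin_mem_polyLt (hγ : IsClifford γ) (u : Spinor n) :
    slashLin γ u ∈ (fieldWC hγ).polyLt 2 := by
  rw [WeylClifford.mem_polyLt_succ]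
  intro i
  have : (fieldWC hγ).d i (slashLin γ u) = _ := dirD_spat_slashLin i u
  rw [this]
  exact powField_mem_polyLt hγ _ _

theorem IsVac.dSlash_Psi2 (hV : IsVac γ v c) : dSlash γ (Psi2 v) = 0 :=
  dSlash_powField_of_ker hV.clifford _ hV.vac_mem.1

theorem IsVac.dSlash_Psi3 (hV : IsVac γ v c) : dSlash γ (Psi3 γ v) = 0 :=
  dSlash_slashLin hV.clifford hV.star_mem.1

theorem IsVac.Psi3_ne_zero (hV : IsVac γ v c) : Psi3 γ v ≠ 0 := fun h =>
  hV.star_ne (slashLin_eq_zero hV.clifford (by have := hV.three_le; omega) h)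

theorem IsVac.dSlash_Psi1 (hV : IsVac γ v c) : dSlash γ (Psi1 γ v) =
    (n : ℂ) • powField (-((n : ℂ) + 2) / 2) ((omegaStar γ).mulVec v) := by
  have e1 : -(n : ℂ) / 2 - 1 = -((n : ℂ) + 2) / 2 := by ring
  rw [Psi1, dSlash_powField hV.clifford, ← Matrix.mulVec_mulVec,
    omega_mulVec_neg hV.clifford (valid_one n), hV.star_mem.1, Matrix.mulVec_zero, neg_zero,
    zero_sub, powField_neg, powField_smul, e1]
  module

theorem IsVac.ySlash_dSlash_Psi1 (hV : IsVac γ v c) :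
    ySlash γ (dSlash γ (Psi1 γ v)) = (n : ℂ) • Psi3 γ v := by
  rw [hV.dSlash_Psi1, map_smul, Psi3]

/-! ### Inclusions between the cyclic modules -/

theorem IsVac.powField_mem (hV : IsVac γ v c) {W : Submodule ℂ (SpinorField n)}
    (hW : Invariant (fieldRep γ) W) (h : Psi2 v ∈ W) {t : Spinor n} (ht : t ∈ spinorKer γ 1 c) :
    powField (-(n : ℂ) / 2) t ∈ W :=
  hV.mem_of_mem (rotEquivariant_powLin _) hW (Or.inl rfl) hV.vac_mem hV.ne_zero h ht

theorem IsVac.slashLin_mem (hV : IsVac γ v c) {W : Submodule ℂ (SpinorField n)}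
    (hW : Invariant (fieldRep γ) W) (h : Psi3 γ v ∈ W) {t : Spinor n}
    (ht : t ∈ spinorKer γ 1 (-c)) : slashLin γ t ∈ W :=
  hV.mem_of_mem (rotEquivariant_slashLin hV.clifford) hW (Or.inr rfl) hV.star_mem hV.star_ne h ht

theorem IsVac.Psi1_mem_grade (hV : IsVac γ v c) : Psi1 γ v ∈
    (spinorKer γ (-1) c).map (powLin (-(n : ℂ) / 2)) := by
  refine ⟨_, ?_, rfl⟩
  rw [← Matrix.mulVec_mulVec]
  have := omega_mem_spinorKer hV.clifford (j := -1) (Or.inr rfl) hV.star_mem.2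
  rwa [_root_.neg_neg] at this

/-- A raising operator turns `ω_{-1}` into a scalar by the oscillator relation and produces
`x_1^{-n/2}` times a nonzero spinor of the kernel of `ω_1` with the chirality of `v`. Irreducibility
under rotations then yields `v` itself. -/
theorem IsVac.Psi2_mem_cyclic (hV : IsVac γ v c) : Psi2 v ∈ cyclic (fieldRep γ) (Psi1 γ v) := by
  have h1 : 1 ≤ n := by have := hV.three_le; omega
  have hinv := invariant_cyclic (fieldRep γ) (Psi1 γ v)
  have h := genOp_mem hinv (isoCoeff 1) (spat ⟨0, h1⟩) (mem_cyclic_self _ _)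
  have e : genOp γ (isoCoeff 1) (spat ⟨0, h1⟩) (Psi1 γ v) = powField (-(n : ℂ) / 2)
      ((γ (Fin.succ (Fin.succ ⟨0, h1⟩))).mulVec ((omegaStar γ).mulVec v)) := by
    rw [Psi1, raise_powField, Matrix.mulVec_mulVec, omega_one_spatial hV.clifford,
      ← Matrix.mulVec_mulVec, Matrix.neg_mulVec, ← Matrix.mulVec_mulVec,
      omega_mulVec_neg hV.clifford (valid_one n), hV.star_mem.1, Matrix.mulVec_zero, neg_zero,
      zero_sub, Matrix.mulVec_neg, _root_.neg_neg, Matrix.mulVec_smul, powField_smul, smul_smul,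
      show (1 / 2 * 2 : ℂ) = 1 by norm_num, one_smul]
  rw [e] at h
  have hm := gamma_mem_spinorKer hV.clifford (Or.inl rfl) ⟨0, h1⟩ hV.star_mem
  rw [_root_.neg_neg] at hm
  exact hV.mem_of_mem (rotEquivariant_powLin _) hinv (Or.inl rfl) hm
    (fun h0 => hV.star_ne (mulVec_eq_zero_of_isUnit (isUnit_gamma hV.clifford _) h0)) h hV.vac_mem

theorem IsVac.degOp_Psi1 (hV : IsVac γ v c) {f : SpinorField n}
    (hf : f ∈ cyclic (fieldRep γ) (Psi1 γ v)) : degOp n f = (-(n : ℂ) / 2) • f := by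
  have h := cyclic_le (v := Psi1 γ v) (invariant_comap_of_commute (γ := γ)
    (O := degOp n - (-(n : ℂ) / 2) • 1) (fun ξ ζ => by
      rw [mul_sub, sub_mul, genOp_degOp hV.clifford, mul_smul_comm, smul_mul_assoc, one_mul,
        mul_one]) invariant_bot) (by
    rw [Submodule.mem_comap, Submodule.mem_bot, LinearMap.sub_apply, Psi1,
      degOp_powField hV.clifford, LinearMap.smul_apply, Module.End.one_apply, sub_self]) hf
  exact sub_eq_zero.1 ((Submodule.mem_bot ℂ).1 h)

theorem IsVac.dSlash_cyclic_Psi2 (hV : IsVac γ v c) {f : SpinorField n}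
    (hf : f ∈ cyclic (fieldRep γ) (Psi2 v)) : dSlash γ f = 0 :=
  (Submodule.mem_bot ℂ).1 (cyclic_le (invariant_comap_of_commute (genOp_dSlash hV.clifford)
    invariant_bot) (by rw [Submodule.mem_comap, Submodule.mem_bot, hV.dSlash_Psi2]) hf)

/-- `T` is computed twice on a lowered `Psi2`. The Casimir identity shows that the result stays in
the cyclic module; the explicit formula exhibits it as a multiple of the lowered field plus a
`ySlash` field. Hence that `ySlash` field lies in the module, and rotations carry it to `Psi3`. -/
theorem IsVac.Psi3_mem_cyclic (hV : IsVac γ v c) : Psi3 γ v ∈ cyclic (fieldRep γ) (Psi2 v) := by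
  have h1 : 1 ≤ n := by have := hV.three_le; omega
  have hn0 : (n : ℂ) ≠ 0 := by exact_mod_cast (by omega : n ≠ 0)
  have hinv := invariant_cyclic (fieldRep γ) (Psi2 v : SpinorField n)
  set i : Fin n := ⟨0, h1⟩
  set f := genOp γ (isoCoeff (-1)) (spat i) (powField (-(n : ℂ) / 2) v) with hf
  have hfm : f ∈ cyclic (fieldRep γ) (Psi2 v) := genOp_mem hinv _ _ (mem_cyclic_self _ _)
  have hle : cyclic (fieldRep γ) (Psi2 v) ≤ cyclic (fieldRep γ) (Psi1 γ v) :=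
    cyclic_le (invariant_cyclic _ _) hV.Psi2_mem_cyclic
  have hG := isGradeData_powLin hV.clifford c
  have hfd := lower_mem_grade (γ := γ) (A₁ := (spinorKer γ (-1) c).map (powLin (-(n : ℂ) / 2))) i
    (A₀ := (spinorKer γ 1 c).map (powLin (-(n : ℂ) / 2))) (d := 0)
    (f := powField (-(n : ℂ) / 2) v) (by rw [grade_zero]; exact ⟨v, hV.vac_mem, rfl⟩)
  have hT := T_apply hV.clifford (hV.degOp_Psi1 (hle hfm))
    (by rw [hV.dSlash_cyclic_Psi2 hfm, map_zero]) (H_grade hV.clifford hG hfd)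
  rw [hV.dSlash_cyclic_Psi2 hfm, map_zero, sub_zero] at hT
  have hTm : (fieldWC hV.clifford).T f ∈ cyclic (fieldRep γ) (Psi2 v) := by
    rw [hT]
    exact Submodule.sub_mem _ (Submodule.smul_mem _ _ (Submodule.sum_mem _ fun j _ =>
      genOp_mem hinv _ _ (genOp_mem hinv _ _ hfm))) (Submodule.smul_mem _ _ hfm)
  rw [hf, T_lower_powField hV.clifford i hV.vac_mem.1] at hTm
  have h2 := (Submodule.add_mem_iff_right _ (Submodule.smul_mem _ _ hfm)).1 hTm
  have h3 := (Submodule.smul_mem_iff _ (div_ne_zero hn0 two_ne_zero)).1 h2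
  exact hV.mem_of_mem (rotEquivariant_slashLin hV.clifford) hinv (Or.inr rfl)
    (gamma_mem_spinorKer hV.clifford (Or.inl rfl) i hV.vac_mem)
    (fun h0 => hV.ne_zero (mulVec_eq_zero_of_isUnit (isUnit_gamma hV.clifford _) h0)) h3 hV.star_mem

theorem IsVac.cyclic_two_le (hV : IsVac γ v c) :
    cyclic (fieldRep γ) (Psi2 v) ≤ cyclic (fieldRep γ) (Psi1 γ v) :=
  cyclic_le (invariant_cyclic _ _) hV.Psi2_mem_cyclic

theorem IsVac.cyclic_three_le (hV : IsVac γ v c) :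
    cyclic (fieldRep γ) (Psi3 γ v) ≤ cyclic (fieldRep γ) (Psi2 v) :=
  cyclic_le (invariant_cyclic _ _) hV.Psi3_mem_cyclic

/-- The homogeneous components of the ambient graded module. -/
def ambient (γ : Gammas n) (c : ℂ) : ℕ → Submodule ℂ (SpinorField n) :=
  grade γ ((spinorKer γ 1 c).map (powLin (-(n : ℂ) / 2)))
    ((spinorKer γ (-1) c).map (powLin (-(n : ℂ) / 2)))

theorem IsVac.cyclic_one_le_ambient (hV : IsVac γ v c) :
    cyclic (fieldRep γ) (Psi1 γ v) ≤ ⨆ d, ambient γ c d :=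
  cyclic_le (invariant_iSup_grade hV.clifford (isGradeData_powLin hV.clifford c))
    (Submodule.mem_iSup_of_mem 1 (le_grade_one hV.Psi1_mem_grade))

theorem IsVac.ySlash_dSlash_cyclic_Psi1 (hV : IsVac γ v c) {f : SpinorField n}
    (hf : f ∈ cyclic (fieldRep γ) (Psi1 γ v)) :
    ySlash γ (dSlash γ f) ∈ cyclic (fieldRep γ) (Psi3 γ v) :=
  cyclic_le (invariant_comap_of_commute (genOp_ySlash_dSlash hV.clifford)
    (invariant_cyclic _ (Psi3 γ v))) (by
      rw [Submodule.mem_comap, Module.End.mul_apply, hV.ySlash_dSlash_Psi1]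
      exact Submodule.smul_mem _ _ (mem_cyclic_self _ _)) hf

theorem IsVac.dSlash_sq_cyclic_Psi1 (hV : IsVac γ v c) {f : SpinorField n}
    (hf : f ∈ cyclic (fieldRep γ) (Psi1 γ v)) : dSlash γ (dSlash γ f) = 0 :=
  (Submodule.mem_bot ℂ).1 (cyclic_le (W := (⊥ : Submodule ℂ (SpinorField n)).comap
    (dSlash γ * dSlash γ)) (invariant_comap_of_commute (fun ξ ζ => by
      rw [← mul_assoc, genOp_dSlash hV.clifford, mul_assoc, genOp_dSlash hV.clifford, mul_assoc])
    invariant_bot) (by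
      rw [Submodule.mem_comap, Submodule.mem_bot, Module.End.mul_apply, hV.dSlash_Psi1, map_smul,
        dSlash_powField_of_ker hV.clifford _ hV.star_mem.1, smul_zero]) hf)

theorem mem_ambient_one (γ : Gammas n) (c : ℂ) {f : SpinorField n} (hf : f ∈ ambient γ c 1) :
    ∃ s ∈ spinorKer γ (-1) c, ∃ t : Fin n → Spinor n, (∀ i, t i ∈ spinorKer γ 1 c) ∧
      f = powField (-(n : ℂ) / 2) s +
        ∑ i, genOp γ (isoCoeff (-1)) (spat i) (powField (-(n : ℂ) / 2) (t i)) := by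
  set Φ : (Spinor n × (Fin n → Spinor n)) →ₗ[ℂ] SpinorField n :=
    (powLin (-(n : ℂ) / 2)).coprod (∑ i, (genOp γ (isoCoeff (-1)) (spat i) ∘ₗ
      powLin (-(n : ℂ) / 2)) ∘ₗ LinearMap.proj i) with hΦ
  have hΦa : ∀ s t, Φ (s, t) = powField (-(n : ℂ) / 2) s +
      ∑ i, genOp γ (isoCoeff (-1)) (spat i) (powField (-(n : ℂ) / 2) (t i)) := by
    intro s t
    rw [hΦ, LinearMap.coprod_apply, LinearMap.sum_apply]
    rfl
  have hle : ambient γ c 1 ≤ ((spinorKer γ (-1) c).prod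
      (Submodule.pi Set.univ fun _ => spinorKer γ 1 c)).map Φ := by
    refine grade_succ_le (fun _ => ?_) ?_
    · rintro _ ⟨s, hs, rfl⟩
      refine ⟨(s, 0), ⟨hs, fun i _ => Submodule.zero_mem _⟩, ?_⟩
      rw [hΦa]
      simp [powField_zero, powLin_apply]
    · rintro i _ hf
      rw [grade_zero] at hf
      obtain ⟨t, ht, rfl⟩ := hf
      refine ⟨(0, Pi.single i t), ⟨Submodule.zero_mem _, fun j _ => ?_⟩, ?_⟩
      · by_cases hj : j = i
        · subst hj; simpa using ht
        · simp only [Pi.single_eq_of_ne hj]; exact Submodule.zero_mem _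
      · rw [hΦa, powField_zero, zero_add, Finset.sum_eq_single i]
        · rw [Pi.single_eq_same]; rfl
        · intro j _ hj
          rw [Pi.single_eq_of_ne hj, powField_zero, map_zero]
        · simp
  obtain ⟨⟨s, t⟩, ⟨hs, ht⟩, rfl⟩ := hle hf
  exact ⟨s, hs, t, fun i => ht i (Set.mem_univ i), hΦa s t⟩

/-! ### Irreducibility of the subquotients -/

/-- The lowest degree is `1` and is an irreducible module of rotations. Either `W` meets it, and
then contains `Psi3`, or `W` vanishes in degrees `0` and `1`; since `dSlash` vanishes on the module,
`le_of_low_degrees` then applies with `N = ⊥`. -/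
theorem IsVac.irreducible_three (hV : IsVac γ v c) {W : Submodule ℂ (SpinorField n)}
    (hW : Invariant (fieldRep γ) W) (hle : W ≤ cyclic (fieldRep γ) (Psi3 γ v)) :
    W = ⊥ ∨ cyclic (fieldRep γ) (Psi3 γ v) ≤ W := by
  have hγ := hV.clifford
  have hn : 1 ≤ n := by have := hV.three_le; omega
  have hG := isGradeData_slashLin hγ (-c)
  have hWG : W ≤ ⨆ d, grade γ ⊥ ((spinorKer γ 1 (-c)).map (slashLin γ)) d :=
    hle.trans (cyclic_le (invariant_iSup_grade hγ hG)
      (Submodule.mem_iSup_of_mem 1 (le_grade_one ⟨_, hV.star_mem, rfl⟩)))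
  have hle1 := hle.trans (hV.cyclic_three_le.trans hV.cyclic_two_le)
  by_cases hex : ∃ f ∈ W, f ∈ grade γ ⊥ ((spinorKer γ 1 (-c)).map (slashLin γ)) 1 ∧ f ≠ 0
  · obtain ⟨f, hf, hf1, hf0⟩ := hex
    have hle2 : grade γ ⊥ ((spinorKer γ 1 (-c)).map (slashLin γ)) 1 ≤
        (spinorKer γ 1 (-c)).map (slashLin γ) := grade_succ_le (fun _ => le_rfl) fun i g hg => by
      rw [grade_zero, Submodule.mem_bot] at hg
      rw [hg, map_zero]
      exact Submodule.zero_mem _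
    obtain ⟨t, ht, rfl⟩ := hle2 hf1
    right
    exact cyclic_le hW (hV.mem_of_mem (rotEquivariant_slashLin hγ) hW (Or.inr rfl) ht
      (fun h => hf0 (by rw [h, map_zero])) hf hV.star_mem)
  · left
    push Not at hex
    rw [eq_bot_iff]
    refine le_of_low_degrees hγ hn hG (k₀ := 0) (k₁ := 2) bot_le ?_ invariant_bot hW bot_le hWG
      (fun f hf => hV.degOp_Psi1 (hle1 hf)) (fun f hf => hV.dSlash_sq_cyclic_Psi1 (hle1 hf))
      (fun f hf => ?_) ?_
    · rintro _ ⟨t, _, rfl⟩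
      exact slashLin_mem_polyLt hγ t
    · rw [hV.dSlash_cyclic_Psi2 (hV.cyclic_three_le (hle hf)), map_zero]
      exact Submodule.zero_mem _
    · intro d hd f hf hfd
      interval_cases d
      · rwa [grade_zero] at hfd
      · exact hex f hf hfd

/-- If `W` has nothing in degree `0`, its elements of degree `1` are killed by the raising operators
and by `dSlash`, so `T` kills them too. Comparison with the explicit form of `T` in degree `1` shows
that they are `ySlash` fields, hence in the module of `Psi3`. -/
theorem IsVac.irreducible_two (hV : IsVac γ v c) {W : Submodule ℂ (SpinorField n)}
    (hW : Invariant (fieldRep γ) W) (hNW : cyclic (fieldRep γ) (Psi3 γ v) ≤ W)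
    (hle : W ≤ cyclic (fieldRep γ) (Psi2 v)) :
    W ≤ cyclic (fieldRep γ) (Psi3 γ v) ∨ cyclic (fieldRep γ) (Psi2 v) ≤ W := by
  have hγ := hV.clifford
  have hn : 1 ≤ n := by have := hV.three_le; omega
  have hn0 : (n : ℂ) ≠ 0 := by exact_mod_cast (by omega : n ≠ 0)
  have hG := isGradeData_powLin hγ c
  have hle1 := hle.trans hV.cyclic_two_le
  have hWG := hle1.trans hV.cyclic_one_le_ambient
  by_cases hex : ∃ f ∈ W, f ∈ ambient γ c 0 ∧ f ≠ 0
  · obtain ⟨f, hf, hf1, hf0⟩ := hex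
    rw [ambient, grade_zero] at hf1
    obtain ⟨t, ht, rfl⟩ := hf1
    right
    exact cyclic_le hW (hV.mem_of_mem (rotEquivariant_powLin _) hW (Or.inl rfl) ht
      (fun h => hf0 (by rw [h, map_zero])) hf hV.vac_mem)
  · left
    push Not at hex
    refine le_of_low_degrees hγ hn hG (k₀ := 1) (k₁ := 1) ?_ ?_ (invariant_cyclic _ _) hW hNW hWG
      (fun f hf => hV.degOp_Psi1 (hle1 hf)) (fun f hf => hV.dSlash_sq_cyclic_Psi1 (hle1 hf))
      (fun f hf => hV.ySlash_dSlash_cyclic_Psi1 (hle1 hf)) ?_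
    · rintro _ ⟨t, _, rfl⟩
      exact powField_mem_polyLt hγ _ _
    · rintro _ ⟨t, _, rfl⟩
      exact powField_mem_polyLt hγ _ _
    · intro d hd f hf hfd
      interval_cases d
      · rw [hex f hf hfd]
        exact Submodule.zero_mem _
      · have hr : ∀ i, genOp γ (isoCoeff 1) (spat i) f = 0 := fun i =>
          hex _ (genOp_mem hW _ _ hf) (raise_mem_grade hγ hG i hfd)
        have hds : dSlash γ f = 0 := hV.dSlash_cyclic_Psi2 (hle hf)
        have hT := T_apply hγ (hV.degOp_Psi1 (hle1 hf)) (hV.dSlash_sq_cyclic_Psi1 (hle1 hf))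
          (H_grade hγ hG hfd)
        simp only [hr, hds, map_zero, Finset.sum_const_zero, smul_zero, Nat.cast_one, sub_self,
          mul_zero, zero_smul] at hT
        obtain ⟨s, hs, t, ht, hft⟩ := mem_ambient_one γ c hfd
        set σ : Spinor n := ∑ i : Fin n, (γ i.succ.succ).mulVec (t i) with hσ
        have hσm : σ ∈ spinorKer γ 1 (-c) := Submodule.sum_mem _ fun i _ =>
          gamma_mem_spinorKer hγ (Or.inl rfl) i (ht i)
        -- All lowered fields are eigenvectors of `T` with eigenvalue `n` up to `ySlash` fields,
        -- whereas `T` vanishes on the power field. Since `T f = 0`, the equation can be solved for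
        -- `f`.
        have hTf : (fieldWC hγ).T f = (n : ℂ) • (f - powField (-(n : ℂ) / 2) s) +
            ((n : ℂ) / 2) • slashLin γ σ := by
          rw [hft, map_add, T_powField, zero_add, map_sum, Finset.sum_congr rfl fun i _ =>
            T_lower_powField hγ i (ht i).1, Finset.sum_add_distrib, ← Finset.smul_sum,
            ← Finset.smul_sum, hσ, map_sum, add_sub_cancel_left]
          rfl
        have hf2 : f = powField (-(n : ℂ) / 2) s - (1 / 2 : ℂ) • slashLin γ σ := by
          rw [hT] at hTf
          have h3 : (n : ℂ) • (f - powField (-(n : ℂ) / 2) s + (1 / 2 : ℂ) • slashLin γ σ) = 0 := by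
            rw [hTf]; module
          have h4 := (smul_eq_zero.1 h3).resolve_left hn0
          rw [← sub_eq_zero, ← h4]
          abel
        -- `dSlash` annihilates both `f` and the `ySlash` field, so it annihilates the power field.
        -- Together with `ω_{-1} s = 0` this forces `s = 0` by the oscillator relation.
        have hs1 : (omega γ 1).mulVec s = 0 := by
          have h5 := hds
          rw [hf2, map_sub, map_smul, dSlash_slashLin hγ hσm.1, smul_zero, sub_zero,
            dSlash_powField hγ] at h5
          refine powField_eq_zero ((smul_eq_zero.1 h5).resolve_left ?_)
          exact div_ne_zero (neg_ne_zero.2 hn0) two_ne_zero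
        have hs0 : s = 0 := by
          have h6 := omega_mulVec_neg hγ (valid_one n) s
          rw [hs.1, hs1, Matrix.mulVec_zero, Matrix.mulVec_zero, neg_zero, zero_sub, eq_comm,
            neg_eq_zero] at h6
          exact (smul_eq_zero.1 h6).resolve_left two_ne_zero
        rw [hf2, hs0, powField_zero, zero_sub]
        exact Submodule.neg_mem _ (Submodule.smul_mem _ _ (hV.slashLin_mem (invariant_cyclic _ _)
          (mem_cyclic_self _ _) hσm))

/-- Modulo the module of `Psi2`, nothing is left in degree `0`, and degree `1` consists of the power
fields with spinors killed by `ω_{-1}`. These form one irreducible module of rotations that contains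
`Psi1`, so `W` either has all of them or none beyond the module of `Psi2`. -/
theorem IsVac.irreducible_one (hV : IsVac γ v c) {W : Submodule ℂ (SpinorField n)}
    (hW : Invariant (fieldRep γ) W) (hNW : cyclic (fieldRep γ) (Psi2 v) ≤ W)
    (hle : W ≤ cyclic (fieldRep γ) (Psi1 γ v)) :
    W ≤ cyclic (fieldRep γ) (Psi2 v) ∨ cyclic (fieldRep γ) (Psi1 γ v) ≤ W := by
  have hγ := hV.clifford
  have hn : 1 ≤ n := by have := hV.three_le; omega
  have hG := isGradeData_powLin hγ c
  have hWG := hle.trans hV.cyclic_one_le_ambient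
  have hpow : ∀ t ∈ spinorKer γ 1 c, powField (-(n : ℂ) / 2) t ∈ cyclic (fieldRep γ) (Psi2 v) :=
    fun t ht => hV.powField_mem (invariant_cyclic _ _) (mem_cyclic_self _ _) ht
  by_cases hex : ∃ s ∈ spinorKer γ (-1) c, s ≠ 0 ∧ powField (-(n : ℂ) / 2) s ∈ W
  · obtain ⟨s, hs, hs0, hsW⟩ := hex
    right
    refine cyclic_le hW ?_
    -- A spinor with `ω_{-1} s = 0` is `-1/2` times `ω_{-1} (ω_1 s)`. Parametrising by `ω_1 s`
    -- brings the irreducibility statement for the kernel of `ω_1` into play.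
    set L : Spinor n →ₗ[ℂ] SpinorField n :=
      powLin (-(n : ℂ) / 2) ∘ₗ Matrix.toLin' (omega γ (-1)) with hL
    have hLa : ∀ u, L u = powField (-(n : ℂ) / 2) ((omega γ (-1)).mulVec u) := fun u => rfl
    have hLr : RotEquivariant γ L := by
      intro i j u
      rw [hLa, hLa, spat_powField, Matrix.mulVec_smul, Matrix.mulVec_sub, Matrix.mulVec_smul]
      congr 3
      rw [Matrix.mulVec_mulVec, Matrix.mulVec_mulVec, mul_assoc, ← neg_eq_iff_eq_neg.2
        (omega_neg_one_spatial hγ j), mul_neg, ← mul_assoc, ← neg_eq_iff_eq_neg.2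
        (omega_neg_one_spatial hγ i), neg_mul, _root_.neg_neg, mul_assoc]
    have h6 := omega_mulVec_neg hγ (valid_one n).neg s
    rw [_root_.neg_neg, hs.1, Matrix.mulVec_zero, neg_zero, zero_sub] at h6
    have hm : (omega γ 1).mulVec s ∈ spinorKer γ 1 (-c) :=
      omega_mem_spinorKer hγ (Or.inl rfl) hs.2
    have h7 := hV.mem_of_mem hLr hW (Or.inr rfl) hm (fun h0 => by
        rw [h0, Matrix.mulVec_zero, eq_comm, neg_eq_zero] at h6
        exact hs0 ((smul_eq_zero.1 h6).resolve_left two_ne_zero)) (by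
        rw [hLa, h6, powField_neg, powField_smul]
        exact W.neg_mem (W.smul_mem _ hsW)) hV.star_mem
    rw [hLa, Matrix.mulVec_mulVec] at h7
    exact h7
  · left
    push Not at hex
    refine le_of_low_degrees hγ hn hG (k₀ := 1) (k₁ := 1) ?_ ?_ (invariant_cyclic _ _) hW hNW hWG
      (fun f hf => hV.degOp_Psi1 (hle hf)) (fun f hf => hV.dSlash_sq_cyclic_Psi1 (hle hf))
      (fun f hf => hV.cyclic_three_le (hV.ySlash_dSlash_cyclic_Psi1 (hle hf))) ?_
    · rintro _ ⟨t, _, rfl⟩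
      exact powField_mem_polyLt hγ _ _
    · rintro _ ⟨t, _, rfl⟩
      exact powField_mem_polyLt hγ _ _
    · intro d hd f hf hfd
      interval_cases d
      · rw [grade_zero] at hfd
        obtain ⟨t, ht, rfl⟩ := hfd
        exact hpow t ht
      · obtain ⟨s, hs, t, ht, hft⟩ := mem_ambient_one γ c hfd
        have h2 : ∑ i, genOp γ (isoCoeff (-1)) (spat i) (powField (-(n : ℂ) / 2) (t i)) ∈
            cyclic (fieldRep γ) (Psi2 v) := Submodule.sum_mem _ fun i _ =>
          genOp_mem (invariant_cyclic _ _) _ _ (hpow _ (ht i))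
        have h3 : powField (-(n : ℂ) / 2) s ∈ W := by
          rw [hft] at hf
          exact (W.add_mem_iff_left (hNW h2)).1 hf
        by_cases hs0 : s = 0
        · rw [hft, hs0, powField_zero, zero_add]; exact h2
        · exact absurd h3 (hex s hs hs0)

end GuptaBleuler

end

noncomputable section

namespace GuptaBleuler

variable {n : ℕ} {γ : Gammas n} {v : Spinor n} {c : ℂ}

/-! ### Maximal vectors -/

theorem IsPosPair.valid {j k : ℤ} (h : IsPosPair n j k) : Valid n j ∧ Valid n k := by
  rcases h with ⟨h1, h2, h3, h4⟩ | ⟨h1, h2, h3⟩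
  · unfold parity at *
    exact ⟨⟨by omega, fun h => by omega⟩, ⟨by omega, fun h => by omega⟩⟩
  · exact ⟨⟨by omega, fun h => by omega⟩, ⟨by omega, fun h => by omega⟩⟩

/-- The derivative along `isoCoeff (-1)` is the only one acting on powers of `x_1`. So on power
fields the positive root vectors act through their spin part alone. -/
theorem IsPosPair.ne_neg_one {j k : ℤ} (h : IsPosPair n j k) : j ≠ -1 ∧ k ≠ -1 := by
  rcases h with ⟨h1, h2, h3, h4⟩ | ⟨h1, h2, h3⟩
  · unfold parity at *; omega
  · omega

theorem IsVac.vac_nilp (hV : IsVac γ v c) {j k : ℤ} (h : IsPosPair n j k) :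
    (omega γ j).mulVec ((omega γ k).mulVec v) -
      ip (isoCoeff j : Fin (n + 2) → ℂ) (isoCoeff k) • v = 0 := by
  have hv := h.valid
  rw [ip_isoCoeff hv.1 hv.2]
  rcases h with ⟨h1, h2, h3, h4⟩ | ⟨h1, h2, h3⟩
  · by_cases hk : 1 ≤ k
    · rw [hV.omega_zero hk h4, if_neg (by unfold parity at *; omega), Matrix.mulVec_zero, zero_smul,
        sub_zero]
    · have hk0 : k = 0 := by unfold parity at *; omega
      subst hk0
      by_cases hj : 1 ≤ j
      · rw [omega_mulVec_comm hV.clifford hv.1 hv.2 (by omega), hV.omega_zero hj h2,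
          if_neg (by omega), Matrix.mulVec_zero, zero_smul, sub_zero, neg_zero]
      · have hj0 : j = 0 := by unfold parity at *; omega
        subst hj0
        rw [Matrix.mulVec_mulVec, omega_zero_sq hV.clifford (hv.1.2 rfl), if_pos (by simp),
          Matrix.neg_mulVec, Matrix.one_mulVec, neg_smul, one_smul, sub_self]
  · rw [omega_mulVec_comm hV.clifford hv.1 hv.2 (by omega), hV.omega_zero h1 (by omega),
      if_neg (by omega), Matrix.mulVec_zero, zero_smul, sub_zero, neg_zero]

/-- For odd `n` the vector is a multiple of the vacuum. For even `n`, `ω_r` is the only annihilator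
that does not kill `ω_{-r} v`, and every positive pair either contains a smaller positive index,
which can be moved to act first, or is `(r, r)`, where `ω_r² = 0`. -/
theorem IsVac.star_nilp (hV : IsVac γ v c) {j k : ℤ} (h : IsPosPair n j k) :
    (omega γ j).mulVec ((omega γ k).mulVec ((omegaStar γ).mulVec v)) -
      ip (isoCoeff j : Fin (n + 2) → ℂ) (isoCoeff k) • (omegaStar γ).mulVec v = 0 := by
  have hγ := hV.clifford
  change (omega γ j).mulVec ((omega γ k).mulVec ((omega γ (starIdx n)).mulVec v)) -
      ip (isoCoeff j : Fin (n + 2) → ℂ) (isoCoeff k) • (omega γ (starIdx n)).mulVec v = 0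
  rcases Nat.mod_two_eq_zero_or_one n with hp | hp
  · have hv := h.valid
    have hs := valid_starIdx n
    rw [starIdx_even hp] at hs ⊢
    have hkill : ∀ j : ℤ, 1 ≤ j → j < rk n →
        (omega γ j).mulVec ((omega γ (-(rk n : ℤ))).mulVec v) = 0 := by
      intro j h1 h2
      rw [omega_mulVec_comm hγ ⟨by omega, by omega⟩ hs (by omega),
        hV.omega_zero h1 (by omega), Matrix.mulVec_zero, neg_zero]
    rw [ip_isoCoeff hv.1 hv.2]
    rcases h with ⟨h1, h2, h3, h4⟩ | ⟨h1, h2, h3⟩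
    · unfold parity at h1 h3
      rw [if_neg (by omega), zero_smul, sub_zero]
      by_cases hjk : j = k
      · rw [hjk, Matrix.mulVec_mulVec, omega_sq hγ hv.2 (by omega), Matrix.zero_mulVec]
      · by_cases hk : k = rk n
        · rw [omega_mulVec_comm hγ hv.1 hv.2 (by omega), hkill j (by omega) (by omega),
            Matrix.mulVec_zero, neg_zero]
        · rw [hkill k (by omega) (by omega), Matrix.mulVec_zero]
    · rw [if_neg (by omega), zero_smul, sub_zero, omega_mulVec_comm hγ hv.1 hv.2 (by omega),
        hkill j h1 (by omega), Matrix.mulVec_zero, neg_zero]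
  · obtain ⟨μ, hμ, hm⟩ := exists_omega_zero_eigen hγ hp hV.ne_zero hV.vacuum
    rw [starIdx_odd hp, hm, Matrix.mulVec_smul, Matrix.mulVec_smul, smul_comm _ μ, ← smul_sub,
      hV.vac_nilp h, smul_zero]

theorem IsVac.vac_weight (hV : IsVac γ v c) (i : Fin (rk n)) :
    (omega γ (-((i.val : ℤ) + 1))).mulVec ((omega γ ((i.val : ℤ) + 1)).mulVec v) = 0 := by
  rw [hV.omega_zero (by omega) (by have := i.2; omega), Matrix.mulVec_zero]

theorem IsVac.star_weight (hV : IsVac γ v c) (i : Fin (rk n)) (hi : i.val ≠ 0) :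
    (omega γ (-((i.val : ℤ) + 1))).mulVec ((omega γ ((i.val : ℤ) + 1)).mulVec
      ((omegaStar γ).mulVec v)) = (2 * (weightGauge n i : ℂ) - 1) • (omegaStar γ).mulVec v := by
  have hγ := hV.clifford
  have hi2 := i.2
  change (omega γ (-((i.val : ℤ) + 1))).mulVec ((omega γ ((i.val : ℤ) + 1)).mulVec
      ((omega γ (starIdx n)).mulVec v)) = (2 * (weightGauge n i : ℂ) - 1) •
      (omega γ (starIdx n)).mulVec v
  unfold weightGauge
  rw [if_neg hi]
  have hvi : Valid n ((i.val : ℤ) + 1) := ⟨by omega, by omega⟩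
  have hs := valid_starIdx n
  rcases Nat.mod_two_eq_zero_or_one n with hp | hp
  · rw [starIdx_even hp] at hs ⊢
    by_cases hr : i.val + 1 = rk n
    · have e : (i.val : ℤ) + 1 = rk n := by omega
      rw [if_pos hr, e, omega_mulVec_neg hγ (e ▸ hvi) v, hV.omega_zero (by omega) le_rfl, Matrix.mulVec_zero, neg_zero, zero_sub,
        Matrix.mulVec_neg, Matrix.mulVec_smul]
      unfold parity
      rw [hp]
      push_cast
      module
    · rw [if_neg hr, omega_mulVec_comm hγ hvi hs (by omega), hV.omega_zero (by omega) (by omega),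
        Matrix.mulVec_zero, neg_zero, Matrix.mulVec_zero]
      push_cast
      module
  · obtain ⟨μ, hμ, hm⟩ := exists_omega_zero_eigen hγ hp hV.ne_zero hV.vacuum
    have hw : (if i.val + 1 = rk n then (parity n : ℝ) - 1 / 2 else 1 / 2) = 1 / 2 := by
      unfold parity
      rw [hp]
      split_ifs <;> norm_num
    rw [hw, starIdx_odd hp, hm, Matrix.mulVec_smul, Matrix.mulVec_smul, hV.vac_weight]
    push_cast
    module

theorem rootOp_powField (hn : 1 ≤ n) {j k : ℤ} (hj : j ≠ -1) (hk : k ≠ -1) (s : ℂ) (u : Spinor n) :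
    rootOp (fieldRep γ) j k (powField s u) = (1 / 2 : ℂ) • powField s
      ((omega γ j).mulVec ((omega γ k).mulVec u) -
        ip (isoCoeff j : Fin (n + 2) → ℂ) (isoCoeff k) • u) := by
  rw [rootOp_fieldRep, genOp_powField (dirD_isoCoeff_powField hn hj s u)
    (dirD_isoCoeff_powField hn hk s u), powField_smul, Matrix.mulVec_mulVec, omega_eq_gam,
    omega_eq_gam]

/-- The Cartan generators on the fields `x_1^s u`. -/
theorem cartan_powField (hn : 1 ≤ n) (i : Fin (rk n)) (s : ℂ) (u : Spinor n) {w : ℂ}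
    (hw : (omega γ (-((i.val : ℤ) + 1))).mulVec ((omega γ ((i.val : ℤ) + 1)).mulVec u) =
      (2 * w - 1) • u) :
    rootOp (fieldRep γ) (-((i.val : ℤ) + 1)) ((i.val : ℤ) + 1) (powField s u) =
      ((if i.val = 0 then s else 0) + w) • powField s u := by
  by_cases hi : i.val = 0
  · rw [hi] at hw ⊢
    rw [if_pos rfl, rootOp_fieldRep]
    simp only [Nat.cast_zero, zero_add] at hw ⊢
    rw [H_powField, hw, powField_add, powField_smul]
    module
  · have hvi : Valid n ((i.val : ℤ) + 1) := by
      have := i.2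
      exact ⟨by omega, by omega⟩
    rw [if_neg hi, rootOp_powField hn (by omega) (by omega), hw, ip_isoCoeff hvi.neg hvi,
      if_pos rfl, powField_sub, powField_smul, powField_smul]
    module

theorem IsVac.nilp_Psi2 (hV : IsVac γ v c) {j k : ℤ} (h : IsPosPair n j k) :
    rootOp (fieldRep γ) j k (Psi2 v) = 0 := by
  rw [Psi2, rootOp_powField (by have := hV.three_le; omega) h.ne_neg_one.1 h.ne_neg_one.2,
    hV.vac_nilp h, powField_zero, smul_zero]

theorem IsVac.weight_Psi2 (hV : IsVac γ v c) (i : Fin (rk n)) :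
    rootOp (fieldRep γ) (-((i.val : ℤ) + 1)) ((i.val : ℤ) + 1) (Psi2 v) =
      (weightPhys n i : ℂ) • Psi2 v := by
  rw [Psi2, cartan_powField (by have := hV.three_le; omega) i _ v (w := 1 / 2)
    (by rw [hV.vac_weight]; module)]
  congr 1
  unfold weightPhys
  split_ifs
  · push_cast; ring
  · simp

theorem rootOp_ySlash (hγ : IsClifford γ) (j k : ℤ) (f : SpinorField n) :
    rootOp (fieldRep γ) j k (ySlash γ f) = ySlash γ (rootOp (fieldRep γ) j k f) := by
  rw [rootOp_fieldRep, genOp_spat_slash hγ]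

theorem IsVac.nilp_Psi3 (hV : IsVac γ v c) {j k : ℤ} (h : IsPosPair n j k) :
    rootOp (fieldRep γ) j k (Psi3 γ v) = 0 := by
  rw [Psi3, rootOp_ySlash hV.clifford,
    rootOp_powField (by have := hV.three_le; omega) h.ne_neg_one.1 h.ne_neg_one.2,
    hV.star_nilp h, powField_zero, smul_zero, map_zero]

theorem IsVac.weight_Psi3 (hV : IsVac γ v c) (i : Fin (rk n)) :
    rootOp (fieldRep γ) (-((i.val : ℤ) + 1)) ((i.val : ℤ) + 1) (Psi3 γ v) =
      (weightGauge n i : ℂ) • Psi3 γ v := by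
  have hn : 1 ≤ n := by have := hV.three_le; omega
  rw [Psi3, rootOp_ySlash hV.clifford]
  by_cases hi : i.val = 0
  · rw [cartan_powField hn i _ _ (w := 1 / 2)
      (by
        rw [hi]
        simp only [Nat.cast_zero, zero_add]
        rw [hV.star_mem.1, Matrix.mulVec_zero]; module), map_smul]
    congr 1
    unfold weightGauge
    rw [if_pos hi, if_pos hi]
    push_cast; ring
  · rw [cartan_powField hn i _ _ (hV.star_weight i hi), if_neg hi, zero_add, map_smul]

theorem IsVac.weight_Psi1 (hV : IsVac γ v c) (i : Fin (rk n)) :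
    rootOp (fieldRep γ) (-((i.val : ℤ) + 1)) ((i.val : ℤ) + 1) (Psi1 γ v) =
      (weightGauge n i : ℂ) • Psi1 γ v := by
  have hn : 1 ≤ n := by have := hV.three_le; omega
  have hγ := hV.clifford
  by_cases hi : i.val = 0
  · rw [Psi1, cartan_powField hn i _ _ (w := -1 / 2)
      (by
        rw [hi]
        simp only [Nat.cast_zero, zero_add]
        rw [← Matrix.mulVec_mulVec, omega_mulVec_neg hγ (valid_one n), hV.star_mem.1,
          Matrix.mulVec_zero, neg_zero, zero_sub, Matrix.mulVec_neg, Matrix.mulVec_smul]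
        module)]
    congr 1
    unfold weightGauge
    rw [if_pos hi, if_pos hi]
    push_cast; ring
  · have hvi : Valid n ((i.val : ℤ) + 1) := by
      have := i.2
      exact ⟨by omega, by omega⟩
    have hone : Valid n (-1) := (valid_one n).neg
    rw [Psi1, cartan_powField hn i _ _ (w := weightGauge n i) (by
      rw [← Matrix.mulVec_mulVec, omega_mulVec_comm hγ hvi hone (by omega), Matrix.mulVec_neg,
        omega_mulVec_comm hγ hvi.neg hone (by omega), _root_.neg_neg, hV.star_weight i hi,
        Matrix.mulVec_smul]), if_neg hi, zero_add]

/-- `Psi1` is maximal only modulo the module of `Psi2`. If an index equals `1`, the result is a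
power field with spinor in the kernel of `ω_1`, which belongs to that module. Otherwise `ω_{-1}` can
be moved to the front and `star_nilp` gives zero. -/
theorem IsVac.nilp_Psi1 (hV : IsVac γ v c) {j k : ℤ} (h : IsPosPair n j k) :
    rootOp (fieldRep γ) j k (Psi1 γ v) ∈ cyclic (fieldRep γ) (Psi2 v) := by
  have hn : 1 ≤ n := by have := hV.three_le; omega
  have hγ := hV.clifford
  have hone : Valid n (-1) := (valid_one n).neg
  have hv := h.valid
  have hne := h.ne_neg_one
  rw [Psi1, rootOp_powField hn hne.1 hne.2, ← Matrix.mulVec_mulVec]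
  refine Submodule.smul_mem _ _ ?_
  set s := (omegaStar γ).mulVec v with hs
  have hodd : ∀ k : ℤ, k ≠ -1 → powField (-(n : ℂ) / 2) ((omega γ 1).mulVec ((omega γ k).mulVec
      ((omega γ (-1)).mulVec s))) ∈ cyclic (fieldRep γ) (Psi2 v) := by
    intro k hk
    refine hV.powField_mem (invariant_cyclic _ _) (mem_cyclic_self _ _) ?_
    have := omega_mem_spinorKer hγ (j := 1) (Or.inl rfl)
      (((hV.star_mem.2).omega_mulVec hγ (-1)).omega_mulVec hγ k)
    simpa only [_root_.neg_neg] using this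
  by_cases hj : j = 1
  · rw [ip_isoCoeff hv.1 hv.2, if_neg (by omega), zero_smul, sub_zero, hj]
    exact hodd k hne.2
  · by_cases hk : k = 1
    · rw [ip_isoCoeff hv.1 hv.2, if_neg (by omega), zero_smul, sub_zero, hk,
        omega_mulVec_comm hγ hv.1 (valid_one n) (by omega), powField_neg]
      exact Submodule.neg_mem _ (hodd j hne.1)
    · rw [omega_mulVec_comm hγ hv.2 hone (by omega), Matrix.mulVec_neg,
        omega_mulVec_comm hγ hv.1 hone (by omega), _root_.neg_neg, ← Matrix.mulVec_smul,
        ← Matrix.mulVec_sub, hV.star_nilp h, Matrix.mulVec_zero, powField_zero]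
      exact Submodule.zero_mem _

end GuptaBleuler

end

noncomputable section

namespace GuptaBleuler

variable {n : ℕ}

/-! ### The topology of the space of fields -/

/-- The operator `∂_{a_1} ⋯ ∂_{a_k}`. -/
def word (w : List (Fin (n + 2))) : Module.End ℂ (SpinorField n) := (w.map pd).prod

theorem isInducing_jet (n : ℕ) : Topology.IsInducing (jet n) := ⟨rfl⟩

theorem tendsto_field_iff {ι : Type*} {l : Filter ι} {F : ι → SpinorField n} {f : SpinorField n} :
    Filter.Tendsto F l (𝓝 f) ↔ ∀ w, ∀ B ∈ compactTraces n, ∀ ε > 0, ∀ᶠ x in l, ∀ z ∈ B,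
      ‖word w (F x) z - word w f z‖ < ε := by
  rw [(isInducing_jet n).tendsto_nhds_iff, tendsto_pi_nhds]
  refine forall_congr' fun w => ?_
  rw [UniformOnFun.tendsto_iff_tendstoUniformlyOn]
  refine forall₂_congr fun B _ => ?_
  rw [Metric.tendstoUniformlyOn_iff]
  refine forall₂_congr fun ε _ => ?_
  refine Filter.eventually_congr (Filter.Eventually.of_forall fun x => forall₂_congr fun z _ => ?_)
  rw [dist_comm, dist_eq_norm]
  rfl

/-- The operators `O` for which `O (F x)` tends to zero uniformly on the traces of compact sets. -/
def smallOps {ι : Type*} (l : Filter ι) (F : ι → SpinorField n) :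
    Submodule ℂ (Module.End ℂ (SpinorField n)) where
  carrier := {O | ∀ B ∈ compactTraces n, ∀ ε > 0, ∀ᶠ x in l, ∀ z ∈ B, ‖O (F x) z‖ < ε}
  zero_mem' := fun B _ ε hε => Filter.Eventually.of_forall fun f z _ => by
    change ‖(0 : Spinor n)‖ < ε
    rwa [norm_zero]
  add_mem' := by
    intro O O' h h' B hB ε hε
    filter_upwards [h B hB (ε / 2) (by positivity), h' B hB (ε / 2) (by positivity)] with x hf hf'
    intro z hz
    calc ‖O (F x) z + O' (F x) z‖ ≤ ‖O (F x) z‖ + ‖O' (F x) z‖ := norm_add_le _ _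
      _ < ε / 2 + ε / 2 := add_lt_add (hf z hz) (hf' z hz)
      _ = ε := by ring
  smul_mem' := by
    intro c O h B hB ε hε
    filter_upwards [h B hB (ε / (‖c‖ + 1)) (by positivity)] with x hf
    intro z hz
    change ‖c • O (F x) z‖ < ε
    rw [norm_smul]
    have h1 := hf z hz
    rw [lt_div_iff₀ (by positivity)] at h1
    nlinarith [norm_nonneg (O (F x) z), norm_nonneg c]

/-- The operators `O` for which `f ↦ O f` is continuous for uniform convergence on the traces of
compact sets. -/
def unifOps (n : ℕ) : Submodule ℂ (Module.End ℂ (SpinorField n)) := smallOps (𝓝 0) id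

theorem tendsto_of_word_mem_smallOps {ι : Type*} {l : Filter ι} {F : ι → SpinorField n}
    {f : SpinorField n} (h : ∀ w, word w ∈ smallOps l fun x => F x - f) :
    Filter.Tendsto F l (𝓝 f) := by
  rw [tendsto_field_iff]
  intro w B hB ε hε
  filter_upwards [h w B hB ε hε] with x hx z hz
  have := hx z hz
  rw [map_sub] at this
  exact this

theorem word_mem_unifOps (w : List (Fin (n + 2))) : word w ∈ unifOps n := by
  intro B hB ε hε
  have h := tendsto_field_iff.1 (Filter.tendsto_id (α := SpinorField n) (x := 𝓝 0)) w B hB ε hε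
  filter_upwards [h] with f hf z hz
  have := hf z hz
  rw [map_zero] at this
  have e : word w (id f) z - (0 : SpinorField n) z = word w f z := sub_zero _
  rwa [e] at this

theorem exists_norm_mulVec_le (A : Matrix (Fin (2 ^ rk n)) (Fin (2 ^ rk n)) ℂ) :
    ∃ C > 0, ∀ s : Spinor n, ‖A.mulVec s‖ ≤ C * ‖s‖ := by
  obtain ⟨C, hC, h⟩ := (Matrix.toLin' A).toContinuousLinearMap.bound
  exact ⟨C, hC, h⟩

theorem exists_norm_coord_le {B : Set (Cover n)} (hB : B ∈ compactTraces n) (a : Fin (n + 2)) :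
    ∃ C > 0, ∀ z ∈ B, |coord a z| ≤ C := by
  obtain ⟨K, hK, _, rfl⟩ := hB
  obtain ⟨C, hC⟩ := hK.exists_bound_of_continuousOn (contDiff_coord a).continuous.continuousOn
  exact ⟨max C 1, by positivity, fun z hz => (hC z hz.1).trans (le_max_left _ _)⟩

theorem mul_mem_unifOps {M O : Module.End ℂ (SpinorField n)} (hO : O ∈ unifOps n)
    (hM : ∀ B ∈ compactTraces n, ∃ C > 0, ∀ z ∈ B, ∀ f : SpinorField n, ‖M f z‖ ≤ C * ‖f z‖) :
    M * O ∈ unifOps n := by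
  intro B hB ε hε
  obtain ⟨C, hC, hM⟩ := hM B hB
  filter_upwards [hO B hB (ε / C) (by positivity)] with f hf z hz
  calc ‖M (O f) z‖ ≤ C * ‖O f z‖ := hM z hz _
    _ < C * (ε / C) := by gcongr; exact hf z hz
    _ = ε := by field_simp

theorem mulMat_mul_mem_unifOps (A : Matrix (Fin (2 ^ rk n)) (Fin (2 ^ rk n)) ℂ)
    {O : Module.End ℂ (SpinorField n)} (hO : O ∈ unifOps n) : mulMat A * O ∈ unifOps n := by
  obtain ⟨C, hC, h⟩ := exists_norm_mulVec_le A
  exact mul_mem_unifOps hO fun B _ => ⟨C, hC, fun z _ f => h (f z)⟩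

theorem mulY_mul_mem_unifOps (a : Fin (n + 2)) {O : Module.End ℂ (SpinorField n)}
    (hO : O ∈ unifOps n) : mulY a * O ∈ unifOps n := by
  refine mul_mem_unifOps hO fun B hB => ?_
  obtain ⟨C, hC, h⟩ := exists_norm_coord_le hB a
  refine ⟨C, hC, fun z hz f => ?_⟩
  rw [mulY_apply, norm_smul, Real.norm_eq_abs]
  gcongr
  exact h z hz

theorem continuous_of_word_mul {O : Module.End ℂ (SpinorField n)}
    (h : ∀ w, word w * O ∈ unifOps n) : Continuous O := by
  refine continuous_of_continuousAt_zero O.toAddMonoidHom ?_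
  change Filter.Tendsto O (𝓝 0) (𝓝 (O 0))
  rw [map_zero, tendsto_field_iff]
  intro w B hB ε hε
  filter_upwards [h w B hB ε hε] with f hf z hz
  rw [map_zero]
  have e : word w (O f) z - (0 : SpinorField n) z = (word w * O) f z := sub_zero _
  rw [e]
  exact hf z hz

theorem word_cons (a : Fin (n + 2)) (w : List (Fin (n + 2))) : word (a :: w) = pd a * word w := by
  unfold word; simp

theorem word_append (w w' : List (Fin (n + 2))) : word (w ++ w') = word w * word w' := by
  unfold word; simp

theorem word_singleton (a : Fin (n + 2)) : word [a] = pd a := by unfold word; simp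

theorem continuous_pd (a : Fin (n + 2)) : Continuous (pd a : SpinorField n → SpinorField n) :=
  continuous_of_word_mul fun w => by
    rw [← word_singleton, ← word_append]; exact word_mem_unifOps _

theorem word_mulMat (w : List (Fin (n + 2))) (A : Matrix (Fin (2 ^ rk n)) (Fin (2 ^ rk n)) ℂ) :
    word w * mulMat A = mulMat A * word w := by
  induction w with
  | nil => unfold word; simp
  | cons a w ih => rw [word_cons, mul_assoc, ih, ← mul_assoc, ← mulMat_pd, mul_assoc]

theorem continuous_mulMat (A : Matrix (Fin (2 ^ rk n)) (Fin (2 ^ rk n)) ℂ) :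
    Continuous (mulMat A : SpinorField n → SpinorField n) :=
  continuous_of_word_mul fun w => by
    rw [word_mulMat]; exact mulMat_mul_mem_unifOps A (word_mem_unifOps w)

/-- Leibniz' rule: derivatives of the coordinates along the frame are constants, so the remainder is
a combination of words with constant coefficients. Hence multiplication by a coordinate is
continuous for the topology of all derivatives. -/
theorem word_mulY (w : List (Fin (n + 2))) (a : Fin (n + 2)) :
    ∃ P ∈ Submodule.span ℂ (Set.range (word (n := n))), word w * mulY a = mulY a * word w + P := by
  induction w with
  | nil => exact ⟨0, Submodule.zero_mem _, by unfold word; simp⟩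
  | cons b w ih =>
    obtain ⟨P, hP, h⟩ := ih
    refine ⟨pd b * P + (if b = a then 1 else 0) * word w, Submodule.add_mem _ ?_ ?_, ?_⟩
    · clear h
      induction hP using Submodule.span_induction with
      | mem x hx =>
        obtain ⟨w', rfl⟩ := hx
        exact Submodule.subset_span ⟨b :: w', word_cons b w'⟩
      | zero => rw [mul_zero]; exact Submodule.zero_mem _
      | add x y _ _ hx hy => rw [mul_add]; exact Submodule.add_mem _ hx hy
      | smul c x _ hx => rw [mul_smul_comm]; exact Submodule.smul_mem _ _ hx
    · split_ifs
      · rw [one_mul]; exact Submodule.subset_span ⟨w, rfl⟩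
      · rw [zero_mul]; exact Submodule.zero_mem _
    · rw [word_cons, mul_assoc, h, mul_add, ← mul_assoc, pd_mulY, add_mul, mul_assoc]
      split_ifs
      · simp only [one_smul, one_mul]; abel
      · simp only [zero_smul, zero_mul]; abel

theorem span_word_le_unifOps : Submodule.span ℂ (Set.range (word (n := n))) ≤ unifOps n :=
  Submodule.span_le.2 (by rintro _ ⟨w, rfl⟩; exact word_mem_unifOps w)

theorem continuous_mulY (a : Fin (n + 2)) : Continuous (mulY a : SpinorField n → SpinorField n) :=
  continuous_of_word_mul fun w => by
    obtain ⟨P, hP, h⟩ := word_mulY w a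
    rw [h]
    exact Submodule.add_mem _ (mulY_mul_mem_unifOps a (word_mem_unifOps w))
      (span_word_le_unifOps hP)

/-- The continuous operators. -/
def contOps (n : ℕ) : Subalgebra ℂ (Module.End ℂ (SpinorField n)) where
  carrier := {O | Continuous O}
  mul_mem' := fun h h' => h.comp h'
  one_mem' := continuous_id
  add_mem' := fun h h' => h.add h'
  zero_mem' := continuous_const
  algebraMap_mem' := fun c => by
    change Continuous fun f : SpinorField n => c • f
    exact continuous_const_smul c

theorem pd_mem_contOps (a : Fin (n + 2)) : pd a ∈ contOps n := continuous_pd a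

theorem mulY_mem_contOps (a : Fin (n + 2)) : mulY a ∈ contOps n := continuous_mulY a

theorem mulMat_mem_contOps (A : Matrix (Fin (2 ^ rk n)) (Fin (2 ^ rk n)) ℂ) :
    mulMat A ∈ contOps n := continuous_mulMat A

theorem fieldRep_mem_contOps (γ : Gammas n) (a b : Fin (n + 2)) : fieldRep γ a b ∈ contOps n :=
  (contOps n).add_mem ((contOps n).sub_mem
    ((contOps n).smul_mem ((contOps n).mul_mem (mulY_mem_contOps a) (pd_mem_contOps b)) _)
    ((contOps n).smul_mem ((contOps n).mul_mem (mulY_mem_contOps b) (pd_mem_contOps a)) _))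
    (mulMat_mem_contOps _)

theorem genOp_mem_contOps (γ : Gammas n) (ξ ζ : Fin (n + 2) → ℂ) : genOp γ ξ ζ ∈ contOps n := by
  rw [← sum_sum_fieldRep]
  exact (contOps n).sum_mem fun a _ => (contOps n).sum_mem fun b _ =>
    (contOps n).smul_mem (fieldRep_mem_contOps γ a b) _

theorem dirD_mem_contOps (ξ : Fin (n + 2) → ℂ) : dirD ξ ∈ contOps n :=
  (contOps n).sum_mem fun a _ => (contOps n).smul_mem (pd_mem_contOps a) _

theorem ySlash_mem_contOps (γ : Gammas n) : ySlash γ ∈ contOps n :=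
  (contOps n).sum_mem fun a _ => (contOps n).mul_mem (mulY_mem_contOps a) (mulMat_mem_contOps _)

theorem contOps_mem_unifOps {O : Module.End ℂ (SpinorField n)} (hO : O ∈ contOps n) :
    O ∈ unifOps n := by
  intro B hB ε hε
  have h : Filter.Tendsto O (𝓝 0) (𝓝 0) := by
    have := (show Continuous O from hO).tendsto 0
    rwa [map_zero] at this
  exact h.eventually (word_mem_unifOps [] B hB ε hε)

theorem invariant_closure {γ : Gammas n} {W : Submodule ℂ (SpinorField n)}
    (hW : Invariant (fieldRep γ) W) : Invariant (fieldRep γ) W.topologicalClosure := by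
  intro a b f hf
  exact map_mem_closure (show Continuous (fieldRep γ a b) from fieldRep_mem_contOps γ a b) hf
    fun g hg => hW a b g hg

theorem singleton_mem_compactTraces {z : Cover n} (hz : z ∈ HPlus n) : {z} ∈ compactTraces n :=
  ⟨{z}, isCompact_singleton, by simpa using Or.inl hz, by
    rw [Set.singleton_inter_of_mem hz]⟩

theorem continuous_eval_of_mem_unifOps {O : Module.End ℂ (SpinorField n)} (hO : O ∈ unifOps n)
    {z : Cover n} (hz : z ∈ HPlus n) : Continuous fun f : SpinorField n => O f z := by
  let e : SpinorField n →+ Spinor n := ⟨⟨fun f => O f z, by rw [map_zero]; rfl⟩,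
    fun f g => by
      change (O (f + g)) z = O f z + O g z
      rw [map_add]; rfl⟩
  refine continuous_of_continuousAt_zero e ?_
  change Filter.Tendsto e (𝓝 0) (𝓝 (e 0))
  rw [map_zero, Metric.tendsto_nhds]
  intro ε hε
  filter_upwards [hO {z} (singleton_mem_compactTraces hz) ε hε] with f hf
  rw [dist_zero_right]
  exact hf z rfl

/-- Evaluation at a point of `H_+` is continuous, so the space is separated. This allows `⊥` to be
treated as the closure of a module, on the same footing as the other denominators. -/
theorem closure_bot_field : (⊥ : Submodule ℂ (SpinorField n)).topologicalClosure = ⊥ := by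
  rw [eq_bot_iff]
  intro f hf
  rw [Submodule.mem_bot]
  refine field_ext fun z hz => ?_
  have hc := continuous_eval_of_mem_unifOps (n := n) (contOps_mem_unifOps (one_mem (contOps n))) hz
  have hcl : IsClosed {f : SpinorField n | f z = 0} := isClosed_singleton.preimage hc
  exact closure_minimal (s := ((⊥ : Submodule ℂ (SpinorField n)) : Set (SpinorField n)))
    (fun g hg => by rw [(Submodule.mem_bot ℂ).1 hg]; rfl) hcl hf

end GuptaBleuler

end

noncomputable section

namespace GuptaBleuler

variable {n : ℕ}

/-! ### Rotations in the time plane -/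

theorem ySq_eq (z : Cover n) : ySq z = Real.exp z.1.re ^ 2 - ∑ i, z.2 i ^ 2 := by
  unfold ySq
  rw [Fin.sum_univ_succ, Fin.sum_univ_succ]
  have h0 : coord 0 z = (Complex.exp z.1).re := rfl
  have h1 : coord (Fin.succ 0) z = (Complex.exp z.1).im := rfl
  have h2 : ∀ i : Fin n, coord i.succ.succ z = z.2 i := fun i => rfl
  have hn : (Complex.exp z.1).re ^ 2 + (Complex.exp z.1).im ^ 2 = Real.exp z.1.re ^ 2 := by
    rw [← Complex.norm_exp, ← Complex.normSq_eq_norm_sq, Complex.normSq_apply]; ring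
  simp only [h0, h1, h2, ← hn]
  simp [eta]
  ring

/-- The lift to the covering of the rotation by the angle `t` in the time plane. -/
def rotZ (t : ℝ) (z : Cover n) : Cover n := (z.1 + t * Complex.I, z.2)

theorem ySq_rotZ (t : ℝ) (z : Cover n) : ySq (rotZ t z) = ySq z := by
  rw [ySq_eq, ySq_eq]; simp [rotZ]

theorem rotZ_mem_HPlus {t : ℝ} {z : Cover n} (hz : z ∈ HPlus n) : rotZ t z ∈ HPlus n := by
  change 0 < ySq _; rw [ySq_rotZ]; exact hz

theorem continuous_rotZ : Continuous fun p : ℝ × Cover n => rotZ p.1 p.2 := by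
  unfold rotZ; fun_prop

/-- Rotations of the time plane preserve `y²`, and the image of a compact set under a compact
interval of angles is compact. It supplies the sets on which averages are controlled. -/
theorem exists_saturation {B : Set (Cover n)} (hB : B ∈ compactTraces n) :
    ∃ B' ∈ compactTraces n, ∀ z ∈ B, ∀ t ∈ Set.Icc 0 (2 * Real.pi), rotZ t z ∈ B' := by
  obtain ⟨K, hK, hKs, rfl⟩ := hB
  refine ⟨_, ⟨(fun p : ℝ × Cover n => rotZ p.1 p.2) '' (Set.Icc 0 (2 * Real.pi) ×ˢ K),
    (isCompact_Icc.prod hK).image continuous_rotZ, ?_, rfl⟩, ?_⟩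
  · rintro _ ⟨⟨t, z⟩, ⟨_, hz⟩, rfl⟩
    rcases hKs hz with h | h
    · exact Or.inl (rotZ_mem_HPlus h)
    · right
      change ySq (rotZ t z) = 0
      rw [ySq_rotZ]; exact h
  · intro z hz t ht
    exact ⟨⟨(t, z), ⟨ht, hz.1⟩, rfl⟩, rotZ_mem_HPlus hz.2⟩

/-- The spinor rotation by the angle `t` in the time plane. -/
def rotS (γ : Gammas n) (t : ℝ) (s : Spinor n) : Spinor n :=
  Real.cos (t / 2) • s + Real.sin (t / 2) • (γ 0 * γ 1).mulVec s

theorem rotS_add (γ : Gammas n) (t : ℝ) (s s' : Spinor n) :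
    rotS γ t (s + s') = rotS γ t s + rotS γ t s' := by
  unfold rotS; rw [Matrix.mulVec_add]; module

theorem rotS_smul (γ : Gammas n) (t : ℝ) (c : ℂ) (s : Spinor n) :
    rotS γ t (c • s) = c • rotS γ t s := by
  unfold rotS
  rw [Matrix.mulVec_smul, smul_add, smul_comm c (Real.cos _), smul_comm c (Real.sin _)]

theorem exists_norm_rotS_le (γ : Gammas n) :
    ∃ C > 0, ∀ t, ∀ s : Spinor n, ‖rotS γ t s‖ ≤ C * ‖s‖ := by
  obtain ⟨C, hC, h⟩ := exists_norm_mulVec_le (γ 0 * γ 1)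
  refine ⟨1 + C, by positivity, fun t s => ?_⟩
  calc ‖rotS γ t s‖ ≤ ‖Real.cos (t / 2) • s‖ + ‖Real.sin (t / 2) • (γ 0 * γ 1).mulVec s‖ :=
        norm_add_le _ _
    _ ≤ 1 * ‖s‖ + 1 * (C * ‖s‖) := by
        rw [norm_smul, norm_smul]
        gcongr
        · exact Real.abs_cos_le_one _
        · exact Real.abs_sin_le_one _
        · exact h s
    _ = (1 + C) * ‖s‖ := by ring

/-- In the logarithmic coordinate of the covering, rotation of the time plane is translation in the
imaginary direction. So the orbital part of its generator is a derivative in a constant direction.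
-/
theorem frame_rot (z : Cover n) :
    (coord 0 z) • frame 1 z - (coord 1 z) • frame 0 z = ((Complex.I, 0) : Cover n) := by
  have h0 : (frame 0 z : Cover n) = (Complex.exp (-z.1), 0) := rfl
  have h1 : (frame 1 z : Cover n) = (Complex.I * Complex.exp (-z.1), 0) := rfl
  have c0 : coord 0 z = (Complex.exp z.1).re := rfl
  have c1 : coord 1 z = (Complex.exp z.1).im := rfl
  rw [h0, h1, c0, c1]
  refine Prod.ext ?_ (by simp)
  simp only [Prod.fst_sub, Prod.smul_fst, Complex.real_smul]
  have h := Complex.re_add_im (Complex.exp z.1)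
  have e : Complex.exp z.1 * Complex.exp (-z.1) = 1 := by
    rw [← Complex.exp_add, add_neg_cancel, Complex.exp_zero]
  calc ((Complex.exp z.1).re : ℂ) * (Complex.I * Complex.exp (-z.1)) -
        ((Complex.exp z.1).im : ℂ) * Complex.exp (-z.1)
      = Complex.I * ((((Complex.exp z.1).re : ℂ) + ((Complex.exp z.1).im : ℂ) * Complex.I) *
        Complex.exp (-z.1)) := by
        linear_combination (((Complex.exp z.1).im : ℂ) * Complex.exp (-z.1)) * (-Complex.I_mul_I)
    _ = Complex.I := by rw [h, e, mul_one]

theorem orbital_zero_one_apply (f : SpinorField n) {z : Cover n} (hz : z ∈ HPlus n) :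
    orbital 0 1 f z = fderiv ℝ f z (Complex.I, 0) := by
  rw [← frame_rot z, map_sub, map_smul, map_smul, ← pd_apply 1 f hz, ← pd_apply 0 f hz]
  unfold orbital
  simp only [LinearMap.sub_apply, LinearMap.smul_apply, Module.End.mul_apply, field_sub_apply,
    field_smul_apply, mulY_apply]
  simp [eta]

theorem fieldRep_zero_one_apply (γ : Gammas n) (f : SpinorField n) {z : Cover n}
    (hz : z ∈ HPlus n) : fieldRep γ 0 1 f z =
      fderiv ℝ f z (Complex.I, 0) + (1 / 2 : ℝ) • (γ 0 * γ 1).mulVec (f z) := by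
  rw [← orbital_zero_one_apply f hz]
  unfold fieldRep
  rw [LinearMap.add_apply, field_add_apply, mulMat_apply]
  congr 1
  have h2 : etaMat (0 : Fin (n + 2)) 1 = 0 := by unfold etaMat; simp
  unfold spinMat
  rw [h2, zero_smul, sub_zero, Matrix.smul_mulVec]
  ext i
  simp

theorem fieldRep_zero_one {γ : Gammas n} (hγ : IsClifford γ) :
    fieldRep γ 0 1 = Complex.I • genOp γ (isoCoeff (-1)) (isoCoeff 1) := by
  have hz : ∀ a, fieldRep γ a a = 0 := fun a => eq_zero_of_eq_neg ((isRep_fieldRep hγ).antisymm a a)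
  rw [← sum_sum_fieldRep]
  simp only [mul_smul, ← Finset.smul_sum]
  rw [sum_isoCoeff_neg_one, sum_isoCoeff_one, sum_isoCoeff_one, hz 0, hz 1,
    (isRep_fieldRep hγ).antisymm 1 0]
  have e : ∀ x : Module.End ℂ (SpinorField n), Complex.I • (Complex.I * (Real.sqrt 2 : ℂ)⁻¹) •
      ((Complex.I * (Real.sqrt 2 : ℂ)⁻¹) • (0 + Complex.I • x) -
        Complex.I • (Complex.I * (Real.sqrt 2 : ℂ)⁻¹) • (-x + Complex.I • (0 : _))) =
      (2 * (Complex.I * Complex.I) * ((Complex.I * (Real.sqrt 2 : ℂ)⁻¹) *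
        (Complex.I * (Real.sqrt 2 : ℂ)⁻¹))) • x := by
    intro x; module
  rw [e, null_sq, Complex.I_mul_I]
  norm_num

/-- The curve combines rotation of the point with the half-angle rotation of the spinor, the
exponential of `(t/2) γ 0 * γ 1`, whose generator squares to `-1`. Its velocity is therefore the
rotated value of the generator applied to the field. -/
theorem hasDerivAt_rot {γ : Gammas n} (hγ : IsClifford γ) (f : SpinorField n) {z : Cover n}
    (hz : z ∈ HPlus n) (t : ℝ) :
    HasDerivAt (fun t => rotS γ t (f (rotZ t z)))
      (rotS γ t (fieldRep γ 0 1 f (rotZ t z))) t := by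
  have hz' := rotZ_mem_HPlus (t := t) hz
  have h1 : HasDerivAt (fun t : ℝ => rotZ t z) ((Complex.I, 0) : Cover n) t := by
    have h2 : HasDerivAt (fun t : ℝ => z.1 + (t : ℂ) * Complex.I) Complex.I t := by
      have := ((Complex.ofRealCLM.hasDerivAt (x := t)).mul_const Complex.I).const_add z.1
      simpa using this
    exact h2.prodMk (hasDerivAt_const t z.2)
  have h2 : HasDerivAt (fun t : ℝ => f (rotZ t z)) (fderiv ℝ f (rotZ t z) (Complex.I, 0)) t :=
    (f.differentiableAt hz').hasFDerivAt.comp_hasDerivAt t h1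
  set J := γ 0 * γ 1 with hJ
  have h3 : HasDerivAt (fun t : ℝ => J.mulVec (f (rotZ t z)))
      (J.mulVec (fderiv ℝ f (rotZ t z) (Complex.I, 0))) t :=
    (((Matrix.toLin' J).restrictScalars ℝ).toContinuousLinearMap.hasFDerivAt).comp_hasDerivAt t h2
  have h4 : HasDerivAt (fun t : ℝ => t / 2) (1 / 2) t := (hasDerivAt_id t).div_const 2
  have h5 := (h4.cos.smul h2).add (h4.sin.smul h3)
  have hJJ : J * J = -1 := by
    have h01 : γ 1 * γ 0 = -(γ 0 * γ 1) := gamma_anticomm hγ (by simp)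
    have e : J * J = γ 0 * (γ 1 * γ 0) * γ 1 := by rw [hJ]; simp only [mul_assoc]
    rw [e, h01, mul_neg, neg_mul, ← mul_assoc, gamma_sq hγ, mul_assoc, gamma_sq hγ]
    simp [eta]
  refine h5.congr_deriv ?_
  rw [fieldRep_zero_one_apply γ f hz']
  unfold rotS
  rw [← hJ, Matrix.mulVec_add, Matrix.mulVec_smul, Matrix.mulVec_mulVec, hJJ, Matrix.neg_mulVec,
    Matrix.one_mulVec]
  module

/-- After multiplication by the inverse character the rotated value of an eigenfield has zero
derivative, so it is constant in `t`. -/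
theorem rot_eigen {γ : Gammas n} (hγ : IsClifford γ) {f : SpinorField n} {κ : ℝ}
    (hf : genOp γ (isoCoeff (-1)) (isoCoeff 1) f = (κ : ℂ) • f) {z : Cover n} (hz : z ∈ HPlus n)
    (t : ℝ) : rotS γ t (f (rotZ t z)) = Complex.exp (κ * t * Complex.I) • f z := by
  have h1 : ∀ t : ℝ, HasDerivAt
      (fun t : ℝ => Complex.exp (-(κ * t * Complex.I)) • rotS γ t (f (rotZ t z))) 0 t := by
    intro t
    have h2 : HasDerivAt (fun t : ℝ => -((κ : ℂ) * t * Complex.I)) (-(κ * Complex.I)) t := by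
      have := (((Complex.ofRealCLM.hasDerivAt (x := t)).const_mul (κ : ℂ)).mul_const
        Complex.I).neg
      simp only [Complex.ofRealCLM_apply, Complex.ofReal_one, mul_one] at this
      exact this
    refine (h2.cexp.smul (hasDerivAt_rot hγ f hz t)).congr_deriv ?_
    rw [fieldRep_zero_one hγ, LinearMap.smul_apply, hf, field_smul_apply, field_smul_apply,
      rotS_smul, rotS_smul]
    module
  have h2 := is_const_of_deriv_eq_zero (fun t => (h1 t).differentiableAt) (fun t => (h1 t).deriv) t 0
  have h3 : rotS γ 0 (f (rotZ 0 z)) = f z := by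
    simp [rotS, rotZ]
  simp only [Complex.ofReal_zero, mul_zero, zero_mul, neg_zero, Complex.exp_zero, one_smul,
    h3] at h2
  rw [← h2, smul_smul, ← Complex.exp_add, add_neg_cancel, Complex.exp_zero, one_smul]

/-! ### Averages -/

/-- The integrand of the average of weight `κ`. -/
def avgFun (γ : Gammas n) (κ : ℝ) (f : Cover n → Spinor n) (z : Cover n) (t : ℝ) : Spinor n :=
  Complex.exp (-(κ * t * Complex.I)) • rotS γ t (f (rotZ t z))

theorem continuous_avgFun {γ : Gammas n} (hγ : IsClifford γ) (κ : ℝ) (f : SpinorField n)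
    {z : Cover n} (hz : z ∈ HPlus n) : Continuous (avgFun γ κ f z) := by
  have h1 : Continuous fun t => rotS γ t (f (rotZ t z)) :=
    continuous_iff_continuousAt.2 fun t => (hasDerivAt_rot hγ f hz t).continuousAt
  have h2 : Continuous fun t : ℝ => Complex.exp (-((κ : ℂ) * t * Complex.I)) := by fun_prop
  exact h2.smul h1

/-- The average over the rotations in the time plane against the character of weight `κ`, evaluated
at a point. -/
def avg {γ : Gammas n} (hγ : IsClifford γ) (κ : ℝ) {z : Cover n} (hz : z ∈ HPlus n) :
    SpinorField n →ₗ[ℂ] Spinor n where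
  toFun f := (2 * Real.pi)⁻¹ • ∫ t in (0)..(2 * Real.pi), avgFun γ κ f z t
  map_add' f g := by
    rw [← smul_add, ← intervalIntegral.integral_add
      ((continuous_avgFun hγ κ f hz).intervalIntegrable _ _)
      ((continuous_avgFun hγ κ g hz).intervalIntegrable _ _)]
    congr 2
    funext t
    unfold avgFun
    rw [← smul_add, ← rotS_add]
    rfl
  map_smul' c f := by
    have h : ∀ t, avgFun γ κ (c • f : SpinorField n) z t = c • avgFun γ κ f z t := by
      intro t
      unfold avgFun
      rw [smul_comm c, ← rotS_smul γ t c]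
      rfl
    simp only [h]
    rw [RingHom.id_apply, smul_comm c, intervalIntegral.integral_smul]

theorem avg_apply {γ : Gammas n} (hγ : IsClifford γ) (κ : ℝ) {z : Cover n} (hz : z ∈ HPlus n)
    (f : SpinorField n) :
    avg hγ κ hz f = (2 * Real.pi)⁻¹ • ∫ t in (0)..(2 * Real.pi), avgFun γ κ f z t := rfl

theorem norm_avgFun (γ : Gammas n) (κ : ℝ) (f : Cover n → Spinor n) (z : Cover n) (t : ℝ) :
    ‖avgFun γ κ f z t‖ = ‖rotS γ t (f (rotZ t z))‖ := by
  unfold avgFun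
  rw [norm_smul]
  have : ‖Complex.exp (-((κ : ℂ) * t * Complex.I))‖ = 1 := by
    rw [Complex.norm_exp]; simp
  rw [this, one_mul]

theorem exists_norm_avg_le {γ : Gammas n} (hγ : IsClifford γ) : ∃ C > 0, ∀ (κ : ℝ) {z : Cover n}
    (hz : z ∈ HPlus n) (f : SpinorField n) (b : ℝ),
    (∀ t ∈ Set.Icc 0 (2 * Real.pi), ‖f (rotZ t z)‖ ≤ b) → ‖avg hγ κ hz f‖ ≤ C * b := by
  obtain ⟨C, hC, h⟩ := exists_norm_rotS_le γ
  refine ⟨C, hC, fun κ z hz f b hb => ?_⟩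
  have hpi : (0 : ℝ) ≤ 2 * Real.pi := by positivity
  have h1 : ‖∫ t in (0)..(2 * Real.pi), avgFun γ κ f z t‖ ≤ (C * b) * |2 * Real.pi - 0| := by
    refine intervalIntegral.norm_integral_le_of_norm_le_const fun t ht => ?_
    rw [Set.uIoc_of_le hpi] at ht
    rw [norm_avgFun]
    exact (h t _).trans (by gcongr; exact hb t ⟨ht.1.le, ht.2⟩)
  rw [avg_apply, norm_smul, norm_inv, Real.norm_eq_abs, abs_of_nonneg hpi]
  rw [sub_zero, abs_of_nonneg hpi] at h1
  have hpi' : (0 : ℝ) < 2 * Real.pi := by positivity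
  calc (2 * Real.pi)⁻¹ * ‖∫ t in (0)..(2 * Real.pi), avgFun γ κ f z t‖
      ≤ (2 * Real.pi)⁻¹ * ((C * b) * (2 * Real.pi)) := by gcongr
    _ = C * b := by field_simp

/-- Orthogonality of characters. The weights themselves need not be integers, but their differences
are, so integration over an interval of length `2π` suffices although the covering group is not
compact. -/
theorem avg_eigen {γ : Gammas n} (hγ : IsClifford γ) {f : SpinorField n} {κ κ' : ℝ} {m : ℤ}
    (hf : genOp γ (isoCoeff (-1)) (isoCoeff 1) f = (κ' : ℂ) • f) (hm : κ' - κ = m) {z : Cover n}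
    (hz : z ∈ HPlus n) : avg hγ κ hz f = if m = 0 then f z else 0 := by
  have h1 : ∀ t : ℝ, avgFun γ κ f z t = Complex.exp ((m * Complex.I) * t) • f z := by
    intro t
    unfold avgFun
    rw [rot_eigen hγ hf hz, smul_smul, ← Complex.exp_add]
    congr 2
    have : (κ' : ℂ) - κ = m := by exact_mod_cast congrArg (fun x : ℝ => (x : ℂ)) hm
    linear_combination (t * Complex.I) * this
  rw [avg_apply]
  simp only [h1]
  rw [intervalIntegral.integral_smul_const]
  have hpi : (2 * Real.pi) ≠ 0 := by positivity
  split_ifs with h0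
  · subst h0
    simp only [Int.cast_zero, zero_mul, Complex.exp_zero, intervalIntegral.integral_const, sub_zero]
    rw [Complex.real_smul, mul_one]
    ext i
    simp only [Pi.smul_apply, smul_eq_mul, Complex.real_smul]
    push_cast
    have : (Real.pi : ℂ) ≠ 0 := by exact_mod_cast Real.pi_ne_zero
    field_simp
  · have hmI : (m : ℂ) * Complex.I ≠ 0 := mul_ne_zero (by exact_mod_cast h0) Complex.I_ne_zero
    rw [integral_exp_mul_complex hmI]
    have : Complex.exp ((m : ℂ) * Complex.I * ((2 * Real.pi : ℝ) : ℂ)) = 1 := by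
      rw [Complex.exp_eq_one_iff]
      exact ⟨m, by push_cast; ring⟩
    rw [this]
    simp

theorem continuous_avg {γ : Gammas n} (hγ : IsClifford γ) (κ : ℝ) {z : Cover n} (hz : z ∈ HPlus n)
    {O : Module.End ℂ (SpinorField n)} (hO : O ∈ contOps n) :
    Continuous fun f : SpinorField n => avg hγ κ hz (O f) := by
  obtain ⟨C, hC, h⟩ := exists_norm_avg_le hγ
  obtain ⟨B, hB, hBz⟩ := exists_saturation (singleton_mem_compactTraces hz)
  refine continuous_of_continuousAt_zero ((avg hγ κ hz) ∘ₗ O).toAddMonoidHom ?_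
  change Filter.Tendsto ((avg hγ κ hz) ∘ₗ O) (𝓝 0) (𝓝 (((avg hγ κ hz) ∘ₗ O) 0))
  rw [map_zero, Metric.tendsto_nhds]
  intro ε hε
  filter_upwards [contOps_mem_unifOps hO B hB (ε / (2 * C)) (by positivity)] with f hf
  rw [dist_zero_right, LinearMap.comp_apply]
  calc ‖avg hγ κ hz (O f)‖ ≤ C * (ε / (2 * C)) :=
        h κ hz (O f) _ fun t ht => (hf _ (hBz z rfl t ht)).le
    _ = ε / 2 := by field_simp
    _ < ε := by linarith

end GuptaBleuler

end

noncomputable section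

namespace GuptaBleuler

variable {n : ℕ}

/-! ### Derivatives in the null basis -/

/-- The vectors of the null basis. -/
def nullVec : Bool ⊕ Fin n → Fin (n + 2) → ℂ
  | Sum.inl true => isoCoeff 1
  | Sum.inl false => isoCoeff (-1)
  | Sum.inr i => spat i

/-- Their weights. -/
def nullWt : Bool ⊕ Fin n → ℤ
  | Sum.inl true => 1
  | Sum.inl false => -1
  | Sum.inr _ => 0

/-- Iterated derivatives along the vectors of the null basis. -/
def nullWord : List (Bool ⊕ Fin n) → Module.End ℂ (SpinorField n)
  | [] => 1
  | i :: w => dirD (nullVec i) * nullWord w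

/-- The weight of an iterated derivative. -/
def wordWt : List (Bool ⊕ Fin n) → ℤ
  | [] => 0
  | i :: w => nullWt i + wordWt w

theorem genOp_dirD (γ : Gammas n) (ξ ζ χ : Fin (n + 2) → ℂ) :
    genOp γ ξ ζ * dirD χ = dirD χ * genOp γ ξ ζ - ip χ ξ • dirD ζ + ip χ ζ • dirD ξ := by
  have e : ∀ ξ ζ : Fin (n + 2) → ℂ, dirD χ * (lowY ξ * dirD ζ) =
      lowY ξ * dirD ζ * dirD χ + ip χ ξ • (dirD ζ : Module.End ℂ (SpinorField n)) := by
    intro ξ ζ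
    rw [← mul_assoc, dirD_lowY, add_mul, mul_assoc, dirD_comm χ, ← mul_assoc, smul_mul_assoc,
      one_mul]
  have e2 : dirD χ * (mulMat (gam γ ξ) * mulMat (gam γ ζ)) =
      mulMat (gam γ ξ) * mulMat (gam γ ζ) * dirD χ := by
    rw [← mul_assoc, ← mulMat_dirD, mul_assoc, ← mulMat_dirD, mul_assoc]
  unfold genOp
  rw [mul_add, mul_sub, e, e, mul_smul_comm, mul_sub, e2, mul_smul_comm, mul_one, add_mul, sub_mul,
    smul_mul_assoc, sub_mul, smul_mul_assoc, one_mul]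
  module

/-- Null derivatives are weight vectors for `H`, so they map eigenfields to eigenfields with a
shifted eigenvalue. This is why jets are expressed in the null basis: averages of derivatives then
need only a shifted character, and no differentiation under the integral. -/
theorem H_dirD_nullVec (γ : Gammas n) (i : Bool ⊕ Fin n) :
    genOp γ (isoCoeff (-1)) (isoCoeff 1) * dirD (nullVec i) =
      dirD (nullVec i) * genOp γ (isoCoeff (-1)) (isoCoeff 1) +
        (nullWt i : ℂ) • dirD (nullVec i) := by
  rw [genOp_dirD]
  rcases i with (_ | _) | i
  · simp only [nullVec, nullWt, ip_neg_neg, ip_neg_one]; push_cast; module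
  · simp only [nullVec, nullWt, ip_one_one, ip_one_neg]; push_cast; module
  · simp only [nullVec, nullWt, ip_spat_one, ip_spat_neg]; push_cast; module

theorem H_nullWord {γ : Gammas n} {f : SpinorField n} {κ : ℂ}
    (hf : genOp γ (isoCoeff (-1)) (isoCoeff 1) f = κ • f) (w : List (Bool ⊕ Fin n)) :
    genOp γ (isoCoeff (-1)) (isoCoeff 1) (nullWord w f) =
      (κ + (wordWt w : ℂ)) • nullWord w f := by
  induction w with
  | nil => simp [nullWord, wordWt, hf]
  | cons i w ih =>
    have h := LinearMap.congr_fun (H_dirD_nullVec γ i) (nullWord w f)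
    simp only [Module.End.mul_apply, LinearMap.add_apply, LinearMap.smul_apply, ih, map_smul] at h
    simp only [nullWord, wordWt, Module.End.mul_apply, h]
    push_cast
    module

theorem nullWord_mem_contOps (w : List (Bool ⊕ Fin n)) : nullWord w ∈ contOps n := by
  induction w with
  | nil => exact one_mem _
  | cons i w ih => exact mul_mem (dirD_mem_contOps _) ih

theorem pd_mem_span (a : Fin (n + 2)) :
    pd a ∈ Submodule.span ℂ (Set.range fun i : Bool ⊕ Fin n => dirD (nullVec i)) := by
  have hp : dirD (isoCoeff 1) ∈
      Submodule.span ℂ (Set.range fun i : Bool ⊕ Fin n => dirD (nullVec i)) :=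
    Submodule.subset_span ⟨Sum.inl true, rfl⟩
  have hm : dirD (isoCoeff (-1)) ∈
      Submodule.span ℂ (Set.range fun i : Bool ⊕ Fin n => dirD (nullVec i)) :=
    Submodule.subset_span ⟨Sum.inl false, rfl⟩
  have hq := null_sq
  set q : ℂ := Complex.I * (Real.sqrt 2 : ℂ)⁻¹ with hqd
  refine Fin.cases ?_ (fun b => Fin.cases ?_ (fun i => ?_) b) a
  · have e : pd 0 = (-q) • (dirD (isoCoeff 1) + dirD (isoCoeff (-1)) :
        Module.End ℂ (SpinorField n)) := by
      have : (-q) • (dirD (isoCoeff 1) + dirD (isoCoeff (-1)) : Module.End ℂ (SpinorField n)) =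
          (-2 * (q * q)) • pd 0 := by
        rw [dirD_one, dirD_neg_one, ← hqd]; module
      rw [this, hq]; norm_num
    rw [e]
    exact Submodule.smul_mem _ _ (Submodule.add_mem _ hp hm)
  · have e : pd 1 = (q * Complex.I) • (dirD (isoCoeff 1) - dirD (isoCoeff (-1)) :
        Module.End ℂ (SpinorField n)) := by
      have : (q * Complex.I) • (dirD (isoCoeff 1) - dirD (isoCoeff (-1)) :
          Module.End ℂ (SpinorField n)) = (2 * (Complex.I * Complex.I) * (q * q)) • pd 1 := by
        rw [dirD_one, dirD_neg_one, ← hqd]; module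
      rw [this, hq, Complex.I_mul_I]; norm_num
    change pd 1 ∈ _
    rw [e]
    exact Submodule.smul_mem _ _ (Submodule.sub_mem _ hp hm)
  · exact Submodule.subset_span ⟨Sum.inr i, dirD_single _⟩

theorem word_mem_span_nullWord (w : List (Fin (n + 2))) :
    word w ∈ Submodule.span ℂ (Set.range (nullWord (n := n))) := by
  induction w with
  | nil => exact Submodule.subset_span ⟨[], by simp [nullWord, word]⟩
  | cons a w ih =>
    rw [word_cons]
    have h := Submodule.mul_mem_mul (pd_mem_span a) ih
    rw [Submodule.span_mul_span] at h
    refine Submodule.span_mono ?_ h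
    rintro _ ⟨_, ⟨i, rfl⟩, _, ⟨w', rfl⟩, rfl⟩
    exact ⟨i :: w', rfl⟩

theorem tendsto_of_nullWord_mem_smallOps {ι : Type*} {l : Filter ι} {F : ι → SpinorField n}
    {f : SpinorField n} (h : ∀ w, nullWord w ∈ smallOps l fun x => F x - f) :
    Filter.Tendsto F l (𝓝 f) :=
  tendsto_of_word_mem_smallOps fun w =>
    (Submodule.span_le.2 (by rintro _ ⟨w, rfl⟩; exact h w) : _ ≤ smallOps l fun x => F x - f)
      (word_mem_span_nullWord w)

/-! ### Homogeneous components of the fields in a closure -/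

/-- The eigenvalues of `H`, as real numbers. -/
def hvalR (n d : ℕ) : ℝ := -((n : ℝ) - 1) / 2 - d

theorem ofReal_hvalR (n d : ℕ) : (hvalR n d : ℂ) = hval n d := by
  unfold hvalR hval; push_cast; ring

section
variable {γ : Gammas n} {v : Spinor n} {c : ℂ}

theorem H_ambient (hγ : IsClifford γ) {d : ℕ} {f : SpinorField n} (hf : f ∈ ambient γ c d) :
    genOp γ (isoCoeff (-1)) (isoCoeff 1) f = hval n d • f :=
  H_grade hγ (isGradeData_powLin hγ c) hf

instance (d : ℕ) : FiniteDimensional ℂ (ambient γ c d) := finiteDimensional_grade d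

theorem avg_ambient (hγ : IsClifford γ) {d d' : ℕ} {f : SpinorField n} (hf : f ∈ ambient γ c d')
    (w : List (Bool ⊕ Fin n)) {z : Cover n} (hz : z ∈ HPlus n) :
    avg hγ (hvalR n d + wordWt w) hz (nullWord w f) = if d' = d then nullWord w f z else 0 := by
  have hH := H_nullWord (H_ambient hγ hf) w
  have e : (hval n d' : ℂ) + (wordWt w : ℂ) = ((hvalR n d' + wordWt w : ℝ) : ℂ) := by
    push_cast; rw [ofReal_hvalR]
  rw [e] at hH
  rw [avg_eigen hγ (κ := hvalR n d + wordWt w) (m := (d : ℤ) - d') hH (by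
    unfold hvalR; push_cast; ring) hz]
  by_cases h : d' = d
  · rw [if_pos h, if_pos (by omega)]
  · rw [if_neg h, if_neg (by omega)]

theorem avg_decomposition (hγ : IsClifford γ) {g : ℕ →₀ SpinorField n}
    (hg : ∀ d, g d ∈ ambient γ c d) (d : ℕ) (w : List (Bool ⊕ Fin n)) {z : Cover n}
    (hz : z ∈ HPlus n) : avg hγ (hvalR n d + wordWt w) hz (nullWord w (∑ d ∈ g.support, g d)) =
      nullWord w (g d) z := by
  rw [map_sum, map_sum, Finset.sum_congr rfl fun d' _ => avg_ambient hγ (hg d') w hz,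
    Finset.sum_ite_eq' g.support d fun d' => nullWord w (g d') z]
  split_ifs with h
  · rfl
  · rw [Finsupp.notMem_support_iff.1 h, map_zero]; rfl

/-- An operator acting by scalars on the homogeneous components. -/
theorem avg_scalar (hγ : IsClifford γ) {M : Submodule ℂ (SpinorField n)}
    (hM : M ≤ ⨆ d, ambient γ c d) {O : Module.End ℂ (SpinorField n)} (hO : O ∈ contOps n)
    {μ : ℕ → ℂ} (hμ : ∀ d, ∀ f ∈ ambient γ c d, O f = μ d • f) {Ψ : SpinorField n}
    (hΨ : Ψ ∈ M.topologicalClosure) (d : ℕ) (w : List (Bool ⊕ Fin n)) {z : Cover n}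
    (hz : z ∈ HPlus n) : avg hγ (hvalR n d + wordWt w) hz (nullWord w (O Ψ)) =
      μ d • avg hγ (hvalR n d + wordWt w) hz (nullWord w Ψ) := by
  have hcl : IsClosed {Ψ : SpinorField n | avg hγ (hvalR n d + wordWt w) hz (nullWord w (O Ψ)) =
      μ d • avg hγ (hvalR n d + wordWt w) hz (nullWord w Ψ)} :=
    isClosed_eq (continuous_avg hγ (hvalR n d + wordWt w) hz (O := nullWord w * O)
      (mul_mem (nullWord_mem_contOps w) hO))
      ((continuous_const_smul (μ d)).comp (continuous_avg hγ _ hz (nullWord_mem_contOps w)))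
  refine closure_minimal (fun f hf => ?_) hcl hΨ
  obtain ⟨g, hg, rfl⟩ := exists_grade_decomposition (hM hf)
  change avg hγ _ hz (nullWord w (O _)) = μ d • avg hγ _ hz (nullWord w _)
  rw [avg_decomposition hγ hg, map_sum, map_sum, map_sum]
  have e : ∀ d' ∈ g.support, avg hγ (hvalR n d + wordWt w) hz (nullWord w (O (g d'))) =
      if d' = d then μ d • nullWord w (g d) z else 0 := by
    intro d' _
    rw [hμ d' _ (hg d'), map_smul, map_smul, avg_ambient hγ (hg d')]
    split_ifs with h
    · rw [h]
    · rw [smul_zero]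
  rw [Finset.sum_congr rfl e, Finset.sum_ite_eq' g.support d]
  split_ifs with h
  · rfl
  · rw [Finsupp.notMem_support_iff.1 h, map_zero]
    exact (smul_zero _).symm

/-- The averages of all null derivatives at all points depend continuously on the field. On `M` they
are the jets of elements of a finite dimensional space, and such jets form a closed subspace. So the
averages of a limit are again the jet of an element of `M`. -/
theorem exists_component (hγ : IsClifford γ) {M : Submodule ℂ (SpinorField n)}
    (hMi : Invariant (fieldRep γ) M) (hM : M ≤ ⨆ d, ambient γ c d) {Ψ : SpinorField n}
    (hΨ : Ψ ∈ M.topologicalClosure) (d : ℕ) : ∃ g ∈ M ⊓ ambient γ c d,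
      ∀ (w : List (Bool ⊕ Fin n)) {z : Cover n} (hz : z ∈ HPlus n),
        nullWord w g z = avg hγ (hvalR n d + wordWt w) hz (nullWord w Ψ) := by
  set F := M ⊓ ambient γ c d with hF
  have : FiniteDimensional ℂ F := Submodule.finiteDimensional_of_le inf_le_right
  let ρ : F →ₗ[ℂ] (List (Bool ⊕ Fin n) × HPlus n → Spinor n) :=
    { toFun := fun g p => nullWord p.1 (g : SpinorField n) p.2
      map_add' := fun g g' => by
        funext p
        change nullWord p.1 ((g : SpinorField n) + (g' : SpinorField n)) p.2 = _
        rw [map_add]; rfl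
      map_smul' := fun a g => by
        funext p
        change nullWord p.1 (a • (g : SpinorField n)) p.2 = _
        rw [map_smul]; rfl }
  -- Finite dimensionality of the homogeneous pieces of `M` enters here; the target is a product of
  -- spinor spaces with the topology of pointwise convergence.
  have hclosed : IsClosed (LinearMap.range ρ : Set (List (Bool ⊕ Fin n) × HPlus n → Spinor n)) :=
    Submodule.closed_of_finiteDimensional _
  let Θ : SpinorField n → (List (Bool ⊕ Fin n) × HPlus n → Spinor n) := fun Ψ p =>
    avg hγ (hvalR n d + wordWt p.1) p.2.2 (nullWord p.1 Ψ)
  have hΘ : Continuous Θ := continuous_pi fun p =>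
    continuous_avg hγ _ p.2.2 (nullWord_mem_contOps p.1)
  have hmem : Θ Ψ ∈ LinearMap.range ρ := by
    refine closure_minimal (s := (M : Set (SpinorField n))) (fun f hf => ?_)
      (hclosed.preimage hΘ) hΨ
    obtain ⟨g, hg, rfl⟩ := exists_grade_decomposition (hM hf)
    refine ⟨⟨g d, component_mem hγ (isGradeData_powLin hγ c) hMi hg hf d, hg d⟩, ?_⟩
    funext p
    exact (avg_decomposition hγ hg d p.1 p.2.2).symm
  obtain ⟨g, hg⟩ := hmem
  exact ⟨g, g.2, fun w z hz => congrFun hg (w, ⟨z, hz⟩)⟩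

/-- Convergence of a Fourier series. Approximate the field by `f` in `M`, a finite sum of
components, so well that `H²` of the error is small on the rotated compact set. The components of
the error are then bounded by a small multiple of `1/(d+1)²` and can be summed, uniformly in the
number of terms. -/
theorem tendsto_sum_components (hγ : IsClifford γ) (hn : 3 ≤ n) {M : Submodule ℂ (SpinorField n)}
    (hM : M ≤ ⨆ d, ambient γ c d) {Ψ : SpinorField n} (hΨ : Ψ ∈ M.topologicalClosure)
    {g : ℕ → SpinorField n}
    (hg : ∀ d, ∀ (w : List (Bool ⊕ Fin n)) {z : Cover n} (hz : z ∈ HPlus n),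
        nullWord w (g d) z = avg hγ (hvalR n d + wordWt w) hz (nullWord w Ψ)) :
    Filter.Tendsto (fun m => ∑ d ∈ Finset.range m, g d) Filter.atTop (𝓝 Ψ) := by
  refine tendsto_of_nullWord_mem_smallOps fun w B hB ε hε => ?_
  set H := genOp γ (isoCoeff (-1)) (isoCoeff 1) with hH
  have hHc : H * H ∈ contOps n := mul_mem (genOp_mem_contOps _ _ _) (genOp_mem_contOps _ _ _)
  have hval_sq : ∀ d, ∀ f ∈ ambient γ c d, (H * H) f = (hval n d * hval n d) • f := by
    intro d f hf
    rw [Module.End.mul_apply, H_ambient hγ hf, map_smul, H_ambient hγ hf, smul_smul]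
  obtain ⟨B', hB', hBB'⟩ := exists_saturation hB
  obtain ⟨C, hC, hCb⟩ := exists_norm_avg_le hγ
  have hsum : Summable fun d : ℕ => 1 / ((d : ℝ) + 1) ^ 2 := by
    exact_mod_cast (summable_nat_add_iff 1).2 (Real.summable_one_div_nat_pow.2 one_lt_two)
  set Z := ∑' d : ℕ, 1 / ((d : ℝ) + 1) ^ 2 with hZ
  have hZ0 : 0 ≤ Z := tsum_nonneg fun d => by positivity
  -- Chosen so that the summed bound `C δ Z` stays below `ε / 2`; the other half is spent on the
  -- approximation of the field by `f`.
  set δ := ε / (2 * (C * Z + 1)) with hδ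
  have hδ0 : 0 < δ := by positivity
  have hsub : Filter.Tendsto (fun f : SpinorField n => Ψ - f) (𝓝 Ψ) (𝓝 0) := by
    have h : Filter.Tendsto (fun f : SpinorField n => Ψ - f) (𝓝 Ψ) (𝓝 (Ψ - Ψ)) :=
      tendsto_const_nhds.sub Filter.tendsto_id
    rwa [sub_self] at h
  have hev1 := hsub.eventually (contOps_mem_unifOps (mul_mem (nullWord_mem_contOps w) hHc) B' hB' δ
    hδ0)
  have hev2 := hsub.eventually (contOps_mem_unifOps (nullWord_mem_contOps w) B hB (ε / 2)
    (by positivity))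
  obtain ⟨f, hfM, hf1, hf2⟩ := ((mem_closure_iff_frequently.1 hΨ).and_eventually
    (hev1.and hev2)).exists
  obtain ⟨h, hh, rfl⟩ := exists_grade_decomposition (hM hfM)
  set f := ∑ d ∈ h.support, h d with hf
  have hfcl : f ∈ M.topologicalClosure := subset_closure hfM
  obtain ⟨m₀, hm₀⟩ : ∃ m₀, ∀ d ∈ h.support, d < m₀ :=
    ⟨h.support.sup id + 1, fun d hd => Nat.lt_succ_of_le (Finset.le_sup (f := id) hd)⟩
  filter_upwards [Filter.eventually_ge_atTop m₀] with m hm z hz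
  have hzH : z ∈ HPlus n := by obtain ⟨K, _, _, rfl⟩ := hB; exact hz.2
  have hfm : f = ∑ d ∈ Finset.range m, h d := by
    rw [hf]
    refine Finset.sum_subset (fun d hd => Finset.mem_range.2 ((hm₀ d hd).trans_le hm)) ?_
    intro d _ hd
    exact Finsupp.notMem_support_iff.1 hd
  have hterm : ∀ d, ‖nullWord w (g d - h d) z‖ ≤ C * δ * (1 / ((d : ℝ) + 1) ^ 2) := by
    intro d
    have e1 : nullWord w (g d - h d) z =
        avg hγ (hvalR n d + wordWt w) hzH (nullWord w (Ψ - f)) := by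
      rw [map_sub, map_sub, map_sub, ← hg d w hzH, hf, avg_decomposition hγ hh]
      rfl
    have hv0 : (1 : ℝ) * ((d : ℝ) + 1) ^ 2 ≤ ‖hval n d * hval n d‖ := by
      rw [← ofReal_hvalR, ← Complex.ofReal_mul, Complex.norm_real, Real.norm_eq_abs,
        abs_of_nonneg (mul_self_nonneg _)]
      have h3 : (3 : ℝ) ≤ n := by exact_mod_cast hn
      have hd0 : (0 : ℝ) ≤ d := Nat.cast_nonneg d
      -- For `n ≥ 3` all eigenvalues of `H` are at most `-1`, so dividing by their squares is
      -- harmless even for `d = 0`.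
      have : (d : ℝ) + 1 ≤ -hvalR n d := by unfold hvalR; linarith
      nlinarith
    have e2 := avg_scalar hγ hM hHc hval_sq
      (Submodule.sub_mem _ hΨ hfcl) d w hzH
    have e3 : ‖avg hγ (hvalR n d + wordWt w) hzH (nullWord w ((H * H) (Ψ - f)))‖ ≤ C * δ :=
      hCb _ hzH _ δ fun t ht => (hf1 _ (hBB' z hz t ht)).le
    rw [e2, norm_smul, ← e1] at e3
    have hpos : (0 : ℝ) < ((d : ℝ) + 1) ^ 2 := by positivity
    rw [mul_one_div, le_div_iff₀ hpos]
    calc ‖nullWord w (g d - h d) z‖ * ((d : ℝ) + 1) ^ 2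
        = 1 * ((d : ℝ) + 1) ^ 2 * ‖nullWord w (g d - h d) z‖ := by ring
      _ ≤ ‖hval n d * hval n d‖ * ‖nullWord w (g d - h d) z‖ := by gcongr
      _ ≤ C * δ := e3
  have e4 : nullWord w (∑ d ∈ Finset.range m, g d - Ψ) z =
      ∑ d ∈ Finset.range m, nullWord w (g d - h d) z - nullWord w (Ψ - f) z := by
    have : ∑ d ∈ Finset.range m, g d - Ψ = ∑ d ∈ Finset.range m, (g d - h d) - (Ψ - f) := by
      rw [Finset.sum_sub_distrib, ← hfm]; abel
    rw [this, map_sub, map_sum, field_sub_apply, field_sum_apply]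
  rw [e4]
  calc ‖∑ d ∈ Finset.range m, nullWord w (g d - h d) z - nullWord w (Ψ - f) z‖
      ≤ ‖∑ d ∈ Finset.range m, nullWord w (g d - h d) z‖ + ‖nullWord w (Ψ - f) z‖ := norm_sub_le _ _
    _ ≤ ∑ d ∈ Finset.range m, C * δ * (1 / ((d : ℝ) + 1) ^ 2) + ‖nullWord w (Ψ - f) z‖ := by
        gcongr
        exact norm_sum_le_of_le _ fun d _ => hterm d
    _ ≤ C * δ * Z + ‖nullWord w (Ψ - f) z‖ := by
        rw [← Finset.mul_sum]
        gcongr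
        exact hsum.sum_le_tsum _ fun d _ => by positivity
    _ < ε / 2 + ε / 2 := by
        refine add_lt_add ?_ (hf2 z hz)
        have : δ * (C * Z + 1) = ε / 2 := by rw [hδ]; field_simp
        nlinarith
    _ = ε := by ring

end

end GuptaBleuler

end

noncomputable section

namespace GuptaBleuler

variable {n : ℕ}

/-! ### The subquotients of the closures -/

theorem aeval_intertwine {V V' : Type*} [AddCommGroup V] [Module ℂ V] [AddCommGroup V']
    [Module ℂ V'] {O : Module.End ℂ V} {O' : Module.End ℂ V'} (L : V →ₗ[ℂ] V')
    (h : ∀ x, L (O x) = O' (L x)) (p : Polynomial ℂ) (x : V) :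
    L (Polynomial.aeval O p x) = Polynomial.aeval O' p (L x) := by
  induction p using Polynomial.induction_on' with
  | add p q hp hq => simp [hp, hq]
  | monomial k a =>
    have hk : ∀ k x, L ((O ^ k) x) = (O' ^ k) (L x) := by
      intro k
      induction k with
      | zero => intro x; simp
      | succ k ih => intro x; rw [pow_succ, pow_succ, Module.End.mul_apply, Module.End.mul_apply, ih, h]
    simp [Polynomial.aeval_monomial, Module.algebraMap_end_apply, hk]

theorem aeval_eigen {V : Type*} [AddCommGroup V] [Module ℂ V] {O : Module.End ℂ V} {x : V} {μ : ℂ}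
    (h : O x = μ • x) (p : Polynomial ℂ) : Polynomial.aeval O p x = p.eval μ • x := by
  induction p using Polynomial.induction_on' with
  | add p q hp hq => simp [hp, hq, add_smul]
  | monomial k a =>
    have hk : ∀ k, (O ^ k) x = μ ^ k • x := by
      intro k
      induction k with
      | zero => simp
      | succ k ih => rw [pow_succ', Module.End.mul_apply, ih, map_smul, h, smul_smul, pow_succ]
    simp [Polynomial.aeval_monomial, Module.algebraMap_end_apply, hk, smul_smul, mul_comm]

section
variable {γ : Gammas n} {v : Spinor n} {c : ℂ}

theorem fieldRep_mem_ambient (hγ : IsClifford γ) {a b : Fin (n + 2)} (hab : a.val < 2 ↔ b.val < 2)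
    {d : ℕ} {f : SpinorField n} (hf : f ∈ ambient γ c d) : fieldRep γ a b f ∈ ambient γ c d := by
  have hG := isGradeData_powLin hγ c
  have hz : ∀ a, fieldRep γ a a = 0 := fun a => eq_zero_of_eq_neg ((isRep_fieldRep hγ).antisymm a a)
  have h01 : fieldRep γ 0 1 f ∈ ambient γ c d := by
    rw [fieldRep_zero_one hγ, LinearMap.smul_apply, H_ambient hγ hf]
    exact Submodule.smul_mem _ _ (Submodule.smul_mem _ _ hf)
  have h10 : fieldRep γ 1 0 f ∈ ambient γ c d := by
    rw [(isRep_fieldRep hγ).antisymm, LinearMap.neg_apply]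
    exact Submodule.neg_mem _ h01
  by_cases ha : a.val < 2
  · have hb := hab.1 ha
    by_cases e : a = b
    · rw [e, hz, LinearMap.zero_apply]; exact Submodule.zero_mem _
    · have h1 : (a = 0 ∧ b = 1) ∨ (a = 1 ∧ b = 0) := by
        simp only [Fin.ext_iff, Fin.val_zero, Fin.val_one] at e ⊢
        omega
      rcases h1 with ⟨rfl, rfl⟩ | ⟨rfl, rfl⟩
      · exact h01
      · exact h10
  · have hb : ¬ b.val < 2 := fun h => ha (hab.2 h)
    have key : ∀ a : Fin (n + 2), ¬ a.val < 2 → ∃ i : Fin n, a = i.succ.succ := by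
      intro a ha
      have := a.2
      refine ⟨⟨a.val - 2, by omega⟩, Fin.ext ?_⟩
      simp only [Fin.val_succ]
      omega
    obtain ⟨i, rfl⟩ := key a ha
    obtain ⟨j, rfl⟩ := key b hb
    rw [fieldRep_eq_genOp]
    exact spat_mem_grade hγ hG i j hf

/-- The components of `f`, read off by averaging, are components of a field in the closure of `N`
and hence lie in `N`. So closing `N` adds nothing inside the graded module, and a maximal vector
outside `N` stays nonzero in the quotient of closures. -/
theorem mem_of_mem_closure (hγ : IsClifford γ) {N : Submodule ℂ (SpinorField n)}
    (hNi : Invariant (fieldRep γ) N) (hN : N ≤ ⨆ d, ambient γ c d) {f : SpinorField n}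
    (hf : f ∈ ⨆ d, ambient γ c d) (hfN : f ∈ N.topologicalClosure) : f ∈ N := by
  obtain ⟨g, hg, rfl⟩ := exists_grade_decomposition hf
  refine Submodule.sum_mem _ fun d _ => ?_
  obtain ⟨m, hm, h⟩ := exists_component hγ hNi hN hfN d
  have : m = g d := field_ext fun z hz => by
    have h1 := h [] hz
    rw [avg_decomposition hγ hg] at h1
    exact h1
  rw [← this]
  exact hm.1

/-- A field of the closure on which a polynomial in a generator of the rotations vanishes modulo
the closure of `N` belongs to `M` modulo the closure of `N`. -/
theorem exists_sub_mem_closure (hγ : IsClifford γ) (hn : 3 ≤ n) {M N : Submodule ℂ (SpinorField n)}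
    (hMi : Invariant (fieldRep γ) M) (hNi : Invariant (fieldRep γ) N)
    (hM : M ≤ ⨆ d, ambient γ c d) (hNM : N ≤ M) {Ψ : SpinorField n}
    (hΨ : Ψ ∈ M.topologicalClosure) {p : Polynomial ℂ} (hp : p ≠ 0)
    (hpΨ : Polynomial.aeval (fieldRep γ 0 1) p Ψ ∈ N.topologicalClosure) :
    ∃ f ∈ M, Ψ - f ∈ N.topologicalClosure := by
  choose g hgM hg using exists_component hγ hMi hM hΨ
  set μ : ℕ → ℂ := fun d => Complex.I * hval n d with hμ
  have hμinj : Function.Injective μ := fun a b h =>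
    hval_injective n (mul_left_cancel₀ Complex.I_ne_zero h)
  have hOμ : ∀ d, ∀ f ∈ ambient γ c d, Polynomial.aeval (fieldRep γ 0 1) p f =
      p.eval (μ d) • f := by
    intro d f hf
    refine aeval_eigen ?_ p
    rw [fieldRep_zero_one hγ, LinearMap.smul_apply, H_ambient hγ hf, smul_smul]
  have hOc : Polynomial.aeval (fieldRep γ 0 1) p ∈ contOps n :=
    Algebra.adjoin_le (Set.singleton_subset_iff.2 (fieldRep_mem_contOps γ 0 1))
      (Polynomial.aeval_mem_adjoin_singleton ℂ _)
  -- The component of degree `d` of `p` applied to the field is `p.eval (μ d)` times `g d`, and it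
  -- lies in `N` by `exists_component`.
  have hgN : ∀ d, p.eval (μ d) ≠ 0 → g d ∈ N := by
    intro d hd
    obtain ⟨m, hm, h⟩ := exists_component hγ hNi (hNM.trans hM) hpΨ d
    have e : m = p.eval (μ d) • g d := field_ext fun z hz => by
      have h1 := h [] hz
      rw [avg_scalar hγ hM hOc hOμ hΨ d [] hz, ← hg d [] hz] at h1
      exact h1
    rw [← N.smul_mem_iff hd, ← e]
    exact hm.1
  -- A nonzero polynomial has finitely many roots and the `μ d` are distinct, so all components from
  -- some degree on lie in `N`. The partial sum up to that degree is the required element of `M`,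
  -- and the tail converges in the closure of `N`.
  obtain ⟨D, hD⟩ : ∃ D, ∀ d, D ≤ d → p.eval (μ d) ≠ 0 := by
    have hfin : {d : ℕ | p.eval (μ d) = 0}.Finite := by
      refine Set.Finite.of_finite_image (f := μ) ?_ hμinj.injOn
      refine (p.roots.toFinset.finite_toSet).subset ?_
      rintro _ ⟨d, hd, rfl⟩
      simpa [hp] using hd
    obtain ⟨D, hD⟩ := hfin.bddAbove
    exact ⟨D + 1, fun d hd h => absurd (hD h) (by omega)⟩
  refine ⟨∑ d ∈ Finset.range D, g d, Submodule.sum_mem _ fun d _ => (hgM d).1, ?_⟩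
  have hlim := (tendsto_sum_components hγ hn hM hΨ hg).sub
    (tendsto_const_nhds (x := ∑ d ∈ Finset.range D, g d))
  refine mem_closure_of_tendsto hlim ?_
  filter_upwards [Filter.eventually_ge_atTop D] with m hm
  rw [← Finset.sum_Ico_eq_sub _ hm]
  exact Submodule.sum_mem _ fun d hd => hgN d (hD d (Finset.mem_Ico.1 hd).1)

/-- Once the `𝔨`-finite vectors of the quotient of closures are identified with the image of `M`,
density is clear, and irreducibility and the maximal vector are inherited from the algebraic
quotient of `M` by `N`. -/
theorem subquotientCarries (hγ : IsClifford γ) (hn : 3 ≤ n) {M N : Submodule ℂ (SpinorField n)}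
    (hMi : Invariant (fieldRep γ) M) (hNi : Invariant (fieldRep γ) N)
    (hM : M ≤ ⨆ d, ambient γ c d) (hNM : N ≤ M)
    (hirr : ∀ W, Invariant (fieldRep γ) W → N ≤ W → W ≤ M → W ≤ N ∨ M ≤ W)
    {lam : Fin (rk n) → ℝ} {ψ : SpinorField n} (hψ : ψ ∈ M) (hψN : ψ ∉ N)
    (hnil : ∀ j k, IsPosPair n j k → rootOp (fieldRep γ) j k ψ ∈ N)
    (hwt : ∀ i : Fin (rk n), rootOp (fieldRep γ) (-((i.val : ℤ) + 1)) ((i.val : ℤ) + 1) ψ =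
      (lam i : ℂ) • ψ) :
    SubquotientCarries (fieldRep γ) M.topologicalClosure N.topologicalClosure lam := by
  set Mc := M.topologicalClosure with hMc
  set Nc := N.topologicalClosure with hNc
  have hMci : Invariant (fieldRep γ) Mc := invariant_closure hMi
  have hNci : Invariant (fieldRep γ) Nc := invariant_closure hNi
  have hle : M ≤ Mc := M.le_topologicalClosure
  set S : Fin (n + 2) → Fin (n + 2) → Module.End ℂ Mc := fun a b =>
    (fieldRep γ a b).restrict (hMci a b) with hS
  have hSv : ∀ a b (x : Mc), ((S a b x : Mc) : SpinorField n) = fieldRep γ a b x := fun a b x => rfl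
  set K := Nc.submoduleOf Mc with hK
  have hKS : ∀ a b, K ≤ K.comap (S a b) := fun a b x hx => hNci a b _ hx
  set R : Fin (n + 2) → Fin (n + 2) → Module.End ℂ (Mc ⧸ K) := fun a b =>
    K.mapQ K (S a b) (hKS a b) with hR
  have hRm : ∀ a b (x : Mc), R a b (K.mkQ x) = K.mkQ (S a b x) := fun a b x => rfl
  have hSrep : IsRep S := by
    have h := isRep_fieldRep hγ
    refine ⟨fun a b => ?_, fun a b e d => ?_⟩
    · ext1 x
      exact Subtype.ext (LinearMap.congr_fun (h.antisymm a b) (x : SpinorField n))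
    · ext1 x
      exact Subtype.ext (LinearMap.congr_fun (h.bracket a b e d) (x : SpinorField n))
  have hroot : ∀ j k (x : Mc), rootOp R j k (K.mkQ x) = K.mkQ (rootOp S j k x) := by
    intro j k x
    unfold rootOp
    simp only [LinearMap.sum_apply, LinearMap.smul_apply, hRm, map_sum, map_smul]
  have hrootS : ∀ j k (x : Mc), ((rootOp S j k x : Mc) : SpinorField n) =
      rootOp (fieldRep γ) j k x := by
    intro j k x
    unfold rootOp
    simp only [LinearMap.sum_apply, LinearMap.smul_apply, AddSubmonoidClass.coe_finsetSum,
      SetLike.val_smul, hSv]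
  have hmk0 : ∀ x : Mc, K.mkQ x = 0 ↔ (x : SpinorField n) ∈ Nc := by
    intro x
    rw [← LinearMap.mem_ker, Submodule.ker_mkQ]
    rfl
  -- the image of `M` in the quotient
  set J : M →ₗ[ℂ] (Mc ⧸ K) := K.mkQ ∘ₗ Submodule.inclusion hle with hJ
  -- In one direction, the characteristic polynomial of the time rotation on a finite dimensional
  -- `𝔨`-stable space annihilates it, so `exists_sub_mem_closure` provides a representative in `M`.
  -- In the other, `M` is the sum of its homogeneous pieces, which are finite dimensional and stable
  -- under `𝔨`.
  have hfin : kFinite R = LinearMap.range J := by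
    apply le_antisymm
    · refine sSup_le ?_
      rintro W ⟨hWf, hWs⟩ x hx
      obtain ⟨Ψ, rfl⟩ := K.mkQ_surjective x
      have hstab : ∀ y ∈ W, R 0 1 y ∈ W := hWs 0 1 (by simp)
      set O := (R 0 1).restrict hstab with hO
      have h0 : Polynomial.aeval O O.charpoly = 0 := LinearMap.aeval_self_charpoly O
      have h1 := aeval_intertwine (O := O) (O' := R 0 1) W.subtype (fun y => rfl) O.charpoly
        ⟨K.mkQ Ψ, hx⟩
      rw [h0, LinearMap.zero_apply, map_zero] at h1
      have h2 := aeval_intertwine (O := S 0 1) (O' := R 0 1) K.mkQ (fun y => rfl) O.charpoly Ψ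
      have h3 : K.mkQ (Polynomial.aeval (S 0 1) O.charpoly Ψ) = 0 := h2.trans h1.symm
      rw [hmk0] at h3
      have h4 := aeval_intertwine (O := S 0 1) (O' := fieldRep γ 0 1) Mc.subtype (fun y => rfl)
        O.charpoly Ψ
      obtain ⟨f, hf, hfN⟩ := exists_sub_mem_closure hγ hn hMi hNi hM hNM Ψ.2
        (LinearMap.charpoly_monic O).ne_zero (p := O.charpoly) (by
          have h5 : Polynomial.aeval (fieldRep γ 0 1) O.charpoly (Ψ : SpinorField n) = _ := h4.symm
          rw [h5]; exact h3)
      refine ⟨⟨f, hf⟩, ?_⟩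
      rw [eq_comm, ← sub_eq_zero, hJ, LinearMap.comp_apply, ← map_sub, hmk0]
      exact hfN
    · rintro _ ⟨⟨f, hf⟩, rfl⟩
      obtain ⟨g, hg, hgf⟩ := exists_grade_decomposition (hM hf)
      have hgM : ∀ d, g d ∈ M := fun d =>
        component_mem hγ (isGradeData_powLin hγ c) hMi hg (hgf.symm ▸ hf) d
      have e : (⟨f, hf⟩ : M) = ∑ d ∈ g.support, ⟨g d, hgM d⟩ := Subtype.ext (by
        rw [AddSubmonoidClass.coe_finsetSum]; exact hgf.symm)
      rw [e, map_sum]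
      refine Submodule.sum_mem _ fun d _ => ?_
      set F := M ⊓ ambient γ c d with hF
      have : FiniteDimensional ℂ F := Submodule.finiteDimensional_of_le inf_le_right
      refine (le_sSup (a := LinearMap.range
        (J ∘ₗ Submodule.inclusion (inf_le_left : F ≤ M))) ⟨inferInstance, ?_⟩ :
        _ ≤ kFinite R) ⟨⟨g d, hgM d, hg d⟩, rfl⟩
      rintro a b hab _ ⟨x, rfl⟩
      exact ⟨⟨fieldRep γ a b x, hMi a b _ x.2.1, fieldRep_mem_ambient hγ hab x.2.2⟩, rfl⟩
  refine ⟨R, fun a b x => ⟨hMci a b _ x.2, rfl⟩, ?_, ?_, ?_, ?_, ?_⟩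
  · refine ⟨fun a b => ?_, fun a b e d => ?_⟩
    · refine Submodule.linearMap_qext _ ?_
      ext1 x
      change R a b (K.mkQ x) = -(R b a (K.mkQ x))
      rw [hRm, hRm, hSrep.antisymm, LinearMap.neg_apply, map_neg]
    · refine Submodule.linearMap_qext _ ?_
      ext1 x
      have h := congrArg K.mkQ (LinearMap.congr_fun (hSrep.bracket a b e d) x)
      simp only [LinearMap.sub_apply, LinearMap.add_apply, LinearMap.smul_apply,
        Module.End.mul_apply, map_sub, map_add, map_smul] at h
      exact h
  · rw [hfin]
    have h1 : DenseRange (Submodule.inclusion hle : M → Mc) :=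
      (denseRange_inclusion_iff hle).2 le_rfl
    have h2 : DenseRange (K.mkQ : Mc → Mc ⧸ K) := K.mkQ_surjective.denseRange
    exact h2.comp h1 K.continuous_mkQ
  · rw [hfin]
    rintro a b _ ⟨x, rfl⟩
    exact ⟨⟨fieldRep γ a b x, hMi a b _ x.2⟩, rfl⟩
  · intro W hW hWi
    rw [hfin] at hW ⊢
    -- The preimage of `W` in `M`: an invariant space between `N` and `M`, to which the algebraic
    -- irreducibility applies.
    set W' := (W.comap J).map M.subtype with hW'
    have hW'i : Invariant (fieldRep γ) W' := by
      rintro a b _ ⟨x, hx, rfl⟩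
      exact ⟨⟨fieldRep γ a b x, hMi a b _ x.2⟩, hWi a b _ hx, rfl⟩
    have hNW : N ≤ W' := by
      intro f hf
      refine ⟨⟨f, hNM hf⟩, ?_, rfl⟩
      change J _ ∈ W
      have : J ⟨f, hNM hf⟩ = 0 := (hmk0 _).2 (N.le_topologicalClosure hf)
      rw [this]
      exact W.zero_mem
    have hWM : W' ≤ M := by rintro _ ⟨x, _, rfl⟩; exact x.2
    rcases hirr W' hW'i hNW hWM with h | h
    · left
      rw [eq_bot_iff]
      intro x hx
      obtain ⟨f, rfl⟩ := hW hx
      exact (hmk0 _).2 (N.le_topologicalClosure (h ⟨f, hx, rfl⟩))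
    · right
      refine le_antisymm hW ?_
      rintro _ ⟨f, rfl⟩
      obtain ⟨x, hx, hxf⟩ := h f.2
      have : x = f := Subtype.ext hxf
      rw [← this]
      exact hx
  · rw [hfin]
    refine ⟨J ⟨ψ, hψ⟩, ⟨_, rfl⟩, ?_, ?_, ?_⟩
    · intro h0
      exact hψN (mem_of_mem_closure hγ hNi (hNM.trans hM) (hM hψ) ((hmk0 _).1 h0))
    · intro j k hjk
      change rootOp R j k (K.mkQ _) = 0
      rw [hroot, hmk0, hrootS]
      exact N.le_topologicalClosure (hnil j k hjk)
    · intro i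
      change rootOp R _ _ (K.mkQ _) = (lam i : ℂ) • K.mkQ _
      rw [hroot, ← map_smul]
      congr 1
      refine Subtype.ext ?_
      rw [hrootS]
      exact hwt i

end

end GuptaBleuler

end

noncomputable section

namespace GuptaBleuler

variable {n : ℕ}

/-! ### The retraction to the cone -/

theorem contDiff_ySq : ContDiff ℝ ∞ (ySq : Cover n → ℝ) :=
  ContDiff.sum fun a _ => contDiff_const.mul ((contDiff_coord a).pow 2)

theorem fderiv_coord_frame (a b : Fin (n + 2)) (z : Cover n) :
    fderiv ℝ (coord b) z (frame a z) = if a = b then 1 else 0 := by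
  obtain ⟨L, hL, h⟩ := fderiv_coord b z
  rw [hL.fderiv, h]

theorem hasFDerivAt_coord (a : Fin (n + 2)) (z : Cover n) :
    HasFDerivAt (coord a) (fderiv ℝ (coord a) z) z :=
  ((contDiff_coord a).differentiable (by simp) z).hasFDerivAt

theorem sum_fderiv_coord_smul_frame (z δ : Cover n) :
    ∑ a, fderiv ℝ (coord a) z δ • frame a z = δ := by
  have h0 : fderiv ℝ (coord 0) z δ = (Complex.exp z.1 * δ.1).re := by
    have h : HasFDerivAt (coord 0) _ z :=
      Complex.reCLM.hasFDerivAt.comp z (hasFDerivAt_exp_fst z)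
    rw [h.fderiv]; rfl
  have h1 : fderiv ℝ (coord 1) z δ = (Complex.exp z.1 * δ.1).im := by
    have h : HasFDerivAt (coord 1) _ z :=
      Complex.imCLM.hasFDerivAt.comp z (hasFDerivAt_exp_fst z)
    rw [h.fderiv]; rfl
  have h2 : ∀ i : Fin n, fderiv ℝ (coord i.succ.succ) z δ = δ.2 i := by
    intro i
    have h : HasFDerivAt (coord i.succ.succ) ((ContinuousLinearMap.proj (R := ℝ) i).comp
        (ContinuousLinearMap.snd ℝ ℂ (Fin n → ℝ))) z :=
      ((ContinuousLinearMap.proj (R := ℝ) (φ := fun _ : Fin n => ℝ) i).comp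
        (ContinuousLinearMap.snd ℝ ℂ (Fin n → ℝ))).hasFDerivAt
    rw [h.fderiv]; rfl
  rw [Fin.sum_univ_succ, Fin.sum_univ_succ]
  have f0 : (frame 0 z : Cover n) = (Complex.exp (-z.1), 0) := rfl
  have f1 : (frame (Fin.succ 0) z : Cover n) = (Complex.I * Complex.exp (-z.1), 0) := rfl
  have f2 : ∀ i : Fin n, (frame i.succ.succ z : Cover n) = (0, Pi.single i 1) := fun i => rfl
  have h1' : fderiv ℝ (coord (Fin.succ 0)) z δ = (Complex.exp z.1 * δ.1).im := h1
  simp only [h0, h1', h2, f0, f1, f2]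
  have e : Complex.exp z.1 * Complex.exp (-z.1) = 1 := by
    rw [← Complex.exp_add, add_neg_cancel, Complex.exp_zero]
  refine Prod.ext ?_ ?_
  · simp only [Prod.fst_add, Prod.fst_sum, Prod.smul_fst, smul_zero, Finset.sum_const_zero,
      add_zero, Complex.real_smul]
    calc _ = ((((Complex.exp z.1 * δ.1).re : ℂ) + ((Complex.exp z.1 * δ.1).im : ℂ) * Complex.I) *
          Complex.exp (-z.1)) := by ring
      _ = δ.1 := by rw [Complex.re_add_im]; linear_combination δ.1 * e
  · funext k
    simp [Prod.snd_sum, Finset.sum_apply, Pi.single_apply]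

theorem fderiv_eq_sum_pd (f : SpinorField n) {z : Cover n} (hz : z ∈ HPlus n) :
    fderiv ℝ f z = ∑ a, (fderiv ℝ (coord a) z).smulRight (pd a f z) := by
  refine ContinuousLinearMap.ext fun δ => ?_
  conv_lhs => rw [← sum_fderiv_coord_smul_frame z δ]
  simp only [map_sum, map_smul, _root_.sum_apply,
    ContinuousLinearMap.smulRight_apply, pd_apply _ f hz]

theorem fderiv_ySq_rotField (a b : Fin (n + 2)) (z : Cover n) :
    fderiv ℝ ySq z (rotField a b z) = 0 := by
  have h : HasFDerivAt (ySq : Cover n → ℝ)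
      (∑ c, (eta c * (2 * coord c z)) • fderiv ℝ (coord c) z) z := by
    refine HasFDerivAt.fun_sum fun c _ => ?_
    have := ((hasFDerivAt_coord c z).pow 2).const_mul (eta c)
    refine this.congr_fderiv ?_
    rw [smul_smul]
    congr 1
    simp
  rw [h.fderiv]
  simp only [_root_.sum_apply, _root_.smul_apply, rotField, map_sub,
    map_smul, fderiv_coord_frame, smul_eq_mul, mul_ite, mul_one,
    mul_zero, Finset.sum_ite_eq, Finset.mem_univ, if_true]
  ring

/-- The displacement of `Re τ` that moves a point to the cone. -/
def coneShift (z : Cover n) : ℝ := 1 / 2 * Real.log (1 - Real.exp (-2 * z.1.re) * ySq z)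

/-- The point `z`, moved to the cone and then by `t` into the future of the cone. -/
def retract (t : ℝ) (z : Cover n) : Cover n := z + (((coneShift z + t : ℝ) : ℂ), 0)

theorem coneShift_of_mem {q : Cover n} (hq : q ∈ Cone n) : coneShift q = 0 := by
  unfold coneShift
  rw [show ySq q = 0 from hq]; simp

theorem retract_zero_of_mem {q : Cover n} (hq : q ∈ Cone n) : retract 0 q = q := by
  unfold retract
  rw [coneShift_of_mem hq]
  simp

/-- The argument of the logarithm is the squared length of the space part divided by `exp (2 Re τ)`.
The shift therefore matches the radius in the time plane to the spatial one, and the further shift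
by `t` multiplies its square by `exp (2t)`. -/
theorem ySq_retract {z : Cover n} (hz : 0 < 1 - Real.exp (-2 * z.1.re) * ySq z) (t : ℝ) :
    ySq (retract t z) = Real.exp z.1.re ^ 2 * (1 - Real.exp (-2 * z.1.re) * ySq z) *
      (Real.exp (2 * t) - 1) := by
  have h1 : ySq (retract t z) = Real.exp (z.1.re + (coneShift z + t)) ^ 2 - ∑ i, z.2 i ^ 2 := by
    rw [ySq_eq]; simp [retract]
  have h2 : ∑ i, z.2 i ^ 2 = Real.exp z.1.re ^ 2 - ySq z := by rw [ySq_eq]; ring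
  have h3 : Real.exp (z.1.re + (coneShift z + t)) ^ 2 = Real.exp z.1.re ^ 2 *
      (1 - Real.exp (-2 * z.1.re) * ySq z) * Real.exp (2 * t) := by
    have h4 : Real.exp (2 * coneShift z) = 1 - Real.exp (-2 * z.1.re) * ySq z := by
      unfold coneShift
      rw [← mul_assoc, mul_one_div_cancel two_ne_zero, one_mul, Real.exp_log hz]
    rw [← h4, ← Real.exp_nat_mul, ← Real.exp_nat_mul, ← Real.exp_add, ← Real.exp_add]
    congr 1
    push_cast
    ring
  have h5 : Real.exp z.1.re ^ 2 * Real.exp (-2 * z.1.re) = 1 := by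
    rw [← Real.exp_nat_mul, ← Real.exp_add]
    simp
  rw [h1, h2, h3]
  linear_combination (-(ySq z)) * h5

theorem eventually_shift_pos {q : Cover n} (hq : q ∈ Cone n) :
    ∀ᶠ z in 𝓝 q, 0 < 1 - Real.exp (-2 * z.1.re) * ySq z := by
  have hc : Continuous fun z : Cover n => 1 - Real.exp (-2 * z.1.re) * ySq z := by
    have := (contDiff_ySq (n := n)).continuous
    fun_prop
  refine hc.continuousAt.eventually (lt_mem_nhds ?_)
  change 0 < 1 - Real.exp (-2 * q.1.re) * ySq q
  rw [show ySq q = 0 from hq]; simp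

theorem retract_mem_HPlus {z : Cover n} (hz : 0 < 1 - Real.exp (-2 * z.1.re) * ySq z) {t : ℝ}
    (ht : 0 < t) : retract t z ∈ HPlus n := by
  change 0 < ySq _
  rw [ySq_retract hz]
  have : 1 < Real.exp (2 * t) := Real.one_lt_exp_iff.2 (by positivity)
  have := sub_pos.2 this
  positivity

theorem retract_mem_Cone {z : Cover n} (hz : 0 < 1 - Real.exp (-2 * z.1.re) * ySq z) :
    retract 0 z ∈ Cone n := by
  change ySq _ = 0
  rw [ySq_retract hz]; simp

theorem contDiffAt_coneShift {q : Cover n} (hq : q ∈ Cone n) : ContDiffAt ℝ ∞ coneShift q := by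
  have h1 : ContDiffAt ℝ ∞ (fun z : Cover n => 1 - Real.exp (-2 * z.1.re) * ySq z) q := by
    refine contDiffAt_const.sub (ContDiffAt.mul ?_ contDiff_ySq.contDiffAt)
    exact (contDiffAt_const.mul
      ((Complex.reCLM.contDiff.comp contDiff_fst).contDiffAt (x := q))).exp
  exact contDiffAt_const.mul (h1.log (eventually_shift_pos hq).self_of_nhds.ne')

theorem fderiv_coneShift_rotField {q : Cover n} (hq : q ∈ Cone n) (a b : Fin (n + 2)) :
    fderiv ℝ coneShift q (rotField a b q) = 0 := by
  have he : HasFDerivAt (fun z : Cover n => Real.exp (-2 * z.1.re))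
      (fderiv ℝ (fun z : Cover n => Real.exp (-2 * z.1.re)) q) q := by
    have : ContDiff ℝ ∞ (fun z : Cover n => Real.exp (-2 * z.1.re)) :=
      (contDiff_const.mul (Complex.reCLM.contDiff.comp contDiff_fst)).exp
    exact (this.differentiable (by simp) q).hasFDerivAt
  have hy : HasFDerivAt (ySq : Cover n → ℝ) (fderiv ℝ ySq q) q :=
    (contDiff_ySq.differentiable (by simp) q).hasFDerivAt
  have h := (((he.mul hy).const_sub 1).log (eventually_shift_pos hq).self_of_nhds.ne').const_mul
    (1 / 2 : ℝ)
  have h' : HasFDerivAt (coneShift : Cover n → ℝ) _ q := h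
  rw [h'.fderiv]
  have h0 : ySq q = 0 := hq
  simp [fderiv_ySq_rotField, h0]

theorem tendsto_retract {q : Cover n} (hq : q ∈ Cone n) :
    Filter.Tendsto (fun p : ℝ × Cover n => retract p.1 p.2) (𝓝 0 ×ˢ 𝓝 q) (𝓝 q) := by
  have h1 : ContinuousAt (fun p : ℝ × Cover n => retract p.1 p.2) (0, q) := by
    unfold retract
    have h2 : ContinuousAt (fun p : ℝ × Cover n => coneShift p.2) (0, q) :=
      ContinuousAt.comp (f := Prod.snd) (x := ((0 : ℝ), q)) (g := coneShift)
        (contDiffAt_coneShift hq).continuousAt continuousAt_snd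
    refine continuousAt_snd.add (ContinuousAt.prodMk ?_ continuousAt_const)
    exact Complex.continuous_ofReal.continuousAt.comp (h2.add continuousAt_fst)
  have h2 : Filter.Tendsto _ _ (𝓝 (retract 0 q)) := h1
  rwa [retract_zero_of_mem hq, nhds_prod_eq] at h2

theorem tendsto_retract_HPlus {q : Cover n} (hq : q ∈ Cone n) :
    Filter.Tendsto (fun p : ℝ × Cover n => retract p.1 p.2) (𝓝[>] 0 ×ˢ 𝓝 q) (𝓝[HPlus n] q) := by
  refine tendsto_nhdsWithin_iff.2 ⟨(tendsto_retract hq).mono_left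
    (Filter.prod_mono nhdsWithin_le_nhds le_rfl), ?_⟩
  have h1 : ∀ᶠ t : ℝ in 𝓝[>] 0, 0 < t := eventually_mem_nhdsWithin
  filter_upwards [h1.prod_mk (eventually_shift_pos hq)] with p hp
  exact retract_mem_HPlus hp.2 hp.1

theorem neBot_nhdsWithin_HPlus {q : Cover n} (hq : q ∈ Cone n) : (𝓝[HPlus n] q).NeBot :=
  (tendsto_retract_HPlus hq).neBot

/-! ### Derivatives of boundary values -/

/-- The derivative along the retraction of the boundary values of a field, `G` being the
boundary values of its partial derivatives. -/
def coneDeriv (q : Cover n) (G : Fin (n + 2) → Spinor n) : Cover n →L[ℝ] Spinor n :=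
  (∑ a, (fderiv ℝ (coord a) q).smulRight (G a)).comp (ContinuousLinearMap.id ℝ (Cover n) +
    (ContinuousLinearMap.inl ℝ ℂ (Fin n → ℝ)).comp (Complex.ofRealCLM.comp (fderiv ℝ coneShift q)))

theorem coneDeriv_rotField {q : Cover n} (hq : q ∈ Cone n) (G : Fin (n + 2) → Spinor n)
    (a b : Fin (n + 2)) : coneDeriv q G (rotField a b q) =
      (eta a * coord a q) • G b - (eta b * coord b q) • G a := by
  unfold coneDeriv
  rw [ContinuousLinearMap.comp_apply, _root_.add_apply,
    ContinuousLinearMap.comp_apply, ContinuousLinearMap.comp_apply,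
    fderiv_coneShift_rotField hq, map_zero, map_zero, add_zero, ContinuousLinearMap.id_apply]
  simp only [_root_.sum_apply, ContinuousLinearMap.smulRight_apply, rotField, map_sub,
    map_smul, fderiv_coord_frame, one_smul, ite_smul, zero_smul, Finset.sum_ite_eq, Finset.mem_univ, if_true]

theorem tendsto_clm_comp {ι E F G : Type*} [NormedAddCommGroup E] [NormedSpace ℝ E]
    [NormedAddCommGroup F] [NormedSpace ℝ F] [NormedAddCommGroup G] [NormedSpace ℝ G]
    {l : Filter ι} {A : ι → F →L[ℝ] G} {B : ι → E →L[ℝ] F} {A₀ : F →L[ℝ] G} {B₀ : E →L[ℝ] F}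
    (hA : Filter.Tendsto A l (𝓝 A₀)) (hB : Filter.Tendsto B l (𝓝 B₀)) :
    Filter.Tendsto (fun i => (A i).comp (B i)) l (𝓝 (A₀.comp B₀)) :=
  (((ContinuousLinearMap.compL ℝ E F G).continuous₂).tendsto (A₀, B₀)).comp (hA.prodMk_nhds hB)

theorem tendsto_clm_smulRight {ι E F : Type*} [NormedAddCommGroup E] [NormedSpace ℝ E]
    [NormedAddCommGroup F] [NormedSpace ℝ F] {l : Filter ι} {A : ι → E →L[ℝ] ℝ} {B : ι → F}
    {A₀ : E →L[ℝ] ℝ} {B₀ : F} (hA : Filter.Tendsto A l (𝓝 A₀)) (hB : Filter.Tendsto B l (𝓝 B₀)) :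
    Filter.Tendsto (fun i => (A i).smulRight (B i)) l (𝓝 (A₀.smulRight B₀)) :=
  (((ContinuousLinearMap.smulRightL ℝ E F).continuous₂).tendsto (A₀, B₀)).comp (hA.prodMk_nhds hB)

/-- The boundary function composed with the retraction is the limit, as `t → 0+`, of the smooth
functions `f (retract t z)`. Their derivatives converge uniformly near `q` to `coneDeriv q G`,
because the partial derivatives of the field have limits at `q`. The theorem on differentiating a
limit then applies, without any smooth extension of the field. -/
theorem hasFDerivAt_boundary (f : SpinorField n) {F : Cover n → Spinor n}
    (hF : ∀ z ∈ Cone n, Filter.Tendsto f (𝓝[HPlus n] z) (𝓝 (F z))) {q : Cover n} (hq : q ∈ Cone n)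
    {G : Fin (n + 2) → Spinor n}
    (hG : ∀ a, Filter.Tendsto (pd a f : SpinorField n) (𝓝[HPlus n] q) (𝓝 (G a))) :
    HasFDerivAt (fun z => F (retract 0 z)) (coneDeriv q G) q := by
  set D : Cover n → Cover n →L[ℝ] Cover n := fun z => ContinuousLinearMap.id ℝ (Cover n) +
    (ContinuousLinearMap.inl ℝ ℂ (Fin n → ℝ)).comp
      (Complex.ofRealCLM.comp (fderiv ℝ coneShift z)) with hD
  have hret := tendsto_retract_HPlus hq
  refine hasFDerivAt_of_tendstoUniformlyOnFilter (l := 𝓝[>] (0 : ℝ))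
    (f := fun t z => f (retract t z))
    (f' := fun t z => (∑ a, (fderiv ℝ (coord a) (retract t z)).smulRight
      (pd a f (retract t z))).comp (D z)) (g' := fun _ => coneDeriv q G) ?_ ?_ ?_
  · rw [← tendsto_prod_filter_iff]
    have h1 : Filter.Tendsto (fun p : ℝ × Cover n => D p.2) (𝓝[>] 0 ×ˢ 𝓝 q) (𝓝 (D q)) := by
      have h2 : ContinuousAt (fderiv ℝ (coneShift : Cover n → ℝ)) q :=
        ((contDiffAt_coneShift hq).fderiv_right (m := 0) (by simp)).continuousAt
      have h3 : ContinuousAt D q :=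
        continuousAt_const.add (continuousAt_const.clm_comp (continuousAt_const.clm_comp h2))
      exact h3.tendsto.comp Filter.tendsto_snd
    refine tendsto_clm_comp (tendsto_finsetSum _ fun a _ => ?_) h1
    have h2 : Filter.Tendsto (fun p : ℝ × Cover n => fderiv ℝ (coord a) (retract p.1 p.2))
        (𝓝[>] 0 ×ˢ 𝓝 q) (𝓝 (fderiv ℝ (coord a) q)) :=
      (((contDiff_coord a).continuous_fderiv (by simp)).tendsto q).comp
        (hret.mono_right nhdsWithin_le_nhds)
    exact tendsto_clm_smulRight h2 ((hG a).comp hret)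
  · have h1 : ∀ᶠ z in 𝓝 q, DifferentiableAt ℝ coneShift z := by
      have h2 := (contDiffAt_coneShift hq).of_le (m := 1) (by simp)
      filter_upwards [h2.eventually (by simp)] with z hz
      exact hz.differentiableAt (by simp)
    have h2 : ∀ᶠ t : ℝ in 𝓝[>] 0, 0 < t := eventually_mem_nhdsWithin
    filter_upwards [h2.prod_mk (h1.and (eventually_shift_pos hq))] with p hp
    have hm := retract_mem_HPlus hp.2.2 hp.1
    rw [← fderiv_eq_sum_pd f hm]
    have h3 : HasFDerivAt (retract p.1) (D p.2) p.2 := by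
      refine (hasFDerivAt_id _).add ?_
      refine HasFDerivAt.congr_fderiv ((Complex.ofRealCLM.hasFDerivAt.comp p.2
        (hp.2.1.hasFDerivAt.add_const p.1)).prodMk (hasFDerivAt_const 0 p.2)) ?_
      rfl
    exact (f.differentiableAt hm).hasFDerivAt.comp p.2 h3
  · filter_upwards [eventually_shift_pos hq] with z hz
    refine (hF _ (retract_mem_Cone hz)).comp (tendsto_nhdsWithin_iff.2 ⟨?_, ?_⟩)
    · have : Continuous fun t : ℝ => retract t z := by unfold retract; fun_prop
      exact (this.tendsto 0).mono_left nhdsWithin_le_nhds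
    · filter_upwards [eventually_mem_nhdsWithin] with t ht
      exact retract_mem_HPlus hz ht

end GuptaBleuler

end

noncomputable section

namespace GuptaBleuler

variable {n : ℕ}

/-! ### Fields with boundary values on the cone -/

/-- The fields that extend smoothly to the whole covering. -/
def smoothFields (n : ℕ) : Submodule ℂ (SpinorField n) where
  carrier := {f | ∃ F : Cover n → Spinor n, ContDiff ℝ ∞ F ∧ ∀ z ∈ HPlus n, f z = F z}
  zero_mem' := ⟨0, contDiff_const, fun _ _ => rfl⟩
  add_mem' := by
    rintro f g ⟨F, hF, hf⟩ ⟨G, hG, hg⟩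
    exact ⟨F + G, hF.add hG, fun z hz => by rw [field_add_apply, hf z hz, hg z hz]; rfl⟩
  smul_mem' := by
    rintro a f ⟨F, hF, hf⟩
    exact ⟨a • F, hF.const_smul a, fun z hz => by rw [field_smul_apply, hf z hz]; rfl⟩

theorem powField_mem_smoothFields (s : ℂ) (u : Spinor n) : powField s u ∈ smoothFields n :=
  ⟨_, (contDiff_const.mul (contDiff_fst.add contDiff_const)).cexp.smul contDiff_const,
    fun _ hz => powField_apply s u hz⟩

theorem pd_mem_smoothFields (a : Fin (n + 2)) {f : SpinorField n} (hf : f ∈ smoothFields n) :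
    pd a f ∈ smoothFields n := by
  obtain ⟨F, hF, hf⟩ := hf
  refine ⟨fun z => fderiv ℝ F z (frame a z),
    (hF.fderiv_right (m := ∞) (by simp)).clm_apply (contDiff_frame a), fun z hz => ?_⟩
  rw [pd_apply a f hz]
  have : (f : Cover n → Spinor n) =ᶠ[𝓝 z] F := by
    filter_upwards [(isOpen_HPlus n).mem_nhds hz] with w hw using hf w hw
  rw [this.fderiv_eq]

theorem mulY_mem_smoothFields (a : Fin (n + 2)) {f : SpinorField n} (hf : f ∈ smoothFields n) :
    mulY a f ∈ smoothFields n := by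
  obtain ⟨F, hF, hf⟩ := hf
  exact ⟨fun z => coord a z • F z, (contDiff_coord a).smul hF, fun z hz => by
    rw [mulY_apply, hf z hz]⟩

theorem mulMat_mem_smoothFields (A : Matrix (Fin (2 ^ rk n)) (Fin (2 ^ rk n)) ℂ)
    {f : SpinorField n} (hf : f ∈ smoothFields n) : mulMat A f ∈ smoothFields n := by
  obtain ⟨F, hF, hf⟩ := hf
  exact ⟨fun z => A.mulVec (F z),
    ((Matrix.toLin' A).restrictScalars ℝ).toContinuousLinearMap.contDiff.comp hF,
    fun z hz => by rw [mulMat_apply, hf z hz]⟩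

theorem ySlash_mem_smoothFields (γ : Gammas n) {f : SpinorField n} (hf : f ∈ smoothFields n) :
    ySlash γ f ∈ smoothFields n := by
  unfold ySlash
  rw [LinearMap.sum_apply]
  exact Submodule.sum_mem _ fun a _ => mulY_mem_smoothFields a (mulMat_mem_smoothFields _ hf)

theorem invariant_smoothFields (γ : Gammas n) : Invariant (fieldRep γ) (smoothFields n) := by
  intro a b f hf
  refine Submodule.add_mem _ (Submodule.sub_mem _ ?_ ?_) (mulMat_mem_smoothFields _ hf)
  · exact Submodule.smul_mem _ _ (mulY_mem_smoothFields a (pd_mem_smoothFields b hf))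
  · exact Submodule.smul_mem _ _ (mulY_mem_smoothFields b (pd_mem_smoothFields a hf))

/-- The closure of the space of smoothly extendable fields. -/
def regularFields (n : ℕ) : Submodule ℂ (SpinorField n) := (smoothFields n).topologicalClosure

theorem mem_regularFields {O : Module.End ℂ (SpinorField n)} (hO : O ∈ contOps n)
    (h : ∀ f ∈ smoothFields n, O f ∈ smoothFields n) {f : SpinorField n}
    (hf : f ∈ regularFields n) : O f ∈ regularFields n :=
  map_mem_closure (show Continuous O from hO) hf h

/-- The part of a closed ball around `q` where `y² ≥ 0` is a compact subset of `H_+ ∪ Q`, so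
convergence in the topology of fields is uniform near `q` inside `H_+`. -/
theorem exists_eventually_norm_sub_lt {S : Set (SpinorField n)} {f : SpinorField n}
    (hf : f ∈ closure S) {q : Cover n} {ε : ℝ} (hε : 0 < ε) :
    ∃ g ∈ S, ∀ᶠ z in 𝓝[HPlus n] q, ‖g z - f z‖ < ε := by
  have hcl : IsClosed {z : Cover n | 0 ≤ ySq z} :=
    isClosed_le continuous_const contDiff_ySq.continuous
  have hB : (Metric.closedBall q 1 ∩ {z : Cover n | 0 ≤ ySq z}) ∩ HPlus n ∈ compactTraces n := by
    refine ⟨_, (isCompact_closedBall q 1).inter_right hcl, fun z hz => ?_, rfl⟩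
    rcases (show 0 ≤ ySq z from hz.2).lt_or_eq with h | h
    · exact Or.inl h
    · exact Or.inr h.symm
  have h1 := tendsto_field_iff.1 (Filter.tendsto_id (α := SpinorField n) (x := 𝓝 f)) [] _ hB ε hε
  obtain ⟨g, hg, h2⟩ := ((mem_closure_iff_frequently.1 hf).and_eventually h1).exists
  refine ⟨g, hg, ?_⟩
  filter_upwards [mem_nhdsWithin_of_mem_nhds (Metric.closedBall_mem_nhds q one_pos),
    self_mem_nhdsWithin] with z hz hz'
  exact h2 z ⟨⟨hz, (show 0 < ySq z from hz').le⟩, hz'⟩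

/-- A field close to a smoothly extendable one oscillates little near `q`, so its values form a
Cauchy filter. -/
theorem exists_tendsto_of_mem_regularFields {f : SpinorField n} (hf : f ∈ regularFields n)
    {q : Cover n} (hq : q ∈ Cone n) : ∃ w, Filter.Tendsto f (𝓝[HPlus n] q) (𝓝 w) := by
  have := neBot_nhdsWithin_HPlus hq
  rw [← cauchy_map_iff_exists_tendsto, Metric.cauchy_iff]
  refine ⟨Filter.map_neBot, fun ε hε => ?_⟩
  obtain ⟨g, ⟨G, hG, hgG⟩, h⟩ := exists_eventually_norm_sub_lt hf (q := q) (ε := ε / 4)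
    (by positivity)
  have h1 : ∀ᶠ z in 𝓝[HPlus n] q, dist (G z) (G q) < ε / 4 :=
    (hG.continuous.tendsto q).mono_left nhdsWithin_le_nhds |>.eventually
      (Metric.ball_mem_nhds _ (by positivity))
  refine ⟨_, Filter.image_mem_map ((h.and h1).and self_mem_nhdsWithin), ?_⟩
  have key : ∀ z, ((‖g z - f z‖ < ε / 4 ∧ dist (G z) (G q) < ε / 4) ∧ z ∈ HPlus n) →
      dist (f z) (G q) < ε / 2 := by
    rintro z ⟨⟨h2, h3⟩, hz⟩
    rw [← dist_eq_norm, hgG z hz, dist_comm] at h2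
    linarith [dist_triangle (f z) (G z) (G q)]
  rintro _ ⟨z, hz, rfl⟩ _ ⟨z', hz', rfl⟩
  linarith [dist_triangle_right (f z) (f z') (G q), key z hz, key z' hz']

theorem isClosed_tendsto_zero (q : Cover n) :
    IsClosed {f : SpinorField n | Filter.Tendsto f (𝓝[HPlus n] q) (𝓝 0)} := by
  refine isClosed_of_closure_subset fun f hf => ?_
  change Filter.Tendsto f _ _
  rw [Metric.tendsto_nhds]
  intro ε hε
  obtain ⟨g, hg, h⟩ := exists_eventually_norm_sub_lt hf (q := q) (ε := ε / 2) (by positivity)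
  have h1 := Metric.tendsto_nhds.1 (show Filter.Tendsto g _ _ from hg) (ε / 2) (by positivity)
  filter_upwards [h, h1] with z h2 h3
  rw [← dist_eq_norm, dist_comm] at h2
  linarith [dist_triangle (f z) (g z) 0]

/-- The boundary values of a field on the cone, extended by zero. -/
def bvFun (f : SpinorField n) : Cover n → Spinor n :=
  (Cone n).indicator (extendFrom (HPlus n) f)

theorem bvFun_of_notMem (f : SpinorField n) {q : Cover n} (hq : q ∉ Cone n) : bvFun f q = 0 :=
  Set.indicator_of_notMem hq _

theorem tendsto_bvFun {f : SpinorField n} (hf : f ∈ regularFields n) {q : Cover n}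
    (hq : q ∈ Cone n) : Filter.Tendsto f (𝓝[HPlus n] q) (𝓝 (bvFun f q)) := by
  unfold bvFun
  rw [Set.indicator_of_mem hq]
  exact tendsto_extendFrom (exists_tendsto_of_mem_regularFields hf hq)

theorem bvFun_eq {f : SpinorField n} {q : Cover n} (hq : q ∈ Cone n) {w : Spinor n}
    (h : Filter.Tendsto f (𝓝[HPlus n] q) (𝓝 w)) : bvFun f q = w := by
  unfold bvFun
  rw [Set.indicator_of_mem hq]
  exact extendFrom_eq (mem_closure_iff_nhdsWithin_neBot.2 (neBot_nhdsWithin_HPlus hq)) h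

/-- Boundary values as a linear map. -/
def bvLin (n : ℕ) : regularFields n →ₗ[ℂ] (Cover n → Spinor n) where
  toFun f := bvFun (f : SpinorField n)
  map_add' f g := by
    funext q
    by_cases hq : q ∈ Cone n
    · exact bvFun_eq hq ((tendsto_bvFun f.2 hq).add (tendsto_bvFun g.2 hq))
    · rw [Pi.add_apply, bvFun_of_notMem _ hq, bvFun_of_notMem _ hq, bvFun_of_notMem _ hq, add_zero]
  map_smul' a f := by
    funext q
    by_cases hq : q ∈ Cone n
    · exact bvFun_eq hq ((tendsto_bvFun f.2 hq).const_smul a)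
    · rw [Pi.smul_apply, bvFun_of_notMem _ hq, bvFun_of_notMem _ hq, smul_zero]

theorem hasFDerivAt_bvFun {f : SpinorField n} (hf : f ∈ regularFields n) {q : Cover n}
    (hq : q ∈ Cone n) : HasFDerivAt (fun z => bvFun f (retract 0 z))
      (coneDeriv q fun a => bvFun (pd a f) q) q :=
  hasFDerivAt_boundary f (fun _ hz => tendsto_bvFun hf hz) hq fun a =>
    tendsto_bvFun (mem_regularFields (pd_mem_contOps a) (fun _ => pd_mem_smoothFields a) hf) hq

theorem bvFun_fieldRep (γ : Gammas n) {f : SpinorField n} (hf : f ∈ regularFields n) {q : Cover n}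
    (hq : q ∈ Cone n) (a b : Fin (n + 2)) : bvFun (fieldRep γ a b f) q =
      coneDeriv q (fun a => bvFun (pd a f) q) (rotField a b q) +
        (spinMat γ a b).mulVec (bvFun f q) := by
  refine bvFun_eq hq ?_
  rw [coneDeriv_rotField hq]
  have hp : ∀ a, Filter.Tendsto (pd a f : SpinorField n) (𝓝[HPlus n] q)
      (𝓝 (bvFun (pd a f) q)) := fun a =>
    tendsto_bvFun (mem_regularFields (pd_mem_contOps a) (fun _ => pd_mem_smoothFields a) hf) hq
  have hy : ∀ a, Filter.Tendsto (fun z : Cover n => eta a * coord a z) (𝓝[HPlus n] q)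
      (𝓝 (eta a * coord a q)) := fun a =>
    ((continuous_const.mul (contDiff_coord a).continuous).tendsto q).mono_left nhdsWithin_le_nhds
  have hm : Filter.Tendsto (fun z => (spinMat γ a b).mulVec (f z)) (𝓝[HPlus n] q)
      (𝓝 ((spinMat γ a b).mulVec (bvFun f q))) :=
    ((Matrix.toLin' (spinMat γ a b)).toContinuousLinearMap.continuous.tendsto _).comp
      (tendsto_bvFun hf hq)
  refine ((((hy a).smul (hp b)).sub ((hy b).smul (hp a))).add hm).congr fun z => ?_
  unfold fieldRep orbital
  simp only [LinearMap.add_apply, LinearMap.sub_apply, LinearMap.smul_apply, Module.End.mul_apply,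
    field_add_apply, field_sub_apply, field_smul_apply, mulY_apply, mulMat_apply, mul_smul]
  congr 2

theorem hasConeAction_bvFun (γ : Gammas n) {f : SpinorField n} (hf : f ∈ regularFields n)
    {q : Cover n} (hq : q ∈ Cone n) (a b : Fin (n + 2)) :
    HasConeAction γ a b (bvFun f) q (bvFun (fieldRep γ a b f) q) := by
  refine ⟨_, ?_, bvFun_fieldRep γ hf hq a b⟩
  refine (hasFDerivAt_bvFun hf hq).hasFDerivWithinAt.congr (fun z hz => ?_) ?_
  · exact congrArg (bvFun f) (retract_zero_of_mem hz).symm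
  · exact congrArg (bvFun f) (retract_zero_of_mem hq).symm

/-- If the boundary values vanish on the cone, the composition with the retraction vanishes near `q`
and has zero derivative. Uniqueness of the derivative kills `coneDeriv`, hence the rotation term,
even though individual partial derivatives need not vanish on the cone. -/
theorem bvFun_fieldRep_eq_zero (γ : Gammas n) {f : SpinorField n} (hf : f ∈ regularFields n)
    (h0 : ∀ q ∈ Cone n, bvFun f q = 0) {q : Cover n} (hq : q ∈ Cone n) (a b : Fin (n + 2)) :
    bvFun (fieldRep γ a b f) q = 0 := by
  have h1 : HasFDerivAt (fun z => bvFun f (retract 0 z)) (0 : Cover n →L[ℝ] Spinor n) q := by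
    refine (hasFDerivAt_const (0 : Spinor n) q).congr_of_eventuallyEq ?_
    filter_upwards [eventually_shift_pos hq] with z hz
    exact h0 _ (retract_mem_Cone hz)
  rw [bvFun_fieldRep γ hf hq, (hasFDerivAt_bvFun hf hq).unique h1, h0 q hq, Matrix.mulVec_zero]
  simp

end GuptaBleuler

end

noncomputable section

namespace GuptaBleuler

variable {n : ℕ}

/-! ### Boundary values of `y̸ Ψ` -/

/-- The matrix `y̸` at a point. -/
def slashMat (γ : Gammas n) (z : Cover n) : Matrix (Fin (2 ^ rk n)) (Fin (2 ^ rk n)) ℂ :=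
  ∑ a, (coord a z : ℂ) • γ a

theorem ySlash_apply (γ : Gammas n) (f : SpinorField n) (z : Cover n) :
    ySlash γ f z = (slashMat γ z).mulVec (f z) := by
  unfold ySlash slashMat
  rw [LinearMap.sum_apply, field_sum_apply, Matrix.sum_mulVec]
  refine Finset.sum_congr rfl fun a _ => ?_
  rw [Module.End.mul_apply, mulY_apply, mulMat_apply, Matrix.smul_mulVec]
  ext i
  simp

theorem continuous_slashMat_mulVec (γ : Gammas n) {F : Cover n → Spinor n} (hF : Continuous F) :
    Continuous fun z => (slashMat γ z).mulVec (F z) := by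
  have h : ∀ z, (slashMat γ z).mulVec (F z) = ∑ a, (coord a z : ℂ) • (γ a).mulVec (F z) := by
    intro z
    unfold slashMat
    rw [Matrix.sum_mulVec]
    exact Finset.sum_congr rfl fun a _ => Matrix.smul_mulVec _ _ _
  simp only [h]
  refine continuous_finsetSum _ fun a _ => ?_
  exact (Complex.continuous_ofReal.comp (contDiff_coord a).continuous).smul
    ((Matrix.toLin' (γ a)).toContinuousLinearMap.continuous.comp hF)

section
variable {γ : Gammas n} {v : Spinor n} {c : ℂ}

theorem gamma_mul_slashMat_add (hγ : IsClifford γ) (a : Fin (n + 2)) (z : Cover n) :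
    γ a * slashMat γ z + slashMat γ z * γ a = (2 * (eta a * coord a z : ℝ) : ℂ) • 1 := by
  unfold slashMat
  rw [Finset.mul_sum, Finset.sum_mul, ← Finset.sum_add_distrib]
  simp only [mul_smul_comm, smul_mul_assoc, ← smul_add, hγ a]
  rw [Finset.sum_eq_single a]
  · rw [smul_smul]
    congr 1
    simp only [etaMat, if_true]
    push_cast
    ring
  · intro b _ hb
    simp [etaMat, hb.symm]
  · simp

theorem slashMat_sq (hγ : IsClifford γ) (z : Cover n) :
    slashMat γ z * slashMat γ z = (ySq z : ℂ) • 1 := by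
  have h : slashMat γ z * slashMat γ z + slashMat γ z * slashMat γ z = (2 * ySq z : ℂ) • 1 := by
    have e : ∀ A, slashMat γ z * A + A * slashMat γ z =
        ∑ a, (coord a z : ℂ) • (γ a * A + A * γ a) := by
      intro A
      unfold slashMat
      rw [Finset.mul_sum, Finset.sum_mul, ← Finset.sum_add_distrib]
      simp only [mul_smul_comm, smul_mul_assoc, ← smul_add]
    rw [e]
    simp only [gamma_mul_slashMat_add hγ, smul_smul]
    rw [← Finset.sum_smul]
    congr 1
    unfold ySq
    push_cast
    rw [Finset.mul_sum]
    exact Finset.sum_congr rfl fun a _ => by ring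
  rw [← two_smul ℂ, mul_smul] at h
  exact smul_right_injective _ (two_ne_zero (α := ℂ)) h

theorem omega_one_mul_slashMat_add (hγ : IsClifford γ) (z : Cover n) :
    omega γ 1 * slashMat γ z + slashMat γ z * omega γ 1 =
      (2 * (Complex.I * (Real.sqrt 2 : ℂ)⁻¹) * Complex.exp z.1) • 1 := by
  unfold omega
  rw [Finset.mul_sum, Finset.sum_mul, ← Finset.sum_add_distrib]
  simp only [mul_smul_comm, smul_mul_assoc, ← smul_add, gamma_mul_slashMat_add hγ]
  rw [sum_isoCoeff_one, smul_smul, ← add_smul, smul_smul]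
  congr 1
  have c0 : coord 0 z = (Complex.exp z.1).re := rfl
  have c1 : coord 1 z = (Complex.exp z.1).im := rfl
  have e := Complex.re_add_im (Complex.exp z.1)
  rw [c0, c1]
  simp only [eta, Fin.val_zero, Fin.val_one, Nat.ofNat_pos, Nat.one_lt_ofNat, if_true, one_mul]
  linear_combination (2 * (Complex.I * (Real.sqrt 2 : ℂ)⁻¹)) * e

/-- The anticommutator of `ω_1` with `slashMat` is the scalar `2 x_1`, which never vanishes on the
covering, so a nonzero spinor cannot be annihilated by both. -/
theorem slashMat_mulVec_ne_zero (hγ : IsClifford γ) (z : Cover n)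
    {u : Spinor n} (hu : (omega γ 1).mulVec u = 0) (h0 : u ≠ 0) : (slashMat γ z).mulVec u ≠ 0 := by
  intro h
  have e := congrArg (fun A => A.mulVec u) (omega_one_mul_slashMat_add hγ z)
  simp only [Matrix.add_mulVec, ← Matrix.mulVec_mulVec, h, hu, Matrix.mulVec_zero, add_zero,
    Matrix.smul_mulVec, Matrix.one_mulVec] at e
  have h2 : (Real.sqrt 2 : ℂ) ≠ 0 := by
    exact_mod_cast (Real.sqrt_pos.2 (zero_lt_two (α := ℝ))).ne'
  refine (smul_ne_zero ?_ h0) e.symm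
  exact mul_ne_zero (mul_ne_zero two_ne_zero (mul_ne_zero Complex.I_ne_zero (inv_ne_zero h2)))
    (Complex.exp_ne_zero _)

/-- The fields `Ψ` for which `y̸ Ψ` vanishes on the cone. -/
def nullFields (γ : Gammas n) : Submodule ℂ (SpinorField n) where
  carrier := {f | ∀ q ∈ Cone n, Filter.Tendsto (ySlash γ f) (𝓝[HPlus n] q) (𝓝 0)}
  zero_mem' := fun q _ => by rw [map_zero]; exact tendsto_const_nhds
  add_mem' := fun {f g} hf hg q hq => by
    rw [map_add]
    have := (hf q hq).add (hg q hq)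
    rw [add_zero] at this
    exact this
  smul_mem' := fun a f hf q hq => by
    rw [map_smul]
    have := (hf q hq).const_smul a
    rw [smul_zero] at this
    exact this

theorem isClosed_nullFields (γ : Gammas n) : IsClosed (nullFields γ : Set (SpinorField n)) := by
  have : (nullFields γ : Set (SpinorField n)) = ⋂ q ∈ Cone n, (ySlash γ) ⁻¹'
      {f : SpinorField n | Filter.Tendsto f (𝓝[HPlus n] q) (𝓝 0)} := by
    ext f
    simp only [Set.mem_iInter]
    rfl
  rw [this]
  exact isClosed_biInter fun q _ => (isClosed_tendsto_zero q).preimage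
    (show Continuous (ySlash γ) from ySlash_mem_contOps γ)

/-- Applying `ySlash` twice multiplies by `y²`, which vanishes on the cone, while the smooth
extension of the field stays bounded near `q`. -/
theorem ySlash_mem_nullFields (hγ : IsClifford γ) {f : SpinorField n} (hf : f ∈ smoothFields n) :
    ySlash γ f ∈ nullFields γ := by
  obtain ⟨F, hF, hf⟩ := hf
  intro q hq
  have h1 : Continuous fun z => (ySq z : ℂ) • F z :=
    (Complex.continuous_ofReal.comp contDiff_ySq.continuous).smul hF.continuous
  have h2 : (ySq q : ℂ) • F q = 0 := by rw [show ySq q = 0 from hq]; simp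
  refine ((h2 ▸ h1.tendsto q).mono_left nhdsWithin_le_nhds).congr' ?_
  filter_upwards [self_mem_nhdsWithin] with z hz
  rw [ySlash_apply, ySlash_apply, Matrix.mulVec_mulVec, slashMat_sq hγ, Matrix.smul_mulVec,
    Matrix.one_mulVec, hf z hz]

theorem fieldRep_ySlash (hγ : IsClifford γ) (a b : Fin (n + 2)) (f : SpinorField n) :
    fieldRep γ a b (ySlash γ f) = ySlash γ (fieldRep γ a b f) := by
  rw [fieldRep_eq_genOp, genOp_spat_slash hγ]

theorem cyclic_Psi3_le_nullFields (hγ : IsClifford γ) (v : Spinor n) :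
    cyclic (fieldRep γ) (Psi3 γ v) ≤ nullFields γ := by
  refine (cyclic_le (W := (smoothFields n).map (ySlash γ)) ?_
    ⟨_, powField_mem_smoothFields _ _, rfl⟩).trans ?_
  · rintro a b _ ⟨f, hf, rfl⟩
    exact ⟨_, invariant_smoothFields γ a b f hf, (fieldRep_ySlash hγ a b f).symm⟩
  · rintro _ ⟨f, hf, rfl⟩
    exact ySlash_mem_nullFields hγ hf

theorem closedModule_le_regularFields (v : Spinor n) :
    closedModule γ (Psi2 v) ≤ regularFields n :=
  Submodule.topologicalClosure_mono
    (cyclic_le (invariant_smoothFields γ) (powField_mem_smoothFields _ _))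

theorem ySlash_mem_regularFields (γ : Gammas n) {f : SpinorField n} (hf : f ∈ regularFields n) :
    ySlash γ f ∈ regularFields n :=
  mem_regularFields (ySlash_mem_contOps γ) (fun _ => ySlash_mem_smoothFields γ) hf

theorem mem_nullFields_iff {f : SpinorField n} (hf : f ∈ regularFields n) :
    f ∈ nullFields γ ↔ ∀ q ∈ Cone n, bvFun (ySlash γ f) q = 0 :=
  forall₂_congr fun _ hq => ⟨fun h => bvFun_eq hq h, fun h =>
    h ▸ tendsto_bvFun (ySlash_mem_regularFields γ hf) hq⟩

theorem tendsto_ySlash_Psi2 (γ : Gammas n) (v : Spinor n) (q : Cover n) :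
    Filter.Tendsto (ySlash γ (Psi2 v)) (𝓝[HPlus n] q)
      (𝓝 ((slashMat γ q).mulVec (xpow (-(n : ℂ) / 2) q • v))) := by
  have h : Continuous fun z : Cover n => xpow (-(n : ℂ) / 2) z • v := by
    unfold xpow; fun_prop
  refine (((continuous_slashMat_mulVec γ h).tendsto q).mono_left nhdsWithin_le_nhds).congr' ?_
  filter_upwards [self_mem_nhdsWithin] with z hz
  rw [ySlash_apply, Psi2, powField_apply _ _ hz]

theorem IsVac.limit_Psi2_ne_zero (hV : IsVac γ v c) (q : Cover n) :
    (slashMat γ q).mulVec (xpow (-(n : ℂ) / 2) q • v) ≠ 0 :=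
  slashMat_mulVec_ne_zero hV.clifford q
    (by rw [Matrix.mulVec_smul, hV.vac_mem.1, smul_zero])
    (smul_ne_zero (xpow_ne_zero _ _) hV.ne_zero)

theorem exists_mem_Cone (hn : 1 ≤ n) : ∃ q : Cover n, q ∈ Cone n := by
  refine ⟨(0, Pi.single ⟨0, hn⟩ 1), ?_⟩
  change ySq _ = 0
  rw [ySq_eq]
  simp [Pi.single_apply, ite_pow]

theorem IsVac.Psi2_notMem_nullFields (hV : IsVac γ v c) : Psi2 v ∉ nullFields γ := by
  intro h
  obtain ⟨q, hq⟩ := exists_mem_Cone (n := n) (by have := hV.three_le; omega)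
  have := neBot_nhdsWithin_HPlus hq
  exact hV.limit_Psi2_ne_zero q (tendsto_nhds_unique (tendsto_ySlash_Psi2 γ v q) (h q hq))

/-- The intersection is invariant, since vanishing on the cone is preserved by the tangential
action. It contains the module of `Psi3` but not `Psi2`, so irreducibility of the quotient leaves
only the module of `Psi3`. -/
theorem IsVac.cyclic_Psi2_inf_nullFields (hV : IsVac γ v c) :
    cyclic (fieldRep γ) (Psi2 v) ⊓ nullFields γ ≤ cyclic (fieldRep γ) (Psi3 γ v) := by
  have hreg : ∀ f ∈ cyclic (fieldRep γ) (Psi2 v), f ∈ regularFields n := fun f hf =>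
    closedModule_le_regularFields v (Submodule.le_topologicalClosure _ hf)
  refine (hV.irreducible_two ?_ (le_inf hV.cyclic_three_le
    (cyclic_Psi3_le_nullFields hV.clifford v)) inf_le_left).resolve_right fun h =>
    hV.Psi2_notMem_nullFields (h (mem_cyclic_self _ _)).2
  rintro a b f ⟨hf, hf0⟩
  have hm := invariant_cyclic (fieldRep γ) (Psi2 v) a b f hf
  refine ⟨hm, (mem_nullFields_iff (hreg _ hm)).2 fun q hq => ?_⟩
  rw [← fieldRep_ySlash hV.clifford]
  exact bvFun_fieldRep_eq_zero γ (ySlash_mem_regularFields γ (hreg f hf))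
    ((mem_nullFields_iff (hreg f hf)).1 hf0) hq a b

/-- `ySlash` commutes with `H` and so preserves weights, which gives the identity on homogeneous
fields. Both sides are continuous, so it passes to the closure. -/
theorem avg_ySlash (hγ : IsClifford γ) {M : Submodule ℂ (SpinorField n)}
    (hM : M ≤ ⨆ d, ambient γ c d) {Ψ : SpinorField n} (hΨ : Ψ ∈ M.topologicalClosure) (d : ℕ)
    {z : Cover n} (hz : z ∈ HPlus n) : avg hγ (hvalR n d) hz (ySlash γ Ψ) =
      (slashMat γ z).mulVec (avg hγ (hvalR n d) hz Ψ) := by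
  set D : SpinorField n →ₗ[ℂ] Spinor n := avg hγ (hvalR n d) hz ∘ₗ ySlash γ -
    (Matrix.toLin' (slashMat γ z)) ∘ₗ avg hγ (hvalR n d) hz with hD
  have hc : Continuous D := by
    have h1 := continuous_avg hγ (hvalR n d) hz (ySlash_mem_contOps γ)
    have h2 := continuous_avg hγ (hvalR n d) hz (one_mem (contOps n))
    exact h1.sub ((Matrix.toLin' (slashMat γ z)).toContinuousLinearMap.continuous.comp h2)
  have h0 : ∀ d', ambient γ c d' ≤ LinearMap.ker D := by
    intro d' f hf
    have hH := H_ambient hγ hf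
    rw [← ofReal_hvalR] at hH
    have hH' : genOp γ (isoCoeff (-1)) (isoCoeff 1) (ySlash γ f) =
        ((hvalR n d' : ℝ) : ℂ) • ySlash γ f := by rw [genOp_spat_slash hγ, hH, map_smul]
    have hm : hvalR n d' - hvalR n d = (((d : ℤ) - d' : ℤ) : ℝ) := by
      unfold hvalR; push_cast; ring
    rw [LinearMap.mem_ker, hD, LinearMap.sub_apply, LinearMap.comp_apply, LinearMap.comp_apply,
      avg_eigen hγ hH hm, avg_eigen hγ hH' hm, Matrix.toLin'_apply, ySlash_apply]
    split_ifs
    · rw [sub_self]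
    · rw [Matrix.mulVec_zero, sub_self]
  have h1 : M ≤ LinearMap.ker D := hM.trans (iSup_le h0)
  have h2 : D Ψ = 0 := closure_minimal (s := (M : Set (SpinorField n))) h1
    (isClosed_singleton.preimage hc) hΨ
  exact sub_eq_zero.1 h2

/-- The decay towards the cone holds near each rotated point of `q`, and compactness of the interval
of angles makes it uniform, so it survives the averaging. -/
theorem eventually_norm_avg_le (hγ : IsClifford γ) {f : SpinorField n}
    (hf : ∀ q ∈ Cone n, Filter.Tendsto f (𝓝[HPlus n] q) (𝓝 0)) {q : Cover n} (hq : q ∈ Cone n)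
    {ε : ℝ} (hε : 0 < ε) :
    ∀ᶠ z in 𝓝 q, ∀ hz : z ∈ HPlus n, ∀ κ, ‖avg hγ κ hz f‖ ≤ ε := by
  obtain ⟨C, hC, hb⟩ := exists_norm_avg_le hγ
  have h1 : ∀ᶠ z in 𝓝 q, ∀ t ∈ Set.Icc 0 (2 * Real.pi), z ∈ HPlus n →
      ‖f (rotZ t z)‖ ≤ ε / C := by
    refine isCompact_Icc.eventually_forall_of_forall_eventually fun t _ => ?_
    have hq' : rotZ t q ∈ Cone n := by
      change ySq _ = 0
      rw [ySq_rotZ]; exact hq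
    have h2 := Metric.tendsto_nhds.1 (hf _ hq') (ε / C) (by positivity)
    rw [eventually_nhdsWithin_iff] at h2
    have h3 : Filter.Tendsto (fun p : Cover n × ℝ => rotZ p.2 p.1) (𝓝 (q, t)) (𝓝 (rotZ t q)) :=
      (continuous_rotZ.comp (continuous_snd.prodMk continuous_fst)).tendsto (q, t)
    filter_upwards [h3.eventually h2] with p hp hz
    have := hp (rotZ_mem_HPlus hz)
    rw [dist_zero_right] at this
    exact this.le
  filter_upwards [h1] with z hz hz' κ
  refine (hb κ hz' f (ε / C) fun t ht => hz t ht hz').trans (le_of_eq ?_)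
  field_simp

/-- Averaging commutes with `ySlash` and preserves vanishing on the cone, so each component has the
vanishing property. Being in the cyclic module of `Psi2`, it then lies in that of `Psi3`, and the
field is the limit of the partial sums of its components. -/
theorem IsVac.mem_closure_of_mem_nullFields (hV : IsVac γ v c) {Ψ : SpinorField n}
    (hΨ : Ψ ∈ closedModule γ (Psi2 v)) (h0 : Ψ ∈ nullFields γ) :
    Ψ ∈ closedModule γ (Psi3 γ v) := by
  have hγ := hV.clifford
  have hM := hV.cyclic_two_le.trans hV.cyclic_one_le_ambient
  choose g hg hgw using exists_component hγ (invariant_cyclic _ _) hM hΨ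
  have hnull : ∀ d, g d ∈ nullFields γ := by
    intro d q hq
    rw [Metric.tendsto_nhds]
    intro ε hε
    rw [eventually_nhdsWithin_iff]
    filter_upwards [eventually_norm_avg_le hγ h0 hq (half_pos hε)] with z hz hz'
    have e : g d z = avg hγ (hvalR n d) hz' Ψ := by
      have h1 := hgw d [] hz'
      have h2 : wordWt ([] : List (Bool ⊕ Fin n)) = 0 := rfl
      rw [h2] at h1
      rw [show g d z = avg hγ _ hz' Ψ from h1]
      congr 1
      simp
    rw [dist_zero_right, ySlash_apply, e, ← avg_ySlash hγ hM hΨ]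
    linarith [hz hz' (hvalR n d)]
  refine mem_closure_of_tendsto (tendsto_sum_components hγ hV.three_le hM hΨ hgw)
    (Filter.Eventually.of_forall fun m => Submodule.sum_mem _ fun d _ =>
      hV.cyclic_Psi2_inf_nullFields ⟨(hg d).1, hnull d⟩)

end

end GuptaBleuler

end

noncomputable section

namespace GuptaBleuler

variable {n : ℕ}

/-! ### The boundary map and the subquotients of the three closed modules -/

section
variable {γ : Gammas n} {v : Spinor n} {c : ℂ}

/-- The boundary values of `y̸ Ψ` for `Ψ` in the closure of the module generated by `Ψ₂`. -/
def slashBoundary (γ : Gammas n) (v : Spinor n) :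
    closedModule γ (Psi2 v) →ₗ[ℂ] (Cover n → Spinor n) :=
  bvLin n ∘ₗ ((ySlash γ).domRestrict (closedModule γ (Psi2 v))).codRestrict (regularFields n)
    fun f => ySlash_mem_regularFields γ (closedModule_le_regularFields v f.2)

theorem slashBoundary_apply (f : closedModule γ (Psi2 v)) :
    slashBoundary γ v f = bvFun (ySlash γ (f : SpinorField n)) := rfl

theorem closedModule_Psi3_le_nullFields (hγ : IsClifford γ) (v : Spinor n) :
    closedModule γ (Psi3 γ v) ≤ nullFields γ :=
  Submodule.topologicalClosure_minimal _ (cyclic_Psi3_le_nullFields hγ v) (isClosed_nullFields γ)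

theorem IsVac.ker_slashBoundary (hV : IsVac γ v c) : LinearMap.ker (slashBoundary γ v) =
    (closedModule γ (Psi3 γ v)).submoduleOf (closedModule γ (Psi2 v)) := by
  ext f
  have hr := closedModule_le_regularFields v f.2
  rw [LinearMap.mem_ker]
  change _ ↔ (f : SpinorField n) ∈ closedModule γ (Psi3 γ v)
  constructor
  · intro h
    exact hV.mem_closure_of_mem_nullFields f.2
      ((mem_nullFields_iff hr).2 fun q _ => congrFun h q)
  · intro h
    have h0 := (mem_nullFields_iff hr).1 (closedModule_Psi3_le_nullFields hV.clifford v h)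
    funext q
    by_cases hq : q ∈ Cone n
    · exact h0 q hq
    · exact bvFun_of_notMem _ hq

/-- `dSlash` vanishes on the whole module of `Psi2`, whereas `ySlash` applied to `dSlash Ψ₁` is a
nonzero multiple of `Psi3`. -/
theorem IsVac.Psi1_notMem (hV : IsVac γ v c) : Psi1 γ v ∉ cyclic (fieldRep γ) (Psi2 v) := by
  intro h
  have h1 := hV.ySlash_dSlash_Psi1
  rw [hV.dSlash_cyclic_Psi2 h, map_zero] at h1
  have hn : (n : ℂ) ≠ 0 := by
    have := hV.three_le
    exact_mod_cast (by omega : n ≠ 0)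
  exact smul_ne_zero hn hV.Psi3_ne_zero h1.symm

theorem IsVac.carries_one_two (hV : IsVac γ v c) : SubquotientCarries (fieldRep γ)
    (closedModule γ (Psi1 γ v)) (closedModule γ (Psi2 v)) (weightGauge n) :=
  subquotientCarries hV.clifford hV.three_le (invariant_cyclic _ _) (invariant_cyclic _ _)
    hV.cyclic_one_le_ambient hV.cyclic_two_le (fun _ => hV.irreducible_one)
    (mem_cyclic_self _ _) hV.Psi1_notMem (fun _ _ => hV.nilp_Psi1) hV.weight_Psi1

theorem IsVac.carries_two_three (hV : IsVac γ v c) : SubquotientCarries (fieldRep γ)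
    (closedModule γ (Psi2 v)) (closedModule γ (Psi3 γ v)) (weightPhys n) :=
  subquotientCarries hV.clifford hV.three_le (invariant_cyclic _ _) (invariant_cyclic _ _)
    (hV.cyclic_two_le.trans hV.cyclic_one_le_ambient) hV.cyclic_three_le
    (fun _ => hV.irreducible_two) (mem_cyclic_self _ _)
    (fun h => hV.Psi2_notMem_nullFields (cyclic_Psi3_le_nullFields hV.clifford v h))
    (fun _ _ h => by rw [hV.nilp_Psi2 h]; exact Submodule.zero_mem _) hV.weight_Psi2

theorem IsVac.carries_three (hV : IsVac γ v c) : SubquotientCarries (fieldRep γ)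
    (closedModule γ (Psi3 γ v)) ⊥ (weightGauge n) := by
  -- The denominator becomes the closure of the zero module, so that the general statement on
  -- subquotients of closures applies.
  rw [← closure_bot_field]
  refine subquotientCarries hV.clifford hV.three_le (invariant_cyclic _ _) invariant_bot
    (hV.cyclic_three_le.trans (hV.cyclic_two_le.trans hV.cyclic_one_le_ambient)) bot_le
    (fun W hW _ hle => ?_) (mem_cyclic_self _ _)
    (fun h => hV.Psi3_ne_zero ((Submodule.mem_bot ℂ).1 h))
    (fun _ _ h => by rw [hV.nilp_Psi3 h]; exact Submodule.zero_mem _) hV.weight_Psi3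
  exact (hV.irreducible_three hW hle).imp le_of_eq id

theorem IsVac.ySlash_dSlash_sq_Psi1 (hV : IsVac γ v c) :
    ((ySlash γ * dSlash γ) ^ 2) (Psi1 γ v) = 0 := by
  simp only [pow_two, Module.End.mul_apply]
  rw [hV.ySlash_dSlash_Psi1, map_smul, hV.dSlash_Psi3, smul_zero, map_zero]

theorem IsVac.exists_boundary_map (hV : IsVac γ v c) :
    ∃ β : (closedModule γ (Psi2 v) ⧸
        (closedModule γ (Psi3 γ v)).submoduleOf (closedModule γ (Psi2 v))) →ₗ[ℂ]
        (Cover n → Spinor n),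
      Function.Injective β ∧
      (∀ x, ∀ z ∉ Cone n, β x z = 0) ∧
      (∀ Ψ : closedModule γ (Psi2 v), ∀ q ∈ Cone n,
        Filter.Tendsto (ySlash γ Ψ : Cover n → Spinor n) (𝓝[HPlus n] q)
          (𝓝 (β (Submodule.Quotient.mk Ψ) q))) ∧
      (∀ (Ψ Ψ' : closedModule γ (Psi2 v)) (a b : Fin (n + 2)),
        (Ψ' : SpinorField n) = fieldRep γ a b Ψ → ∀ q ∈ Cone n,
          HasConeAction γ a b (β (Submodule.Quotient.mk Ψ)) q
            (β (Submodule.Quotient.mk Ψ') q)) := by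
  have hreg : ∀ Ψ : closedModule γ (Psi2 v), ySlash γ (Ψ : SpinorField n) ∈ regularFields n :=
    fun Ψ => ySlash_mem_regularFields γ (closedModule_le_regularFields v Ψ.2)
  refine ⟨Submodule.liftQ _ (slashBoundary γ v) hV.ker_slashBoundary.ge, ?_, ?_, ?_, ?_⟩
  · exact LinearMap.ker_eq_bot.1 (Submodule.ker_liftQ_eq_bot _ _ _ hV.ker_slashBoundary.le)
  · intro x z hz
    obtain ⟨Ψ, rfl⟩ := Submodule.Quotient.mk_surjective _ x
    rw [Submodule.liftQ_apply, slashBoundary_apply]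
    exact bvFun_of_notMem _ hz
  · intro Ψ q hq
    rw [Submodule.liftQ_apply, slashBoundary_apply]
    exact tendsto_bvFun (hreg Ψ) hq
  · intro Ψ Ψ' a b h q hq
    rw [Submodule.liftQ_apply, Submodule.liftQ_apply, slashBoundary_apply, slashBoundary_apply, h,
      ← fieldRep_ySlash hV.clifford]
    exact hasConeAction_bvFun γ (hreg Ψ) hq a b

end

end GuptaBleuler

end

theorem mainTheorem10 (n : ℕ) (hn : 3 ≤ n) (γ : GuptaBleuler.Gammas n)
    (hγ : GuptaBleuler.IsClifford γ) (v : GuptaBleuler.Spinor n)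
    (hv : GuptaBleuler.IsMaximalVector (GuptaBleuler.spinRep γ) (GuptaBleuler.sigma n) v)
    (Ψ₁ Ψ₂ Ψ₃ : GuptaBleuler.SpinorField n)
    (hΨ₁ : Ψ₁ = GuptaBleuler.Psi1 γ v) (hΨ₂ : Ψ₂ = GuptaBleuler.Psi2 v)
    (hΨ₃ : Ψ₃ = GuptaBleuler.Psi3 γ v)
    (H₁ H₂ H₃ : Submodule ℂ (GuptaBleuler.SpinorField n))
    (hH₁ : H₁ = GuptaBleuler.closedModule γ Ψ₁) (hH₂ : H₂ = GuptaBleuler.closedModule γ Ψ₂)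
    (hH₃ : H₃ = GuptaBleuler.closedModule γ Ψ₃) :
    -- the chain of closed invariant subspaces
    (H₃ ≤ H₂ ∧ H₂ ≤ H₁ ∧
      IsClosed (H₁ : Set (GuptaBleuler.SpinorField n)) ∧
      IsClosed (H₂ : Set (GuptaBleuler.SpinorField n)) ∧
      IsClosed (H₃ : Set (GuptaBleuler.SpinorField n)) ∧
      GuptaBleuler.Invariant (GuptaBleuler.fieldRep γ) H₁ ∧
      GuptaBleuler.Invariant (GuptaBleuler.fieldRep γ) H₂ ∧
      GuptaBleuler.Invariant (GuptaBleuler.fieldRep γ) H₃) ∧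
    -- the representations carried by `H₁ / H₂`, `H₃` and `H₂ / H₃`
    (GuptaBleuler.SubquotientCarries (GuptaBleuler.fieldRep γ) H₁ H₂
        (GuptaBleuler.weightGauge n) ∧
      GuptaBleuler.SubquotientCarries (GuptaBleuler.fieldRep γ) H₃ ⊥
        (GuptaBleuler.weightGauge n) ∧
      GuptaBleuler.SubquotientCarries (GuptaBleuler.fieldRep γ) H₂ H₃
        (GuptaBleuler.weightPhys n)) ∧
    -- the Dirac-type operator
    (GuptaBleuler.dSlash γ Ψ₂ = 0 ∧ GuptaBleuler.dSlash γ Ψ₃ = 0 ∧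
      GuptaBleuler.ySlash γ (GuptaBleuler.dSlash γ Ψ₁) = (n : ℂ) • Ψ₃ ∧
      (n : ℂ) • Ψ₃ ≠ 0 ∧
      ((GuptaBleuler.ySlash γ * GuptaBleuler.dSlash γ) ^ 2) Ψ₁ = 0) ∧
    -- limits at the cone
    (∀ Ψ ∈ H₃, ∀ q ∈ GuptaBleuler.Cone n,
      Filter.Tendsto (GuptaBleuler.ySlash γ Ψ : GuptaBleuler.Cover n → GuptaBleuler.Spinor n)
        (nhdsWithin q (GuptaBleuler.HPlus n)) (nhds 0)) ∧
    (∀ q ∈ GuptaBleuler.Cone n, ∃ w : GuptaBleuler.Spinor n, w ≠ 0 ∧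
      Filter.Tendsto (GuptaBleuler.ySlash γ Ψ₂ : GuptaBleuler.Cover n → GuptaBleuler.Spinor n)
        (nhdsWithin q (GuptaBleuler.HPlus n)) (nhds w)) ∧
    -- the realization of `H₂ / H₃` by fields on the cone
    (∃ β : (H₂ ⧸ H₃.submoduleOf H₂) →ₗ[ℂ] (GuptaBleuler.Cover n → GuptaBleuler.Spinor n),
      Function.Injective β ∧
      (∀ x, ∀ z ∉ GuptaBleuler.Cone n, β x z = 0) ∧
      (∀ Ψ : H₂, ∀ q ∈ GuptaBleuler.Cone n,
        Filter.Tendsto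
          (GuptaBleuler.ySlash γ Ψ : GuptaBleuler.Cover n → GuptaBleuler.Spinor n)
          (nhdsWithin q (GuptaBleuler.HPlus n)) (nhds (β (Submodule.Quotient.mk Ψ) q))) ∧
      (∀ (Ψ Ψ' : H₂) (a b : Fin (n + 2)),
        (Ψ' : GuptaBleuler.SpinorField n) = GuptaBleuler.fieldRep γ a b Ψ →
        ∀ q ∈ GuptaBleuler.Cone n,
          GuptaBleuler.HasConeAction γ a b (β (Submodule.Quotient.mk Ψ)) q
            (β (Submodule.Quotient.mk Ψ') q))) := by
  subst hΨ₁ hΨ₂ hΨ₃ hH₁ hH₂ hH₃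
  have hvac := GuptaBleuler.isVacuum_of_isMaximalVector hγ hv
  obtain ⟨c, hc0, hc⟩ := GuptaBleuler.exists_chirality hγ hv.ne_zero hvac
  have hV : GuptaBleuler.IsVac γ v c := ⟨hγ, hn, hv.ne_zero, hvac, hc0, hc⟩
  have hn0 : (n : ℂ) ≠ 0 := by exact_mod_cast (by omega : n ≠ 0)
  refine ⟨⟨Submodule.topologicalClosure_mono hV.cyclic_three_le,
    Submodule.topologicalClosure_mono hV.cyclic_two_le,
    Submodule.isClosed_topologicalClosure _, Submodule.isClosed_topologicalClosure _,
    Submodule.isClosed_topologicalClosure _,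
    GuptaBleuler.invariant_closure (GuptaBleuler.invariant_cyclic _ _),
    GuptaBleuler.invariant_closure (GuptaBleuler.invariant_cyclic _ _),
    GuptaBleuler.invariant_closure (GuptaBleuler.invariant_cyclic _ _)⟩,
    ⟨hV.carries_one_two, hV.carries_three, hV.carries_two_three⟩,
    ⟨hV.dSlash_Psi2, hV.dSlash_Psi3, hV.ySlash_dSlash_Psi1, smul_ne_zero hn0 hV.Psi3_ne_zero,
      hV.ySlash_dSlash_sq_Psi1⟩,
    fun Ψ hΨ => GuptaBleuler.closedModule_Psi3_le_nullFields hγ v hΨ,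
    fun q _ => ⟨_, hV.limit_Psi2_ne_zero q, GuptaBleuler.tendsto_ySlash_Psi2 γ v q⟩,
    hV.exists_boundary_map⟩
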